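/- Let $M$ be a finite-dimensional smooth Riemannian manifold without boundary, with distance $d$, and let $H:T^*M\to\mathbb R$ be a $C^3$ Hamiltonian that is strictly convex and superlinear in the momentum (the Riemannian metric is not assumed to be related to $H$). Put $W(q)=\min_p H(q,p)$. Let $N_*\subset M$ be a smooth embedded submanifold of codimension at least $2$, and let $N\subset N_*$ be a compact subset, the scatterer (for example $N=N_*$ if $N_*$ is compact, or a compact subdomain of $N_*$). Let $E>\max_N W$. *Billiards.* Let $\Omega,A\subset M$ and $n\ge1$. A periodic orbit of the billiard $(\Omega,A,H=E)$ with $n$ reflections is a cyclic sequence of trajectories $z_j=(\gamma_j,p_j):[0,T_j]\to T^*M$, $T_j>0$, $j\in\mathbb Z/n$, of the Hamiltonian system with energy $H=E$, such that $\gamma_j([0,T_j])\subset\Omega$, $\gamma_j(t)\notin A$ for $0<t<T_j$, $\gamma_j(T_j)=\gamma_{j+1}(0)=:x_{j+1}\in A$, the velocities $\dot\gamma_j(0),\dot\gamma_j(T_j)$ are not tangent to $A$, and at each collision $\Delta p=p_{j+1}(0)-p_j(T_j)$ satisfies $\Delta p\perp T_{x_{j+1}}A$, $\Delta H=0$ and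 $\Delta p\neq0$. A periodic collision chain of the degenerate billiard $(M,N,H=E)$ is such an orbit with $\Omega=M$, $A=N$; its collision points $x_j$ are assumed to lie in the interior of $N$ relative to $N_*$ (a void condition if $N=N_*$). *Nondegeneracy.* The end points of $z_j$ are nonconjugate if every variation of $z_j$ through trajectories with the same initial point, with free duration, for which the first-order variations of the energy and of the end point vanish, has vanishing first-order variation of the initial momentum. In this case there is a locally unique family of trajectories of energy $E$ containing $z_j$, joining $q_-$ to $q_+$ and depending smoothly on $(q_-,q_+)$ near $(x_j,x_{j+1})$; let $L_j(q_-,q_+)=\int p\,dq$ be its Maupertuis action. The chain is nondegenerate if the end points of every $z_j$ are nonconjugate and $(x_0,\dots,x_{n-1})$ is a nondegenerate critical point of the periodic discrete action $(y_0,\dots,y_{n-1})\mapsto\sum_{j\in\mathbb Z/n}L_j(y_j,y_{j+1})$ restricted to $N_*^n$. *Thin scatterers.* Let $(x,u)\mapsto f(x,u)\in M$ be a smooth map defined for tangent vectors $u\in T_xM$ near the zero section over $N_*$, with $f(x,0)=x$ and $D_uf(x,0)u=u$ for $x\in N_*$ and $u\in T_x^\perp N_*$ (for example the Riemannian exponential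 map). For $x\in N_*$ let $B_x\subset T_x^\perp N_*$ be a bounded open convex neighbourhood of $0$ whose boundary $S_x$ is a smooth hypersurface of $T_x^\perp N_*$ with positive definite second fundamental form, depending smoothly on $x$. For $\varepsilon>0$ put $$N_\varepsilon=\{f(x,\varepsilon u):x\in N,\ u\in B_x\},\qquad \Sigma_\varepsilon=\{f(x,\varepsilon s):x\in N,\ s\in S_x\},\qquad \Omega_\varepsilon=M\setminus N_\varepsilon .$$ **Theorem.** For every nondegenerate periodic collision chain $(z_j,T_j)_{j\in\mathbb Z/n}$ of $(M,N,H=E)$ as above, with $z_j=(\gamma_j,p_j)$, there are $\varepsilon_0>0$ and $K$ such that for every $\varepsilon\in(0,\varepsilon_0)$ there is a periodic orbit $(z_j^\varepsilon,T_j^\varepsilon)_{j\in\mathbb Z/n}$ of the billiard $(\Omega_\varepsilon,\Sigma_\varepsilon,H=E)$ with the same number $n$ of reflections, $z_j^\varepsilon=(\gamma_j^\varepsilon,p_j^\varepsilon)$, that $O(\varepsilon)$-shadows the chain: for all $j$ and all $\theta\in[0,1]$, $$|T_j^\varepsilon-T_j|\le K\varepsilon,\qquad d\bigl(\gamma_j^\varepsilon(\theta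 T_j^\varepsilon),\gamma_j(\theta T_j)\bigr)\le K\varepsilon .$$ -/

import Mathlib

open Set Filter Topology Manifold Bundle
open scoped ContDiff

noncomputable section

namespace DegenerateBilliard

/-! Throughout, `M` is a manifold without boundary modelled on a finite-dimensional space `E`. -/

/-- The total space `T*M` of the cotangent bundle. Its standard bundle charts are the canonical
charts `(q, p)` induced by the charts of `M`. -/
abbrev CotangentBundle (E : Type*) [NormedAddCommGroup E] [NormedSpace ℝ E]
    (M : Type*) [TopologicalSpace M] [ChartedSpace E M] [IsManifold 𝓘(ℝ, E) ∞ M] : Type _ :=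
  TotalSpace (E →L[ℝ] ℝ) (fun q : M => TangentSpace 𝓘(ℝ, E) q →L[ℝ] Bundle.Trivial M ℝ q)

variable {E : Type*} [NormedAddCommGroup E] [NormedSpace ℝ E]

section Hamiltonian

variable {M : Type*} [TopologicalSpace M] [ChartedSpace E M] [IsManifold 𝓘(ℝ, E) ∞ M]

/-- `H` is a `C³` Hamiltonian on `T*M`, strictly convex and superlinear in the momentum. -/
structure IsConvexHamiltonian (H : CotangentBundle E M → ℝ) : Prop where
  contMDiff : ContMDiff (𝓘(ℝ, E).prod 𝓘(ℝ, E →L[ℝ] ℝ)) 𝓘(ℝ, ℝ) 3 H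
  strictConvex : ∀ q : M, StrictConvexOn ℝ univ
    (fun p : TangentSpace 𝓘(ℝ, E) q →L[ℝ] Bundle.Trivial M ℝ q => H ⟨q, p⟩)
  superlinear : ∀ q : M, Tendsto
    (fun p : E →L[ℝ] ℝ =>
      H ⟨q, (show TangentSpace 𝓘(ℝ, E) q →L[ℝ] Bundle.Trivial M ℝ q from p)⟩ / ‖p‖)
    (Bornology.cobounded (E →L[ℝ] ℝ)) atTop

/-- `W(q) = min_p H(q, p)`. -/
def minEnergy (H : CotangentBundle E M → ℝ) (q : M) : ℝ :=
  ⨅ p : TangentSpace 𝓘(ℝ, E) q →L[ℝ] Bundle.Trivial M ℝ q, H ⟨q, p⟩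

/-- `z : [0, T] → T*M` is a solution of Hamilton's equations with Hamiltonian `H`: in every
canonical chart, with `(v, κ) = (q̇, ṗ)` and `h` the local expression of `H`,
`∂h/∂p = q̇` and `∂h/∂q = -ṗ`, i.e. `dh (w, η) = η v - κ w`. -/
structure IsHamiltonianArc (H : CotangentBundle E M → ℝ) (z : ℝ → CotangentBundle E M)
    (T : ℝ) : Prop where
  pos : 0 < T
  continuousOn : ContinuousOn z (Icc 0 T)
  hamilton : ∀ t ∈ Icc (0 : ℝ) T, ∀ z₀ : CotangentBundle E M,
    z t ∈ (extChartAt (𝓘(ℝ, E).prod 𝓘(ℝ, E →L[ℝ] ℝ)) z₀).source →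
    ∃ (v : E) (κ : E →L[ℝ] ℝ),
      HasDerivWithinAt (fun s => extChartAt (𝓘(ℝ, E).prod 𝓘(ℝ, E →L[ℝ] ℝ)) z₀ (z s))
        ((v, κ) : E × (E →L[ℝ] ℝ)) (Icc 0 T) t ∧
      ∀ (w : E) (η : E →L[ℝ] ℝ),
        fderiv ℝ (fun ξ : E × (E →L[ℝ] ℝ) =>
            H ((extChartAt (𝓘(ℝ, E).prod 𝓘(ℝ, E →L[ℝ] ℝ)) z₀).symm ξ))
          (extChartAt (𝓘(ℝ, E).prod 𝓘(ℝ, E →L[ℝ] ℝ)) z₀ (z t)) (w, η) = η v - κ w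

/-- A trajectory `z : [0, T] → T*M` of the Hamiltonian system on the energy level `H = e`. -/
structure IsEnergyArc (H : CotangentBundle E M → ℝ) (e : ℝ) (z : ℝ → CotangentBundle E M)
    (T : ℝ) : Prop where
  arc : IsHamiltonianArc H z T
  energy : ∀ t ∈ Icc (0 : ℝ) T, H (z t) = e

/-- The velocity at time `t ∈ [0, T]` of the curve in `M` underlying `z : [0, T] → T*M`. -/
def velocity (z : ℝ → CotangentBundle E M) (T t : ℝ) : TangentSpace 𝓘(ℝ, E) (z t).proj :=
  mfderivWithin 𝓘(ℝ, ℝ) 𝓘(ℝ, E) (fun s => (z s).proj) (Icc 0 T) t (1 : ℝ)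

/-- The Maupertuis action `∫ p dq` of `z : [0, T] → T*M`. -/
def action (z : ℝ → CotangentBundle E M) (T : ℝ) : ℝ :=
  ∫ t in (0 : ℝ)..T, ((z t).2 (velocity z T t) : ℝ)

/-- The tangent space of a subset `A` at `x`: the span of the velocities at `x` of the curves that
lie in `A`. This is the usual tangent space wherever `A` is a submanifold. -/
def tangentSpan (A : Set M) (x : M) : Submodule ℝ (TangentSpace 𝓘(ℝ, E) x) :=
  Submodule.span ℝ {v | ∃ c : ℝ → M, MDifferentiableAt 𝓘(ℝ, ℝ) 𝓘(ℝ, E) c 0 ∧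
    (∀ᶠ s in 𝓝 (0 : ℝ), c s ∈ A) ∧
    (⟨c 0, mfderiv 𝓘(ℝ, ℝ) 𝓘(ℝ, E) c 0 (1 : ℝ)⟩ : TangentBundle 𝓘(ℝ, E) M) = ⟨x, v⟩}

/-- Elastic reflection at a point `x ∈ A`, from the state `before` to the state `after`: the jump
of the momentum annihilates `T_x A`, the energy is preserved, and the jump is nonzero. -/
def IsElasticReflection (H : CotangentBundle E M → ℝ) (A : Set M)
    (before after : CotangentBundle E M) : Prop :=
  ∃ (x : M) (p p' : TangentSpace 𝓘(ℝ, E) x →L[ℝ] Bundle.Trivial M ℝ x),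
    before = ⟨x, p⟩ ∧ after = ⟨x, p'⟩ ∧ x ∈ A ∧
    (∀ v ∈ tangentSpan (E := E) A x, p' v = p v) ∧ H ⟨x, p'⟩ = H ⟨x, p⟩ ∧ p' ≠ p

/-- A periodic orbit with `n` reflections of the billiard `(Ω, A, H = e)` in the domain `Ω` with
scatterer `A`: the cyclic concatenation of the trajectories `z j : [0, T j] → T*M`, `j ∈ ℤ/n`, of
energy `e`. They stay in `Ω`, meet `A` exactly at their end points and are not tangent to `A`
there, and the state at the end of the `j`-th trajectory is elastically reflected into the initial
state of the next one. With `Ω = M` this is a periodic collision chain of the degenerate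
billiard `(M, A, H = e)`. -/
structure IsPeriodicBilliardOrbit (H : CotangentBundle E M → ℝ) (e : ℝ) (Ω A : Set M)
    {n : ℕ} [NeZero n] (z : Fin n → ℝ → CotangentBundle E M) (T : Fin n → ℝ) : Prop where
  arc : ∀ j, IsEnergyArc H e (z j) (T j)
  mem_domain : ∀ j, ∀ t ∈ Icc (0 : ℝ) (T j), (z j t).proj ∈ Ω
  no_early_collision : ∀ j, ∀ t ∈ Ioo (0 : ℝ) (T j), (z j t).proj ∉ A
  not_tangent_start : ∀ j, velocity (z j) (T j) 0 ∉ tangentSpan (E := E) A (z j 0).proj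
  not_tangent_end : ∀ j, velocity (z j) (T j) (T j) ∉ tangentSpan (E := E) A (z j (T j)).proj
  reflection : ∀ j, IsElasticReflection H A (z j (T j)) (z (j + 1) 0)

/-- The end points of the trajectory `z : [0, T] → T*M` are not conjugate on its energy level: a
variation through trajectories with the same initial point, with free duration, for which the
first-order variations of the energy and of the end point vanish, is trivial to first order. -/
def NonConjugate (H : CotangentBundle E M → ℝ) (z : ℝ → CotangentBundle E M) (T : ℝ) : Prop :=
  ∀ (Z : ℝ → ℝ → CotangentBundle E M) (τ : ℝ → ℝ) (P : ℝ → E →L[ℝ] ℝ)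
    (τ' : ℝ) (P' : E →L[ℝ] ℝ),
    (∀ᶠ s in 𝓝 (0 : ℝ), IsHamiltonianArc H (Z s) (τ s) ∧
      Z s 0 = ⟨(z 0).proj,
        (show TangentSpace 𝓘(ℝ, E) (z 0).proj →L[ℝ] Bundle.Trivial M ℝ (z 0).proj from P s)⟩) →
    Z 0 0 = z 0 → τ 0 = T →
    HasDerivAt τ τ' 0 → HasDerivAt P P' 0 →
    HasDerivAt (fun s => H (Z s 0)) 0 0 →
    HasMFDerivAt 𝓘(ℝ, ℝ) 𝓘(ℝ, E) (fun s => (Z s (τ s)).proj) 0 0 →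
    P' = 0

/-- `S` is, near the end points `(a, b)` of the trajectory `z : [0, T] → T*M` of energy `e`, the
action function `S(q₋, q₊) = ∫ p dq` of a family of trajectories of energy `e` that join `q₋` to
`q₊`, depend smoothly (through their initial state and duration) on `(q₋, q₊)`, and contain `z`. -/
def IsLocalAction (H : CotangentBundle E M → ℝ) (e : ℝ) (z : ℝ → CotangentBundle E M) (T : ℝ)
    (S : M × M → ℝ) : Prop :=
  ∃ (U : Set (M × M)) (Z : M × M → ℝ → CotangentBundle E M) (τ : M × M → ℝ),
    IsOpen U ∧ ((z 0).proj, (z T).proj) ∈ U ∧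
    Z ((z 0).proj, (z T).proj) 0 = z 0 ∧ τ ((z 0).proj, (z T).proj) = T ∧
    ContMDiffOn (𝓘(ℝ, E).prod 𝓘(ℝ, E)) (𝓘(ℝ, E).prod 𝓘(ℝ, E →L[ℝ] ℝ)) 1 (fun q => Z q 0) U ∧
    ContMDiffOn (𝓘(ℝ, E).prod 𝓘(ℝ, E)) 𝓘(ℝ, ℝ) 1 τ U ∧
    ∀ q ∈ U, IsEnergyArc H e (Z q) (τ q) ∧ (Z q 0).proj = q.1 ∧ (Z q (τ q)).proj = q.2 ∧
      S q = action (Z q) (τ q)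

/-- The local action function of a trajectory with nonconjugate end points. For such a trajectory
a local action function exists, and any two of them agree near the end points. -/
def localAction (H : CotangentBundle E M → ℝ) (e : ℝ) (z : ℝ → CotangentBundle E M) (T : ℝ) :
    M × M → ℝ :=
  Classical.epsilon (IsLocalAction H e z T)

/-- The periodic discrete action `y ↦ ∑_{j ∈ ℤ/n} L_j(y_j, y_{j+1})`, where `L_j` is the local
action function of the `j`-th trajectory of the chain. -/
def periodicAction (H : CotangentBundle E M → ℝ) (e : ℝ) {n : ℕ} [NeZero n]
    (z : Fin n → ℝ → CotangentBundle E M) (T : Fin n → ℝ) (y : Fin n → M) : ℝ :=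
  ∑ j, localAction H e (z j) (T j) (y j, y (j + 1))

/-- `Φ` is a chart of `M` near `x` that maps `N` to the subspace `F`. -/
def IsSliceChart (N : Set M) (Φ : OpenPartialHomeomorph M E) (F : Submodule ℝ E) (x : M) : Prop :=
  Φ ∈ IsManifold.maximalAtlas 𝓘(ℝ, E) ∞ M ∧ x ∈ Φ.source ∧ ∀ q ∈ Φ.source, q ∈ N ↔ Φ q ∈ F

/-- `N` is a (smooth, embedded, boundaryless) submanifold of codimension at least two; the
dimension may vary from one component of `N` to another. -/
def IsDegenerateScatterer (E : Type*) [NormedAddCommGroup E] [NormedSpace ℝ E]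
    {M : Type*} [TopologicalSpace M] [ChartedSpace E M] [IsManifold 𝓘(ℝ, E) ∞ M]
    (N : Set M) : Prop :=
  ∀ x ∈ N, ∃ (Φ : OpenPartialHomeomorph M E) (F : Submodule ℝ E),
    IsSliceChart N Φ F x ∧ Module.finrank ℝ F + 2 ≤ Module.finrank ℝ E

/-- `x ∈ Nⁿ` is a nondegenerate critical point of the restriction of `A` to `Nⁿ`: in slice charts,
the derivative vanishes at `x` and the Hessian has trivial kernel. -/
def IsNondegenerateCriticalPoint (E : Type*) [NormedAddCommGroup E] [NormedSpace ℝ E]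
    {M : Type*} [TopologicalSpace M] [ChartedSpace E M] [IsManifold 𝓘(ℝ, E) ∞ M]
    (N : Set M) {n : ℕ} (A : (Fin n → M) → ℝ) (x : Fin n → M) : Prop :=
  ∃ (Φ : Fin n → OpenPartialHomeomorph M E) (F : Fin n → Submodule ℝ E) (ξ₀ : ∀ j, F j),
    (∀ j, IsSliceChart N (Φ j) (F j) (x j)) ∧ (∀ j, (ξ₀ j : E) = Φ j (x j)) ∧
    fderiv ℝ (fun ξ : ∀ j, F j => A (fun j => (Φ j).symm (ξ j))) ξ₀ = 0 ∧
    ∀ u : ∀ j, F j,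
      fderiv ℝ (fderiv ℝ (fun ξ : ∀ j, F j => A (fun j => (Φ j).symm (ξ j)))) ξ₀ u = 0 → u = 0

/-- The periodic chain `(z, T)` is nondegenerate with respect to the scatterer `N`: its collision
orbits have nonconjugate end points, and its collision points form a nondegenerate critical point
of the periodic discrete action on `Nⁿ`. -/
structure IsNondegenerateChain (H : CotangentBundle E M → ℝ) (e : ℝ) (N : Set M)
    {n : ℕ} [NeZero n] (z : Fin n → ℝ → CotangentBundle E M) (T : Fin n → ℝ) : Prop where
  nonConjugate : ∀ j, NonConjugate H (z j) (T j)
  nondegenerate : IsNondegenerateCriticalPoint E N (periodicAction H e z T)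
    (fun j => (z j 0).proj)

end Hamiltonian

section Tube

variable {M : Type*} [EMetricSpace M] [ChartedSpace E M] [IsManifold 𝓘(ℝ, E) ∞ M]
  [RiemannianBundle (fun x : M => TangentSpace 𝓘(ℝ, E) x)]

/-- The normal space `T_x^⊥ N`. -/
def normalSpace (E : Type*) [NormedAddCommGroup E] [NormedSpace ℝ E]
    {M : Type*} [EMetricSpace M] [ChartedSpace E M] [IsManifold 𝓘(ℝ, E) ∞ M]
    [RiemannianBundle (fun x : M => TangentSpace 𝓘(ℝ, E) x)] (N : Set M) (x : M) :
    Submodule ℝ (TangentSpace 𝓘(ℝ, E) x) :=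
  (tangentSpan (E := E) N x)ᗮ

/-- `f` is a smooth map `(x, u) ↦ f(x, u) ∈ M`, defined near the zero section over `N`, with
`f(x, 0) = x` and `D_u f(x, 0) u = u` for `x ∈ N` and `u ∈ T_x^⊥ N`. The Riemannian exponential
map is an example. -/
def IsTubularMap (N : Set M) (f : TangentBundle 𝓘(ℝ, E) M → M) : Prop :=
  (∃ V : Set (TangentBundle 𝓘(ℝ, E) M), IsOpen V ∧ (∀ x ∈ N, ⟨x, 0⟩ ∈ V) ∧
    ContMDiffOn 𝓘(ℝ, E).tangent 𝓘(ℝ, E) ∞ f V) ∧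
  (∀ x ∈ N, f ⟨x, 0⟩ = x) ∧
  ∀ x ∈ N, ∀ u ∈ normalSpace E N x,
    (⟨f ⟨x, (0 : ℝ) • u⟩, mfderiv 𝓘(ℝ, ℝ) 𝓘(ℝ, E) (fun s : ℝ => f ⟨x, s • u⟩) 0 (1 : ℝ)⟩ :
      TangentBundle 𝓘(ℝ, E) M) = ⟨x, u⟩

/-- `B x ⊆ T_x^⊥ N`, `x ∈ N`, are bounded open convex neighbourhoods of `0` whose boundaries
`S x = ∂(B x)` are smooth hypersurfaces of `T_x^⊥ N` with positive definite second fundamental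
form and depend smoothly on `x`: near each `(x, s)` with `s ∈ S x`, the set of the `(y, u)` with
`u ∈ B y` is `{ρ < 0}` for a smooth `ρ` whose restriction to `T_x^⊥ N` has at `s` a nonzero
derivative and a Hessian that is positive definite on the kernel of this derivative. -/
structure IsConvexProfile (N : Set M) (B : ∀ x : M, Set (normalSpace E N x)) : Prop where
  isOpen : ∀ x ∈ N, IsOpen (B x)
  convex : ∀ x ∈ N, Convex ℝ (B x)
  bounded : ∀ x ∈ N, Bornology.IsBounded (B x)
  zero_mem : ∀ x ∈ N, 0 ∈ B x
  boundary : ∀ x ∈ N, ∀ s ∈ frontier (B x), ∃ ρ : TangentBundle 𝓘(ℝ, E) M → ℝ,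
    ContMDiffAt 𝓘(ℝ, E).tangent 𝓘(ℝ, ℝ) ∞ ρ ⟨x, s⟩ ∧
    (∀ᶠ y in 𝓝 (⟨x, s⟩ : TangentBundle 𝓘(ℝ, E) M), y.proj ∈ N →
      ∀ h : y.2 ∈ normalSpace E N y.proj, (⟨y.2, h⟩ ∈ B y.proj ↔ ρ y < 0)) ∧
    fderiv ℝ (fun u : normalSpace E N x => ρ ⟨x, u⟩) s ≠ 0 ∧
    ∀ w : normalSpace E N x, fderiv ℝ (fun u : normalSpace E N x => ρ ⟨x, u⟩) s w = 0 → w ≠ 0 →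
      0 < fderiv ℝ (fderiv ℝ (fun u : normalSpace E N x => ρ ⟨x, u⟩)) s w w

/-- The open tube `N_ε = {f(x, εu) : x ∈ C, u ∈ B x}` around `C`. -/
def tube {N : Set M} (C : Set M) (f : TangentBundle 𝓘(ℝ, E) M → M)
    (B : ∀ x : M, Set (normalSpace E N x)) (ε : ℝ) : Set M :=
  {q | ∃ x ∈ C, ∃ u ∈ B x, q = f ⟨x, ε • (u : TangentSpace 𝓘(ℝ, E) x)⟩}

/-- The boundary `Σ_ε = {f(x, εs) : x ∈ C, s ∈ S x}` of the tube, where `S x = ∂(B x)`. -/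
def tubeBoundary {N : Set M} (C : Set M) (f : TangentBundle 𝓘(ℝ, E) M → M)
    (B : ∀ x : M, Set (normalSpace E N x)) (ε : ℝ) : Set M :=
  {q | ∃ x ∈ C, ∃ s ∈ frontier (B x), q = f ⟨x, ε • (s : TangentSpace 𝓘(ℝ, E) x)⟩}

/-- The periodic orbit `(z', T')` shadows the periodic orbit `(z, T)` with error `δ`: the durations
of corresponding trajectories differ by at most `δ`, and, after affine reparametrization of time,
so do the positions. -/
def Shadows {n : ℕ} (z' : Fin n → ℝ → CotangentBundle E M) (T' : Fin n → ℝ)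
    (z : Fin n → ℝ → CotangentBundle E M) (T : Fin n → ℝ) (δ : ℝ) : Prop :=
  ∀ j, |T' j - T j| ≤ δ ∧ ∀ θ ∈ Icc (0 : ℝ) 1,
    edist (z' j (θ * T' j)).proj (z j (θ * T j)).proj ≤ ENNReal.ofReal δ

end Tube

end DegenerateBilliard

end

/-!
A collision of a billiard orbit with a thin tube is parametrized by a base point and a point of the
profile. In a local trivialization of the normal bundle the collision points are `Ψ_j(ξ_j, ε η_j)`,
where `ξ_j` is a coordinate on the submanifold and `η_j` lies on the boundary `ρ_j(ξ_j, η_j) = 0` of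
a strictly convex set. Since the derivative of the Maupertuis action is `p₊ dq₊ - p₋ dq₋`, the law
of reflection says that `(ξ, η)` is a critical point of the periodic action `𝒜(ξ, ε η)` under these
constraints. After division of its `η`-component by `ε`, the system of Lagrange equations extends
continuously differentiably to `ε = 0`, where it decouples. There `ξ` is a critical point of the
action on the product of the scatterers, which is nondegenerate by assumption, and `η_j` is the
boundary point at which the momentum jump of the chain, a nonzero linear form on the normal space, is
maximal. That point is nondegenerate because the second fundamental form is definite. Hence the
implicit function theorem gives a family of solutions that is continuously differentiable in `ε`
(`exists_multiplier_curve`, `exists_critical_curves`).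

The formula for the derivative of the action (`first_variation`, `localAction_eq`, `exists_segment`,
`exists_chain_family`) rests on the differentiable dependence of trajectories on their initial states
(`exists_local_flow`, `exists_flow`). The Hamiltonian vector field is only `C²`, but the tautological
form pulls back without loss of a derivative, so that the action in its end points is `C²`.

The trajectories so obtained have to stay outside the tubes and to meet them transversally. Strict
convexity of `H` makes the momentum jump negative on the incoming and positive on the outgoing
velocity (`jump_velocity`). As the jump is conormal to the tube, the velocities are transversal, and
the trajectories stay out of the tubes near their end points for a time that does not depend on `ε`
(`IsDefiningFunction.exists_exit`, `IsLocalTube.exists_exit`). During the remaining time they are kept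
away from the tubes by compactness (`eventually_avoid`, `segment_avoids`), because the trajectories of
the chain meet the scatterer only at their end points. This gives the billiard orbits
(`exists_orbit_family`), and differentiability in `ε` gives the shadowing estimate
(`exists_eventually_shadows`).
-/

noncomputable section

namespace DegenerateBilliard

set_option synthInstance.maxHeartbeats 200000

/-! ### The flow of a `C²` vector field -/

section

/-- Two solutions `x`, `y` of `ẋ = σ X(x)` whose initial points differ by `k` satisfy
`y = x + A k + O(‖k‖²)`, where `A` solves the linearized equation along `x`. The sign `σ = ±1` allows
for both directions of time. -/
lemma gronwall_linearization {V : Type*} [NormedAddCommGroup V] [NormedSpace ℝ V]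
    {X : V → V} {s : Set V} (hs : Convex ℝ s) {K K₂ : NNReal} (hd : ∀ x ∈ s, DifferentiableAt ℝ X x)
    (hK : LipschitzOnWith K X s) (hK₂ : LipschitzOnWith K₂ (fderiv ℝ X) s)
    {x y : ℝ → V} {A : ℝ → V →L[ℝ] V} {k : V} {h C σ : ℝ} (hσ : |σ| = 1)
    (hx : ∀ t ∈ Icc 0 h, HasDerivAt x (σ • X (x t)) t) (hxs : ∀ t ∈ Icc 0 h, x t ∈ s)
    (hy : ∀ t ∈ Icc 0 h, HasDerivAt y (σ • X (y t)) t) (hys : ∀ t ∈ Icc 0 h, y t ∈ s)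
    (hA : ∀ t ∈ Icc 0 h, HasDerivAt A (σ • (fderiv ℝ X (x t)).comp (A t)) t)
    (hAC : ∀ t ∈ Icc 0 h, ‖A t‖ ≤ C)
    (hxA : ∀ t ∈ Icc 0 h, x t + A t k ∈ s) (hA0 : A 0 = ContinuousLinearMap.id ℝ V)
    (h0 : y 0 = x 0 + k) {t : ℝ} (ht : t ∈ Icc 0 h) :
    ‖y t - x t - A t k‖ ≤ gronwallBound 0 K (K₂ * C ^ 2 * ‖k‖ ^ 2) t := by
  have hLip : ∀ t ∈ Ico 0 h, LipschitzOnWith K (fun v => σ • X v) s := by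
    intro t _
    refine LipschitzOnWith.of_dist_le_mul fun u hu v hv => ?_
    rw [dist_smul₀, Real.norm_eq_abs, hσ, one_mul]
    exact hK.dist_le_mul u hu v hv
  have hA' : ∀ t ∈ Icc 0 h, HasDerivAt (fun t => x t + A t k)
      (σ • X (x t) + σ • fderiv ℝ X (x t) (A t k)) t := by
    intro t ht
    have := (hA t ht).clm_apply (hasDerivAt_const t k)
    simpa using (hx t ht).fun_add this
  have hrem : ∀ t ∈ Icc 0 h, dist (σ • X (x t) + σ • fderiv ℝ X (x t) (A t k))
      (σ • X (x t + A t k)) ≤ K₂ * C ^ 2 * ‖k‖ ^ 2 := by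
    intro t ht
    have h1 : ‖A t k‖ ≤ C * ‖k‖ := (A t).le_of_opNorm_le (hAC t ht) k
    have h2 : ‖X (x t + A t k) - X (x t) - fderiv ℝ X (x t) (x t + A t k - x t)‖ ≤
        (K₂ * (C * ‖k‖)) * ‖x t + A t k - x t‖ := by
      have hseg := hs.segment_subset (hxs t ht) (hxA t ht)
      refine (convex_segment (x t) (x t + A t k)).norm_image_sub_le_of_norm_fderiv_le' 
        (𝕜 := ℝ) (fun z hz => hd z (hseg hz)) (fun z hz => ?_) (left_mem_segment ..)
        (right_mem_segment ..)
      have := hK₂.dist_le_mul z (hseg hz) (x t) (hxs t ht)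
      rw [dist_eq_norm, dist_eq_norm] at this
      refine this.trans (mul_le_mul_of_nonneg_left ?_ K₂.2)
      obtain ⟨θ, hθ, rfl⟩ : ∃ θ ∈ Icc (0:ℝ) 1, x t + θ • (A t k) = z := by
        rw [segment_eq_image'] at hz
        obtain ⟨θ, hθ, rfl⟩ := hz
        exact ⟨θ, hθ, by simp⟩
      rw [add_sub_cancel_left, norm_smul, Real.norm_of_nonneg hθ.1]
      calc θ * ‖A t k‖ ≤ 1 * ‖A t k‖ := by gcongr; exact hθ.2
        _ ≤ C * ‖k‖ := by rwa [one_mul]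
    rw [add_sub_cancel_left] at h2
    rw [dist_comm, dist_eq_norm, ← smul_add, ← smul_sub, norm_smul, Real.norm_eq_abs, hσ, one_mul,
      ← sub_sub]
    refine h2.trans ?_
    have hC : 0 ≤ C := (norm_nonneg _).trans (hAC t ht)
    calc (K₂ * (C * ‖k‖)) * ‖A t k‖ ≤ (K₂ * (C * ‖k‖)) * (C * ‖k‖) := by gcongr
      _ = K₂ * C ^ 2 * ‖k‖ ^ 2 := by ring
  have key := dist_le_of_approx_trajectories_ODE_of_mem (v := fun _ v => σ • X v) (s := fun _ => s)
    (a := 0) (b := h) (K := K) (f := fun t => x t + A t k) (g := y) (δ := 0)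
    (εf := K₂ * C ^ 2 * ‖k‖ ^ 2) (εg := 0) (g' := fun t => σ • X (y t)) hLip
    (fun t ht => (hA' t ht).continuousAt.continuousWithinAt)
    (fun t ht => (hA' t (Ico_subset_Icc_self ht)).hasDerivWithinAt)
    (fun t ht => hrem t (Ico_subset_Icc_self ht))
    (fun t ht => hxA t (Ico_subset_Icc_self ht))
    (fun t ht => (hy t ht).continuousAt.continuousWithinAt)
    (fun t ht => (hy t (Ico_subset_Icc_self ht)).hasDerivWithinAt) (by simp)
    (fun t ht => hys t (Ico_subset_Icc_self ht)) (by simp [hA0, h0]) t ht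
  rw [dist_comm, dist_eq_norm, add_zero, sub_zero, ← sub_sub] at key
  exact key

/-- A `C²` vector field has a `C¹` local flow. The flow of the extended system `(X, DX ∘ A)`, which is
continuous by the Picard-Lindelöf theorem, provides both the flow `φ` of `X` and a continuous
candidate `A` for its derivative; `gronwall_linearization` shows that `A` is the derivative. -/
theorem exists_local_flow {V : Type*} [NormedAddCommGroup V] [NormedSpace ℝ V] [CompleteSpace V]
    {X : V → V} {x₀ : V} (hX : ContDiffAt ℝ 2 X x₀) {O : Set V} (hO : O ∈ 𝓝 x₀) :
    ∃ (φ : V → ℝ → V) (U : Set V) (h : ℝ), 0 < h ∧ IsOpen U ∧ x₀ ∈ U ∧ (∀ x ∈ U, φ x 0 = x) ∧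
      (∀ x ∈ U, ∀ t ∈ Ioo (-h) h, HasDerivAt (φ x) (X (φ x t)) t ∧ φ x t ∈ O) ∧
      ContDiffOn ℝ 1 (Function.uncurry φ) (U ×ˢ Ioo (-h) h) := by
  set I := ContinuousLinearMap.id ℝ V
  let Y : V × (V →L[ℝ] V) → V × (V →L[ℝ] V) := fun z => (X z.1, (fderiv ℝ X z.1).comp z.2)
  have hdX : ContDiffAt ℝ 1 (fderiv ℝ X) x₀ := hX.fderiv_right (by norm_num)
  have hY : ContDiffAt ℝ 1 Y (x₀, I) := by
    refine ContDiffAt.prodMk ?_ ?_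
    · exact (hX.of_le (by norm_num)).comp (x₀, I) contDiffAt_fst
    · exact (hdX.comp (x₀, I) contDiffAt_fst).clm_comp contDiffAt_snd
  -- a ball on which `X` and its derivative are Lipschitz
  obtain ⟨K, s₁, hs₁, hK⟩ := (hX.of_le (by norm_num : (1 : WithTop ℕ∞) ≤ 2)).exists_lipschitzOnWith
  obtain ⟨K₂, s₂, hs₂, hK₂⟩ := hdX.exists_lipschitzOnWith
  have hdiff : ∀ᶠ x in 𝓝 x₀, ContDiffAt ℝ 2 X x := hX.eventually (by simp)
  obtain ⟨δ, hδ, hball⟩ := Metric.mem_nhds_iff.1 (inter_mem (inter_mem hs₁ hs₂) (inter_mem hdiff hO))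
  have hd : ∀ x ∈ Metric.ball x₀ δ, ContDiffAt ℝ 2 X x := fun x hx => (hball hx).2.1
  -- the flow of the extended system
  obtain ⟨ε, hε, a, r, L, K', hr, hpl⟩ := IsPicardLindelof.of_contDiffAt_one hY
  obtain ⟨Γ, hΓ, hΓc⟩ := (hpl 0).exists_forall_mem_closedBall_eq_hasDerivWithinAt_continuousOn
  simp only [zero_sub, zero_add] at hΓ hΓc
  have hΓ0 : Γ ((x₀, I), 0) = (x₀, I) := (hΓ _ (Metric.mem_closedBall_self r.2)).1
  have hΓat : ContinuousAt Γ ((x₀, I), 0) :=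
    hΓc.continuousAt (prod_mem_nhds (Metric.closedBall_mem_nhds _ hr) (Icc_mem_nhds (by simpa) hε))
  have hnear : ∀ᶠ p in 𝓝 (((x₀, I), 0) : (V × (V →L[ℝ] V)) × ℝ),
      Γ p ∈ Metric.ball x₀ (δ / 2) ×ˢ Metric.ball I 1 := by
    apply hΓat
    rw [hΓ0]
    exact prod_mem_nhds (Metric.ball_mem_nhds _ (by positivity)) (Metric.ball_mem_nhds _ one_pos)
  have hnear' : ∀ᶠ p in 𝓝 ((x₀, 0) : V × ℝ), ((p.1, I), p.2) ∈ Metric.ball (x₀, I) (r : ℝ) ×ˢ Ioo (-ε) ε ∧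
      Γ ((p.1, I), p.2) ∈ Metric.ball x₀ (δ / 2) ×ˢ Metric.ball I 1 := by
    have hc : ContinuousAt (fun p : V × ℝ => (((p.1, I), p.2) : (V × (V →L[ℝ] V)) × ℝ)) (x₀, 0) := by
      fun_prop
    refine (hc.eventually ?_).and (hc.eventually hnear)
    exact prod_mem_nhds (Metric.ball_mem_nhds _ hr) (Ioo_mem_nhds (by simpa) hε)
  rw [nhds_prod_eq] at hnear'
  obtain ⟨U, ⟨hx₀U, hU⟩, J, hJ, hUJ⟩ := ((nhds_basis_opens x₀).prod
    (nhds_basis_zero_abs_lt ℝ)).mem_iff.1 hnear' |>.imp (fun p hp => hp) |> fun ⟨p, hp, hq⟩ =>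
      (⟨p.1, hp.1, p.2, hp.2, hq⟩ : ∃ U, (x₀ ∈ U ∧ IsOpen U) ∧ ∃ J : ℝ, 0 < J ∧
        U ×ˢ {b | |b| < J} ⊆ {p : V × ℝ | ((p.1, I), p.2) ∈ Metric.ball (x₀, I) (r : ℝ) ×ˢ Ioo (-ε) ε ∧
      Γ ((p.1, I), p.2) ∈ Metric.ball x₀ (δ / 2) ×ˢ Metric.ball I 1})
  have hUJ' : ∀ x ∈ U, ∀ t, |t| < J → (((x, I) ∈ Metric.ball (x₀, I) (r : ℝ)) ∧ t ∈ Ioo (-ε) ε) ∧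
      (Γ ((x, I), t)).1 ∈ Metric.ball x₀ (δ / 2) ∧ (Γ ((x, I), t)).2 ∈ Metric.ball I 1 :=
    fun x hx t ht => hUJ (mk_mem_prod hx ht)
  have hmem : ∀ t : ℝ, t ∈ Ioo (-J) J ↔ |t| < J := fun t => abs_lt.symm
  set φ : V → ℝ → V := fun x t => (Γ ((x, I), t)).1
  set A : V → ℝ → V →L[ℝ] V := fun x t => (Γ ((x, I), t)).2
  have hΓd : ∀ x ∈ U, ∀ t, |t| < J →
      HasDerivAt (fun t => Γ ((x, I), t)) (Y (Γ ((x, I), t))) t := by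
    intro x hx t ht
    have := hUJ' x hx t ht
    exact ((hΓ _ (Metric.ball_subset_closedBall this.1.1)).2 t (Ioo_subset_Icc_self this.1.2)).hasDerivAt
      (Icc_mem_nhds this.1.2.1 this.1.2.2)
  have hφd : ∀ x ∈ U, ∀ t, |t| < J → HasDerivAt (φ x) (X (φ x t)) t :=
    fun x hx t ht => (hΓd x hx t ht).fst
  have hAd : ∀ x ∈ U, ∀ t, |t| < J → HasDerivAt (A x) ((fderiv ℝ X (φ x t)).comp (A x t)) t :=
    fun x hx t ht => (hΓd x hx t ht).snd
  have hφb : ∀ x ∈ U, ∀ t, |t| < J → φ x t ∈ Metric.ball x₀ δ := fun x hx t ht =>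
    Metric.ball_subset_ball (by linarith) (hUJ' x hx t ht).2.1
  have hφ0 : ∀ x ∈ U, Γ ((x, I), 0) = (x, I) := fun x hx =>
    (hΓ _ (Metric.ball_subset_closedBall (hUJ' x hx 0 (by simpa)).1.1)).1
  have hA2 : ∀ x ∈ U, ∀ t, |t| < J → ‖A x t‖ ≤ 2 := by
    intro x hx t ht
    have h1 := (hUJ' x hx t ht).2.2
    rw [Metric.mem_ball, dist_eq_norm] at h1
    have h2 : ‖I‖ ≤ 1 := ContinuousLinearMap.norm_id_le
    calc ‖A x t‖ = ‖(A x t - I) + I‖ := by simp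
      _ ≤ ‖A x t - I‖ + ‖I‖ := norm_add_le _ _
      _ ≤ 2 := by linarith
  have hK' : LipschitzOnWith K X (Metric.ball x₀ δ) := hK.mono fun x hx => (hball hx).1.1
  have hK₂' : LipschitzOnWith K₂ (fderiv ℝ X) (Metric.ball x₀ δ) := hK₂.mono fun x hx => (hball hx).1.2
  -- the space derivative of the flow
  have hfd : ∀ x ∈ U, ∀ t, |t| < J → HasFDerivAt (fun x => φ x t) (A x t) x := by
    intro x hx t ht
    -- negative times are reduced to positive ones by reversing the vector field
    obtain ⟨σ, hσ, hσt⟩ : ∃ σ : ℝ, |σ| = 1 ∧ σ * |t| = t := by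
      rcases le_total 0 t with h | h
      · exact ⟨1, by simp, by simp [abs_of_nonneg h]⟩
      · exact ⟨-1, by simp, by simp [abs_of_nonpos h]⟩
    have hst : ∀ s ∈ Icc 0 |t|, |σ * s| < J := by
      intro s hs
      rw [abs_mul, hσ, one_mul, abs_of_nonneg hs.1]
      exact hs.2.trans_lt ht
    have hcomp : ∀ {W : Type _} [NormedAddCommGroup W] [NormedSpace ℝ W] (g : ℝ → W) (g' : W) (s : ℝ),
        HasDerivAt g g' (σ * s) → HasDerivAt (fun s => g (σ * s)) (σ • g') s := by
      intro W _ _ g g' s hg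
      have := hg.scomp s ((hasDerivAt_id s).const_mul σ)
      simpa [Function.comp_def] using this
    have hbig : (fun y => φ y t - φ x t - A x t (y - x)) =O[𝓝 x] fun y => ‖y - x‖ ^ 2 := by
      have hev : ∀ᶠ y in 𝓝 x, y ∈ U ∩ Metric.ball x (δ / 4) :=
        inter_mem (hU.mem_nhds hx) (Metric.ball_mem_nhds _ (by positivity))
      refine Asymptotics.IsBigO.of_bound (gronwallBound 0 K (K₂ * 2 ^ 2) |t|) ?_
      filter_upwards [hev] with y hy
      have hk : ‖y - x‖ < δ / 4 := by simpa [dist_eq_norm] using hy.2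
      have key := gronwall_linearization (convex_ball x₀ δ) (X := X) (K := K) (K₂ := K₂)
        (fun z hz => (hd z hz).differentiableAt (by norm_num)) hK' hK₂'
        (x := fun s => φ x (σ * s)) (y := fun s => φ y (σ * s)) (A := fun s => A x (σ * s))
        (k := y - x) (h := |t|) (C := 2) hσ
        (fun s hs => hcomp _ _ s (hφd x hx _ (hst s hs))) (fun s hs => hφb x hx _ (hst s hs))
        (fun s hs => hcomp _ _ s (hφd y hy.1 _ (hst s hs))) (fun s hs => hφb y hy.1 _ (hst s hs))
        (fun s hs => hcomp _ _ s (hAd x hx _ (hst s hs))) (fun s hs => hA2 x hx _ (hst s hs))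
        (fun s hs => ?_) (by simp only [mul_zero, A, hφ0 x hx, I])
        (by simp only [mul_zero, φ, hφ0 x hx, hφ0 y hy.1]; abel)
        (t := |t|) ⟨abs_nonneg t, le_rfl⟩
      · simp only [hσt] at key
        refine key.trans (le_of_eq ?_)
        rw [norm_pow, norm_norm]
        have : ∀ c d : ℝ, gronwallBound 0 K (c * d) |t| = gronwallBound 0 K c |t| * d := by
          intro c d
          by_cases hK0 : (K : ℝ) = 0
          · simp only [hK0, gronwallBound_K0]; ring
          · simp only [gronwallBound_of_K_ne_0 hK0]; ring
        exact this _ _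
      · have h1 := (hUJ' x hx _ (hst s hs)).2.1
        have h2 : ‖A x (σ * s) (y - x)‖ ≤ 2 * ‖y - x‖ :=
          (A x _).le_of_opNorm_le (hA2 x hx _ (hst s hs)) _
        rw [Metric.mem_ball, dist_eq_norm] at h1 ⊢
        calc ‖φ x (σ * s) + A x (σ * s) (y - x) - x₀‖
            = ‖(φ x (σ * s) - x₀) + A x (σ * s) (y - x)‖ := by congr 1; abel
          _ ≤ ‖φ x (σ * s) - x₀‖ + ‖A x (σ * s) (y - x)‖ := norm_add_le _ _
          _ < δ := by linarith
    refine HasFDerivAt.of_isLittleO (hbig.trans_isLittleO ?_)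
    refine Asymptotics.isLittleO_norm_right.1 ?_
    have hz : Tendsto (fun y => ‖y - x‖) (𝓝 x) (𝓝 0) := by
      have : Continuous fun y : V => ‖y - x‖ := by fun_prop
      simpa using this.tendsto x
    simpa [Function.comp_def] using
      (Asymptotics.isLittleO_pow_id (𝕜 := ℝ) one_lt_two).comp_tendsto hz
  refine ⟨φ, U, J, hJ, hU, hx₀U, fun x hx => by simp only [φ, hφ0 x hx], fun x hx t ht =>
    ⟨hφd x hx t ((hmem t).1 ht), (hball (hφb x hx t ((hmem t).1 ht))).2.2⟩, ?_⟩
  have hopen : IsOpen (U ×ˢ Ioo (-J) J) := hU.prod isOpen_Ioo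
  have hΓcont : ∀ p ∈ U ×ˢ Ioo (-J) J, ContinuousAt (fun p : V × ℝ => Γ ((p.1, I), p.2)) p := by
    rintro ⟨x, t⟩ ⟨hx, ht⟩
    have hh := (hUJ' x hx t ((hmem t).1 ht)).1
    have h1 : ContinuousAt Γ ((x, I), t) := hΓc.continuousAt (prod_mem_nhds
      (mem_of_superset (Metric.isOpen_ball.mem_nhds hh.1) Metric.ball_subset_closedBall)
      (Icc_mem_nhds hh.2.1 hh.2.2))
    exact ContinuousAt.comp (f := fun p : V × ℝ => ((p.1, I), p.2)) (x := (x, t)) h1 (by fun_prop)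
  have hφc : ∀ p ∈ U ×ˢ Ioo (-J) J, ContinuousAt (Function.uncurry φ) p := fun p hp => (hΓcont p hp).fst
  have hAc : ∀ p ∈ U ×ˢ Ioo (-J) J, ContinuousAt (Function.uncurry A) p := fun p hp => (hΓcont p hp).snd
  have hXc : ∀ p ∈ U ×ˢ Ioo (-J) J, ContinuousAt (fun p : V × ℝ => X (φ p.1 p.2)) p := by
    rintro ⟨x, t⟩ ⟨hx, ht⟩
    exact ContinuousAt.comp (f := Function.uncurry φ) (x := (x, t))
      (hd _ (hφb x hx t ((hmem t).1 ht))).continuousAt (hφc _ ⟨hx, ht⟩)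
  -- continuous partial derivatives in space and time give the joint derivative
  set D : V × ℝ → V × ℝ →L[ℝ] V := fun p => (A p.1 p.2).coprod
    (ContinuousLinearMap.toSpanSingleton ℝ (X (φ p.1 p.2)))
  have hDc : ∀ p ∈ U ×ˢ Ioo (-J) J, ContinuousAt (fun p : V × ℝ =>
      (ContinuousLinearMap.toSpanSingleton ℝ (X (φ p.1 p.2)))) p := fun p hp =>
    (ContinuousLinearMap.toSpanSingletonCLE (𝕜 := ℝ) (E := V)).continuous.continuousAt.comp (hXc p hp)
  have hstrict : ∀ p ∈ U ×ˢ Ioo (-J) J, HasStrictFDerivAt (Function.uncurry φ) (D p) p := by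
    intro p hp
    refine hasStrictFDerivAt_uncurry_coprod (u := p) (f := φ) (f₁ := A)
      (f₂ := fun x t => ContinuousLinearMap.toSpanSingleton ℝ (X (φ x t))) ?_ ?_ (hAc p hp) (hDc p hp)
    · filter_upwards [hopen.mem_nhds hp] with v hv
      exact hfd v.1 hv.1 v.2 ((hmem _).1 hv.2)
    · filter_upwards [hopen.mem_nhds hp] with v hv
      exact (hφd v.1 hv.1 v.2 ((hmem _).1 hv.2)).hasFDerivAt
  have hone : (1 : WithTop ℕ∞) = 0 + 1 := by norm_num
  rw [hone, contDiffOn_succ_iff_fderiv_of_isOpen hopen]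
  refine ⟨fun p hp => (hstrict p hp).hasFDerivAt.differentiableAt.differentiableWithinAt, by simp,
    contDiffOn_zero.2 fun p hp => ContinuousAt.continuousWithinAt ?_⟩
  have : fderiv ℝ (Function.uncurry φ) =ᶠ[𝓝 p] D := by
    filter_upwards [hopen.mem_nhds hp] with q hq using (hstrict q hq).hasFDerivAt.fderiv
  refine ContinuousAt.congr ?_ this.symm
  have h1 := hAc p hp
  have h2 := hDc p hp
  have : D = fun p => (A p.1 p.2).comp (ContinuousLinearMap.fst ℝ V ℝ) +
      (ContinuousLinearMap.toSpanSingleton ℝ (X (φ p.1 p.2))).comp (ContinuousLinearMap.snd ℝ V ℝ) := by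
    funext q
    exact ContinuousLinearMap.ext fun v => by simp [D]
  rw [this]
  exact (ContinuousAt.clm_comp h1 continuousAt_const).add (ContinuousAt.clm_comp h2 continuousAt_const)

end

/-! ### The implicit function theorem and families of convex sets -/

section

/-- The implicit function theorem in finite dimensions, with injectivity of the partial derivative
and equality of dimensions in place of its invertibility. -/
theorem exists_implicit_function {X Y Z : Type*} [NormedAddCommGroup X] [NormedSpace ℝ X]
    [CompleteSpace X] [NormedAddCommGroup Y] [NormedSpace ℝ Y] [FiniteDimensional ℝ Y]
    [NormedAddCommGroup Z] [NormedSpace ℝ Z] [FiniteDimensional ℝ Z] {F : X × Y → Z} {x₀ : X} {y₀ : Y}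
    (hF : ContDiffAt ℝ 1 F (x₀, y₀)) (h0 : F (x₀, y₀) = 0)
    (hdim : Module.finrank ℝ Y = Module.finrank ℝ Z)
    (hker : ∀ v, fderiv ℝ F (x₀, y₀) (0, v) = 0 → v = 0) :
    ∃ g : X → Y, g x₀ = y₀ ∧ ContDiffAt ℝ 1 g x₀ ∧ ∀ᶠ x in 𝓝 x₀, F (x, g x) = 0 := by
  have : CompleteSpace Y := FiniteDimensional.complete ℝ Y
  have : CompleteSpace Z := FiniteDimensional.complete ℝ Z
  set L : Y →L[ℝ] Z := fderiv ℝ F (x₀, y₀) ∘L .inr ℝ X Y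
  have hinj : Function.Injective (L : Y →ₗ[ℝ] Z) :=
    (injective_iff_map_eq_zero _).2 fun v hv => hker v (by simpa [L] using hv)
  have hL : L.IsInvertible :=
    ⟨(LinearEquiv.ofInjectiveOfFinrankEq (L : Y →ₗ[ℝ] Z) hinj hdim).toContinuousLinearEquiv, by
      ext v; rfl⟩
  refine ⟨hF.implicitFunction one_ne_zero hL, hF.implicitFunction_apply_self one_ne_zero hL,
    hF.contDiffAt_implicitFunction one_ne_zero hL, ?_⟩
  filter_upwards [hF.eventually_apply_implicitFunction one_ne_zero hL] with x hx
  rw [hx, h0]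

section ConvexFamily

variable {F G : Type*} [NormedAddCommGroup F] [NormedSpace ℝ F] [NormedAddCommGroup G]
  [NormedSpace ℝ G]

/-- Near `p₀`, the sets `B ξ` of the family `B` are the sublevel sets `{η | ρ (ξ, η) < 0}` of a `C¹`
function whose derivative in the direction of `G` does not vanish at `p₀`. -/
structure IsDefiningFunction (B : F → Set G) (ρ : F × G → ℝ) (p₀ : F × G) : Prop where
  contDiffAt : ContDiffAt ℝ 1 ρ p₀
  mem_iff : ∀ᶠ p in 𝓝 p₀, p.2 ∈ B p.1 ↔ ρ p < 0
  fderiv_ne : ∃ w : G, fderiv ℝ ρ p₀ (0, w) ≠ 0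

namespace IsDefiningFunction

variable {B : F → Set G} {ρ : F × G → ℝ} {p₀ : F × G}

lemma eventually_continuousAt (h : IsDefiningFunction B ρ p₀) : ∀ᶠ p in 𝓝 p₀, ContinuousAt ρ p :=
  (h.contDiffAt.eventually (by simp)).mono fun _ hp => hp.continuousAt

lemma eventually_notMem_closure (h : IsDefiningFunction B ρ p₀) :
    ∀ᶠ p in 𝓝 p₀, 0 < ρ p → p.2 ∉ closure (B p.1) := by
  filter_upwards [h.mem_iff.eventually_nhds, h.eventually_continuousAt] with p hp hc hpos hcl
  have h1 : ∀ᶠ q in 𝓝 p, q.2 ∉ B q.1 := by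
    filter_upwards [hp, hc.eventually (lt_mem_nhds hpos)] with q hq hq' hB
    exact lt_asymm (hq.1 hB) hq'
  have h2 : ∀ᶠ η in 𝓝 p.2, η ∉ B p.1 :=
    ((Continuous.prodMk_right p.1).continuousAt (x := p.2)).eventually h1
  exact (mem_closure_iff_frequently.1 hcl) h2

lemma eventually_eq_zero_of_mem_frontier (h : IsDefiningFunction B ρ p₀) :
    ∀ᶠ p in 𝓝 p₀, p.2 ∈ frontier (B p.1) → ρ p = 0 := by
  filter_upwards [h.eventually_notMem_closure, h.mem_iff.eventually_nhds,
    h.eventually_continuousAt] with p hp hp' hc hfr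
  rcases lt_trichotomy (ρ p) 0 with hlt | heq | hgt
  · exfalso
    have h1 : ∀ᶠ q in 𝓝 p, q.2 ∈ B q.1 := by
      filter_upwards [hp', hc.eventually (gt_mem_nhds hlt)] with q hq hq' using hq.2 hq'
    have h2 : ∀ᶠ η in 𝓝 p.2, η ∈ B p.1 :=
      ((Continuous.prodMk_right p.1).continuousAt (x := p.2)).eventually h1
    exact hfr.2 (mem_interior_iff_mem_nhds.2 h2)
  · exact heq
  · exact absurd hfr.1 (hp hgt)

lemma hasDerivAt_line {p : F × G} (hd : DifferentiableAt ℝ ρ p) (w : G) :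
    HasDerivAt (fun t : ℝ => ρ (p.1, p.2 + t • w)) (fderiv ℝ ρ p (0, w)) 0 := by
  have h1 : HasDerivAt (fun t : ℝ => ((p.1, p.2 + t • w) : F × G)) (0, w) 0 := by
    have := ((hasDerivAt_id (0 : ℝ)).smul_const w).const_add p.2
    simpa using (hasDerivAt_const (0 : ℝ) p.1).prodMk this
  have h2 : HasFDerivAt ρ (fderiv ℝ ρ p) ((fun t : ℝ => ((p.1, p.2 + t • w) : F × G)) 0) := by
    simpa using hd.hasFDerivAt
  exact h2.comp_hasDerivAt (0 : ℝ) h1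

omit [NormedSpace ℝ F] in
lemma tendsto_line (p : F × G) (w : G) :
    Tendsto (fun t : ℝ => ((p.1, p.2 + t • w) : F × G)) (𝓝[>] 0) (𝓝 p) := by
  have : Continuous fun t : ℝ => ((p.1, p.2 + t • w) : F × G) := by fun_prop
  have h := this.tendsto 0
  simp only [zero_smul, add_zero] at h
  exact h.mono_left nhdsWithin_le_nhds

lemma eventually_neg_line {p : F × G} (hd : DifferentiableAt ℝ ρ p) (h0 : ρ p = 0) {w : G}
    (hw : fderiv ℝ ρ p (0, w) < 0) : ∀ᶠ t in 𝓝[>] (0 : ℝ), ρ (p.1, p.2 + t • w) < 0 := by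
  have h := (hasDerivAt_line hd w).hasDerivWithinAt (s := Ioi 0)
  rw [hasDerivWithinAt_iff_tendsto_slope' (by simp)] at h
  filter_upwards [h.eventually (gt_mem_nhds hw), self_mem_nhdsWithin] with t ht ht0
  rw [slope_def_field] at ht
  simp only [zero_smul, add_zero, h0, sub_zero] at ht
  exact (div_neg_iff_of_pos ht0).1 ht
where
  div_neg_iff_of_pos {a b : ℝ} (hb : 0 < b) : a / b < 0 ↔ a < 0 := by
    rw [div_lt_iff₀ hb, zero_mul]

/-- The zeros of a defining function are boundary points: since its derivative along `G` is nonzero,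
negative values occur arbitrarily close to a zero. -/
lemma eventually_mem_frontier (h : IsDefiningFunction B ρ p₀)
    (hB : ∀ᶠ p in 𝓝 p₀, IsOpen (B p.1)) :
    ∀ᶠ p in 𝓝 p₀, ρ p = 0 → p.2 ∈ frontier (B p.1) := by
  obtain ⟨w, hw⟩ := h.fderiv_ne
  have hc : ContinuousAt (fun p => fderiv ℝ ρ p (0, w)) p₀ :=
    (h.contDiffAt.continuousAt_fderiv one_ne_zero).clm_apply continuousAt_const
  filter_upwards [h.mem_iff.eventually_nhds, hc.eventually_ne hw,
    h.contDiffAt.eventually (by simp), hB] with p hp hne hd hopen h0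
  have hd' := hd.differentiableAt one_ne_zero
  refine ⟨?_, fun hint => ?_⟩
  · obtain ⟨w', hw'⟩ : ∃ w' : G, fderiv ℝ ρ p (0, w') < 0 := by
      rcases hne.lt_or_gt with h1 | h1
      · exact ⟨w, h1⟩
      · refine ⟨-w, ?_⟩
        have : ((0 : F), -w) = -(0, w) := by simp
        rw [this, map_neg]; linarith
    have h1 : ∀ᶠ t in 𝓝[>] (0 : ℝ), p.2 + t • w' ∈ B p.1 := by
      filter_upwards [eventually_neg_line hd' h0 hw', (tendsto_line p w').eventually hp] with t ht ht'
      exact ht'.2 ht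
    have h2 : Tendsto (fun t : ℝ => p.2 + t • w') (𝓝[>] 0) (𝓝 p.2) :=
      (continuous_snd.tendsto p).comp (tendsto_line p w')
    exact mem_closure_of_tendsto h2 h1
  · exact absurd (hp.self_of_nhds.1 (interior_subset hint)) (by simp [h0])

/-- To first order, moving from a boundary point in an outward direction leaves the set, and moving
in the opposite direction enters it, uniformly in the base point and the direction. -/
lemma exists_step (h : IsDefiningFunction B ρ p₀) {w₀ : G} (hw₀ : 0 < fderiv ℝ ρ p₀ (0, w₀)) :
    ∃ β > (0 : ℝ), ∃ c > (0 : ℝ), ∀ (p : F × G) (ξ : F) (w : G) (σ : ℝ), ‖p - p₀‖ < β → ρ p = 0 →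
      ‖w - w₀‖ ≤ β → σ ∈ Ioc 0 c → ‖ξ - p.1‖ ≤ β * σ →
      p.2 + σ • w ∉ closure (B ξ) ∧ p.2 - σ • w ∈ B ξ := by
  -- by strict differentiability at `p₀`, `ρ` changes by `± σ d` up to an error smaller than `σ d`
  set D := fderiv ℝ ρ p₀
  set d := D (0, w₀)
  have hstrict := h.contDiffAt.hasStrictFDerivAt one_ne_zero
  have hκ : 0 < d / (4 * (‖w₀‖ + 2)) := by positivity
  have hev := hstrict.isLittleO.def hκ
  rw [nhds_prod_eq] at hev
  obtain ⟨r, hr, hball⟩ := Metric.nhds_basis_ball.prod_self.mem_iff.1 hev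
  have hev2 : ∀ᶠ p in 𝓝 p₀, (p.2 ∈ B p.1 ↔ ρ p < 0) ∧ (0 < ρ p → p.2 ∉ closure (B p.1)) :=
    h.mem_iff.and h.eventually_notMem_closure
  obtain ⟨r', hr', hball'⟩ := Metric.mem_nhds_iff.1 hev2
  set R := min r r'
  have hR : 0 < R := lt_min hr hr'
  set β := min 1 (min (R / 4) (d / (8 * (‖D‖ + 1))))
  have hβ : 0 < β := by positivity
  have hβ1 : β ≤ 1 := min_le_left _ _
  have hβR : β ≤ R / 4 := (min_le_right _ _).trans (min_le_left _ _)
  have hβd : ‖D‖ * β ≤ d / 8 := by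
    have h1 : β ≤ d / (8 * (‖D‖ + 1)) := (min_le_right _ _).trans (min_le_right _ _)
    rw [le_div_iff₀ (by positivity)] at h1
    nlinarith [norm_nonneg D, hβ]
  set c := min 1 (R / (4 * (‖w₀‖ + 1)))
  have hc : 0 < c := by positivity
  refine ⟨β, hβ, c, hc, fun p ξ w σ hp hp0 hw hσ hξ => ?_⟩
  have hwn : ‖w‖ ≤ ‖w₀‖ + β := by
    calc ‖w‖ = ‖(w - w₀) + w₀‖ := by simp
      _ ≤ ‖w - w₀‖ + ‖w₀‖ := norm_add_le _ _
      _ ≤ ‖w₀‖ + β := by linarith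
  have hσ1 : σ ≤ 1 := hσ.2.trans (min_le_left _ _)
  have hσw : σ * ‖w‖ ≤ R / 4 := by
    have h1 : σ ≤ R / (4 * (‖w₀‖ + 1)) := hσ.2.trans (min_le_right _ _)
    rw [le_div_iff₀ (by positivity)] at h1
    nlinarith [hσ.1, norm_nonneg w]
  -- the estimate for a displacement `τ w` with `τ = ± σ`
  have key : ∀ τ : ℝ, |τ| = σ → (ξ, p.2 + τ • w) ∈ Metric.ball p₀ R ∧
      |ρ (ξ, p.2 + τ • w) - τ * d| < σ * d := by
    intro τ hτ
    have hdiff : ((ξ, p.2 + τ • w) : F × G) - p = (ξ - p.1, τ • w) := by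
      ext <;> simp
    have hnτ : ‖τ • w‖ = σ * ‖w‖ := by rw [norm_smul, Real.norm_eq_abs, hτ]
    have hnd : ‖((ξ, p.2 + τ • w) : F × G) - p‖ ≤ σ * (‖w₀‖ + 2) := by
      rw [hdiff, Prod.norm_def, hnτ]
      refine max_le (hξ.trans ?_) ?_
      · nlinarith [hσ.1, norm_nonneg w₀]
      · exact mul_le_mul_of_nonneg_left (by linarith) hσ.1.le
    have hmem : (ξ, p.2 + τ • w) ∈ Metric.ball p₀ R := by
      rw [Metric.mem_ball, dist_eq_norm]
      have h1 : ‖((ξ, p.2 + τ • w) : F × G) - p‖ ≤ R / 4 := by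
        rw [hdiff, Prod.norm_def, hnτ]
        refine max_le (hξ.trans ?_) hσw
        nlinarith [hσ.1]
      calc ‖((ξ, p.2 + τ • w) : F × G) - p₀‖ = ‖(((ξ, p.2 + τ • w) : F × G) - p) + (p - p₀)‖ := by
            simp
        _ ≤ _ := norm_add_le _ _
        _ < R := by linarith
    refine ⟨hmem, ?_⟩
    have hpb : p ∈ Metric.ball p₀ R := by
      rw [Metric.mem_ball, dist_eq_norm]; linarith
    have h1 := hball (mk_mem_prod (Metric.ball_subset_ball (min_le_left _ _) hmem)
      (Metric.ball_subset_ball (min_le_left _ _) hpb))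
    simp only [mem_ofPred_eq, hp0, sub_zero, hdiff] at h1
    rw [← hdiff] at h1
    have h2 : D (((ξ, p.2 + τ • w) : F × G) - p) = D (ξ - p.1, τ • (w - w₀)) + τ * d := by
      rw [hdiff, ← smul_eq_mul, ← map_smul, ← map_add]
      congr 1
      ext <;> simp [smul_sub]
    have h3 : |D (ξ - p.1, τ • (w - w₀))| ≤ σ * (d / 8) := by
      have : ‖((ξ - p.1, τ • (w - w₀)) : F × G)‖ ≤ σ * β := by
        rw [Prod.norm_def, norm_smul, Real.norm_eq_abs, hτ]
        exact max_le (by linarith [hξ]) (mul_le_mul_of_nonneg_left hw hσ.1.le)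
      calc |D (ξ - p.1, τ • (w - w₀))| ≤ ‖D‖ * ‖((ξ - p.1, τ • (w - w₀)) : F × G)‖ :=
            D.le_opNorm _
        _ ≤ ‖D‖ * (σ * β) := by gcongr
        _ = σ * (‖D‖ * β) := by ring
        _ ≤ σ * (d / 8) := mul_le_mul_of_nonneg_left hβd hσ.1.le
    have h4 : ‖ρ (ξ, p.2 + τ • w) - D (((ξ, p.2 + τ • w) : F × G) - p)‖ ≤ σ * (d / 4) := by
      refine h1.trans ((mul_le_mul_of_nonneg_left hnd hκ.le).trans (le_of_eq ?_))
      field_simp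
    rw [h2, Real.norm_eq_abs] at h4
    have hd0 : 0 < σ * d := mul_pos hσ.1 hw₀
    calc |ρ (ξ, p.2 + τ • w) - τ * d|
        = |(ρ (ξ, p.2 + τ • w) - (D (ξ - p.1, τ • (w - w₀)) + τ * d)) +
            D (ξ - p.1, τ • (w - w₀))| := by congr 1; ring
      _ ≤ σ * (d / 4) + σ * (d / 8) := (abs_add_le _ _).trans (add_le_add h4 h3)
      _ < σ * d := by linarith
  obtain ⟨m1, k1⟩ := key σ (abs_of_pos hσ.1)
  obtain ⟨m2, k2⟩ := key (-σ) (by rw [abs_neg, abs_of_pos hσ.1])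
  refine ⟨(hball' (Metric.ball_subset_ball (min_le_right _ _) m1)).2 ?_, ?_⟩
  · have := (abs_lt.1 k1).1
    linarith
  · have h5 := (hball' (Metric.ball_subset_ball (min_le_right _ _) m2)).1
    simp only [neg_smul, ← sub_eq_add_neg] at h5 k2
    refine h5.2 ?_
    have := (abs_lt.1 k2).2
    linarith

/-- A curve that starts at a boundary point of the rescaled set `ε B` with an outward velocity
stays out of the closures of the rescaled sets for a time that does not depend on `ε`. -/
theorem exists_exit (h : IsDefiningFunction B ρ p₀) {w₀ : G} (hw₀ : 0 < fderiv ℝ ρ p₀ (0, w₀))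
    (hconv : ∀ᶠ ξ in 𝓝 p₀.1, Convex ℝ (B ξ)) {K : ℝ} (hK : 0 ≤ K) :
    ∃ δ > (0 : ℝ), ∀ (ε t : ℝ) (p : F × G) (ξ : F) (u : G), ε ∈ Ioo 0 δ → t ∈ Ioo 0 δ →
      ‖p - p₀‖ < δ → ρ p = 0 → ‖ξ - p.1‖ ≤ K * t → ‖u - ε • p.2 - t • w₀‖ ≤ δ * t →
      ε⁻¹ • u ∉ closure (B ξ) := by
  obtain ⟨β, hβ, c, hc, hstep⟩ := h.exists_step hw₀
  obtain ⟨r, hr, hball⟩ := Metric.mem_nhds_iff.1 hconv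
  set δ := min (min β (r / (2 * (K + 1)))) (min (β / (K + 1)) (c * β / (K + 1)))
  have hδ : 0 < δ := by positivity
  have hδβ : δ ≤ β := (min_le_left _ _).trans (min_le_left _ _)
  have hδr : δ * (2 * (K + 1)) ≤ r :=
    (le_div_iff₀ (by positivity)).1 ((min_le_left _ _).trans (min_le_right _ _))
  have hδ1 : δ * (K + 1) ≤ β :=
    (le_div_iff₀ (by positivity)).1 ((min_le_right _ _).trans (min_le_left _ _))
  have hδ2 : δ * (K + 1) ≤ c * β :=
    (le_div_iff₀ (by positivity)).1 ((min_le_right _ _).trans (min_le_right _ _))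
  refine ⟨δ, hδ, fun ε t p ξ u hε ht hp hp0 hξ hu hcl => ?_⟩
  set w := t⁻¹ • (u - ε • p.2)
  have hw : ‖w - w₀‖ ≤ β := by
    have : w - w₀ = t⁻¹ • (u - ε • p.2 - t • w₀) := by
      simp only [w, smul_sub, inv_smul_smul₀ ht.1.ne']
    rw [this, norm_smul, norm_inv, Real.norm_of_nonneg ht.1.le, inv_mul_le_iff₀ ht.1]
    nlinarith [ht.1]
  set σ := t / ε
  have hσ : 0 < σ := div_pos ht.1 hε.1
  have hεu : ε⁻¹ • u = p.2 + σ • w := by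
    simp only [w, σ, smul_smul, div_eq_mul_inv]
    rw [show t * ε⁻¹ * t⁻¹ = ε⁻¹ by field_simp [ht.1.ne'], smul_sub, inv_smul_smul₀ hε.1.ne']
    abel
  rw [hεu] at hcl
  rcases le_or_gt σ c with hle | hgt
  · refine (hstep p ξ w σ (hp.trans_le hδβ) hp0 hw ⟨hσ, hle⟩ (hξ.trans ?_)).1 hcl
    have : t = σ * ε := by simp only [σ]; field_simp [hε.1.ne']
    rw [this]
    have h1 : ε * K ≤ β := by nlinarith [hε.1, hε.2]
    nlinarith
  · have h1 : ‖ξ - p.1‖ ≤ β * c := hξ.trans (by nlinarith [ht.1, ht.2])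
    obtain ⟨hout, hin⟩ := hstep p ξ w c (hp.trans_le hδβ) hp0 hw ⟨hc, le_rfl⟩ h1
    have hξ0 : ξ ∈ Metric.ball p₀.1 r := by
      rw [Metric.mem_ball, dist_eq_norm]
      have h2 : ‖p.1 - p₀.1‖ ≤ ‖p - p₀‖ := norm_fst_le (p - p₀)
      calc ‖ξ - p₀.1‖ = ‖(ξ - p.1) + (p.1 - p₀.1)‖ := by simp
        _ ≤ ‖ξ - p.1‖ + ‖p.1 - p₀.1‖ := norm_add_le _ _
        _ < r := by nlinarith [ht.1, ht.2]
    -- the point `p.2 + c w` lies between `p.2 - c w` and `p.2 + σ w`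
    refine hout ((hball hξ0).closure.segment_subset (subset_closure hin) hcl ?_)
    refine ⟨(σ - c) / (σ + c), 2 * c / (σ + c), div_nonneg (by linarith) (by linarith), by positivity,
      by field_simp; ring, ?_⟩
    have hs : σ + c ≠ 0 := by positivity
    have e1 : (σ - c) / (σ + c) + 2 * c / (σ + c) = 1 := by field_simp; ring
    have e2 : -((σ - c) / (σ + c) * c) + 2 * c / (σ + c) * σ = c := by field_simp; ring
    calc _ = ((σ - c) / (σ + c) + 2 * c / (σ + c)) • p.2 +
          (-((σ - c) / (σ + c) * c) + 2 * c / (σ + c) * σ) • w := by module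
      _ = p.2 + c • w := by rw [e1, e2, one_smul]

end IsDefiningFunction

/-- A family of convex sets with locally defined boundaries is locally bounded. -/
theorem exists_eventually_bounded [FiniteDimensional ℝ G] {B : F → Set G} {ξ₀ : F}
    (hopen : IsOpen (B ξ₀)) (hbdd : Bornology.IsBounded (B ξ₀))
    (hconv : ∀ᶠ ξ in 𝓝 ξ₀, Convex ℝ (B ξ)) (hzero : ∀ᶠ ξ in 𝓝 ξ₀, (0 : G) ∈ B ξ)
    (hdef : ∀ s ∈ frontier (B ξ₀), ∃ ρ : F × G → ℝ, IsDefiningFunction B ρ (ξ₀, s)) :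
    ∃ R : ℝ, ∀ᶠ ξ in 𝓝 ξ₀, ∀ v ∈ closure (B ξ), ‖v‖ ≤ R := by
  have h0 : (0 : G) ∈ B ξ₀ := hzero.self_of_nhds
  have hc0 : Convex ℝ (B ξ₀) := hconv.self_of_nhds
  have hcpt : IsCompact (frontier (B ξ₀)) :=
    Metric.isCompact_of_isClosed_isBounded isClosed_frontier
      (hbdd.closure.subset frontier_subset_closure)
  obtain ⟨R₀, hR₀⟩ := hcpt.isBounded.exists_norm_le
  have hloc : ∀ s ∈ frontier (B ξ₀), ∀ᶠ q in 𝓝 s ×ˢ 𝓝 ξ₀, ∃ t ∈ Ioc (1 : ℝ) 2, t • q.1 ∉ B q.2 := by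
    intro s hs
    obtain ⟨ρ, hρ⟩ := hdef s hs
    have hρd : DifferentiableAt ℝ ρ (ξ₀, s) := hρ.contDiffAt.differentiableAt one_ne_zero
    have hρ0 : ρ (ξ₀, s) = 0 := hρ.eventually_eq_zero_of_mem_frontier.self_of_nhds hs
    -- the radial derivative is positive
    have hle : ∀ b ∈ B ξ₀, fderiv ℝ ρ (ξ₀, s) (0, b - s) ≤ 0 := by
      intro b hb
      by_contra! hpos
      have h1 : fderiv ℝ (fun p => -ρ p) (ξ₀, s) (0, b - s) < 0 := by
        rw [fderiv_fun_neg]; simpa using hpos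
      have h2 := IsDefiningFunction.eventually_neg_line hρd.neg (by simp [hρ0]) h1
      have h3 := (IsDefiningFunction.tendsto_line (ξ₀, s) (b - s)).eventually hρ.mem_iff
      have h4 : ∀ᶠ t in 𝓝[>] (0 : ℝ), t < 1 := nhdsWithin_le_nhds (gt_mem_nhds one_pos)
      obtain ⟨t, ⟨ht2, ht3⟩, ht4, ht0⟩ := ((h2.and h3).and (h4.and self_mem_nhdsWithin)).exists
      have h5 : s + t • (b - s) ∈ B ξ₀ := by
        have := hc0.combo_closure_interior_mem_interior hs.1 (hopen.interior_eq.symm ▸ hb)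
          (sub_nonneg.2 ht4.le) ht0 (by ring : (1 - t) + t = 1)
        rw [hopen.interior_eq] at this
        convert this using 1
        module
      have h6 := ht3.1 h5
      simp only [Pi.neg_apply] at h6 ht2
      linarith
    obtain ⟨w, hw⟩ : ∃ w : G, 0 < fderiv ℝ ρ (ξ₀, s) (0, w) := by
      obtain ⟨w, hw⟩ := hρ.fderiv_ne
      rcases hw.lt_or_gt with h | h
      · refine ⟨-w, ?_⟩
        have : ((0 : F), -w) = -(0, w) := by simp
        rw [this, map_neg]; linarith
      · exact ⟨w, h⟩
    have hlt : 0 < fderiv ℝ ρ (ξ₀, s) (0, s) := by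
      have h1 : ∀ᶠ τ in 𝓝[>] (0 : ℝ), τ • w ∈ B ξ₀ := by
        have hcw : Continuous fun τ : ℝ => τ • w := by fun_prop
        refine nhdsWithin_le_nhds (hcw.continuousAt.eventually (hopen.mem_nhds ?_))
        simpa using h0
      obtain ⟨τ, hτ, hτ0⟩ := (h1.and self_mem_nhdsWithin).exists
      have h2 := hle _ hτ
      have h3 : ((0 : F), τ • w - s) = τ • (0, w) - (0, s) := by ext <;> simp
      rw [h3, map_sub, map_smul, smul_eq_mul] at h2
      have := mul_pos hτ0 hw
      linarith
    have h7 : fderiv ℝ (fun p => -ρ p) (ξ₀, s) (0, s) < 0 := by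
      rw [fderiv_fun_neg]; simpa using hlt
    have h8 := IsDefiningFunction.eventually_neg_line hρd.neg (by simp [hρ0]) h7
    have h9 := (IsDefiningFunction.tendsto_line (ξ₀, s) s).eventually
      (hρ.mem_iff.eventually_nhds.and hρ.eventually_continuousAt)
    have h10 : ∀ᶠ t in 𝓝[>] (0 : ℝ), t < 1 := nhdsWithin_le_nhds (gt_mem_nhds one_pos)
    obtain ⟨t, ⟨ht8, ht9⟩, ht10, ht0⟩ := ((h8.and h9).and (h10.and self_mem_nhdsWithin)).exists
    have hts : s + t • s = (1 + t) • s := by module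
    simp only [hts, Pi.neg_apply] at ht8 ht9
    have h11 : ∀ᶠ p in 𝓝 (ξ₀, (1 + t) • s), p.2 ∉ B p.1 := by
      filter_upwards [ht9.1, ht9.2.eventually (lt_mem_nhds (show 0 < ρ (ξ₀, (1 + t) • s) by linarith))]
        with p hp hp' hpB
      exact lt_asymm hp' (hp.1 hpB)
    have hcont : Continuous fun q : G × F => ((q.2, (1 + t) • q.1) : F × G) := by fun_prop
    rw [← nhds_prod_eq]
    filter_upwards [(hcont.tendsto (s, ξ₀)).eventually h11] with q hq
    exact ⟨1 + t, ⟨by simpa using ht0, by linarith⟩, hq⟩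
  have hall : ∀ᶠ ξ in 𝓝 ξ₀, ∀ s ∈ frontier (B ξ₀), ∃ t ∈ Ioc (1 : ℝ) 2, t • s ∉ B ξ :=
    hcpt.eventually_forall_of_forall_eventually 
      (P := fun ξ s => ∃ t ∈ Ioc (1 : ℝ) 2, t • s ∉ B ξ)
      (fun s hs => by
        have := hloc s hs
        rw [← nhds_prod_eq] at this
        exact (continuous_swap.tendsto (ξ₀, s)).eventually this)
  refine ⟨2 * |R₀|, ?_⟩
  filter_upwards [hall, hconv, hzero] with ξ hξ hcξ h0ξ
  have : ∀ v ∈ B ξ, ‖v‖ ≤ 2 * |R₀| := by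
    intro v hv
    rcases eq_or_ne v 0 with rfl | hv0
    · simp
    have hnhds : B ξ₀ ∈ 𝓝 (0 : G) := hopen.mem_nhds h0
    have hg : 0 < gauge (B ξ₀) v :=
      (gauge_pos (absorbent_nhds_zero hnhds) (NormedSpace.isVonNBounded_of_isBounded ℝ hbdd)).2 hv0
    set g := gauge (B ξ₀) v
    have hs : g⁻¹ • v ∈ frontier (B ξ₀) := by
      rw [← gauge_eq_one_iff_mem_frontier hc0 hnhds, gauge_smul_of_nonneg (inv_nonneg.2 hg.le)]
      simp [g, hg.ne']
    obtain ⟨t, ht, htB⟩ := hξ _ hs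
    have h1 : t * g⁻¹ > 1 := by
      by_contra! hle
      refine htB ?_
      rw [smul_smul]
      have := hcξ.smul_mem_of_zero_mem h0ξ hv (t := t * g⁻¹) ⟨by have := ht.1; positivity, hle⟩
      exact this
    have h2 := hR₀ _ hs
    rw [norm_smul, norm_inv, Real.norm_of_nonneg hg.le] at h2
    have h3 : g < t := by
      rw [gt_iff_lt, ← div_eq_mul_inv, one_lt_div hg] at h1
      exact h1
    rw [inv_mul_le_iff₀ hg] at h2
    calc ‖v‖ ≤ g * R₀ := h2
      _ ≤ g * |R₀| := by gcongr; exact le_abs_self _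
      _ ≤ 2 * |R₀| := by gcongr; linarith [ht.2]
  intro v hv
  have hcl : closure (B ξ) ⊆ Metric.closedBall 0 (2 * |R₀|) :=
    closure_minimal (fun v hv => by simpa using this v hv) Metric.isClosed_closedBall
  simpa using hcl hv

end ConvexFamily

end

/-! ### Canonical charts of the cotangent bundle -/

section

variable {E : Type*} [NormedAddCommGroup E] [NormedSpace ℝ E]
variable {M : Type*} [TopologicalSpace M] [ChartedSpace E M] [IsManifold 𝓘(ℝ, E) ∞ M]

/-- The model with corners of `T*M`. -/
abbrev coI (E : Type*) [NormedAddCommGroup E] [NormedSpace ℝ E] :=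
  𝓘(ℝ, E).prod 𝓘(ℝ, E →L[ℝ] ℝ)

lemma mem_extChartAt_source_iff (z₀ z : CotangentBundle E M) :
    z ∈ (extChartAt (coI E) z₀).source ↔ z.proj ∈ (extChartAt 𝓘(ℝ, E) z₀.proj).source := by
  rw [FiberBundle.extChartAt]
  simp [hom_trivializationAt_apply]

lemma extChartAt_fst (z₀ z : CotangentBundle E M) :
    (extChartAt (coI E) z₀ z).1 = extChartAt 𝓘(ℝ, E) z₀.proj z.proj := by
  rw [FiberBundle.extChartAt]
  simp [hom_trivializationAt_apply]

/-- The momentum coordinate of the bundle chart pairs with the coordinates of a tangent vector as the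
covector pairs with the vector. -/
lemma extChartAt_snd_apply (z₀ z : CotangentBundle E M) (hz : z ∈ (extChartAt (coI E) z₀).source)
    (v : TangentSpace 𝓘(ℝ, E) z.proj) :
    (extChartAt (coI E) z₀ z).2 (mfderiv 𝓘(ℝ, E) 𝓘(ℝ, E) (extChartAt 𝓘(ℝ, E) z₀.proj) z.proj v)
      = z.2 v := by
  rw [mem_extChartAt_source_iff] at hz
  have hz' := hz
  rw [extChartAt_source] at hz'
  have h2 : (extChartAt (coI E) z₀ z).2 = ContinuousLinearMap.comp (z.2 : E →L[ℝ] ℝ)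
      ((trivializationAt E (TangentSpace 𝓘(ℝ, E)) z₀.proj).symmL ℝ z.proj : E →L[ℝ] E) := by
    rw [FiberBundle.extChartAt]
    simp [hom_trivializationAt_apply, ContinuousLinearMap.inCoordinates]
  rw [h2, TangentBundle.symmL_trivializationAt (I := 𝓘(ℝ, E)) hz']
  exact congrArg z.2 (DFunLike.congr_fun
    (mfderivWithin_extChartAt_symm_comp_mfderiv_extChartAt' (I := 𝓘(ℝ, E)) hz) v)

lemma extChartAt_mk (z₀ : CotangentBundle E M) (p : TangentSpace 𝓘(ℝ, E) z₀.proj →L[ℝ] Bundle.Trivial M ℝ z₀.proj) :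
    extChartAt (coI E) z₀ ⟨z₀.proj, p⟩ = (extChartAt 𝓘(ℝ, E) z₀.proj z₀.proj, p) := by
  have hz : (⟨z₀.proj, p⟩ : CotangentBundle E M) ∈ (extChartAt (coI E) z₀).source := by
    rw [mem_extChartAt_source_iff]; simp
  refine Prod.ext (extChartAt_fst _ _) (ContinuousLinearMap.ext fun v => ?_)
  have := extChartAt_snd_apply z₀ _ hz v
  rw [mfderiv_extChartAt_self] at this
  exact this

end

/-! ### Symplectic transition maps and the Hamiltonian vector field -/

section

variable {E : Type*} [NormedAddCommGroup E] [NormedSpace ℝ E]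

section Symplectic

/-! Shortcut instances for the dual of `E × E*`. -/

instance instNormedAddCommGroupPhaseDual : NormedAddCommGroup ((E × (E →L[ℝ] ℝ)) →L[ℝ] ℝ) :=
  ContinuousLinearMap.toNormedAddCommGroup

instance instAddCommGroupPhaseDual : AddCommGroup ((E × (E →L[ℝ] ℝ)) →L[ℝ] ℝ) :=
  ContinuousLinearMap.addCommGroup

instance instTopologicalSpacePhaseDual : TopologicalSpace ((E × (E →L[ℝ] ℝ)) →L[ℝ] ℝ) :=
  ContinuousLinearMap.topologicalSpace

instance instModulePhaseDual : Module ℝ ((E × (E →L[ℝ] ℝ)) →L[ℝ] ℝ) :=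
  ContinuousLinearMap.module

instance instNormedSpacePhaseDual : NormedSpace ℝ ((E × (E →L[ℝ] ℝ)) →L[ℝ] ℝ) :=
  ContinuousLinearMap.toNormedSpace

variable (E) in
/-- The canonical symplectic form on `E × E*`, as a map to the dual:
`(v, κ) ↦ ((w, η) ↦ η v - κ w)`. -/
def symplecticFlat : (E × (E →L[ℝ] ℝ)) →ₗ[ℝ] ((E × (E →L[ℝ] ℝ)) →L[ℝ] ℝ) where
  toFun a := (ContinuousLinearMap.apply ℝ ℝ a.1).comp (ContinuousLinearMap.snd ℝ E (E →L[ℝ] ℝ)) -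
    a.2.comp (ContinuousLinearMap.fst ℝ E (E →L[ℝ] ℝ))
  map_add' a b := by
    refine ContinuousLinearMap.ext fun c => ?_
    change c.2 (a.1 + b.1) - (a.2 c.1 + b.2 c.1) = (c.2 a.1 - a.2 c.1) + (c.2 b.1 - b.2 c.1)
    rw [map_add]
    ring
  map_smul' r a := by
    refine ContinuousLinearMap.ext fun c => ?_
    change c.2 (r • a.1) - r * a.2 c.1 = r * (c.2 a.1 - a.2 c.1)
    rw [map_smul, smul_eq_mul]
    ring

@[simp] lemma symplecticFlat_apply (a b : E × (E →L[ℝ] ℝ)) :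
    symplecticFlat E a b = b.2 a.1 - a.2 b.1 := rfl

lemma symplecticFlat_injective [FiniteDimensional ℝ E] : Function.Injective (symplecticFlat E) := by
  refine (injective_iff_map_eq_zero _).2 fun a ha => ?_
  have h : ∀ b : E × (E →L[ℝ] ℝ), b.2 a.1 - a.2 b.1 = 0 := fun b => by
    rw [← symplecticFlat_apply, ha]; rfl
  refine Prod.ext ?_ (ContinuousLinearMap.ext fun w => ?_)
  · refine (SeparatingDual.eq_zero_iff_forall_dual_eq_zero (R := ℝ) _).2 fun η => ?_
    simpa using h (0, η)
  · simpa using h (w, 0)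

lemma finrank_strongDual (V : Type*) [NormedAddCommGroup V] [NormedSpace ℝ V]
    [FiniteDimensional ℝ V] : Module.finrank ℝ (V →L[ℝ] ℝ) = Module.finrank ℝ V := by
  rw [← (LinearMap.toContinuousLinearMap (𝕜 := ℝ) (E := V) (F' := ℝ)).finrank_eq]
  exact Subspace.dual_finrank_eq

variable (E) in
/-- The isomorphism of `E × E*` with its dual given by the canonical symplectic form. -/
def symplecticEquiv [FiniteDimensional ℝ E] :
    (E × (E →L[ℝ] ℝ)) ≃L[ℝ] ((E × (E →L[ℝ] ℝ)) →L[ℝ] ℝ) :=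
  (LinearEquiv.ofInjectiveOfFinrankEq (symplecticFlat E) symplecticFlat_injective
    (finrank_strongDual _).symm).toContinuousLinearEquiv

lemma symplecticEquiv_apply [FiniteDimensional ℝ E] (a b : E × (E →L[ℝ] ℝ)) :
    symplecticEquiv E a b = b.2 a.1 - a.2 b.1 :=
  symplecticFlat_apply a b

end Symplectic

section ChartTransition

variable {V : Type*} [NormedAddCommGroup V] [NormedSpace ℝ V]
  {HV : Type*} [TopologicalSpace HV] {I : ModelWithCorners ℝ V HV} [I.Boundaryless]
  {Q : Type*} [TopologicalSpace Q] [ChartedSpace HV Q] [IsManifold I ∞ Q]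

lemma contDiffAt_transition (x y z : Q) (hx : z ∈ (extChartAt I x).source)
    (hy : z ∈ (extChartAt I y).source) :
    ContDiffAt ℝ ∞ (extChartAt I y ∘ (extChartAt I x).symm) (extChartAt I x z) := by
  have h := contDiffWithinAt_ext_coord_change (I := I) (n := ∞) y x (y := extChartAt I x z) (by
    rw [PartialEquiv.trans_source]
    refine ⟨(extChartAt I x).map_source hx, ?_⟩
    rwa [mem_preimage, (extChartAt I x).left_inv hx])
  rwa [I.range_eq_univ, contDiffWithinAt_univ] at h

omit [IsManifold I ∞ Q] in
lemma eventually_mem_source (x : Q) {z : Q} (hx : z ∈ (extChartAt I x).source) {U : Set Q}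
    (hU : U ∈ 𝓝 z) : ∀ᶠ ξ in 𝓝 (extChartAt I x z), ξ ∈ (extChartAt I x).target ∧
      (extChartAt I x).symm ξ ∈ U := by
  have hc := continuousAt_extChartAt_symm' (I := I) hx
  refine (Filter.Eventually.and ?_ (hc.eventually ?_))
  · exact (isOpen_extChartAt_target x).mem_nhds ((extChartAt I x).map_source hx)
  · rwa [(extChartAt I x).left_inv hx]

end ChartTransition

variable {M : Type*} [TopologicalSpace M] [ChartedSpace E M] [IsManifold 𝓘(ℝ, E) ∞ M]

/-- The transition maps between canonical charts preserve the tautological one-form. -/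
lemma transition_snd_apply (z₀ z₁ z : CotangentBundle E M)
    (h₀ : z ∈ (extChartAt (coI E) z₀).source) (h₁ : z ∈ (extChartAt (coI E) z₁).source) (v : E) :
    (extChartAt (coI E) z₁ z).2 (fderiv ℝ (extChartAt 𝓘(ℝ, E) z₁.proj ∘
      (extChartAt 𝓘(ℝ, E) z₀.proj).symm) (extChartAt 𝓘(ℝ, E) z₀.proj z.proj) v) =
    (extChartAt (coI E) z₀ z).2 v := by
  have k₀ := (mem_extChartAt_source_iff z₀ z).1 h₀
  have k₁ := (mem_extChartAt_source_iff z₁ z).1 h₁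
  obtain ⟨v', hv'⟩ : ∃ v' : TangentSpace 𝓘(ℝ, E) z.proj,
      mfderiv 𝓘(ℝ, E) 𝓘(ℝ, E) (extChartAt 𝓘(ℝ, E) z₀.proj) z.proj v' = v := by
    obtain ⟨A, hA⟩ := isInvertible_mfderiv_extChartAt (I := 𝓘(ℝ, E)) k₀
    exact ⟨A.symm v, by rw [← hA]; exact A.apply_symm_apply v⟩
  have hd : DifferentiableAt ℝ (extChartAt 𝓘(ℝ, E) z₁.proj ∘ (extChartAt 𝓘(ℝ, E) z₀.proj).symm)
      (extChartAt 𝓘(ℝ, E) z₀.proj z.proj) :=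
    (contDiffAt_transition z₀.proj z₁.proj z.proj k₀ k₁).differentiableAt (by simp)
  have h0 : HasMFDerivAt 𝓘(ℝ, E) 𝓘(ℝ, E) (extChartAt 𝓘(ℝ, E) z₀.proj) z.proj
      (mfderiv 𝓘(ℝ, E) 𝓘(ℝ, E) (extChartAt 𝓘(ℝ, E) z₀.proj) z.proj) :=
    (mdifferentiableAt_extChartAt (by simpa using k₀)).hasMFDerivAt
  have h1 : HasMFDerivAt 𝓘(ℝ, E) 𝓘(ℝ, E) (extChartAt 𝓘(ℝ, E) z₁.proj) z.proj
      (mfderiv 𝓘(ℝ, E) 𝓘(ℝ, E) (extChartAt 𝓘(ℝ, E) z₁.proj) z.proj) :=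
    (mdifferentiableAt_extChartAt (by simpa using k₁)).hasMFDerivAt
  have h2 := hd.hasFDerivAt.hasMFDerivAt.comp z.proj h0
  have h3 : (extChartAt 𝓘(ℝ, E) z₁.proj ∘ (extChartAt 𝓘(ℝ, E) z₀.proj).symm) ∘
      (extChartAt 𝓘(ℝ, E) z₀.proj) =ᶠ[𝓝 z.proj] extChartAt 𝓘(ℝ, E) z₁.proj := by
    filter_upwards [(isOpen_extChartAt_source z₀.proj).mem_nhds k₀] with q hq
    simp only [Function.comp_apply, (extChartAt 𝓘(ℝ, E) z₀.proj).left_inv hq]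
  have h4 := hasMFDerivAt_unique (h2.congr_of_eventuallyEq h3.symm) h1
  rw [← hv', extChartAt_snd_apply z₀ z h₀, ← extChartAt_snd_apply z₁ z h₁, ← h4]
  rfl

variable [FiniteDimensional ℝ E]

/-- The Hamiltonian vector field of `H` in the canonical chart at `z₀`. -/
def chartField (H : CotangentBundle E M → ℝ) (z₀ : CotangentBundle E M)
    (ξ : E × (E →L[ℝ] ℝ)) : E × (E →L[ℝ] ℝ) :=
  (symplecticEquiv E).symm (fderiv ℝ (H ∘ (extChartAt (coI E) z₀).symm) ξ)

omit [FiniteDimensional ℝ E] in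
lemma contDiffAt_localHamiltonian {H : CotangentBundle E M → ℝ}
    (hH : ContMDiff (coI E) 𝓘(ℝ, ℝ) 3 H) (z₀ : CotangentBundle E M) {ξ : E × (E →L[ℝ] ℝ)}
    (hξ : ξ ∈ (extChartAt (coI E) z₀).target) :
    ContDiffAt ℝ 3 (H ∘ (extChartAt (coI E) z₀).symm) ξ := by
  have h := (hH.contMDiffOn (s := univ)).comp
    ((contMDiffOn_extChartAt_symm (I := coI E) (n := 3) z₀)) (fun _ _ => mem_univ _)
  exact (contMDiffOn_iff_contDiffOn.1 h).contDiffAt ((isOpen_extChartAt_target z₀).mem_nhds hξ)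

lemma contDiffAt_chartField {H : CotangentBundle E M → ℝ}
    (hH : ContMDiff (coI E) 𝓘(ℝ, ℝ) 3 H) (z₀ : CotangentBundle E M) {ξ : E × (E →L[ℝ] ℝ)}
    (hξ : ξ ∈ (extChartAt (coI E) z₀).target) :
    ContDiffAt ℝ 2 (chartField H z₀) ξ := by
  have h := (contDiffAt_localHamiltonian hH z₀ hξ).fderiv_right (m := 2) (by norm_num)
  exact (symplecticEquiv E).symm.contDiff.contDiffAt.comp ξ h

lemma eq_chartField_iff (H : CotangentBundle E M → ℝ) (z₀ : CotangentBundle E M)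
    (ξ a : E × (E →L[ℝ] ℝ)) : a = chartField H z₀ ξ ↔ ∀ (w : E) (η : E →L[ℝ] ℝ),
      fderiv ℝ (H ∘ (extChartAt (coI E) z₀).symm) ξ (w, η) = η a.1 - a.2 w := by
  rw [chartField, ContinuousLinearEquiv.eq_symm_apply]
  constructor
  · intro h w η
    rw [← h, symplecticEquiv_apply]
  · intro h
    refine ContinuousLinearMap.ext fun b => ?_
    rw [symplecticEquiv_apply, ← h]

/-- The transition maps between canonical charts are symplectic, so they map Hamiltonian vector
fields to Hamiltonian vector fields. -/
lemma fderiv_transition_chartField {H : CotangentBundle E M → ℝ}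
    (hH : ContMDiff (coI E) 𝓘(ℝ, ℝ) 3 H) (z₀ z₁ z : CotangentBundle E M)
    (h₀ : z ∈ (extChartAt (coI E) z₀).source) (h₁ : z ∈ (extChartAt (coI E) z₁).source) :
    fderiv ℝ (extChartAt (coI E) z₁ ∘ (extChartAt (coI E) z₀).symm) (extChartAt (coI E) z₀ z)
      (chartField H z₀ (extChartAt (coI E) z₀ z)) = chartField H z₁ (extChartAt (coI E) z₁ z) := by
  set ξ := extChartAt (coI E) z₀ z
  set Ψ := extChartAt (coI E) z₁ ∘ (extChartAt (coI E) z₀).symm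
  set ψ := extChartAt 𝓘(ℝ, E) z₁.proj ∘ (extChartAt 𝓘(ℝ, E) z₀.proj).symm
  have k₀ := (mem_extChartAt_source_iff z₀ z).1 h₀
  have k₁ := (mem_extChartAt_source_iff z₁ z).1 h₁
  have hξ1 : ξ.1 = extChartAt 𝓘(ℝ, E) z₀.proj z.proj := extChartAt_fst z₀ z
  have hΨd : DifferentiableAt ℝ Ψ ξ :=
    (contDiffAt_transition (I := coI E) z₀ z₁ z h₀ h₁).differentiableAt (by simp)
  have hψ : ContDiffAt ℝ 2 ψ ξ.1 := by
    rw [hξ1]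
    exact (contDiffAt_transition z₀.proj z₁.proj z.proj k₀ k₁).of_le (by norm_cast)
  have hΨξ : Ψ ξ = extChartAt (coI E) z₁ z := by
    simp only [Ψ, Function.comp_apply, ξ, (extChartAt (coI E) z₀).left_inv h₀]
  have hev : ∀ᶠ ξ' in 𝓝 ξ, ξ' ∈ (extChartAt (coI E) z₀).target ∧
      (extChartAt (coI E) z₀).symm ξ' ∈ (extChartAt (coI E) z₁).source :=
    eventually_mem_source z₀ h₀ ((isOpen_extChartAt_source z₁).mem_nhds h₁)
  have hpt : ∀ ξ', ξ' ∈ (extChartAt (coI E) z₀).target →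
      (extChartAt (coI E) z₀).symm ξ' ∈ (extChartAt (coI E) z₁).source →
      (Ψ ξ').1 = ψ ξ'.1 ∧ ∀ v, (Ψ ξ').2 (fderiv ℝ ψ ξ'.1 v) = ξ'.2 v := by
    intro ξ' ht hs
    set z' := (extChartAt (coI E) z₀).symm ξ'
    have hz' : z' ∈ (extChartAt (coI E) z₀).source := (extChartAt (coI E) z₀).map_target ht
    have e : extChartAt (coI E) z₀ z' = ξ' := (extChartAt (coI E) z₀).right_inv ht
    have e1 : ξ'.1 = extChartAt 𝓘(ℝ, E) z₀.proj z'.proj := by rw [← e, extChartAt_fst]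
    refine ⟨?_, fun v => ?_⟩
    · have : (Ψ ξ').1 = extChartAt 𝓘(ℝ, E) z₁.proj z'.proj := extChartAt_fst z₁ z'
      rw [this, e1]
      simp only [ψ, Function.comp_apply]
      rw [(extChartAt 𝓘(ℝ, E) z₀.proj).left_inv ((mem_extChartAt_source_iff z₀ z').1 hz')]
    · have := transition_snd_apply z₀ z₁ z' hz' hs v
      rwa [e, ← e1] at this
  set L := fderiv ℝ Ψ ξ
  -- `L` is known from differentiating `Ψ(q, p).1 = ψ(q)` and `Ψ(q, p).2 (Dψ(q) v) = p v`
  have hL1 : ∀ b : E × (E →L[ℝ] ℝ), (L b).1 = fderiv ℝ ψ ξ.1 b.1 := by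
    intro b
    have h1 : HasFDerivAt (fun ξ' => (Ψ ξ').1) ((ContinuousLinearMap.fst ℝ E (E →L[ℝ] ℝ)).comp L) ξ :=
      hΨd.hasFDerivAt.fst
    have h2 : HasFDerivAt (fun ξ' : E × (E →L[ℝ] ℝ) => ψ ξ'.1)
        ((fderiv ℝ ψ ξ.1).comp (ContinuousLinearMap.fst ℝ E (E →L[ℝ] ℝ))) ξ :=
      HasFDerivAt.comp ξ (hψ.differentiableAt (by norm_num)).hasFDerivAt hasFDerivAt_fst
    have h3 : (fun ξ' => (Ψ ξ').1) =ᶠ[𝓝 ξ] fun ξ' => ψ ξ'.1 := by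
      filter_upwards [hev] with ξ' h using (hpt ξ' h.1 h.2).1
    exact DFunLike.congr_fun (h1.unique (h2.congr_of_eventuallyEq h3)) b
  have hL2 : ∀ (b : E × (E →L[ℝ] ℝ)) (v : E), (L b).2 (fderiv ℝ ψ ξ.1 v) +
      (Ψ ξ).2 (fderiv ℝ (fderiv ℝ ψ) ξ.1 b.1 v) = b.2 v := by
    intro b v
    have h1 : HasFDerivAt (fun ξ' => (Ψ ξ').2) ((ContinuousLinearMap.snd ℝ E (E →L[ℝ] ℝ)).comp L) ξ :=
      hΨd.hasFDerivAt.snd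
    have h2 : HasFDerivAt (fun ξ' : E × (E →L[ℝ] ℝ) => fderiv ℝ ψ ξ'.1)
        ((fderiv ℝ (fderiv ℝ ψ) ξ.1).comp (ContinuousLinearMap.fst ℝ E (E →L[ℝ] ℝ))) ξ :=
      HasFDerivAt.comp (g := fderiv ℝ ψ) ξ ((hψ.fderiv_right (m := 1) (by norm_num)).differentiableAt
        (by norm_num)).hasFDerivAt hasFDerivAt_fst
    have h3 := h1.clm_apply (h2.clm_apply (hasFDerivAt_const v ξ))
    have h4 : HasFDerivAt (fun ξ' : E × (E →L[ℝ] ℝ) => ξ'.2 v)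
        ((ContinuousLinearMap.apply ℝ ℝ v).comp (ContinuousLinearMap.snd ℝ E (E →L[ℝ] ℝ))) ξ :=
      ((ContinuousLinearMap.apply ℝ ℝ v).comp (ContinuousLinearMap.snd ℝ E (E →L[ℝ] ℝ))).hasFDerivAt
    have h5 : (fun ξ' => (Ψ ξ').2 (fderiv ℝ ψ ξ'.1 v)) =ᶠ[𝓝 ξ] fun ξ' => ξ'.2 v := by
      filter_upwards [hev] with ξ' h using (hpt ξ' h.1 h.2).2 v
    have h6 := DFunLike.congr_fun (h3.unique (h4.congr_of_eventuallyEq h5)) b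
    simp at h6
    linarith
  have hsymm : ∀ v w : E, fderiv ℝ (fderiv ℝ ψ) ξ.1 v w = fderiv ℝ (fderiv ℝ ψ) ξ.1 w v :=
    fun v w => hψ.isSymmSndFDerivAt (by simp) v w
  -- the terms with second derivatives of `ψ` cancel by symmetry
  have hΩ : ∀ a b, symplecticEquiv E (L a) (L b) = symplecticEquiv E a b := by
    intro a b
    rw [symplecticEquiv_apply, symplecticEquiv_apply, hL1, hL1]
    have e1 := hL2 b a.1
    have e2 := hL2 a b.1
    rw [hsymm b.1 a.1] at e1
    linarith
  have hsurj : Function.Surjective L := by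
    have hinj : Function.Injective (L : (E × (E →L[ℝ] ℝ)) →ₗ[ℝ] (E × (E →L[ℝ] ℝ))) := by
      refine (injective_iff_map_eq_zero _).2 fun a ha => ?_
      have ha' : L a = 0 := ha
      refine (symplecticEquiv E).injective (ContinuousLinearMap.ext fun b => ?_)
      rw [← hΩ, ha']; simp
    exact LinearMap.injective_iff_surjective.1 hinj
  have hh : ∀ b, fderiv ℝ (H ∘ (extChartAt (coI E) z₀).symm) ξ b =
      fderiv ℝ (H ∘ (extChartAt (coI E) z₁).symm) (Ψ ξ) (L b) := by
    intro b
    have h1 : DifferentiableAt ℝ (H ∘ (extChartAt (coI E) z₁).symm) (Ψ ξ) := by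
      rw [hΨξ]
      exact (contDiffAt_localHamiltonian hH z₁ ((extChartAt (coI E) z₁).map_source h₁)).differentiableAt
        (by norm_num)
    have h2 := h1.hasFDerivAt.comp ξ hΨd.hasFDerivAt
    have h3 : (H ∘ (extChartAt (coI E) z₀).symm) =ᶠ[𝓝 ξ] (H ∘ (extChartAt (coI E) z₁).symm) ∘ Ψ := by
      filter_upwards [hev] with ξ' h
      simp only [Ψ, Function.comp_apply, (extChartAt (coI E) z₁).left_inv h.2]
    rw [(h2.congr_of_eventuallyEq h3).fderiv]
    rfl
  rw [← hΨξ]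
  refine (symplecticEquiv E).injective (ContinuousLinearMap.ext fun c => ?_)
  obtain ⟨b, rfl⟩ := hsurj c
  rw [hΩ, chartField, chartField, ContinuousLinearEquiv.apply_symm_apply,
    ContinuousLinearEquiv.apply_symm_apply, hh]

/-- `z` solves Hamilton's equations at the time `t`, as a curve on `s`. -/
def HamiltonianWithinAt (H : CotangentBundle E M → ℝ) (z : ℝ → CotangentBundle E M) (s : Set ℝ)
    (t : ℝ) : Prop :=
  ContinuousWithinAt z s t ∧ ∀ z₀ : CotangentBundle E M, z t ∈ (extChartAt (coI E) z₀).source →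
    HasDerivWithinAt (fun r => extChartAt (coI E) z₀ (z r))
      (chartField H z₀ (extChartAt (coI E) z₀ (z t))) s t

/-- It suffices to verify Hamilton's equations in one canonical chart. -/
lemma HamiltonianWithinAt.of_chart {H : CotangentBundle E M → ℝ}
    (hH : ContMDiff (coI E) 𝓘(ℝ, ℝ) 3 H) {z : ℝ → CotangentBundle E M} {s : Set ℝ} {t : ℝ}
    (ht : t ∈ s) (hc : ContinuousWithinAt z s t) (z₀ : CotangentBundle E M)
    (h₀ : z t ∈ (extChartAt (coI E) z₀).source)
    (hd : HasDerivWithinAt (fun r => extChartAt (coI E) z₀ (z r))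
      (chartField H z₀ (extChartAt (coI E) z₀ (z t))) s t) : HamiltonianWithinAt H z s t := by
  refine ⟨hc, fun z₁ h₁ => ?_⟩
  have hΨ : HasFDerivAt (extChartAt (coI E) z₁ ∘ (extChartAt (coI E) z₀).symm) _
      (extChartAt (coI E) z₀ (z t)) :=
    ((contDiffAt_transition (I := coI E) z₀ z₁ (z t) h₀ h₁).differentiableAt (by simp)).hasFDerivAt
  have h2 := hΨ.comp_hasDerivWithinAt t hd
  rw [fderiv_transition_chartField hH z₀ z₁ (z t) h₀ h₁] at h2
  refine h2.congr_of_eventuallyEq_of_mem ?_ ht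
  filter_upwards [hc ((isOpen_extChartAt_source z₀).mem_nhds h₀)] with r hr
  simp only [Function.comp_apply, (extChartAt (coI E) z₀).left_inv hr]

/-- Trajectories are the integral curves of the Hamiltonian vector field. -/
lemma isHamiltonianArc_iff {H : CotangentBundle E M → ℝ} {z : ℝ → CotangentBundle E M} {T : ℝ} :
    IsHamiltonianArc H z T ↔ 0 < T ∧ ∀ t ∈ Icc (0 : ℝ) T, HamiltonianWithinAt H z (Icc 0 T) t := by
  constructor
  · refine fun h => ⟨h.pos, fun t ht => ⟨h.continuousOn t ht, fun z₀ h₀ => ?_⟩⟩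
    obtain ⟨v, κ, hd, hh⟩ := h.hamilton t ht z₀ h₀
    rwa [(eq_chartField_iff H z₀ _ (v, κ)).2 hh] at hd
  · refine fun h => ⟨h.1, fun t ht => (h.2 t ht).1, fun t ht z₀ h₀ => ?_⟩
    exact ⟨_, _, (h.2 t ht).2 z₀ h₀, (eq_chartField_iff H z₀ _ _).1 rfl⟩

end

/-! ### The flow along a trajectory -/

section

variable {E : Type*} [NormedAddCommGroup E] [NormedSpace ℝ E]
variable {M : Type*} [TopologicalSpace M] [ChartedSpace E M] [IsManifold 𝓘(ℝ, E) ∞ M]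

instance instT2SpaceCotangentBundle [T2Space M] : T2Space (CotangentBundle E M) := by
  refine t2_iff_nhds.2 fun {x y} hne => ?_
  have hx : Tendsto id (𝓝 x ⊓ 𝓝 y) (𝓝 x) := inf_le_left
  have hy : Tendsto id (𝓝 x ⊓ 𝓝 y) (𝓝 y) := inf_le_right
  have hproj : Continuous (fun z : CotangentBundle E M => z.proj) :=
    FiberBundle.continuous_proj (E →L[ℝ] ℝ) _
  have h1 : x.proj = y.proj := tendsto_nhds_unique ((hproj.tendsto x).comp hx) ((hproj.tendsto y).comp hy)
  have hxs : x ∈ (extChartAt (coI E) x).source := mem_extChartAt_source x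
  have hys : y ∈ (extChartAt (coI E) x).source := by
    rw [mem_extChartAt_source_iff, ← h1]; exact mem_extChartAt_source _
  refine (extChartAt (coI E) x).injOn hxs hys (tendsto_nhds_unique
    ((continuousAt_extChartAt' (I := coI E) hxs).tendsto.comp hx)
    ((continuousAt_extChartAt' (I := coI E) hys).tendsto.comp hy))

variable [FiniteDimensional ℝ E]

lemma HamiltonianWithinAt.mono {H : CotangentBundle E M → ℝ} {z : ℝ → CotangentBundle E M}
    {s s' : Set ℝ} {t : ℝ} (h : HamiltonianWithinAt H z s t) (hs : s' ⊆ s) :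
    HamiltonianWithinAt H z s' t :=
  ⟨h.1.mono hs, fun z₀ h₀ => (h.2 z₀ h₀).mono hs⟩

lemma HamiltonianWithinAt.congr {H : CotangentBundle E M → ℝ} {z w : ℝ → CotangentBundle E M}
    {s : Set ℝ} {t : ℝ} (h : HamiltonianWithinAt H z s t) (hw : w =ᶠ[𝓝[s] t] z) (ht : w t = z t) :
    HamiltonianWithinAt H w s t := by
  refine ⟨h.1.congr_of_eventuallyEq hw ht, fun z₀ h₀ => ?_⟩
  rw [ht] at h₀ ⊢
  refine (h.2 z₀ h₀).congr_of_eventuallyEq ?_ (by rw [ht])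
  filter_upwards [hw] with r hr
  rw [hr]

lemma HamiltonianWithinAt.comp_sub {H : CotangentBundle E M → ℝ} {z : ℝ → CotangentBundle E M}
    {t c : ℝ} (h : HamiltonianWithinAt H z univ (t - c)) :
    HamiltonianWithinAt H (fun r => z (r - c)) univ t := by
  refine ⟨?_, fun z₀ h₀ => ?_⟩
  · have h1 := h.1
    rw [continuousWithinAt_univ] at h1 ⊢
    exact ContinuousAt.comp (f := fun r => r - c) (g := z) h1 (by fun_prop)
  · have h1 := h.2 z₀ h₀
    rw [hasDerivWithinAt_univ] at h1 ⊢
    have h2 := h1.scomp t ((hasDerivAt_id t).sub_const c)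
    rw [one_smul] at h2
    exact h2

/-- A property of the points of `[0, T]` that spreads locally and holds at `0` holds at `T`. -/
lemma induction_on_Icc {T : ℝ} (hT : 0 ≤ T) {P : ℝ → Prop} (h0 : P 0)
    (hstep : ∀ t₁ ∈ Icc 0 T, ∃ η > 0, ∀ t₀ ∈ Icc 0 T, ∀ t' ∈ Icc 0 T, |t₀ - t₁| < η → |t' - t₁| < η →
      P t₀ → P t') : P T := by
  have hpc := (isPreconnected_Icc (a := (0 : ℝ)) (b := T))
  by_contra hbad
  have h0m : (0 : ℝ) ∈ Icc 0 T := ⟨le_rfl, hT⟩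
  have hTm : T ∈ Icc 0 T := ⟨hT, le_rfl⟩
  choose! η hη hηstep using hstep
  set A := ⋃ t ∈ {t | t ∈ Icc 0 T ∧ P t}, Metric.ball t (η t)
  set B := ⋃ t ∈ {t | t ∈ Icc 0 T ∧ ¬ P t}, Metric.ball t (η t)
  have hAo : IsOpen A := isOpen_biUnion fun _ _ => Metric.isOpen_ball
  have hBo : IsOpen B := isOpen_biUnion fun _ _ => Metric.isOpen_ball
  obtain ⟨t, ht, htA, htB⟩ := hpc A B hAo hBo (fun t ht => by
      by_cases hg : P t
      · exact Or.inl (mem_biUnion (show t ∈ {t | t ∈ Icc 0 T ∧ P t} from ⟨ht, hg⟩)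
          (Metric.mem_ball_self (hη t ht)))
      · exact Or.inr (mem_biUnion (show t ∈ {t | t ∈ Icc 0 T ∧ ¬ P t} from ⟨ht, hg⟩)
          (Metric.mem_ball_self (hη t ht))))
    ⟨0, h0m, mem_biUnion (show (0 : ℝ) ∈ {t | t ∈ Icc 0 T ∧ P t} from ⟨h0m, h0⟩)
          (Metric.mem_ball_self (hη 0 h0m))⟩
    ⟨T, hTm, mem_biUnion (show T ∈ {t | t ∈ Icc 0 T ∧ ¬ P t} from ⟨hTm, hbad⟩)
          (Metric.mem_ball_self (hη T hTm))⟩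
  obtain ⟨a, ⟨haI, haG⟩, hta⟩ := mem_iUnion₂.1 htA
  obtain ⟨b, ⟨hbI, hbG⟩, htb⟩ := mem_iUnion₂.1 htB
  rw [Metric.mem_ball, Real.dist_eq] at hta htb
  have htG : P t := hηstep a haI a haI t ht (by simpa using hη a haI) hta haG
  exact hbG (hηstep b hbI t ht b hbI htb (by simpa using hη b hbI) htG)

/-- Solutions of Hamilton's equations are determined by their initial states. -/
theorem eqOn_of_hamiltonian [T2Space M] {H : CotangentBundle E M → ℝ}
    (hH : ContMDiff (coI E) 𝓘(ℝ, ℝ) 3 H) {w₁ w₂ : ℝ → CotangentBundle E M} {a b : ℝ}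
    (h₁ : ∀ t ∈ Icc a b, HamiltonianWithinAt H w₁ (Icc a b) t)
    (h₂ : ∀ t ∈ Icc a b, HamiltonianWithinAt H w₂ (Icc a b) t) (h0 : w₁ a = w₂ a) :
    EqOn w₁ w₂ (Icc a b) := by
  have hc₁ : ContinuousOn w₁ (Icc a b) := fun t ht => (h₁ t ht).1
  have hc₂ : ContinuousOn w₂ (Icc a b) := fun t ht => (h₂ t ht).1
  have hclosed : IsClosed ({t | w₁ t = w₂ t} ∩ Icc a b) := by
    have := (hc₁.prodMk hc₂).preimage_isClosed_of_isClosed isClosed_Icc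
      (isClosed_diagonal (X := CotangentBundle E M))
    convert this using 1
    rw [inter_comm]
    rfl
  suffices h : Icc a b ⊆ {t | w₁ t = w₂ t} from fun t ht => h ht
  refine hclosed.Icc_subset_of_forall_exists_gt h0 fun x hx y hy => ?_
  obtain ⟨hxe, hxab⟩ := hx
  have hxI : x ∈ Icc a b := Ico_subset_Icc_self hxab
  have hxe : w₁ x = w₂ x := hxe
  set ch := extChartAt (coI E) (w₁ x)
  have hsrc : w₁ x ∈ ch.source := mem_extChartAt_source _
  obtain ⟨K, s, hs, hK⟩ := ((contDiffAt_chartField hH (w₁ x)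
    (mem_extChartAt_target (I := coI E) (w₁ x))).of_le
      (by norm_num : (1 : WithTop ℕ∞) ≤ 2)).exists_lipschitzOnWith
  have hnear : ∀ w : ℝ → CotangentBundle E M, w x = w₁ x → ContinuousWithinAt w (Icc a b) x →
      ∀ᶠ t in 𝓝[Icc a b] x, w t ∈ ch.source ∧ ch (w t) ∈ s := by
    intro w hw hwc
    have h1 : ∀ᶠ z in 𝓝 (w x), z ∈ ch.source ∧ ch z ∈ s := by
      rw [hw]
      exact Filter.Eventually.and (show ∀ᶠ z in 𝓝 (w₁ x), z ∈ ch.source from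
          (isOpen_extChartAt_source (I := coI E) (w₁ x)).mem_nhds hsrc)
        ((continuousAt_extChartAt (I := coI E) (w₁ x)).eventually hs)
    exact hwc.eventually h1
  have hgt : ∀ᶠ t in 𝓝[>] x, t ∈ Icc a b :=
    mem_of_superset (Ioc_mem_nhdsGT hxab.2) fun t ht => ⟨hxab.1.trans ht.1.le, ht.2⟩
  have hev := (hnear w₁ rfl (hc₁ x hxI)).and (hnear w₂ hxe.symm (hc₂ x hxI))
  rw [eventually_nhdsWithin_iff] at hev
  obtain ⟨r, hr, hball⟩ := Metric.mem_nhds_iff.1 hev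
  set c := min (min y b) (x + r / 2)
  have hxc : x < c := lt_min (lt_min hy hxab.2) (by linarith)
  have hcb : c ≤ b := (min_le_left _ _).trans (min_le_right _ _)
  have hcr : c ≤ x + r / 2 := min_le_right _ _
  have hin : ∀ t ∈ Icc x c, t ∈ Icc a b := fun t ht => ⟨hxab.1.trans ht.1, ht.2.trans hcb⟩
  have hgood : ∀ t ∈ Icc x c, (w₁ t ∈ ch.source ∧ ch (w₁ t) ∈ s) ∧ (w₂ t ∈ ch.source ∧ ch (w₂ t) ∈ s) := by
    intro t ht
    refine hball ?_ (hin t ht)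
    rw [Metric.mem_ball, Real.dist_eq, abs_of_nonneg (by linarith [ht.1])]
    linarith [ht.2]
  have hcont : ∀ w : ℝ → CotangentBundle E M, ContinuousOn w (Icc a b) →
      (∀ t ∈ Icc x c, w t ∈ ch.source) → ContinuousOn (fun t => ch (w t)) (Icc x c) := by
    intro w hw hws
    exact (continuousOn_extChartAt (I := coI E) (w₁ x)).comp (hw.mono hin) hws
  have hder : ∀ w : ℝ → CotangentBundle E M, (∀ t ∈ Icc a b, HamiltonianWithinAt H w (Icc a b) t) →
      (∀ t ∈ Icc x c, w t ∈ ch.source) → ∀ t ∈ Ico x c,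
        HasDerivWithinAt (fun t => ch (w t)) (chartField H (w₁ x) (ch (w t))) (Ici t) t := by
    intro w hw hws t ht
    have ht' := Ico_subset_Icc_self ht
    refine ((hw t (hin t ht')).2 (w₁ x) (hws t ht')).mono_of_mem_nhdsWithin ?_
    exact Icc_mem_nhdsGE_of_mem ⟨(hin t ht').1, ht.2.trans_le hcb⟩
  have key := ODE_solution_unique_of_mem_Icc_right (v := fun _ => chartField H (w₁ x)) (s := fun _ => s)
    (K := K) (fun _ _ => hK) (hcont w₁ hc₁ fun t ht => (hgood t ht).1.1)
    (hder w₁ h₁ fun t ht => (hgood t ht).1.1)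
    (fun t ht => (hgood t (Ico_subset_Icc_self ht)).1.2)
    (hcont w₂ hc₂ fun t ht => (hgood t ht).2.1)
    (hder w₂ h₂ fun t ht => (hgood t ht).2.1)
    (fun t ht => (hgood t (Ico_subset_Icc_self ht)).2.2) (by simp only [hxe])
  have hcI : c ∈ Icc x c := ⟨hxc.le, le_rfl⟩
  refine ⟨c, ?_, hxc, (min_le_left _ _).trans (min_le_left _ _)⟩
  exact ch.injOn (hgood c hcI).1.1 (hgood c hcI).2.1 (key hcI)

/-- `Φ` is a `C¹` family of solutions of Hamilton's equations on the time interval `(-δ, T + δ)`, the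
member `Φ ζ` starting at `ζ ∈ U`. -/
structure IsFlowOn (H : CotangentBundle E M → ℝ) (Φ : CotangentBundle E M → ℝ → CotangentBundle E M)
    (U : Set (CotangentBundle E M)) (T δ : ℝ) : Prop where
  isOpen : IsOpen U
  delta_pos : 0 < δ
  map_zero : ∀ ζ ∈ U, Φ ζ 0 = ζ
  hamiltonian : ∀ ζ ∈ U, ∀ t ∈ Ioo (-δ) (T + δ), HamiltonianWithinAt H (Φ ζ) univ t
  contMDiffOn : ContMDiffOn ((coI E).prod 𝓘(ℝ, ℝ)) (coI E) 1 (Function.uncurry Φ)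
    (U ×ˢ Ioo (-δ) (T + δ))

/-- Near every state there is a `C¹` flow for short times. -/
theorem exists_flow_at {H : CotangentBundle E M → ℝ} (hH : ContMDiff (coI E) 𝓘(ℝ, ℝ) 3 H)
    (z₀ : CotangentBundle E M) : ∃ Φ U δ, IsFlowOn H Φ U 0 δ ∧ z₀ ∈ U := by
  set ch := extChartAt (coI E) z₀
  have hO : ch.target ∈ 𝓝 (ch z₀) := extChartAt_target_mem_nhds z₀
  have : CompleteSpace (E × (E →L[ℝ] ℝ)) := FiniteDimensional.complete ℝ _
  obtain ⟨φ, U, h, hh, hUo, hU, hφ0, hφ, hφc⟩ :=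
    exists_local_flow (contDiffAt_chartField hH z₀ (mem_extChartAt_target (I := coI E) z₀)) hO
  set W := ch.source ∩ ch ⁻¹' U
  have hWo : IsOpen W := (continuousOn_extChartAt (I := coI E) z₀).isOpen_inter_preimage
    (isOpen_extChartAt_source z₀) hUo
  refine ⟨fun ζ t => ch.symm (φ (ch ζ) t), W, h, ⟨hWo, hh, fun ζ hζ => ?_, fun ζ hζ t ht => ?_, ?_⟩,
    mem_extChartAt_source z₀, hU⟩
  · simp only [hφ0 _ hζ.2, ch.left_inv hζ.1]
  · rw [zero_add] at ht
    obtain ⟨hd, hmem⟩ := hφ _ hζ.2 t ht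
    have hsrc : ch.symm (φ (ch ζ) t) ∈ ch.source := ch.map_target hmem
    refine HamiltonianWithinAt.of_chart hH (mem_univ t) ?_ z₀ hsrc ?_
    · rw [continuousWithinAt_univ]
      exact ContinuousAt.comp (f := φ (ch ζ)) (g := ch.symm)
        ((continuousOn_extChartAt_symm (I := coI E) z₀).continuousAt
          ((isOpen_extChartAt_target (I := coI E) z₀).mem_nhds hmem)) hd.continuousAt
    · rw [hasDerivWithinAt_univ]
      have : (fun r => ch (ch.symm (φ (ch ζ) r))) =ᶠ[𝓝 t] φ (ch ζ) := by
        filter_upwards [Ioo_mem_nhds ht.1 ht.2] with r hr using ch.right_inv (hφ _ hζ.2 r hr).2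
      change HasDerivAt (fun r => ch (ch.symm (φ (ch ζ) r)))
        (chartField H z₀ (ch (ch.symm (φ (ch ζ) t)))) t
      rw [ch.right_inv hmem]
      exact hd.congr_of_eventuallyEq this
  · rw [zero_add]
    have h1 : ContMDiffOn ((coI E).prod 𝓘(ℝ, ℝ)) 𝓘(ℝ, (E × (E →L[ℝ] ℝ)) × ℝ) 1
        (fun p : CotangentBundle E M × ℝ => (ch p.1, p.2)) (W ×ˢ Ioo (-h) h) := by
      refine ContMDiffOn.prodMk_space ?_ contMDiffOn_snd
      exact (contMDiffOn_extChartAt (I := coI E) (n := 1) (x := z₀)).comp contMDiffOn_fst fun p hp => by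
        have := hp.1.1
        rwa [extChartAt_source] at this
    have h2 : ContMDiffOn 𝓘(ℝ, (E × (E →L[ℝ] ℝ)) × ℝ) 𝓘(ℝ, E × (E →L[ℝ] ℝ)) 1 (Function.uncurry φ)
        (U ×ˢ Ioo (-h) h) := contMDiffOn_iff_contDiffOn.2 hφc
    have h3 := h2.comp h1 fun p hp => ⟨hp.1.2, hp.2⟩
    exact (contMDiffOn_extChartAt_symm (I := coI E) (n := 1) z₀).comp h3
      fun p hp => (hφ _ hp.1.2 _ hp.2).2

/-- A trajectory is contained in a flow of trajectories of the same length. The time interval on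
which a flow exists is continued along the trajectory, by concatenation with short flows. -/
theorem exists_flow [T2Space M] {H : CotangentBundle E M → ℝ} (hH : ContMDiff (coI E) 𝓘(ℝ, ℝ) 3 H)
    {z : ℝ → CotangentBundle E M} {T : ℝ} (hz : IsHamiltonianArc H z T) :
    ∃ Φ U δ, IsFlowOn H Φ U T δ ∧ z 0 ∈ U ∧ EqOn (Φ (z 0)) z (Icc 0 T) := by
  rw [isHamiltonianArc_iff] at hz
  obtain ⟨hT, hz⟩ := hz
  have hzc : ContinuousOn z (Icc 0 T) := fun t ht => (hz t ht).1
  -- any flow that starts at `z 0` extends `z`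
  have huniq : ∀ Φ U δ t₀, IsFlowOn H Φ U t₀ δ → z 0 ∈ U → t₀ ≤ T → EqOn (Φ (z 0)) z (Icc 0 t₀) := by
    intro Φ U δ t₀ hΦ h0 ht₀
    refine eqOn_of_hamiltonian hH (fun t ht => ?_) (fun t ht => ?_) (hΦ.map_zero _ h0)
    · exact (hΦ.hamiltonian _ h0 t ⟨by linarith [ht.1, hΦ.delta_pos], by
        linarith [ht.2, hΦ.delta_pos]⟩).mono (subset_univ _)
    · exact (hz t ⟨ht.1, ht.2.trans ht₀⟩).mono (Icc_subset_Icc_right ht₀)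
  let Good : ℝ → Prop := fun t₀ => ∃ Φ U δ, IsFlowOn H Φ U t₀ δ ∧ z 0 ∈ U
  have hstep : ∀ t₁ ∈ Icc 0 T, ∃ η > 0, ∀ t₀ ∈ Icc 0 T, ∀ t' ∈ Icc 0 T, |t₀ - t₁| < η → |t' - t₁| < η →
      Good t₀ → Good t' := by
    intro t₁ ht₁
    obtain ⟨φ, W, h, hφ, hW⟩ := exists_flow_at hH (z t₁)
    have hev : ∀ᶠ t in 𝓝[Icc 0 T] t₁, z t ∈ W := hzc t₁ ht₁ (hφ.isOpen.mem_nhds hW)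
    rw [eventually_nhdsWithin_iff] at hev
    obtain ⟨r, hr, hball⟩ := Metric.mem_nhds_iff.1 hev
    have hh := hφ.delta_pos
    refine ⟨min r (h / 4), lt_min hr (by linarith), fun t₀ ht₀ t' ht' h₀ h' hG => ?_⟩
    obtain ⟨Φ, U, δ, hΦ, hU⟩ := hG
    have hδ := hΦ.delta_pos
    rcases le_or_gt t' t₀ with hle | hlt
    · exact ⟨Φ, U, δ, ⟨hΦ.isOpen, hδ, hΦ.map_zero, fun ζ hζ t ht =>
        hΦ.hamiltonian ζ hζ t ⟨ht.1, by linarith [ht.2]⟩, hΦ.contMDiffOn.mono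
          (prod_mono_right (Ioo_subset_Ioo_right (by linarith)))⟩, hU⟩
    have hz0W : Φ (z 0) t₀ ∈ W := by
      rw [huniq Φ U δ t₀ hΦ hU ht₀.2 ⟨ht₀.1, le_rfl⟩]
      exact hball (lt_of_lt_of_le h₀ (min_le_left _ _)) ht₀
    have ht'0 : t' - t₀ < h / 2 := by
      have h1 := (abs_lt.1 (lt_of_lt_of_le h₀ (min_le_right _ _))).1
      have h2 := (abs_lt.1 (lt_of_lt_of_le h' (min_le_right _ _))).2
      linarith
    set δ' := min δ (h / 2)
    have hδ' : 0 < δ' := lt_min hδ (by linarith)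
    have hδ'1 : δ' ≤ δ := min_le_left _ _
    have hδ'2 : δ' ≤ h / 2 := min_le_right _ _
    -- the states at the time `t₀`
    have hslice : ContMDiffOn (coI E) (coI E) 1 (fun ζ => Φ ζ t₀) U :=
      hΦ.contMDiffOn.comp (f := fun ζ : CotangentBundle E M => (ζ, t₀))
        (contMDiffOn_id.prodMk contMDiffOn_const)
        fun ζ hζ => ⟨hζ, by linarith [ht₀.1], by linarith⟩
    set U' := U ∩ (fun ζ => Φ ζ t₀) ⁻¹' W
    have hU'o : IsOpen U' := hslice.continuousOn.isOpen_inter_preimage hΦ.isOpen hφ.isOpen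
    set Φ' : CotangentBundle E M → ℝ → CotangentBundle E M := fun ζ t =>
      if t ≤ t₀ then Φ ζ t else φ (Φ ζ t₀) (t - t₀)
    have hφham : ∀ ζ ∈ U', ∀ t ∈ Ioo (t₀ - h) (t₀ + h),
        HamiltonianWithinAt H (fun r => φ (Φ ζ t₀) (r - t₀)) univ t := by
      intro ζ hζ t ht
      exact (hφ.hamiltonian _ hζ.2 (t - t₀) ⟨by linarith [ht.1], by linarith [ht.2]⟩).comp_sub
    -- the two flows agree on the overlap of their time intervals, so the concatenation is `C¹`
    have hagree : ∀ ζ ∈ U', ∀ t ∈ Ico t₀ (t₀ + δ'), Φ ζ t = φ (Φ ζ t₀) (t - t₀) := by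
      intro ζ hζ t ht
      refine eqOn_of_hamiltonian hH (a := t₀) (b := t) (w₁ := Φ ζ)
        (w₂ := fun r => φ (Φ ζ t₀) (r - t₀)) (fun r hr => ?_) (fun r hr => ?_) ?_ ⟨ht.1, le_rfl⟩
      · exact (hΦ.hamiltonian ζ hζ.1 r ⟨by linarith [ht₀.1, hr.1], by
          linarith [hr.2, ht.2]⟩).mono (subset_univ _)
      · exact (hφham ζ hζ r ⟨by linarith [hr.1], by linarith [hr.2, ht.2]⟩).mono (subset_univ _)
      · simp only [sub_self, hφ.map_zero _ hζ.2]
    have hΦ'1 : ∀ ζ ∈ U', ∀ t < t₀ + δ', Φ' ζ t = Φ ζ t := by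
      intro ζ hζ t ht
      by_cases hle : t ≤ t₀
      · simp only [Φ', if_pos hle]
      · simp only [Φ', if_neg hle]
        exact (hagree ζ hζ t ⟨(not_le.1 hle).le, ht⟩).symm
    have hΦ'2 : ∀ ζ t, t₀ < t → Φ' ζ t = φ (Φ ζ t₀) (t - t₀) := by
      intro ζ t ht
      simp only [Φ', if_neg (not_le.2 ht)]
    refine ⟨Φ', U', δ', ⟨hU'o, hδ', fun ζ hζ => ?_, fun ζ hζ t ht => ?_, ?_⟩, hU, hz0W⟩
    · rw [hΦ'1 ζ hζ 0 (by linarith [ht₀.1]), hΦ.map_zero ζ hζ.1]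
    · rcases lt_or_ge t (t₀ + δ') with hlt' | hge'
      · refine (hΦ.hamiltonian ζ hζ.1 t ⟨by linarith [ht.1], by linarith⟩).congr ?_ (hΦ'1 ζ hζ t hlt')
        rw [nhdsWithin_univ]
        filter_upwards [gt_mem_nhds hlt'] with r hr using hΦ'1 ζ hζ r hr
      · refine (hφham ζ hζ t ⟨by linarith, by linarith [ht.2]⟩).congr ?_ (hΦ'2 ζ t (by linarith))
        rw [nhdsWithin_univ]
        filter_upwards [lt_mem_nhds (show t₀ < t by linarith)] with r hr using hΦ'2 ζ r hr
    · rintro ⟨ζ, t⟩ ⟨hζ, ht⟩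
      have hζ : ζ ∈ U' := hζ
      have ht : t ∈ Ioo (-δ') (t' + δ') := ht
      refine ContMDiffAt.contMDiffWithinAt ?_
      rcases lt_or_ge t (t₀ + δ') with hlt' | hge'
      · have h1 : ContMDiffAt ((coI E).prod 𝓘(ℝ, ℝ)) (coI E) 1 (Function.uncurry Φ) (ζ, t) :=
          hΦ.contMDiffOn.contMDiffAt (prod_mem_nhds (hΦ.isOpen.mem_nhds hζ.1)
            (Ioo_mem_nhds (by linarith [ht.1]) (by linarith)))
        refine h1.congr_of_eventuallyEq ?_
        filter_upwards [prod_mem_nhds (hU'o.mem_nhds hζ) (gt_mem_nhds hlt')] with p hp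
        exact hΦ'1 p.1 hp.1 p.2 hp.2
      · have h0 : ContMDiffAt ((coI E).prod 𝓘(ℝ, ℝ)) (coI E) 1 (Function.uncurry φ)
            (Φ ζ t₀, t - t₀) :=
          hφ.contMDiffOn.contMDiffAt (prod_mem_nhds (hφ.isOpen.mem_nhds hζ.2)
            (Ioo_mem_nhds (by linarith) (by linarith [ht.2])))
        have h1 : ContMDiffAt ((coI E).prod 𝓘(ℝ, ℝ)) ((coI E).prod 𝓘(ℝ, ℝ)) 1
            (fun p : CotangentBundle E M × ℝ => (Φ p.1 t₀, p.2 - t₀)) (ζ, t) := by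
          refine ContMDiffAt.prodMk ?_ ?_
          · have hs : ContMDiffAt (coI E) (coI E) 1 (fun ζ => Φ ζ t₀) ζ :=
              hslice.contMDiffAt (hΦ.isOpen.mem_nhds hζ.1)
            exact hs.comp (ζ, t) (contMDiffAt_fst (I := coI E) (J := 𝓘(ℝ, ℝ)))
          · have hsub : ContMDiffAt 𝓘(ℝ, ℝ) 𝓘(ℝ, ℝ) 1 (fun r : ℝ => r - t₀) t :=
              (contDiff_id.sub contDiff_const).contMDiff.contMDiffAt
            exact hsub.comp (ζ, t) (contMDiffAt_snd (I := coI E) (J := 𝓘(ℝ, ℝ)))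
        refine (h0.comp (ζ, t) h1).congr_of_eventuallyEq ?_
        filter_upwards [prod_mem_nhds (hU'o.mem_nhds hζ) (lt_mem_nhds (show t₀ < t by linarith))]
          with p hp
        exact hΦ'2 p.1 p.2 hp.2
  have hgood0 : Good 0 := by
    obtain ⟨Φ, U, δ, h1, h2⟩ := exists_flow_at hH (z 0)
    exact ⟨Φ, U, δ, h1, h2⟩
  have hgoodT : Good T := induction_on_Icc hT.le hgood0 hstep
  obtain ⟨Φ, U, δ, hΦ, hU⟩ := hgoodT
  exact ⟨Φ, U, δ, hΦ, hU, huniq Φ U δ T hΦ hU le_rfl⟩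

end

/-! ### Velocity, action density and momentum jumps -/

section

variable {E : Type*} [NormedAddCommGroup E] [NormedSpace ℝ E]
variable {M : Type*} [TopologicalSpace M] [ChartedSpace E M] [IsManifold 𝓘(ℝ, E) ∞ M]
variable [FiniteDimensional ℝ E]

lemma fderiv_localHamiltonian_apply (H : CotangentBundle E M → ℝ) (z₀ : CotangentBundle E M)
    (ξ b : E × (E →L[ℝ] ℝ)) : fderiv ℝ (H ∘ (extChartAt (coI E) z₀).symm) ξ b =
      b.2 (chartField H z₀ ξ).1 - (chartField H z₀ ξ).2 b.1 :=
  (eq_chartField_iff H z₀ ξ _).1 rfl b.1 b.2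

lemma hasMFDerivWithinAt_proj {H : CotangentBundle E M → ℝ}
    {z : ℝ → CotangentBundle E M} {s : Set ℝ} {t : ℝ} (hz : HamiltonianWithinAt H z s t) :
    MDifferentiableWithinAt 𝓘(ℝ, ℝ) 𝓘(ℝ, E) (fun r => (z r).proj) s t := by
  have hproj : ContMDiff (coI E) 𝓘(ℝ, E) 1 (fun w : CotangentBundle E M => w.proj) :=
    contMDiff_proj _
  have h1 := (hz.2 (z t) (mem_extChartAt_source _)).differentiableWithinAt.mdifferentiableWithinAt
  have h2 : MDifferentiableWithinAt 𝓘(ℝ, E × (E →L[ℝ] ℝ)) (coI E) (extChartAt (coI E) (z t)).symm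
      univ (extChartAt (coI E) (z t) (z t)) := by
    have := mdifferentiableWithinAt_extChartAt_symm (I := coI E) (x := z t)
      (mem_extChartAt_target (I := coI E) (z t))
    rwa [ModelWithCorners.range_eq_univ] at this
  have h3 := h2.comp t h1 (fun _ _ => mem_univ _)
  have h4 : MDifferentiableWithinAt 𝓘(ℝ, ℝ) (coI E) z s t := by
    refine h3.congr_of_eventuallyEq ?_ ?_
    · filter_upwards [hz.1.eventually (show ∀ᶠ w in 𝓝 (z t),
        w ∈ (extChartAt (coI E) (z t)).source from (isOpen_extChartAt_source (I := coI E) (z t)).mem_nhds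
          (mem_extChartAt_source _))] with r hr
      simp only [Function.comp_apply, (extChartAt (coI E) (z t)).left_inv hr]
    · simp only [Function.comp_apply,
        (extChartAt (coI E) (z t)).left_inv (mem_extChartAt_source _)]
  exact ((hproj.mdifferentiable one_ne_zero) (z t)).comp_mdifferentiableWithinAt t h4

/-- In a canonical chart the velocity of the underlying curve in `M` is the first component of the
Hamiltonian vector field. -/
lemma mfderiv_chart_velocity {H : CotangentBundle E M → ℝ}
    {z : ℝ → CotangentBundle E M} {s : Set ℝ} {t : ℝ} (hz : HamiltonianWithinAt H z s t)
    (hs : UniqueDiffWithinAt ℝ s t) (z₀ : CotangentBundle E M)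
    (h₀ : z t ∈ (extChartAt (coI E) z₀).source) :
    mfderiv 𝓘(ℝ, E) 𝓘(ℝ, E) (extChartAt 𝓘(ℝ, E) z₀.proj) (z t).proj
      (mfderivWithin 𝓘(ℝ, ℝ) 𝓘(ℝ, E) (fun r => (z r).proj) s t (1 : ℝ)) =
    (chartField H z₀ (extChartAt (coI E) z₀ (z t))).1 := by
  have k₀ := (mem_extChartAt_source_iff z₀ (z t)).1 h₀
  have h1 := (hz.2 z₀ h₀).fst
  simp only [extChartAt_fst] at h1
  have h2 : HasMFDerivAt 𝓘(ℝ, E) 𝓘(ℝ, E) (extChartAt 𝓘(ℝ, E) z₀.proj) (z t).proj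
      (mfderiv 𝓘(ℝ, E) 𝓘(ℝ, E) (extChartAt 𝓘(ℝ, E) z₀.proj) (z t).proj) :=
    (mdifferentiableAt_extChartAt (by simpa using k₀)).hasMFDerivAt
  have h3 := h2.comp_hasMFDerivWithinAt t (hasMFDerivWithinAt_proj hz).hasMFDerivWithinAt
  obtain ⟨L, hL, h4⟩ : ∃ L : ℝ →L[ℝ] E, L 1 = mfderiv 𝓘(ℝ, E) 𝓘(ℝ, E)
      (extChartAt 𝓘(ℝ, E) z₀.proj) (z t).proj
      (mfderivWithin 𝓘(ℝ, ℝ) 𝓘(ℝ, E) (fun r => (z r).proj) s t (1 : ℝ)) ∧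
      HasFDerivWithinAt (fun r => extChartAt 𝓘(ℝ, E) z₀.proj (z r).proj) L s t :=
    ⟨_, rfl, hasMFDerivWithinAt_iff_hasFDerivWithinAt.1 h3⟩
  have h5 := hs.eq_deriv s h4.hasDerivWithinAt h1
  exact hL.symm.trans h5

/-- The velocity `∂H/∂p` of the solutions of Hamilton's equations through the state `ζ`. -/
def stateVelocity (H : CotangentBundle E M → ℝ) (ζ : CotangentBundle E M) :
    TangentSpace 𝓘(ℝ, E) ζ.proj :=
  (chartField H ζ (extChartAt (coI E) ζ ζ)).1

lemma velocity_eq {H : CotangentBundle E M → ℝ}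
    {z : ℝ → CotangentBundle E M} {s : Set ℝ} {t : ℝ} (hz : HamiltonianWithinAt H z s t)
    (hs : UniqueDiffWithinAt ℝ s t) :
    mfderivWithin 𝓘(ℝ, ℝ) 𝓘(ℝ, E) (fun r => (z r).proj) s t (1 : ℝ) = stateVelocity H (z t) := by
  have h := mfderiv_chart_velocity hz hs (z t) (mem_extChartAt_source _)
  rw [mfderiv_extChartAt_self] at h
  exact h

lemma mfderiv_chart_stateVelocity {H : CotangentBundle E M → ℝ}
    (hH : ContMDiff (coI E) 𝓘(ℝ, ℝ) 3 H) (z₀ ζ : CotangentBundle E M)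
    (h₀ : ζ ∈ (extChartAt (coI E) z₀).source) :
    mfderiv 𝓘(ℝ, E) 𝓘(ℝ, E) (extChartAt 𝓘(ℝ, E) z₀.proj) ζ.proj (stateVelocity H ζ) =
      (chartField H z₀ (extChartAt (coI E) z₀ ζ)).1 := by
  obtain ⟨Φ, U, δ, hΦ, hU⟩ := exists_flow_at hH ζ
  have hδ := hΦ.delta_pos
  have h1 := hΦ.hamiltonian ζ hU 0 ⟨by linarith, by linarith⟩
  have h2 := mfderiv_chart_velocity h1 uniqueDiffWithinAt_univ z₀ (by rwa [hΦ.map_zero ζ hU])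
  rw [velocity_eq h1 uniqueDiffWithinAt_univ] at h2
  rwa [hΦ.map_zero ζ hU] at h2

/-- The Lagrangian `p ∂H/∂p` whose integral along a trajectory is the Maupertuis action. -/
def actionDensity (H : CotangentBundle E M → ℝ) (ζ : CotangentBundle E M) : ℝ :=
  ζ.2 (stateVelocity H ζ)

lemma actionDensity_chart {H : CotangentBundle E M → ℝ}
    (hH : ContMDiff (coI E) 𝓘(ℝ, ℝ) 3 H) (z₀ ζ : CotangentBundle E M)
    (h₀ : ζ ∈ (extChartAt (coI E) z₀).source) :
    actionDensity H ζ = (extChartAt (coI E) z₀ ζ).2 (chartField H z₀ (extChartAt (coI E) z₀ ζ)).1 := by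
  rw [← mfderiv_chart_stateVelocity hH z₀ ζ h₀, extChartAt_snd_apply z₀ ζ h₀]
  rfl

lemma continuous_actionDensity {H : CotangentBundle E M → ℝ}
    (hH : ContMDiff (coI E) 𝓘(ℝ, ℝ) 3 H) : Continuous (actionDensity H) := by
  refine continuous_iff_continuousAt.2 fun ζ => ?_
  have h1 : ContinuousAt (extChartAt (coI E) ζ) ζ := continuousAt_extChartAt ζ
  have h2 : ContinuousAt (chartField H ζ) (extChartAt (coI E) ζ ζ) :=
    (contDiffAt_chartField hH ζ (mem_extChartAt_target (I := coI E) ζ)).continuousAt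
  have h3 : ContinuousAt (fun w => (extChartAt (coI E) ζ w).2
      (chartField H ζ (extChartAt (coI E) ζ w)).1) ζ :=
    h1.snd.clm_apply (ContinuousAt.comp (f := extChartAt (coI E) ζ) (g := chartField H ζ) h2 h1).fst
  refine h3.congr ?_
  filter_upwards [(isOpen_extChartAt_source (I := coI E) ζ).mem_nhds (mem_extChartAt_source _)] with w hw
  exact (actionDensity_chart hH ζ w hw).symm

lemma velocity_eq_stateVelocity {H : CotangentBundle E M → ℝ} {z : ℝ → CotangentBundle E M} {T : ℝ}
    (hz : IsHamiltonianArc H z T) {t : ℝ} (ht : t ∈ Icc 0 T) :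
    velocity z T t = stateVelocity H (z t) := by
  rw [isHamiltonianArc_iff] at hz
  exact velocity_eq (hz.2 t ht) (uniqueDiffOn_Icc hz.1 t ht)

lemma action_eq {H : CotangentBundle E M → ℝ} {z : ℝ → CotangentBundle E M} {T : ℝ}
    (hz : IsHamiltonianArc H z T) : action z T = ∫ t in (0 : ℝ)..T, actionDensity H (z t) := by
  refine intervalIntegral.integral_congr fun t ht => ?_
  rw [uIcc_of_le hz.pos.le] at ht
  simp only [actionDensity, velocity_eq_stateVelocity hz ht]

/-- The velocity of the trajectories is the derivative of `H` along the fibres, `q̇ = ∂H/∂p`. -/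
lemma hasDerivAt_fiber {H : CotangentBundle E M → ℝ} (hH : ContMDiff (coI E) 𝓘(ℝ, ℝ) 3 H) (x : M)
    (p η : TangentSpace 𝓘(ℝ, E) x →L[ℝ] Bundle.Trivial M ℝ x) :
    HasDerivAt (fun s : ℝ => H ⟨x, p + s • η⟩) (η (stateVelocity H ⟨x, p⟩)) 0 := by
  set ζ : CotangentBundle E M := ⟨x, p⟩
  set h := H ∘ (extChartAt (coI E) ζ).symm
  have h0 : extChartAt (coI E) ζ ζ = (extChartAt 𝓘(ℝ, E) x x, p) := extChartAt_mk ζ p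
  have hd := ((contDiffAt_localHamiltonian hH ζ
      (mem_extChartAt_target (I := coI E) ζ)).differentiableAt (by norm_num)).hasFDerivAt
  set p₁ : E →L[ℝ] ℝ := p with hp₁
  set η₁ : E →L[ℝ] ℝ := η with hη₁
  have hline : HasDerivAt (fun s : ℝ => ((extChartAt 𝓘(ℝ, E) x x, p₁ + s • η₁) :
      E × (E →L[ℝ] ℝ))) ((0 : E), η₁) 0 := by
    have h1 : HasDerivAt (fun s : ℝ => p₁ + s • η₁) ((1 : ℝ) • η₁) 0 :=
      ((hasDerivAt_id (0 : ℝ)).smul_const η₁).const_add p₁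
    rw [one_smul] at h1
    exact (hasDerivAt_const (0 : ℝ) _).prodMk h1
  have e0 : (fun s : ℝ => ((extChartAt 𝓘(ℝ, E) x x, p₁ + s • η₁) :
      E × (E →L[ℝ] ℝ))) 0 = extChartAt (coI E) ζ ζ := by
    rw [h0]
    simp only [zero_smul, add_zero]
    rfl
  rw [← e0] at hd
  have h2 := hd.comp_hasDerivAt (0 : ℝ) hline
  rw [fderiv_localHamiltonian_apply, e0] at h2
  simp only [map_zero, sub_zero] at h2
  refine h2.congr_of_eventuallyEq (Eventually.of_forall fun s => ?_)
  have hs : extChartAt (coI E) ζ ⟨x, p + s • η⟩ = (extChartAt 𝓘(ℝ, E) x x, p + s • η) :=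
    extChartAt_mk ζ (p + s • η)
  have hsrc : (⟨x, p + s • η⟩ : CotangentBundle E M) ∈ (extChartAt (coI E) ζ).source := by
    rw [mem_extChartAt_source_iff]; exact mem_extChartAt_source x
  have := (extChartAt (coI E) ζ).left_inv hsrc
  rw [hs] at this
  exact congrArg H this.symm

/-- By strict convexity of the energy in the momentum, an elastic jump of the momentum is negative on
the incoming and positive on the outgoing velocity. -/
lemma jump_velocity {H : CotangentBundle E M → ℝ} (hH : IsConvexHamiltonian H) (x : M)
    (p p' : TangentSpace 𝓘(ℝ, E) x →L[ℝ] Bundle.Trivial M ℝ x) (hne : p' ≠ p)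
    (he : H ⟨x, p'⟩ = H ⟨x, p⟩) :
    (p' - p) (stateVelocity H ⟨x, p⟩) < (0 : ℝ) ∧ (0 : ℝ) < (p' - p) (stateVelocity H ⟨x, p'⟩) := by
  have key : ∀ p p' : TangentSpace 𝓘(ℝ, E) x →L[ℝ] Bundle.Trivial M ℝ x, p' ≠ p →
      H ⟨x, p'⟩ = H ⟨x, p⟩ → (p' - p) (stateVelocity H ⟨x, p⟩) < (0 : ℝ) := by
    intro p p' hne he
    have hsc : StrictConvexOn ℝ univ (fun s : ℝ => H ⟨x, p + s • (p' - p)⟩) := by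
      refine ⟨convex_univ, fun s _ t _ hst a b ha hb hab => ?_⟩
      have h := (hH.strictConvex x).2 (mem_univ (p + s • (p' - p))) (mem_univ (p + t • (p' - p)))
        (fun h => hst ?_) ha hb hab
      · have e : a • (p + s • (p' - p)) + b • (p + t • (p' - p)) =
            p + (a • s + b • t) • (p' - p) := by
          have : p = (a + b) • p := by rw [hab, one_smul]
          calc _ = (a + b) • p + (a • s + b • t) • (p' - p) := by
                simp only [smul_eq_mul]; module
            _ = _ := by rw [← this]
        rwa [e] at h
      · have h1 : (s - t) • (p' - p) = 0 := by
          refine (sub_smul s t (show E →L[ℝ] ℝ from p' - p)).trans (sub_eq_zero.2 ?_)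
          exact add_left_cancel (a := (show E →L[ℝ] ℝ from p)) h
        rcases smul_eq_zero.1 h1 with h2 | h2
        · exact sub_eq_zero.1 h2
        · exact absurd (sub_eq_zero.1 h2) hne
    have h1 := hsc.lt_slope_of_hasDerivAt (mem_univ 0) (mem_univ 1) one_pos
      (hasDerivAt_fiber hH.contMDiff x p (p' - p))
    simp only [slope_def_field, one_smul, zero_smul, add_zero, add_sub_cancel, he, sub_self,
      zero_div] at h1
    exact h1
  refine ⟨key p p' hne he, ?_⟩
  have h := key p' p hne.symm he.symm
  have e : (p - p') (stateVelocity H ⟨x, p'⟩) = -((p' - p) (stateVelocity H ⟨x, p'⟩)) := by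
    rw [← neg_sub]; rfl
  rw [e] at h
  exact neg_lt_zero.1 h

end

/-! ### The first variation formula in a chart -/

section

variable {E : Type*} [NormedAddCommGroup E] [NormedSpace ℝ E]
variable {M : Type*} [TopologicalSpace M] [ChartedSpace E M] [IsManifold 𝓘(ℝ, E) ∞ M]
variable [FiniteDimensional ℝ E]

section FirstVariation

variable {Y : Type*} [NormedAddCommGroup Y] [NormedSpace ℝ Y]

/-- Along a family of solutions on one energy level the time derivative of the action agrees, up to
`o(‖b - b₀‖)`, with that of the pairing of the momentum with the displacement: the difference is
`dh` applied to the displacement in phase space, which is tangent to the energy level. -/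
lemma eventually_lagrangian_sub_le {H : CotangentBundle E M → ℝ}
    (hH : ContMDiff (coI E) 𝓘(ℝ, ℝ) 3 H) (z₁ : CotangentBundle E M) {e : ℝ}
    {x : Y → ℝ → E × (E →L[ℝ] ℝ)} {b₀ : Y} {r₀ : ℝ}
    (hx : ContDiffAt ℝ 1 (Function.uncurry x) (b₀, r₀))
    (htgt : x b₀ r₀ ∈ (extChartAt (coI E) z₁).target)
    (he : ∀ᶠ p in 𝓝 (b₀, r₀), (H ∘ (extChartAt (coI E) z₁).symm) (x p.1 p.2) = e)
    {ε : ℝ} (hε : 0 < ε) :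
    ∀ᶠ p in 𝓝 (b₀, r₀), |(x p.1 p.2).2 (chartField H z₁ (x p.1 p.2)).1 -
        (x b₀ p.2).2 (chartField H z₁ (x b₀ p.2)).1 -
        ((chartField H z₁ (x b₀ p.2)).2 ((x p.1 p.2).1 - (x b₀ p.2).1) +
          (x b₀ p.2).2 ((chartField H z₁ (x p.1 p.2)).1 - (chartField H z₁ (x b₀ p.2)).1))| ≤
      ε * ‖p.1 - b₀‖ := by
  obtain ⟨K, s, hs, hK⟩ := hx.exists_lipschitzOnWith
  set h := H ∘ (extChartAt (coI E) z₁).symm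
  set X := chartField H z₁
  have hst : HasStrictFDerivAt h (fderiv ℝ h (x b₀ r₀)) (x b₀ r₀) :=
    (contDiffAt_localHamiltonian hH z₁ htgt).hasStrictFDerivAt (by norm_num)
  have hXc : ContinuousAt X (x b₀ r₀) := (contDiffAt_chartField hH z₁ htgt).continuousAt
  set ε₁ := ε / (3 * (K + 1))
  have hK0 : (0 : ℝ) ≤ K := K.2
  have hε₁ : 0 < ε₁ := by positivity
  have hb₀ : Tendsto (fun p : Y × ℝ => (b₀, p.2)) (𝓝 (b₀, r₀)) (𝓝 (b₀, r₀)) :=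
    (Continuous.continuousAt (by fun_prop : Continuous fun p : Y × ℝ => (b₀, p.2)))
  have hxt : Tendsto (fun p : Y × ℝ => x p.1 p.2) (𝓝 (b₀, r₀)) (𝓝 (x b₀ r₀)) := hx.continuousAt
  have hX : ∀ᶠ p in 𝓝 (b₀, r₀), ‖X (x p.1 p.2) - X (x b₀ r₀)‖ ≤ ε₁ := by
    have := (hXc.tendsto.comp hxt).sub_const (X (x b₀ r₀))
    rw [sub_self] at this
    filter_upwards [(tendsto_zero_iff_norm_tendsto_zero.1 this).eventually_le_const hε₁] with p hp
    exact hp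
  have hst' := (hst.isLittleO.def hε₁)
  have hpair : Tendsto (fun p : Y × ℝ => (x p.1 p.2, x b₀ p.2)) (𝓝 (b₀, r₀))
      (𝓝 (x b₀ r₀, x b₀ r₀)) := hxt.prodMk_nhds (hxt.comp hb₀)
  filter_upwards [hpair.eventually hst', hX, hb₀.eventually hX, he, hb₀.eventually he, hs,
    hb₀.eventually hs] with p h1 h2 h3 h4 h5 h6 h7
  have hlip : ‖x p.1 p.2 - x b₀ p.2‖ ≤ K * ‖p.1 - b₀‖ := by
    have := hK.dist_le_mul _ h6 _ h7
    rw [dist_eq_norm, dist_eq_norm] at this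
    refine this.trans (le_of_eq ?_)
    congr 1
    simp [Prod.norm_def]
  set ξ := x p.1 p.2
  set ξ₀ := x b₀ p.2
  set ξ' := x b₀ r₀
  rw [h4, h5, sub_self, zero_sub, norm_neg, fderiv_localHamiltonian_apply] at h1
  -- the first bracket on the right is `dh` at `x b₀ r₀`, applied to `ξ - ξ₀`
  have e1 : ξ.2 (X ξ).1 - ξ₀.2 (X ξ₀).1 -
      ((X ξ₀).2 (ξ.1 - ξ₀.1) + ξ₀.2 ((X ξ).1 - (X ξ₀).1)) =
      ((ξ - ξ₀).2 (X ξ').1 - (X ξ').2 (ξ - ξ₀).1) + (ξ - ξ₀).2 (X ξ - X ξ').1 -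
        (X ξ₀ - X ξ').2 (ξ - ξ₀).1 := by
    simp only [Prod.fst_sub, Prod.snd_sub, map_sub, sub_apply]
    ring
  have hn : ∀ a c : E × (E →L[ℝ] ℝ), |a.2 c.1| ≤ ‖a‖ * ‖c‖ := fun a c =>
    (a.2.le_opNorm c.1).trans (mul_le_mul (norm_snd_le a) (norm_fst_le c) (norm_nonneg _)
      (norm_nonneg _))
  rw [e1]
  have h8 := hn (ξ - ξ₀) (X ξ - X ξ')
  have h9 := hn (X ξ₀ - X ξ') (ξ - ξ₀)
  have h10 : ‖ξ - ξ₀‖ * ‖X ξ - X ξ'‖ ≤ ‖ξ - ξ₀‖ * ε₁ := mul_le_mul_of_nonneg_left h2 (norm_nonneg _)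
  have h11 : ‖X ξ₀ - X ξ'‖ * ‖ξ - ξ₀‖ ≤ ε₁ * ‖ξ - ξ₀‖ := mul_le_mul_of_nonneg_right h3 (norm_nonneg _)
  have h12 : ‖ξ - ξ₀‖ * (3 * ε₁) ≤ (K * ‖p.1 - b₀‖) * (3 * ε₁) :=
    mul_le_mul_of_nonneg_right hlip (by positivity)
  have h13 : K * (3 * ε₁) ≤ ε := by
    have : (K + 1) * (3 * ε₁) = ε := by simp only [ε₁]; field_simp
    nlinarith
  have h14 : (K * (3 * ε₁)) * ‖p.1 - b₀‖ ≤ ε * ‖p.1 - b₀‖ :=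
    mul_le_mul_of_nonneg_right h13 (norm_nonneg _)
  rw [Real.norm_eq_abs] at h1
  have h15 := abs_add_le ((ξ - ξ₀).2 (X ξ').1 - (X ξ').2 (ξ - ξ₀).1) ((ξ - ξ₀).2 (X ξ - X ξ').1)
  have h16 := abs_sub (((ξ - ξ₀).2 (X ξ').1 - (X ξ').2 (ξ - ξ₀).1) + (ξ - ξ₀).2 (X ξ - X ξ').1)
    ((X ξ₀ - X ξ').2 (ξ - ξ₀).1)
  linarith

/-- The first variation formula for `∫ p dq` in a canonical chart. -/
lemma hasFDerivAt_integral_chart {H : CotangentBundle E M → ℝ}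
    (hH : ContMDiff (coI E) 𝓘(ℝ, ℝ) 3 H) (z₁ : CotangentBundle E M) {e a c : ℝ} (hac : a ≤ c)
    {x : Y → ℝ → E × (E →L[ℝ] ℝ)} {b₀ : Y}
    (hx : ∀ r ∈ Icc a c, ContDiffAt ℝ 1 (Function.uncurry x) (b₀, r))
    (htgt : ∀ r ∈ Icc a c, x b₀ r ∈ (extChartAt (coI E) z₁).target)
    (hd : ∀ r ∈ Icc a c, ∀ᶠ p in 𝓝 (b₀, r), HasDerivAt (x p.1) (chartField H z₁ (x p.1 p.2)) p.2)
    (he : ∀ r ∈ Icc a c, ∀ᶠ p in 𝓝 (b₀, r),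
      (H ∘ (extChartAt (coI E) z₁).symm) (x p.1 p.2) = e) :
    HasFDerivAt (fun b => ∫ r in a..c, (x b r).2 (chartField H z₁ (x b r)).1)
      ((x b₀ c).2 ∘L fderiv ℝ (fun b => (x b c).1) b₀ -
        (x b₀ a).2 ∘L fderiv ℝ (fun b => (x b a).1) b₀) b₀ := by
  set X := chartField H z₁
  have hdx : ∀ r ∈ Icc a c, HasFDerivAt (fun b => (x b₀ r).2 ((x b r).1 - (x b₀ r).1))
      ((x b₀ r).2 ∘L fderiv ℝ (fun b => (x b r).1) b₀) b₀ := by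
    intro r hr
    have h1 : DifferentiableAt ℝ (fun b => x b r) b₀ :=
      ((hx r hr).differentiableAt one_ne_zero).comp (f := fun b => (b, r)) b₀ (by fun_prop)
    exact (x b₀ r).2.hasFDerivAt.comp b₀ (h1.fst.hasFDerivAt.sub_const _)
  have hc : c ∈ Icc a c := right_mem_Icc.2 hac
  have ha : a ∈ Icc a c := left_mem_Icc.2 hac
  have hR := (hdx c hc).sub (hdx a ha)
  have hev : ∀ ε > 0, ∀ᶠ b in 𝓝 b₀, ∀ r ∈ Icc a c,
      HasDerivAt (x b) (X (x b r)) r ∧ ContinuousAt X (x b r) ∧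
      |(x b r).2 (X (x b r)).1 - (x b₀ r).2 (X (x b₀ r)).1 -
        ((X (x b₀ r)).2 ((x b r).1 - (x b₀ r).1) + (x b₀ r).2 ((X (x b r)).1 - (X (x b₀ r)).1))| ≤
      ε * ‖b - b₀‖ := by
    intro ε hε
    refine isCompact_Icc.eventually_forall_of_forall_eventually (P := fun b r =>
      HasDerivAt (x b) (X (x b r)) r ∧ ContinuousAt X (x b r) ∧
      |(x b r).2 (X (x b r)).1 - (x b₀ r).2 (X (x b₀ r)).1 -
        ((X (x b₀ r)).2 ((x b r).1 - (x b₀ r).1) + (x b₀ r).2 ((X (x b r)).1 - (X (x b₀ r)).1))| ≤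
      ε * ‖b - b₀‖) fun r hr => ?_
    have h1 : ∀ᶠ p in 𝓝 (b₀, r), ContinuousAt X (x p.1 p.2) := by
      have h2 : ∀ᶠ ξ in 𝓝 (x b₀ r), ContinuousAt X ξ := by
        filter_upwards [(isOpen_extChartAt_target (I := coI E) z₁).mem_nhds (htgt r hr)] with ξ hξ
        exact (contDiffAt_chartField hH z₁ hξ).continuousAt
      exact (hx r hr).continuousAt.eventually h2
    filter_upwards [hd r hr, h1, eventually_lagrangian_sub_le hH z₁ (hx r hr) (htgt r hr) (he r hr) hε]
      with p h2 h3 h4 using ⟨h2, h3, h4⟩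
  -- the integral differs from the boundary terms by `o(‖b - b₀‖)`
  have key : ∀ ε > 0, ∀ᶠ b in 𝓝 b₀, ‖(∫ r in a..c, (x b r).2 (X (x b r)).1) -
      (∫ r in a..c, (x b₀ r).2 (X (x b₀ r)).1) -
      ((x b₀ c).2 ((x b c).1 - (x b₀ c).1) - (x b₀ a).2 ((x b a).1 - (x b₀ a).1))‖ ≤
      (ε * ‖b - b₀‖) * |c - a| := by
    intro ε hε
    have hb₀ := (hev ε hε).self_of_nhds
    filter_upwards [hev ε hε] with b hb
    have hcx : ∀ b, (∀ r ∈ Icc a c, HasDerivAt (x b) (X (x b r)) r ∧ ContinuousAt X (x b r)) →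
        ContinuousOn (x b) (uIcc a c) ∧ ContinuousOn (fun r => X (x b r)) (uIcc a c) := by
      intro b hb
      rw [uIcc_of_le hac]
      exact ⟨fun r hr => (hb r hr).1.continuousAt.continuousWithinAt, fun r hr =>
        (ContinuousAt.comp (f := x b) (g := X) (hb r hr).2 (hb r hr).1.continuousAt).continuousWithinAt⟩
    obtain ⟨c1, c2⟩ := hcx b fun r hr => ⟨(hb r hr).1, (hb r hr).2.1⟩
    obtain ⟨c3, c4⟩ := hcx b₀ fun r hr => ⟨(hb₀ r hr).1, (hb₀ r hr).2.1⟩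
    have i1 : ContinuousOn (fun r => (x b r).2 (X (x b r)).1) (uIcc a c) := c1.snd.clm_apply c2.fst
    have i2 : ContinuousOn (fun r => (x b₀ r).2 (X (x b₀ r)).1) (uIcc a c) := c3.snd.clm_apply c4.fst
    have i3 : ContinuousOn (fun r => (X (x b₀ r)).2 ((x b r).1 - (x b₀ r).1) +
        (x b₀ r).2 ((X (x b r)).1 - (X (x b₀ r)).1)) (uIcc a c) :=
      (c4.snd.clm_apply (c1.fst.sub c3.fst)).add (c3.snd.clm_apply (c2.fst.sub c4.fst))
    have hint := intervalIntegral.integral_eq_sub_of_hasDerivAt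
      (f := fun r => (x b₀ r).2 ((x b r).1 - (x b₀ r).1))
      (f' := fun r => (X (x b₀ r)).2 ((x b r).1 - (x b₀ r).1) +
        (x b₀ r).2 ((X (x b r)).1 - (X (x b₀ r)).1)) (a := a) (b := c) (fun r hr => by
        rw [uIcc_of_le hac] at hr
        have d1 : HasDerivAt (fun r => (x b₀ r).1) (X (x b₀ r)).1 r := (hb₀ r hr).1.fst
        have d2 : HasDerivAt (fun r => (x b₀ r).2) (X (x b₀ r)).2 r := (hb₀ r hr).1.snd
        have d3 : HasDerivAt (fun r => (x b r).1) (X (x b r)).1 r := (hb r hr).1.fst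
        exact d2.clm_apply (d3.sub d1))
      i3.intervalIntegrable
    rw [← hint, ← intervalIntegral.integral_sub i1.intervalIntegrable i2.intervalIntegrable,
      ← intervalIntegral.integral_sub (ContinuousOn.intervalIntegrable
        (u := fun r => (x b r).2 (X (x b r)).1 - (x b₀ r).2 (X (x b₀ r)).1) (i1.sub i2)) i3.intervalIntegrable]
    refine intervalIntegral.norm_integral_le_of_norm_le_const fun r hr => ?_
    rw [uIoc_of_le hac] at hr
    exact (hb r (Ioc_subset_Icc_self hr)).2.2
  have hlo : HasFDerivAt (fun b => (∫ r in a..c, (x b r).2 (X (x b r)).1) -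
      (∫ r in a..c, (x b₀ r).2 (X (x b₀ r)).1) -
      ((x b₀ c).2 ((x b c).1 - (x b₀ c).1) - (x b₀ a).2 ((x b a).1 - (x b₀ a).1))) (0 : Y →L[ℝ] ℝ) b₀ := by
    rw [hasFDerivAt_iff_isLittleO]
    refine Asymptotics.IsLittleO.of_bound fun ε hε => ?_
    have hA : 0 < |c - a| + 1 := by positivity
    filter_upwards [key (ε / (|c - a| + 1)) (by positivity)] with b hb
    simp only [sub_self, map_zero, zero_apply, sub_zero]
    refine hb.trans ?_
    have : ε / (|c - a| + 1) * ‖b - b₀‖ * |c - a| = (ε * ‖b - b₀‖) * (|c - a| / (|c - a| + 1)) := by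
      ring
    rw [this]
    refine mul_le_of_le_one_right (by positivity) ((div_le_one hA).2 (by linarith))
  have := (hlo.add hR).add_const (∫ r in a..c, (x b₀ r).2 (X (x b₀ r)).1)
  rw [zero_add] at this
  refine this.congr_of_eventuallyEq (Eventually.of_forall fun b => ?_)
  simp only [Pi.add_apply, Pi.sub_apply]
  ring

end FirstVariation

end

/-! ### The first variation formula -/

section

variable {E : Type*} [NormedAddCommGroup E] [NormedSpace ℝ E]
variable {M : Type*} [TopologicalSpace M] [ChartedSpace E M] [IsManifold 𝓘(ℝ, E) ∞ M]
variable [FiniteDimensional ℝ E]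

section FirstVariation

variable {Y : Type*} [NormedAddCommGroup Y] [NormedSpace ℝ Y]

/-- The pull-back `ζ^*(p dq)` of the tautological one-form of `T*M`, at the point `b`. -/
def tautologicalForm (ζ : Y → CotangentBundle E M) (b : Y) : Y →L[ℝ] ℝ :=
  (show E →L[ℝ] ℝ from (ζ b).2) ∘L
    (show Y →L[ℝ] E from mfderiv 𝓘(ℝ, Y) 𝓘(ℝ, E) (fun b => (ζ b).proj) b)

omit [FiniteDimensional ℝ E] in
lemma tautologicalForm_apply (ζ : Y → CotangentBundle E M) (b v : Y) :
    tautologicalForm ζ b v = (ζ b).2 (mfderiv 𝓘(ℝ, Y) 𝓘(ℝ, E) (fun b => (ζ b).proj) b v) := rfl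

omit [FiniteDimensional ℝ E] in
lemma contMDiffAt_proj_comp {n : WithTop ℕ∞} (hn : n ≤ ∞) {ζ : Y → CotangentBundle E M} {b : Y}
    (hζ : ContMDiffAt 𝓘(ℝ, Y) (coI E) n ζ b) :
    ContMDiffAt 𝓘(ℝ, Y) 𝓘(ℝ, E) n (fun b => (ζ b).proj) b := by
  have hproj : ContMDiff (coI E) 𝓘(ℝ, E) n (fun w : CotangentBundle E M => w.proj) :=
    (contMDiff_proj (n := ∞) _).of_le hn
  exact (hproj (ζ b)).comp b hζ

omit [FiniteDimensional ℝ E] in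
lemma fderiv_extChartAt_comp {q : M} {c : Y → M} {b : Y}
    (hc : MDifferentiableAt 𝓘(ℝ, Y) 𝓘(ℝ, E) c b) (hq : c b ∈ (extChartAt 𝓘(ℝ, E) q).source) (v : Y) :
    fderiv ℝ (fun b => extChartAt 𝓘(ℝ, E) q (c b)) b v =
      mfderiv 𝓘(ℝ, E) 𝓘(ℝ, E) (extChartAt 𝓘(ℝ, E) q) (c b) (mfderiv 𝓘(ℝ, Y) 𝓘(ℝ, E) c b v) := by
  have h1 : MDifferentiableAt 𝓘(ℝ, E) 𝓘(ℝ, E) (extChartAt 𝓘(ℝ, E) q) (c b) :=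
    mdifferentiableAt_extChartAt (by simpa using hq)
  have h2 := mfderiv_comp b h1 hc
  rw [mfderiv_eq_fderiv] at h2
  exact DFunLike.congr_fun h2 v

omit [FiniteDimensional ℝ E] in
lemma tautologicalForm_chart (z₁ : CotangentBundle E M) {ζ : Y → CotangentBundle E M} {b : Y}
    (hζ : MDifferentiableAt 𝓘(ℝ, Y) 𝓘(ℝ, E) (fun b => (ζ b).proj) b)
    (h₁ : ζ b ∈ (extChartAt (coI E) z₁).source) :
    tautologicalForm ζ b = (extChartAt (coI E) z₁ (ζ b)).2 ∘L
      fderiv ℝ (fun b => (extChartAt (coI E) z₁ (ζ b)).1) b := by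
  refine ContinuousLinearMap.ext fun v => ?_
  rw [tautologicalForm_apply, ContinuousLinearMap.comp_apply, ← extChartAt_snd_apply z₁ _ h₁]
  simp only [extChartAt_fst]
  rw [fderiv_extChartAt_comp hζ ((mem_extChartAt_source_iff z₁ _).1 h₁)]

omit [FiniteDimensional ℝ E] in
lemma contDiffAt_chart {n : WithTop ℕ∞} (hn : n ≤ ∞) (z₁ : CotangentBundle E M)
    {ζ : Y → CotangentBundle E M} {b : Y} (hζ : ContMDiffAt 𝓘(ℝ, Y) (coI E) n ζ b)
    (h₁ : ζ b ∈ (extChartAt (coI E) z₁).source) :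
    ContDiffAt ℝ n (fun b => extChartAt (coI E) z₁ (ζ b)) b := by
  rw [← contMDiffAt_iff_contDiffAt]
  have h2 : ContMDiffAt (coI E) 𝓘(ℝ, E × (E →L[ℝ] ℝ)) n (extChartAt (coI E) z₁) (ζ b) :=
    (contMDiffAt_extChartAt' (I := coI E) (n := ∞) (by simpa using h₁)).of_le hn
  exact h2.comp b hζ

/-- The first variation formula for the action `∫ p dq` on an energy level, for a fixed time. -/
theorem hasFDerivAt_integral_actionDensity {H : CotangentBundle E M → ℝ}
    (hH : ContMDiff (coI E) 𝓘(ℝ, ℝ) 3 H) {e T : ℝ} (hT : 0 ≤ T)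
    {w : Y → ℝ → CotangentBundle E M} {b₀ : Y}
    (hw : ∀ r ∈ Icc 0 T, ContMDiffAt 𝓘(ℝ, Y × ℝ) (coI E) 1 (Function.uncurry w) (b₀, r))
    (hd : ∀ r ∈ Icc 0 T, ∀ᶠ p in 𝓝 (b₀, r), HamiltonianWithinAt H (w p.1) univ p.2)
    (he : ∀ r ∈ Icc 0 T, ∀ᶠ p in 𝓝 (b₀, r), H (w p.1 p.2) = e) :
    HasFDerivAt (fun b => ∫ r in (0 : ℝ)..T, actionDensity H (w b r))
      (tautologicalForm (fun b => w b T) b₀ - tautologicalForm (fun b => w b 0) b₀) b₀ := by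
  have hwr : ∀ r ∈ Icc 0 T, ContMDiffAt 𝓘(ℝ, Y) (coI E) 1 (fun b => w b r) b₀ := by
    intro r hr
    have h1 : ContMDiffAt 𝓘(ℝ, Y) 𝓘(ℝ, Y × ℝ) 1 (fun b : Y => (b, r)) b₀ :=
      contMDiffAt_iff_contDiffAt.2 (by fun_prop)
    exact ContMDiffAt.comp (g := Function.uncurry w) b₀ (hw r hr) h1
  -- integrability of the action density on `[0, T]` near `b₀`
  have hint : ∀ᶠ b in 𝓝 b₀, ContinuousOn (fun r => actionDensity H (w b r)) (Icc 0 T) := by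
    have := isCompact_Icc.eventually_forall_of_forall_eventually (P := fun b r =>
      HamiltonianWithinAt H (w b) univ r) hd
    filter_upwards [this] with b hb r hr
    exact ((continuous_actionDensity hH).continuousAt.comp
      (continuousWithinAt_univ _ _ |>.1 (hb r hr).1)).continuousWithinAt
  suffices h : T ∈ Icc 0 T → HasFDerivAt (fun b => ∫ r in (0 : ℝ)..T, actionDensity H (w b r))
      (tautologicalForm (fun b => w b T) b₀ - tautologicalForm (fun b => w b 0) b₀) b₀ from
    h ⟨hT, le_rfl⟩
  refine induction_on_Icc (P := fun t => t ∈ Icc 0 T → HasFDerivAt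
    (fun b => ∫ r in (0 : ℝ)..t, actionDensity H (w b r))
      (tautologicalForm (fun b => w b t) b₀ - tautologicalForm (fun b => w b 0) b₀) b₀) hT ?_ ?_
  · intro _
    simp only [intervalIntegral.integral_same, sub_self]
    exact hasFDerivAt_const _ _
  intro t₁ ht₁
  set z₁ := w b₀ t₁
  set ch := extChartAt (coI E) z₁
  have hsrc : ch.source ∈ 𝓝 (w b₀ t₁) := extChartAt_source_mem_nhds z₁
  have hcont : Tendsto (Function.uncurry w) (𝓝 (b₀, t₁)) (𝓝 (w b₀ t₁)) := (hw t₁ ht₁).continuousAt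
  -- near `(b₀, t₁)` the family stays in one chart
  obtain ⟨η, hη, hball⟩ := Metric.eventually_nhds_iff.1
    (hcont.eventually (show ∀ᶠ ζ in 𝓝 (w b₀ t₁), ζ ∈ ch.source from hsrc))
  have hmem : ∀ r, |r - t₁| < η → ∀ᶠ p in 𝓝 (b₀, r), w p.1 p.2 ∈ ch.source := by
    intro r hr
    filter_upwards [Metric.isOpen_ball.mem_nhds (show (b₀, r) ∈ Metric.ball (b₀, t₁) η by
      simpa [Metric.mem_ball, Prod.dist_eq, Real.dist_eq, hη] using hr)] with p hp
    exact hball (Metric.mem_ball.1 hp)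
  refine ⟨η, hη, ?_⟩
  -- the formula between two times in this chart
  have hstep : ∀ a ∈ Icc 0 T, ∀ c ∈ Icc 0 T, |a - t₁| < η → |c - t₁| < η → a ≤ c →
      HasFDerivAt (fun b => ∫ r in a..c, actionDensity H (w b r))
      (tautologicalForm (fun b => w b c) b₀ - tautologicalForm (fun b => w b a) b₀) b₀ := by
    intro a ha c hc haη hcη hac
    have hIcc : ∀ r ∈ Icc a c, r ∈ Icc 0 T ∧ |r - t₁| < η := fun r hr =>
      ⟨⟨ha.1.trans hr.1, hr.2.trans hc.2⟩, abs_lt.2 ⟨by linarith [(abs_lt.1 haη).1, hr.1],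
        by linarith [(abs_lt.1 hcη).2, hr.2]⟩⟩
    have hs : ∀ r ∈ Icc a c, w b₀ r ∈ ch.source := fun r hr => (hmem r (hIcc r hr).2).self_of_nhds
    have key := hasFDerivAt_integral_chart hH z₁ (e := e) hac (x := fun b r => ch (w b r)) (b₀ := b₀)
      (fun r hr => contDiffAt_chart (by simp) z₁ (ζ := Function.uncurry w) (hw r (hIcc r hr).1) (hs r hr))
      (fun r hr => ch.map_source (hs r hr))
      (fun r hr => by
        filter_upwards [hmem r (hIcc r hr).2, hd r (hIcc r hr).1] with p h1 h2
        exact hasDerivWithinAt_univ.1 (h2.2 z₁ h1))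
      (fun r hr => by
        filter_upwards [hmem r (hIcc r hr).2, he r (hIcc r hr).1] with p h1 h2
        change H (ch.symm (ch (w p.1 p.2))) = e
        rw [ch.left_inv h1]
        exact h2)
    have hmd : ∀ r ∈ Icc a c, MDifferentiableAt 𝓘(ℝ, Y) 𝓘(ℝ, E) (fun b => (w b r).proj) b₀ := fun r hr =>
      (contMDiffAt_proj_comp (by simp) (hwr r (hIcc r hr).1)).mdifferentiableAt one_ne_zero
    rw [← tautologicalForm_chart z₁ (hmd c ⟨hac, le_rfl⟩) (hs c ⟨hac, le_rfl⟩),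
      ← tautologicalForm_chart z₁ (hmd a ⟨le_rfl, hac⟩) (hs a ⟨le_rfl, hac⟩)] at key
    refine key.congr_of_eventuallyEq ?_
    have := isCompact_Icc.eventually_forall_of_forall_eventually (P := fun b r =>
      w b r ∈ ch.source) (fun r hr => hmem r (hIcc r hr).2) (K := Icc a c)
    filter_upwards [this] with b hb
    refine intervalIntegral.integral_congr fun r hr => ?_
    rw [uIcc_of_le hac] at hr
    exact actionDensity_chart hH z₁ _ (hb r hr)
  have hii : ∀ a ∈ Icc 0 T, ∀ c ∈ Icc 0 T, ∀ᶠ b in 𝓝 b₀,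
      IntervalIntegrable (fun r => actionDensity H (w b r)) MeasureTheory.volume a c := by
    intro a ha c hc
    filter_upwards [hint] with b hb
    exact (hb.mono (uIcc_subset_Icc ha hc)).intervalIntegrable
  have h0 : (0 : ℝ) ∈ Icc 0 T := ⟨le_rfl, hT⟩
  intro t₀ ht₀ t' ht' h₀η h'η ih _
  rcases le_total t₀ t' with hle | hle
  · have h := (ih ht₀).add (hstep t₀ ht₀ t' ht' h₀η h'η hle)
    refine (h.congr_of_eventuallyEq ?_).congr_fderiv ?_
    · filter_upwards [hii 0 h0 t₀ ht₀, hii t₀ ht₀ t' ht'] with b h1 h2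
      exact (intervalIntegral.integral_add_adjacent_intervals h1 h2).symm
    · abel
  · have h := (ih ht₀).sub (hstep t' ht' t₀ ht₀ h'η h₀η hle)
    refine (h.congr_of_eventuallyEq ?_).congr_fderiv ?_
    · filter_upwards [hii 0 h0 t' ht', hii t' ht' t₀ ht₀] with b h1 h2
      rw [Pi.sub_apply, ← intervalIntegral.integral_add_adjacent_intervals h1 h2, add_sub_cancel_right]
    · abel

lemma HamiltonianWithinAt.hasDerivAt_energy {H : CotangentBundle E M → ℝ}
    (hH : ContMDiff (coI E) 𝓘(ℝ, ℝ) 3 H) {z : ℝ → CotangentBundle E M} {t : ℝ}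
    (hz : HamiltonianWithinAt H z univ t) : HasDerivAt (fun t => H (z t)) 0 t := by
  have h1 := hasDerivWithinAt_univ.1 (hz.2 (z t) (mem_extChartAt_source _))
  have h2 := ((contDiffAt_localHamiltonian hH (z t)
    (mem_extChartAt_target (I := coI E) (z t))).differentiableAt (by norm_num)).hasFDerivAt
  have h3 := h2.comp_hasDerivAt t h1
  rw [fderiv_localHamiltonian_apply, sub_self] at h3
  refine h3.congr_of_eventuallyEq ?_
  filter_upwards [((continuousWithinAt_univ _ _).1 hz.1).eventually (show ∀ᶠ w in 𝓝 (z t),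
    w ∈ (extChartAt (coI E) (z t)).source from (isOpen_extChartAt_source (I := coI E) (z t)).mem_nhds
      (mem_extChartAt_source _))] with r hr
  simp only [Function.comp_apply, (extChartAt (coI E) (z t)).left_inv hr]

/-- Conservation of energy. -/
lemma IsFlowOn.energy_eq {H : CotangentBundle E M → ℝ}
    (hH : ContMDiff (coI E) 𝓘(ℝ, ℝ) 3 H) {Φ : CotangentBundle E M → ℝ → CotangentBundle E M}
    {U : Set (CotangentBundle E M)} {T δ : ℝ} (hΦ : IsFlowOn H Φ U T δ) (hT : 0 ≤ T)
    {ζ : CotangentBundle E M} (hζ : ζ ∈ U) {t : ℝ} (ht : t ∈ Ioo (-δ) (T + δ)) :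
    H (Φ ζ t) = H ζ := by
  have hδ := hΦ.delta_pos
  have hd : ∀ r ∈ Ioo (-δ) (T + δ), HasDerivAt (fun t => H (Φ ζ t)) 0 r := fun r hr =>
    (hΦ.hamiltonian ζ hζ r hr).hasDerivAt_energy hH
  have := isOpen_Ioo.is_const_of_deriv_eq_zero isPreconnected_Ioo
    (fun r hr => (hd r hr).differentiableAt.differentiableWithinAt) (fun r hr => (hd r hr).deriv) ht
    (show (0 : ℝ) ∈ Ioo (-δ) (T + δ) from ⟨by linarith, by linarith⟩)
  simpa only [hΦ.map_zero ζ hζ] using this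

lemma IsFlowOn.contMDiffAt {H : CotangentBundle E M → ℝ}
    {Φ : CotangentBundle E M → ℝ → CotangentBundle E M}
    {U : Set (CotangentBundle E M)} {T δ : ℝ} (hΦ : IsFlowOn H Φ U T δ)
    {ζ : CotangentBundle E M} (hζ : ζ ∈ U) {t : ℝ} (ht : t ∈ Ioo (-δ) (T + δ)) :
    ContMDiffAt ((coI E).prod 𝓘(ℝ, ℝ)) (coI E) 1 (Function.uncurry Φ) (ζ, t) :=
  hΦ.contMDiffOn.contMDiffAt ((hΦ.isOpen.prod isOpen_Ioo).mem_nhds ⟨hζ, ht⟩)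

lemma IsFlowOn.contMDiffAt_comp {H : CotangentBundle E M → ℝ}
    {Φ : CotangentBundle E M → ℝ → CotangentBundle E M}
    {U : Set (CotangentBundle E M)} {T δ : ℝ} (hΦ : IsFlowOn H Φ U T δ)
    {ζ : Y → CotangentBundle E M} {τ : Y → ℝ} {b : Y} (hζ : ContMDiffAt 𝓘(ℝ, Y) (coI E) 1 ζ b)
    (hτ : ContMDiffAt 𝓘(ℝ, Y) 𝓘(ℝ, ℝ) 1 τ b) (hU : ζ b ∈ U) (ht : τ b ∈ Ioo (-δ) (T + δ)) :
    ContMDiffAt 𝓘(ℝ, Y) (coI E) 1 (fun b => Φ (ζ b) (τ b)) b :=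
  ContMDiffAt.comp (g := Function.uncurry Φ) (f := fun b => (ζ b, τ b)) b
    (hΦ.contMDiffAt hU ht) (hζ.prodMk hτ)

/-- The first variation formula for the action `∫ p dq` on an energy level, for a free time:
`dS = p₊ dq₊ - p₋ dq₋`. -/
theorem first_variation {H : CotangentBundle E M → ℝ}
    (hH : ContMDiff (coI E) 𝓘(ℝ, ℝ) 3 H) {Φ : CotangentBundle E M → ℝ → CotangentBundle E M}
    {U : Set (CotangentBundle E M)} {T δ : ℝ} (hΦ : IsFlowOn H Φ U T δ) (hT : 0 ≤ T)
    {ζ : Y → CotangentBundle E M} {τ : Y → ℝ} {b₀ : Y} (hζ : ContMDiffAt 𝓘(ℝ, Y) (coI E) 1 ζ b₀)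
    (hU : ζ b₀ ∈ U) {e : ℝ} (he : ∀ᶠ b in 𝓝 b₀, H (ζ b) = e)
    (hτ : DifferentiableAt ℝ τ b₀) (hτ₀ : τ b₀ = T) :
    HasFDerivAt (fun b => ∫ r in (0 : ℝ)..τ b, actionDensity H (Φ (ζ b) r))
      (tautologicalForm (fun b => Φ (ζ b) (τ b)) b₀ - tautologicalForm ζ b₀) b₀ := by
  have hδ := hΦ.delta_pos
  have hζU : ∀ᶠ b in 𝓝 b₀, ζ b ∈ U := hζ.continuousAt.eventually (hΦ.isOpen.mem_nhds hU)
  have hI : ∀ r ∈ Icc 0 T, r ∈ Ioo (-δ) (T + δ) := fun r hr => ⟨by linarith [hr.1], by linarith [hr.2]⟩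
  have h0 : (0 : ℝ) ∈ Icc 0 T := ⟨le_rfl, hT⟩
  have hTT : T ∈ Icc 0 T := ⟨hT, le_rfl⟩
  have hev : ∀ r ∈ Icc 0 T, ∀ᶠ p in 𝓝 (b₀, r), ζ p.1 ∈ U ∧ H (ζ p.1) = e ∧ p.2 ∈ Ioo (-δ) (T + δ) :=
    fun r hr => ((hζU.and he).prod_nhds (isOpen_Ioo.mem_nhds (hI r hr))).mono fun p h => ⟨h.1.1, h.1.2, h.2⟩
  have hw : ∀ r ∈ Icc 0 T, ContMDiffAt 𝓘(ℝ, Y × ℝ) (coI E) 1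
      (Function.uncurry fun b r => Φ (ζ b) r) (b₀, r) := by
    intro r hr
    have h1 : ContMDiffAt 𝓘(ℝ, Y × ℝ) 𝓘(ℝ, Y) 1 (fun p : Y × ℝ => p.1) (b₀, r) :=
      contMDiffAt_iff_contDiffAt.2 contDiffAt_fst
    have h2 : ContMDiffAt 𝓘(ℝ, Y × ℝ) 𝓘(ℝ, ℝ) 1 (fun p : Y × ℝ => p.2) (b₀, r) :=
      contMDiffAt_iff_contDiffAt.2 contDiffAt_snd
    exact hΦ.contMDiffAt_comp (ζ := fun p : Y × ℝ => ζ p.1) (τ := fun p : Y × ℝ => p.2) (b := (b₀, r))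
      (ContMDiffAt.comp (g := ζ) (b₀, r) hζ h1) h2 hU (hI r hr)
  have hfix := hasFDerivAt_integral_actionDensity hH (e := e) hT (w := fun b r => Φ (ζ b) r) (b₀ := b₀) hw
    (fun r hr => (hev r hr).mono fun p h => hΦ.hamiltonian _ h.1 _ h.2.2)
    (fun r hr => (hev r hr).mono fun p h => by rw [← h.2.1]; exact hΦ.energy_eq hH hT h.1 h.2.2)
  have hform0 : tautologicalForm (fun b => Φ (ζ b) 0) b₀ = tautologicalForm ζ b₀ := by
    have hcongr : (fun b => (Φ (ζ b) 0).proj) =ᶠ[𝓝 b₀] fun b => (ζ b).proj := by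
      filter_upwards [hζU] with b hb
      rw [hΦ.map_zero _ hb]
    refine ContinuousLinearMap.ext fun v => ?_
    rw [tautologicalForm_apply, tautologicalForm_apply, hcongr.mfderiv_eq, hΦ.map_zero _ hU]
  rw [hform0] at hfix
  -- the contribution of the variation of the time
  set ℓ := fun p : Y × ℝ => actionDensity H (Φ (ζ p.1) p.2)
  set ℓ₀ := actionDensity H (Φ (ζ b₀) T)
  have hcont : ∀ᶠ p in 𝓝 (b₀, T), ContinuousAt (fun r => actionDensity H (Φ (ζ p.1) r)) p.2 ∧
      IntervalIntegrable (fun r => actionDensity H (Φ (ζ p.1) r)) MeasureTheory.volume 0 T := by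
    filter_upwards [hev T hTT] with p hp
    have hc : ∀ r ∈ Ioo (-δ) (T + δ), ContinuousAt (fun r => actionDensity H (Φ (ζ p.1) r)) r :=
      fun r hr => (continuous_actionDensity hH).continuousAt.comp
        ((continuousWithinAt_univ _ _).1 (hΦ.hamiltonian _ hp.1 r hr).1)
    refine ⟨hc _ hp.2.2, ContinuousOn.intervalIntegrable fun r hr => ?_⟩
    rw [uIcc_of_le hT] at hr
    exact (hc r (hI r hr)).continuousWithinAt
  have hℓ : ContinuousAt ℓ (b₀, T) :=
    ContinuousAt.comp (g := actionDensity H) (continuous_actionDensity hH).continuousAt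
      (hw T hTT).continuousAt
  have hvar : HasFDerivAt (fun b => ∫ r in T..τ b, actionDensity H (Φ (ζ b) r))
      (ℓ₀ • fderiv ℝ τ b₀) b₀ := by
    have hlo : HasFDerivAt (fun b => (∫ r in T..τ b, actionDensity H (Φ (ζ b) r)) - (τ b - T) * ℓ₀)
        (0 : Y →L[ℝ] ℝ) b₀ := by
      rw [hasFDerivAt_iff_isLittleO]
      have hO : (fun b => τ b - T) =O[𝓝 b₀] fun b => b - b₀ := by
        rw [← hτ₀]; exact hτ.isBigO_sub
      refine Asymptotics.IsLittleO.trans_isBigO (g := fun b => τ b - T) ?_ hO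
      refine Asymptotics.IsLittleO.of_bound fun ε hε => ?_
      have h1 : ∀ᶠ p in 𝓝 (b₀, T), ‖ℓ p - ℓ₀‖ ≤ ε := by
        have := hℓ.tendsto.sub_const ℓ₀
        rw [show ℓ (b₀, T) - ℓ₀ = 0 from sub_self _] at this
        filter_upwards [(tendsto_zero_iff_norm_tendsto_zero.1 this).eventually_le_const hε] with p hp
        exact hp
      obtain ⟨η, hη, hball⟩ := Metric.eventually_nhds_iff.1 (h1.and hcont)
      have hτc : ∀ᶠ b in 𝓝 b₀, dist (τ b) T < η := by
        have := hτ.continuousAt.tendsto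
        rw [hτ₀] at this
        exact this.eventually (Metric.ball_mem_nhds T hη)
      filter_upwards [hτc, Metric.ball_mem_nhds b₀ hη] with b hb1 hb2
      have hr : ∀ r ∈ uIcc T (τ b), dist (b, r) (b₀, T) < η := by
        intro r hr
        rw [Prod.dist_eq]
        refine max_lt hb2 (lt_of_le_of_lt ?_ hb1)
        rw [Real.dist_eq, Real.dist_eq]
        exact abs_sub_left_of_mem_uIcc hr
      have hci : IntervalIntegrable (fun r => actionDensity H (Φ (ζ b) r)) MeasureTheory.volume T (τ b) :=
        ContinuousOn.intervalIntegrable fun r h => (hball (hr r h)).2.1.continuousWithinAt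
      have hconst : (τ b - T) * ℓ₀ = ∫ _ in T..τ b, ℓ₀ := by
        rw [intervalIntegral.integral_const, smul_eq_mul]
      simp only [hτ₀, intervalIntegral.integral_same, sub_self, zero_mul, sub_zero, zero_apply]
      rw [hconst, ← intervalIntegral.integral_sub hci intervalIntegrable_const]
      refine intervalIntegral.norm_integral_le_of_norm_le_const fun r h => ?_
      exact (hball (hr r (uIoc_subset_uIcc h))).1
    have := hlo.add ((hτ.hasFDerivAt.sub_const T).mul_const ℓ₀)
    rw [zero_add] at this
    refine this.congr_of_eventuallyEq (Eventually.of_forall fun b => ?_)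
    simp only [Pi.add_apply, sub_add_cancel]
  -- varying the time moves the end point by `q̇ dτ`, which contributes `p q̇ dτ = ℓ₀ dτ`
  have hform : tautologicalForm (fun b => Φ (ζ b) (τ b)) b₀ =
      tautologicalForm (fun b => Φ (ζ b) T) b₀ + ℓ₀ • fderiv ℝ τ b₀ := by
    set z₁ := Φ (ζ b₀) T
    have hsrc : z₁ ∈ (extChartAt (coI E) z₁).source := mem_extChartAt_source _
    have hx : DifferentiableAt ℝ (fun p : Y × ℝ => extChartAt (coI E) z₁ (Φ (ζ p.1) p.2)) (b₀, T) :=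
      (contDiffAt_chart (by simp) z₁ (ζ := Function.uncurry fun b r => Φ (ζ b) r) (hw T hTT)
        hsrc).differentiableAt one_ne_zero
    set L := fderiv ℝ (fun p : Y × ℝ => extChartAt (coI E) z₁ (Φ (ζ p.1) p.2)) (b₀, T) with hL
    have hT' : HasFDerivAt (fun b => ((b, T) : Y × ℝ)) (ContinuousLinearMap.inl ℝ Y ℝ) b₀ :=
      hasFDerivAt_prodMk_left b₀ T
    have hτ' : HasFDerivAt (fun b => ((b, τ b) : Y × ℝ))
        ((ContinuousLinearMap.id ℝ Y).prod (fderiv ℝ τ b₀)) b₀ :=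
      (hasFDerivAt_id b₀).prodMk hτ.hasFDerivAt
    have d1 : HasFDerivAt (fun b => extChartAt (coI E) z₁ (Φ (ζ b) T))
        (L ∘L ContinuousLinearMap.inl ℝ Y ℝ) b₀ := HasFDerivAt.comp
          (g := fun p : Y × ℝ => extChartAt (coI E) z₁ (Φ (ζ p.1) p.2)) b₀ hx.hasFDerivAt hT'
    have d2 : HasFDerivAt (fun b => extChartAt (coI E) z₁ (Φ (ζ b) (τ b)))
        (L ∘L (ContinuousLinearMap.id ℝ Y).prod (fderiv ℝ τ b₀)) b₀ := by
      refine HasFDerivAt.comp (f := fun b => (b, τ b))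
          (g := fun p : Y × ℝ => extChartAt (coI E) z₁ (Φ (ζ p.1) p.2)) b₀ ?_ hτ'
      rw [hτ₀]
      exact hx.hasFDerivAt
    have d3 : L (0, 1) = chartField H z₁ (extChartAt (coI E) z₁ z₁) := by
      have h1 : HasDerivAt (fun r : ℝ => ((b₀, r) : Y × ℝ)) ((0 : Y), (1 : ℝ)) T :=
        (hasDerivAt_const T b₀).prodMk (hasDerivAt_id T)
      have h2 := HasFDerivAt.comp_hasDerivAt (l := fun p : Y × ℝ => extChartAt (coI E) z₁ (Φ (ζ p.1) p.2))
        T hx.hasFDerivAt h1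
      have h3 := hasDerivWithinAt_univ.1 ((hΦ.hamiltonian _ hU T (hI T hTT)).2 z₁ hsrc)
      exact h2.unique h3
    have m1 : MDifferentiableAt 𝓘(ℝ, Y) 𝓘(ℝ, E) (fun b => (Φ (ζ b) T).proj) b₀ :=
      (contMDiffAt_proj_comp (by simp) (hΦ.contMDiffAt_comp hζ contMDiffAt_const hU
        (hI T hTT))).mdifferentiableAt one_ne_zero
    have m2 : MDifferentiableAt 𝓘(ℝ, Y) 𝓘(ℝ, E) (fun b => (Φ (ζ b) (τ b)).proj) b₀ := by
      have h1 : MDifferentiableAt 𝓘(ℝ, Y × ℝ) 𝓘(ℝ, E) (fun p : Y × ℝ => (Φ (ζ p.1) p.2).proj) (b₀, τ b₀) := by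
        rw [hτ₀]
        exact (contMDiffAt_proj_comp (by simp) (hw T hTT)).mdifferentiableAt one_ne_zero
      exact MDifferentiableAt.comp (g := fun p : Y × ℝ => (Φ (ζ p.1) p.2).proj) (f := fun b => (b, τ b))
        b₀ h1 hτ'.differentiableAt.mdifferentiableAt
    rw [tautologicalForm_chart z₁ m1 hsrc, tautologicalForm_chart z₁ m2 (by simpa only [hτ₀] using hsrc)]
    have f1 : HasFDerivAt (fun b => (extChartAt (coI E) z₁ (Φ (ζ b) T)).1) _ b₀ := d1.fst
    have f2 : HasFDerivAt (fun b => (extChartAt (coI E) z₁ (Φ (ζ b) (τ b))).1) _ b₀ := d2.fst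
    rw [f1.fderiv, f2.fderiv, hτ₀]
    refine ContinuousLinearMap.ext fun v => ?_
    have hsplit : L (v, fderiv ℝ τ b₀ v) = L (v, 0) + fderiv ℝ τ b₀ v • L (0, 1) := by
      rw [← map_smul, ← map_add]; simp
    have hd1 : ℓ₀ = (extChartAt (coI E) z₁ z₁).2 (chartField H z₁ (extChartAt (coI E) z₁ z₁)).1 :=
      actionDensity_chart hH z₁ z₁ hsrc
    change (extChartAt (coI E) z₁ z₁).2 (L (v, fderiv ℝ τ b₀ v)).1 =
      (extChartAt (coI E) z₁ z₁).2 (L (v, 0)).1 + ℓ₀ * fderiv ℝ τ b₀ v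
    rw [hsplit, d3, hd1, Prod.fst_add, Prod.smul_fst, map_add, map_smul, smul_eq_mul, mul_comm]
  refine ((hfix.add hvar).congr_of_eventuallyEq ?_).congr_fderiv ?_
  · obtain ⟨η, hη, hball⟩ := Metric.eventually_nhds_iff.1 hcont
    have hτc : ∀ᶠ b in 𝓝 b₀, dist (τ b) T < η := by
      have := hτ.continuousAt.tendsto
      rw [hτ₀] at this
      exact this.eventually (Metric.ball_mem_nhds T hη)
    filter_upwards [hτc, Metric.ball_mem_nhds b₀ hη] with b hb1 hb2
    have hr : ∀ r ∈ uIcc T (τ b), dist (b, r) (b₀, T) < η := by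
      intro r hr
      rw [Prod.dist_eq]
      refine max_lt hb2 (lt_of_le_of_lt ?_ hb1)
      rw [Real.dist_eq, Real.dist_eq]
      exact abs_sub_left_of_mem_uIcc hr
    refine (intervalIntegral.integral_add_adjacent_intervals (hball (hr T left_mem_uIcc)).2
      (ContinuousOn.intervalIntegrable fun r h => (hball (hr r h)).1.continuousWithinAt)).symm
  · rw [hform]; abel

end FirstVariation

end

/-! ### The boundary value problem and the local action -/

section

variable {E : Type*} [NormedAddCommGroup E] [NormedSpace ℝ E]
variable {M : Type*} [TopologicalSpace M] [ChartedSpace E M] [IsManifold 𝓘(ℝ, E) ∞ M]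
variable [FiniteDimensional ℝ E]

omit [FiniteDimensional ℝ E] in
lemma extChartAt_symm_mk (z₀ : CotangentBundle E M) (p : E →L[ℝ] ℝ) :
    (extChartAt (coI E) z₀).symm (extChartAt 𝓘(ℝ, E) z₀.proj z₀.proj, p) =
      (⟨z₀.proj, (show TangentSpace 𝓘(ℝ, E) z₀.proj →L[ℝ] Bundle.Trivial M ℝ z₀.proj from p)⟩ :
        CotangentBundle E M) := by
  have hsrc : (⟨z₀.proj, (show TangentSpace 𝓘(ℝ, E) z₀.proj →L[ℝ] Bundle.Trivial M ℝ z₀.proj from p)⟩ :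
      CotangentBundle E M) ∈ (extChartAt (coI E) z₀).source := by
    rw [mem_extChartAt_source_iff]; exact mem_extChartAt_source _
  have h := (extChartAt (coI E) z₀).left_inv hsrc
  rw [extChartAt_mk] at h
  exact h

section Shooting

variable (H : CotangentBundle E M → ℝ) (e : ℝ) (Φ : CotangentBundle E M → ℝ → CotangentBundle E M)
  (z₀ z₁ : CotangentBundle E M)

/-- The equations, in charts, for an initial momentum `y.1` and a duration `y.2` of the trajectory of
energy `e` that joins the point `x.1` to the point `x.2`. -/
def shootingMap (p : (E × E) × ((E →L[ℝ] ℝ) × ℝ)) : ℝ × E :=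
  (H ((extChartAt (coI E) z₀).symm (p.1.1, p.2.1)) - e,
    extChartAt 𝓘(ℝ, E) z₁.proj (Φ ((extChartAt (coI E) z₀).symm (p.1.1, p.2.1)) p.2.2).proj - p.1.2)

variable {H Φ} {U : Set (CotangentBundle E M)} {T δ : ℝ}

lemma contMDiffAt_shootingEnd (hΦ : IsFlowOn H Φ U T δ)
    {x : (E × E) × ((E →L[ℝ] ℝ) × ℝ)} (h₀ : (x.1.1, x.2.1) ∈ (extChartAt (coI E) z₀).target)
    (hU : (extChartAt (coI E) z₀).symm (x.1.1, x.2.1) ∈ U) (ht : x.2.2 ∈ Ioo (-δ) (T + δ)) :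
    ContMDiffAt 𝓘(ℝ, (E × E) × ((E →L[ℝ] ℝ) × ℝ)) (coI E) 1
      (fun p => Φ ((extChartAt (coI E) z₀).symm (p.1.1, p.2.1)) p.2.2) x := by
  have h1 : ContMDiffAt 𝓘(ℝ, (E × E) × ((E →L[ℝ] ℝ) × ℝ)) 𝓘(ℝ, E × (E →L[ℝ] ℝ)) 1
      (fun p => (p.1.1, p.2.1)) x := contMDiffAt_iff_contDiffAt.2 (by fun_prop)
  have h2 : ContMDiffAt 𝓘(ℝ, E × (E →L[ℝ] ℝ)) (coI E) 1 (extChartAt (coI E) z₀).symm (x.1.1, x.2.1) :=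
    (contMDiffOn_extChartAt_symm (I := coI E) (n := 1) z₀).contMDiffAt
      ((isOpen_extChartAt_target (I := coI E) z₀).mem_nhds h₀)
  refine hΦ.contMDiffAt_comp (ζ := fun p => (extChartAt (coI E) z₀).symm (p.1.1, p.2.1))
    (τ := fun p => p.2.2) (b := x) (ContMDiffAt.comp x h2 h1) ?_ hU ht
  exact contMDiffAt_iff_contDiffAt.2 (by fun_prop)

lemma contDiffAt_shootingMap (hH : ContMDiff (coI E) 𝓘(ℝ, ℝ) 3 H) (hΦ : IsFlowOn H Φ U T δ)
    {x : (E × E) × ((E →L[ℝ] ℝ) × ℝ)} (h₀ : (x.1.1, x.2.1) ∈ (extChartAt (coI E) z₀).target)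
    (hU : (extChartAt (coI E) z₀).symm (x.1.1, x.2.1) ∈ U) (ht : x.2.2 ∈ Ioo (-δ) (T + δ))
    (h₁ : (Φ ((extChartAt (coI E) z₀).symm (x.1.1, x.2.1)) x.2.2).proj ∈
      (extChartAt 𝓘(ℝ, E) z₁.proj).source) :
    ContDiffAt ℝ 1 (shootingMap H e Φ z₀ z₁) x := by
  have h1 : ContDiffAt ℝ 1 (fun p : (E × E) × ((E →L[ℝ] ℝ) × ℝ) =>
      H ((extChartAt (coI E) z₀).symm (p.1.1, p.2.1))) x :=
    ContDiffAt.comp (g := H ∘ (extChartAt (coI E) z₀).symm)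
      (f := fun p : (E × E) × ((E →L[ℝ] ℝ) × ℝ) => (p.1.1, p.2.1)) x
      ((contDiffAt_localHamiltonian hH z₀ h₀).of_le (by norm_num)) (by fun_prop)
  have h2 := contMDiffAt_proj_comp (by simp) (contMDiffAt_shootingEnd z₀ hΦ h₀ hU ht)
  have h3 : ContMDiffAt 𝓘(ℝ, E) 𝓘(ℝ, E) 1 (extChartAt 𝓘(ℝ, E) z₁.proj)
      (Φ ((extChartAt (coI E) z₀).symm (x.1.1, x.2.1)) x.2.2).proj :=
    (contMDiffAt_extChartAt' (n := ∞) (by simpa using h₁)).of_le (by simp)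
  have h4 := contMDiffAt_iff_contDiffAt.1 (ContMDiffAt.comp x h3 h2)
  exact (h1.sub contDiffAt_const).prodMk (h4.sub (by fun_prop))

/-- If the end points are not conjugate, the equations of the boundary value problem can be solved
for the initial momentum and the duration. The free duration is excluded from the kernel because
the velocity at the end point does not vanish. -/
lemma shootingMap_kernel (hH : ContMDiff (coI E) 𝓘(ℝ, ℝ) 3 H) {z : ℝ → CotangentBundle E M}
    (hΦ : IsFlowOn H Φ U T δ) (hT : 0 < T) (hU : z 0 ∈ U) (hzT : Φ (z 0) T = z T)
    (hnc : NonConjugate H z T) (hv : stateVelocity H (z T) ≠ 0) (v : (E →L[ℝ] ℝ) × ℝ)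
    (hker : fderiv ℝ (shootingMap H e Φ (z 0) (z T))
      (((extChartAt (coI E) (z 0) (z 0)).1, extChartAt 𝓘(ℝ, E) (z T).proj (z T).proj),
        ((extChartAt (coI E) (z 0) (z 0)).2, T)) (0, v) = 0) : v = 0 := by
  have hδ := hΦ.delta_pos
  set ch₀ := extChartAt (coI E) (z 0) with hch₀
  set φ₁ := extChartAt 𝓘(ℝ, E) (z T).proj with hφ₁
  set ξ₀ := ch₀ (z 0)
  have hξ₀ : (ξ₀.1, ξ₀.2) ∈ ch₀.target := mem_extChartAt_target (I := coI E) (z 0)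
  have hsymm : ch₀.symm (ξ₀.1, ξ₀.2) = z 0 := ch₀.left_inv (mem_extChartAt_source (I := coI E) (z 0))
  have hTI : T ∈ Ioo (-δ) (T + δ) := ⟨by linarith, by linarith⟩
  have hsrc₁ : (z T).proj ∈ φ₁.source := mem_extChartAt_source _
  set x₀ : (E × E) × ((E →L[ℝ] ℝ) × ℝ) := ((ξ₀.1, φ₁ (z T).proj), (ξ₀.2, T)) with hx₀
  have hF := (contDiffAt_shootingMap e (z 0) (z T) (x := x₀) hH hΦ hξ₀
    (by rw [show (x₀.1.1, x₀.2.1) = (ξ₀.1, ξ₀.2) from rfl, ← hch₀, hsymm]; exact hU) hTI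
    (by rw [show (x₀.1.1, x₀.2.1) = (ξ₀.1, ξ₀.2) from rfl, ← hch₀, hsymm,
          show x₀.2.2 = T from rfl, hzT]; exact hsrc₁)).differentiableAt one_ne_zero
  obtain ⟨P', τ'⟩ := v
  set P : ℝ → E →L[ℝ] ℝ := fun s => ξ₀.2 + s • P' with hP
  set τ : ℝ → ℝ := fun s => T + s * τ' with hτ
  have dP : HasDerivAt P P' 0 := by
    have := ((hasDerivAt_id (0 : ℝ)).smul_const P').const_add ξ₀.2
    rw [one_smul] at this
    exact this
  have dτ : HasDerivAt τ τ' 0 := by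
    have := ((hasDerivAt_id (0 : ℝ)).mul_const τ').const_add T
    rw [one_mul] at this
    exact this
  have hP0 : P 0 = ξ₀.2 := by simp [hP]
  have hτ0 : τ 0 = T := by simp [hτ]
  have dl : HasDerivAt (fun s => (((ξ₀.1, φ₁ (z T).proj), (P s, τ s)) : (E × E) × ((E →L[ℝ] ℝ) × ℝ)))
      (0, (P', τ')) 0 := (hasDerivAt_const (0 : ℝ) _).prodMk (dP.prodMk dτ)
  have hl0 : (fun s => (((ξ₀.1, φ₁ (z T).proj), (P s, τ s)) : (E × E) × ((E →L[ℝ] ℝ) × ℝ))) 0 = x₀ := by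
    simp only [hP0, hτ0, hx₀]
  have dF := HasFDerivAt.comp_hasDerivAt_of_eq (l := shootingMap H e Φ (z 0) (z T)) 0
    hF.hasFDerivAt dl hl0.symm
  rw [hker] at dF
  have dF1 : HasDerivAt (fun s => H (ch₀.symm (ξ₀.1, P s)) - e) 0 0 := dF.fst
  have dF2 : HasDerivAt (fun s => φ₁ (Φ (ch₀.symm (ξ₀.1, P s)) (τ s)).proj - φ₁ (z T).proj) 0 0 := dF.snd
  -- the variation through trajectories with initial momentum `P s` and duration `τ s`
  have hfst : ξ₀.1 = extChartAt 𝓘(ℝ, E) (z 0).proj (z 0).proj := extChartAt_fst _ _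
  have hmk : ∀ p, ch₀.symm (ξ₀.1, p) = ⟨(z 0).proj,
      (show TangentSpace 𝓘(ℝ, E) (z 0).proj →L[ℝ] Bundle.Trivial M ℝ (z 0).proj from p)⟩ := by
    intro p
    rw [hfst]
    exact extChartAt_symm_mk (z 0) p
  have hini0 : ch₀.symm (ξ₀.1, P 0) = z 0 := by rw [hP0, hsymm]
  have hcini : ContinuousAt (fun s => ch₀.symm (ξ₀.1, P s)) 0 := by
    have h1 : ContinuousAt (fun s => (ξ₀.1, P s)) 0 := continuousAt_const.prodMk dP.continuousAt
    have h2 : ContinuousAt ch₀.symm (ξ₀.1, P 0) := by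
      rw [hP0]
      exact (continuousOn_extChartAt_symm (I := coI E) (z 0)).continuousAt
        ((isOpen_extChartAt_target (I := coI E) (z 0)).mem_nhds hξ₀)
    exact ContinuousAt.comp (f := fun s => (ξ₀.1, P s)) (g := ch₀.symm) h2 h1
  have hevU : ∀ᶠ s in 𝓝 (0 : ℝ), ch₀.symm (ξ₀.1, P s) ∈ U :=
    hcini.eventually (hΦ.isOpen.mem_nhds (by simpa only [hini0] using hU))
  have hevτ : ∀ᶠ s in 𝓝 (0 : ℝ), τ s ∈ Ioo 0 (T + δ) :=
    dτ.continuousAt.eventually (isOpen_Ioo.mem_nhds (by rw [hτ0]; exact ⟨hT, by linarith⟩))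
  have hend0 : (Φ (ch₀.symm (ξ₀.1, P 0)) (τ 0)).proj = (z T).proj := by rw [hini0, hτ0, hzT]
  have hmd : MDifferentiableAt 𝓘(ℝ, ℝ) 𝓘(ℝ, E)
      (fun s => (Φ (ch₀.symm (ξ₀.1, P s)) (τ s)).proj) 0 := by
    have h1 : ContMDiffAt 𝓘(ℝ, (E × E) × ((E →L[ℝ] ℝ) × ℝ)) 𝓘(ℝ, E) 1
        (fun p => (Φ (ch₀.symm (p.1.1, p.2.1)) p.2.2).proj)
        ((fun s => (((ξ₀.1, φ₁ (z T).proj), (P s, τ s)) : (E × E) × ((E →L[ℝ] ℝ) × ℝ))) 0) := by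
      rw [hl0]
      exact contMDiffAt_proj_comp (by simp) (contMDiffAt_shootingEnd (z 0) (x := x₀) hΦ hξ₀
        (by rw [show (x₀.1.1, x₀.2.1) = (ξ₀.1, ξ₀.2) from rfl, ← hch₀, hsymm]; exact hU) hTI)
    exact MDifferentiableAt.comp (g := fun p : (E × E) × ((E →L[ℝ] ℝ) × ℝ) =>
      (Φ (ch₀.symm (p.1.1, p.2.1)) p.2.2).proj) 0 (h1.mdifferentiableAt one_ne_zero)
      dl.differentiableAt.mdifferentiableAt
  have hend : HasMFDerivAt 𝓘(ℝ, ℝ) 𝓘(ℝ, E) (fun s => (Φ (ch₀.symm (ξ₀.1, P s)) (τ s)).proj) 0 0 := by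
    have hs : (Φ (ch₀.symm (ξ₀.1, P 0)) (τ 0)).proj ∈ φ₁.source := by rw [hend0]; exact hsrc₁
    have h1 := fderiv_extChartAt_comp hmd hs 1
    have dF3 : HasDerivAt (fun s => φ₁ (Φ (ch₀.symm (ξ₀.1, P s)) (τ s)).proj) 0 0 := by
      simpa using dF2.add_const (φ₁ (z T).proj)
    rw [fderiv_apply_one_eq_deriv, dF3.deriv] at h1
    have h2 := (isInvertible_mfderiv_extChartAt (I := 𝓘(ℝ, E)) hs).injective
    have h3 : mfderiv 𝓘(ℝ, ℝ) 𝓘(ℝ, E) (fun s => (Φ (ch₀.symm (ξ₀.1, P s)) (τ s)).proj) 0 (1 : ℝ) = 0 :=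
      h2 (h1.symm.trans (map_zero _).symm)
    have h4 := hmd.hasMFDerivAt
    have h5 : mfderiv 𝓘(ℝ, ℝ) 𝓘(ℝ, E) (fun s => (Φ (ch₀.symm (ξ₀.1, P s)) (τ s)).proj) 0 = 0 :=
      ContinuousLinearMap.ext_ring h3
    rwa [h5] at h4
  have hP' : P' = 0 := by
    refine hnc (fun s => Φ (ch₀.symm (ξ₀.1, P s))) τ P τ' P' ?_ ?_ hτ0 dτ dP ?_ hend
    · filter_upwards [hevU, hevτ] with s hs hτs
      refine ⟨isHamiltonianArc_iff.2 ⟨hτs.1, fun t ht => (hΦ.hamiltonian _ hs t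
        ⟨by linarith [ht.1], by linarith [ht.2, hτs.2]⟩).mono (subset_univ _)⟩, ?_⟩
      rw [hΦ.map_zero _ hs, hmk]
    · simp only [hini0, hΦ.map_zero _ hU]
    · have h1 : HasDerivAt (fun s => H (ch₀.symm (ξ₀.1, P s))) 0 0 := by
        simpa using dF1.add_const e
      refine h1.congr_of_eventuallyEq ?_
      filter_upwards [hevU] with s hs
      rw [hΦ.map_zero _ hs]
  subst hP'
  -- only the duration varies
  have h1 : HasDerivAt (fun t => extChartAt 𝓘(ℝ, E) (z T).proj (Φ (z 0) t).proj)
      (chartField H (z T) (extChartAt (coI E) (z T) (z T))).1 T := by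
    have h2 := hasDerivWithinAt_univ.1 ((hΦ.hamiltonian _ hU T hTI).2 (z T)
      (by rw [hzT]; exact mem_extChartAt_source _))
    rw [hzT] at h2
    have h3 : HasDerivAt (fun t => (extChartAt (coI E) (z T) (Φ (z 0) t)).1)
      (chartField H (z T) (extChartAt (coI E) (z T) (z T))).1 T := h2.fst
    simpa only [extChartAt_fst] using h3
  have h2 : HasDerivAt (fun s => φ₁ (Φ (z 0) (τ s)).proj) (τ' • stateVelocity H (z T)) 0 :=
    HasDerivAt.scomp_of_eq (h := τ) (g₁ := fun t => φ₁ (Φ (z 0) t).proj) 0 h1 dτ hτ0.symm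
  have h3 : ∀ s, ch₀.symm (ξ₀.1, P s) = z 0 := by
    intro s
    rw [show P s = P 0 by simp [hP], hini0]
  simp only [h3] at dF2
  have h4 : (τ' • (stateVelocity H (z T) : E)) = 0 := by
    have h5 := dF2.add_const (φ₁ (z T).proj)
    simp only [sub_add_cancel] at h5
    exact h2.unique h5
  rcases smul_eq_zero.1 h4 with h5 | h5
  · rw [h5]; rfl
  · exact absurd h5 hv

/-- A trajectory with nonconjugate end points has a local action function: the implicit function
theorem solves the boundary value problem for end points close to the given ones. -/
theorem exists_isLocalAction (hH : ContMDiff (coI E) 𝓘(ℝ, ℝ) 3 H) {z : ℝ → CotangentBundle E M}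
    (hΦ : IsFlowOn H Φ U T δ) (hT : 0 < T) (hU : z 0 ∈ U) (hzT : Φ (z 0) T = z T) (he : H (z 0) = e)
    (hnc : NonConjugate H z T) (hv : stateVelocity H (z T) ≠ 0) :
    ∃ S, IsLocalAction H e z T S := by
  have hδ := hΦ.delta_pos
  set ch₀ := extChartAt (coI E) (z 0) with hch₀
  set φ₀ := extChartAt 𝓘(ℝ, E) (z 0).proj with hφ₀
  set φ₁ := extChartAt 𝓘(ℝ, E) (z T).proj with hφ₁
  set ξ₀ := ch₀ (z 0) with hξ₀def
  have hfst : ξ₀.1 = φ₀ (z 0).proj := extChartAt_fst _ _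
  have hξ₀ : (ξ₀.1, ξ₀.2) ∈ ch₀.target := mem_extChartAt_target (I := coI E) (z 0)
  have hsymm : ch₀.symm (ξ₀.1, ξ₀.2) = z 0 := ch₀.left_inv (mem_extChartAt_source (I := coI E) (z 0))
  have hTI : T ∈ Ioo (-δ) (T + δ) := ⟨by linarith, by linarith⟩
  have hsrc₁ : (z T).proj ∈ φ₁.source := mem_extChartAt_source _
  set x₀ : E × E := (ξ₀.1, φ₁ (z T).proj) with hx₀
  set y₀ : (E →L[ℝ] ℝ) × ℝ := (ξ₀.2, T) with hy₀
  have hF := contDiffAt_shootingMap e (z 0) (z T) (x := (x₀, y₀)) hH hΦ hξ₀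
    (by change ch₀.symm (ξ₀.1, ξ₀.2) ∈ U; rw [hsymm]; exact hU) hTI
    (by change (Φ (ch₀.symm (ξ₀.1, ξ₀.2)) T).proj ∈ φ₁.source; rw [hsymm, hzT]; exact hsrc₁)
  have hF0 : shootingMap H e Φ (z 0) (z T) (x₀, y₀) = 0 := by
    change (H (ch₀.symm (ξ₀.1, ξ₀.2)) - e, φ₁ (Φ (ch₀.symm (ξ₀.1, ξ₀.2)) T).proj - φ₁ (z T).proj) = 0
    rw [hsymm, hzT, he, sub_self, sub_self]
    rfl
  obtain ⟨g, hg0, hgc, hgF⟩ := exists_implicit_function hF hF0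
    (by rw [Module.finrank_prod, Module.finrank_prod, finrank_strongDual, add_comm])
    (fun v hv' => shootingMap_kernel e hH hΦ hT hU hzT hnc hv v hv')
  set κ : M × M → E × E := fun q => (φ₀ q.1, φ₁ q.2) with hκ
  have hκ0 : κ ((z 0).proj, (z T).proj) = x₀ := by rw [hκ, hx₀, hfst]
  have hκc : ContinuousAt κ ((z 0).proj, (z T).proj) :=
    (ContinuousAt.comp (f := Prod.fst) (x := ((z 0).proj, (z T).proj))
        (continuousAt_extChartAt (I := 𝓘(ℝ, E)) (z 0).proj) continuousAt_fst).prodMk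
      (ContinuousAt.comp (f := Prod.snd) (x := ((z 0).proj, (z T).proj))
        (continuousAt_extChartAt (I := 𝓘(ℝ, E)) (z T).proj) continuousAt_snd)
  set ζ : M × M → CotangentBundle E M := fun q => ch₀.symm (φ₀ q.1, (g (κ q)).1) with hζ
  set τ : M × M → ℝ := fun q => (g (κ q)).2 with hτ
  have hgκ : ContinuousAt (fun q => g (κ q)) ((z 0).proj, (z T).proj) := by
    refine ContinuousAt.comp (g := g) (f := κ) ?_ hκc
    rw [hκ0]; exact hgc.continuousAt
  have hcξ : ContinuousAt (fun q => ((φ₀ q.1, (g (κ q)).1) : E × (E →L[ℝ] ℝ)))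
      ((z 0).proj, (z T).proj) :=
    (ContinuousAt.comp (f := Prod.fst) (x := ((z 0).proj, (z T).proj))
        (continuousAt_extChartAt (I := 𝓘(ℝ, E)) (z 0).proj) continuousAt_fst).prodMk hgκ.fst
  have hξ0' : (φ₀ (z 0).proj, (g (κ ((z 0).proj, (z T).proj))).1) = (ξ₀.1, ξ₀.2) := by
    rw [hκ0, hg0, ← hfst]
  have hζ0 : ζ ((z 0).proj, (z T).proj) = z 0 := by
    change ch₀.symm (φ₀ (z 0).proj, (g (κ ((z 0).proj, (z T).proj))).1) = z 0
    rw [hξ0', hsymm]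
  have hτ0 : τ ((z 0).proj, (z T).proj) = T := by
    change (g (κ ((z 0).proj, (z T).proj))).2 = T
    rw [hκ0, hg0]
  have hζc : ContinuousAt ζ ((z 0).proj, (z T).proj) := by
    refine ContinuousAt.comp (g := ch₀.symm) ?_ hcξ
    change ContinuousAt ch₀.symm (φ₀ (z 0).proj, (g (κ ((z 0).proj, (z T).proj))).1)
    rw [hξ0']
    exact (continuousOn_extChartAt_symm (I := coI E) (z 0)).continuousAt
        ((isOpen_extChartAt_target (I := coI E) (z 0)).mem_nhds hξ₀)
  have hendc : ContinuousAt (fun q => (Φ (ζ q) (τ q)).proj) ((z 0).proj, (z T).proj) := by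
    have h1 : ContinuousAt (fun p : CotangentBundle E M × ℝ => (Φ p.1 p.2).proj)
        (ζ ((z 0).proj, (z T).proj), τ ((z 0).proj, (z T).proj)) := by
      have h2 := (hΦ.contMDiffAt hU hTI).continuousAt
      rw [hζ0, hτ0]
      exact ContinuousAt.comp (f := Function.uncurry Φ)
        (g := fun w : CotangentBundle E M => w.proj) (FiberBundle.continuous_proj _ _).continuousAt h2
    exact ContinuousAt.comp (f := fun q => (ζ q, τ q))
      (g := fun p : CotangentBundle E M × ℝ => (Φ p.1 p.2).proj) h1 (hζc.prodMk hgκ.snd)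
  -- all conditions hold near the end points
  have hev : ∀ᶠ q in 𝓝 ((z 0).proj, (z T).proj), (q.1 ∈ φ₀.source ∧ q.2 ∈ φ₁.source ∧ ζ q ∈ U ∧
      τ q ∈ Ioo 0 (T + δ)) ∧ (φ₀ q.1, (g (κ q)).1) ∈ ch₀.target ∧ ContDiffAt ℝ 1 g (κ q) ∧
      shootingMap H e Φ (z 0) (z T) (κ q, g (κ q)) = 0 ∧ (Φ (ζ q) (τ q)).proj ∈ φ₁.source := by
    have e1 : ∀ᶠ q in 𝓝 ((z 0).proj, (z T).proj), q.1 ∈ φ₀.source :=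
      continuousAt_fst.preimage_mem_nhds (extChartAt_source_mem_nhds (I := 𝓘(ℝ, E)) (z 0).proj)
    have e2 : ∀ᶠ q in 𝓝 ((z 0).proj, (z T).proj), q.2 ∈ φ₁.source :=
      continuousAt_snd.preimage_mem_nhds (extChartAt_source_mem_nhds (I := 𝓘(ℝ, E)) (z T).proj)
    have e3 : ∀ᶠ q in 𝓝 ((z 0).proj, (z T).proj), ζ q ∈ U :=
      hζc.preimage_mem_nhds (hΦ.isOpen.mem_nhds (by rw [hζ0]; exact hU))
    have e4 : ∀ᶠ q in 𝓝 ((z 0).proj, (z T).proj), τ q ∈ Ioo 0 (T + δ) :=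
      hgκ.snd.preimage_mem_nhds (isOpen_Ioo.mem_nhds
        (show τ ((z 0).proj, (z T).proj) ∈ Ioo 0 (T + δ) by rw [hτ0]; exact ⟨hT, by linarith⟩))
    have e5 : ∀ᶠ q in 𝓝 ((z 0).proj, (z T).proj), (φ₀ q.1, (g (κ q)).1) ∈ ch₀.target :=
      hcξ.preimage_mem_nhds ((isOpen_extChartAt_target (I := coI E) (z 0)).mem_nhds
        (by simp only [hξ0']; exact hξ₀))
    have e6 : ∀ᶠ q in 𝓝 ((z 0).proj, (z T).proj), ContDiffAt ℝ 1 g (κ q) :=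
      hκc.eventually (by rw [hκ0]; exact hgc.eventually (by simp))
    have e7 : ∀ᶠ q in 𝓝 ((z 0).proj, (z T).proj),
        shootingMap H e Φ (z 0) (z T) (κ q, g (κ q)) = 0 :=
      hκc.eventually (p := fun x => shootingMap H e Φ (z 0) (z T) (x, g x) = 0)
        (by rw [hκ0]; exact hgF)
    have e8 : ∀ᶠ q in 𝓝 ((z 0).proj, (z T).proj), (Φ (ζ q) (τ q)).proj ∈ φ₁.source :=
      hendc.preimage_mem_nhds ((isOpen_extChartAt_source (I := 𝓘(ℝ, E)) (z T).proj).mem_nhds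
        (by rw [hζ0, hτ0, hzT]; exact hsrc₁))
    filter_upwards [e1, e2, e3, e4, e5, e6, e7, e8] with q h1 h2 h3 h4 h5 h6 h7 h8
    exact ⟨⟨h1, h2, h3, h4⟩, h5, h6, h7, h8⟩
  obtain ⟨V, hV, hVo, hmem⟩ := eventually_nhds_iff.1 hev
  have hκm : ∀ q ∈ V, ContMDiffAt (𝓘(ℝ, E).prod 𝓘(ℝ, E)) 𝓘(ℝ, E × E) 1 κ q := fun q hq =>
    ContMDiffAt.prodMk_space
      (ContMDiffAt.comp q ((contMDiffAt_extChartAt' (n := ∞) (by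
        rw [← extChartAt_source 𝓘(ℝ, E)]; exact (hV q hq).1.1)).of_le (by simp)) contMDiffAt_fst)
      (ContMDiffAt.comp q ((contMDiffAt_extChartAt' (n := ∞) (by
        rw [← extChartAt_source 𝓘(ℝ, E)]; exact (hV q hq).1.2.1)).of_le (by simp)) contMDiffAt_snd)
  refine ⟨fun q => action (Φ (ζ q)) (τ q), V, fun q => Φ (ζ q), τ, hVo, hmem, ?_, hτ0, ?_, ?_, ?_⟩
  · change Φ (ζ ((z 0).proj, (z T).proj)) 0 = z 0
    rw [hζ0, hΦ.map_zero _ hU]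
  · have hgm : ∀ q ∈ V, ContMDiffAt (𝓘(ℝ, E).prod 𝓘(ℝ, E)) 𝓘(ℝ, E × (E →L[ℝ] ℝ)) 1
        (fun q => (φ₀ q.1, (g (κ q)).1)) q := by
      intro q hq
      have h1 : ContMDiffAt 𝓘(ℝ, E × E) 𝓘(ℝ, E × (E →L[ℝ] ℝ)) 1 (fun x => (x.1, (g x).1)) (κ q) :=
        contMDiffAt_iff_contDiffAt.2 (contDiffAt_fst.prodMk (hV q hq).2.2.1.fst)
      exact ContMDiffAt.comp q h1 (hκm q hq)
    have hζm : ContMDiffOn (𝓘(ℝ, E).prod 𝓘(ℝ, E)) (coI E) 1 ζ V := fun q hq =>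
      (ContMDiffAt.comp q ((contMDiffOn_extChartAt_symm (I := coI E) (n := 1) (z 0)).contMDiffAt
        ((isOpen_extChartAt_target (I := coI E) (z 0)).mem_nhds (hV q hq).2.1))
        (hgm q hq)).contMDiffWithinAt
    exact hζm.congr fun q hq => hΦ.map_zero _ (hV q hq).1.2.2.1
  · intro q hq
    have h1 : ContMDiffAt 𝓘(ℝ, E × E) 𝓘(ℝ, ℝ) 1 (fun x => (g x).2) (κ q) :=
      contMDiffAt_iff_contDiffAt.2 (hV q hq).2.2.1.snd
    exact (ContMDiffAt.comp q h1 (hκm q hq)).contMDiffWithinAt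
  · intro q hq
    obtain ⟨⟨hq0, hq1, hqU, hqτ⟩, hqt, -, hqF, hqe⟩ := hV q hq
    have hq2 : H (ζ q) - e = 0 := congrArg Prod.fst hqF
    have hq3 : φ₁ (Φ (ζ q) (τ q)).proj - φ₁ q.2 = 0 := congrArg Prod.snd hqF
    refine ⟨⟨isHamiltonianArc_iff.2 ⟨hqτ.1, fun t ht => (hΦ.hamiltonian _ hqU t
      ⟨by linarith [ht.1], by linarith [ht.2, hqτ.2]⟩).mono (subset_univ _)⟩, fun t ht => ?_⟩, ?_, ?_, rfl⟩
    · rw [hΦ.energy_eq hH hT.le hqU ⟨by linarith [ht.1], by linarith [ht.2, hqτ.2]⟩]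
      exact sub_eq_zero.1 hq2
    · change (Φ (ζ q) 0).proj = q.1
      rw [hΦ.map_zero _ hqU]
      have hs : ζ q ∈ ch₀.source := ch₀.map_target hqt
      refine φ₀.injOn ((mem_extChartAt_source_iff _ _).1 hs) hq0 ?_
      rw [← extChartAt_fst (z 0) (ζ q), ← hch₀, ch₀.right_inv hqt]
    · exact φ₁.injOn hqe hq1 (sub_eq_zero.1 hq3)

/-- The local action function is given by a family of members of the flow that is parametrized by
the end points. -/
theorem localAction_eq [T2Space M] (hH : ContMDiff (coI E) 𝓘(ℝ, ℝ) 3 H) {z : ℝ → CotangentBundle E M}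
    (hΦ : IsFlowOn H Φ U T δ) (hT : 0 < T) (hU : z 0 ∈ U) (hzT : Φ (z 0) T = z T) (he : H (z 0) = e)
    (hnc : NonConjugate H z T) (hv : stateVelocity H (z T) ≠ 0) :
    ∃ (ζ : M × M → CotangentBundle E M) (τ : M × M → ℝ),
      ζ ((z 0).proj, (z T).proj) = z 0 ∧ τ ((z 0).proj, (z T).proj) = T ∧
      ∀ᶠ q in 𝓝 ((z 0).proj, (z T).proj),
        ContMDiffAt (𝓘(ℝ, E).prod 𝓘(ℝ, E)) (coI E) 1 ζ q ∧
        ContMDiffAt (𝓘(ℝ, E).prod 𝓘(ℝ, E)) 𝓘(ℝ, ℝ) 1 τ q ∧ ζ q ∈ U ∧ τ q ∈ Ioo 0 (T + δ) ∧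
        H (ζ q) = e ∧ (ζ q).proj = q.1 ∧ (Φ (ζ q) (τ q)).proj = q.2 ∧
        localAction H e z T q = ∫ t in (0 : ℝ)..τ q, actionDensity H (Φ (ζ q) t) := by
  have hδ := hΦ.delta_pos
  obtain ⟨V, Z, τ, hVo, hmem, hZ0, hτ0, hZc, hτc, hZ⟩ := Classical.epsilon_spec
    (exists_isLocalAction e hH hΦ hT hU hzT he hnc hv)
  refine ⟨fun q => Z q 0, τ, hZ0, hτ0, ?_⟩
  have hV : V ∈ 𝓝 ((z 0).proj, (z T).proj) := hVo.mem_nhds hmem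
  have hc1 := (hZc.contMDiffAt hV).continuousAt
  have hc2 := (hτc.contMDiffAt hV).continuousAt
  filter_upwards [hV, hc1.eventually (hΦ.isOpen.mem_nhds (by simpa only [hZ0] using hU)),
    hc2.eventually (isOpen_Ioo.mem_nhds (show τ _ ∈ Ioo 0 (T + δ) by rw [hτ0]; exact ⟨hT, by linarith⟩))]
    with q hq hqU hqτ
  obtain ⟨harc, hq1, hq2, hS⟩ := hZ q hq
  have harc' := isHamiltonianArc_iff.1 harc.arc
  have heq : EqOn (Φ (Z q 0)) (Z q) (Icc 0 (τ q)) := eqOn_of_hamiltonian hH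
    (fun t ht => (hΦ.hamiltonian _ hqU t ⟨by linarith [ht.1], by linarith [ht.2, hqτ.2]⟩).mono
      (subset_univ _)) harc'.2 (hΦ.map_zero _ hqU)
  have h0 : (0 : ℝ) ∈ Icc 0 (τ q) := ⟨le_rfl, hqτ.1.le⟩
  refine ⟨hZc.contMDiffAt (hVo.mem_nhds hq), hτc.contMDiffAt (hVo.mem_nhds hq), hqU, hqτ,
    harc.energy 0 h0, hq1, ?_, ?_⟩
  · rw [heq ⟨hqτ.1.le, le_rfl⟩, hq2]
  · refine hS.trans ((action_eq harc.arc).trans (intervalIntegral.integral_congr fun t ht => ?_))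
    rw [uIcc_of_le hqτ.1.le] at ht
    simp only [heq ht]

end Shooting

end

/-! ### Slice charts -/

section

variable {E : Type*} [NormedAddCommGroup E] [NormedSpace ℝ E]

section SliceChart

variable {M : Type*} [TopologicalSpace M] [ChartedSpace E M] [IsManifold 𝓘(ℝ, E) ∞ M]
  {N : Set M} {Φ : OpenPartialHomeomorph M E} {F : Submodule ℝ E} {x : M}

omit [IsManifold 𝓘(ℝ, E) ∞ M] in
lemma tangentBundle_mk_eq {x y : M} (h : x = y) {u v : E} (huv : u = v) :
    (⟨x, (show TangentSpace 𝓘(ℝ, E) x from u)⟩ : TangentBundle 𝓘(ℝ, E) M) =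
      ⟨y, (show TangentSpace 𝓘(ℝ, E) y from v)⟩ := by
  subst h; subst huv; rfl

/-- The derivative of the map `Φ` at `y`, in the trivializations of the tangent spaces that underlie
their definition. -/
def chartDeriv (Φ : OpenPartialHomeomorph M E) (y : M) : E →L[ℝ] E :=
  mfderiv 𝓘(ℝ, E) 𝓘(ℝ, E) Φ y

/-- The derivative of the inverse of the map `Φ` at `ξ`. -/
def chartDerivSymm (Φ : OpenPartialHomeomorph M E) (ξ : E) : E →L[ℝ] E :=
  mfderiv 𝓘(ℝ, E) 𝓘(ℝ, E) Φ.symm ξ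

/-- The tangent bundle of the model space is a product, also as a manifold. -/
lemma contMDiff_mk_model : ContMDiff 𝓘(ℝ, E × E) 𝓘(ℝ, E).tangent ∞
    (fun p : E × E => (⟨p.1, p.2⟩ : TangentBundle 𝓘(ℝ, E) E)) := by
  intro p
  rw [Bundle.contMDiffAt_totalSpace]
  refine ⟨contMDiffAt_iff_contDiffAt.2 contDiffAt_fst, ?_⟩
  simp only [TangentBundle.trivializationAt_apply, mfld_simps]
  have h : ContDiffAt ℝ ∞ (fun p : E × E => p.2) p := contDiffAt_snd
  refine contMDiffAt_iff_contDiffAt.2 (h.congr_of_eventuallyEq (Eventually.of_forall fun q => ?_))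
  have hid : (OpenPartialHomeomorph.refl E : E → E) ∘ (OpenPartialHomeomorph.refl E).symm = id := rfl
  simp only [chartAt_self_eq, hid, fderiv_id, fderivWithin_univ]
  rfl

/-- The coordinates on the tangent bundle induced by `Φ` are smooth. -/
lemma contMDiffOn_mk_mfderiv_symm (hΦ : Φ ∈ IsManifold.maximalAtlas 𝓘(ℝ, E) ∞ M) :
    ContMDiffOn 𝓘(ℝ, E × E) 𝓘(ℝ, E).tangent ∞
    (fun p : E × E => (⟨Φ.symm p.1, chartDerivSymm Φ p.1 p.2⟩ : TangentBundle 𝓘(ℝ, E) M))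
    (Φ.target ×ˢ univ) := by
  have h1 := (contMDiffOn_symm_of_mem_maximalAtlas hΦ).contMDiffOn_tangentMapWithin (m := ∞) (by simp)
    Φ.open_target.uniqueMDiffOn
  have h2 := h1.comp (contMDiff_mk_model (E := E)).contMDiffOn (s := Φ.target ×ˢ univ) (fun p hp => hp.1)
  refine h2.congr fun p hp => ?_
  simp only [Function.comp_apply, tangentMapWithin, mfderivWithin_of_isOpen Φ.open_target hp.1]
  rfl

omit [IsManifold 𝓘(ℝ, E) ∞ M] in
lemma mdifferentiable_of_mem_maximalAtlas (hΦ : Φ ∈ IsManifold.maximalAtlas 𝓘(ℝ, E) ∞ M) :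
    Φ.MDifferentiable 𝓘(ℝ, E) 𝓘(ℝ, E) :=
  ⟨(contMDiffOn_of_mem_maximalAtlas hΦ).mdifferentiableOn (by simp),
    (contMDiffOn_symm_of_mem_maximalAtlas hΦ).mdifferentiableOn (by simp)⟩

omit [IsManifold 𝓘(ℝ, E) ∞ M] in
lemma chartDerivSymm_chartDeriv (hΦ : Φ ∈ IsManifold.maximalAtlas 𝓘(ℝ, E) ∞ M) {y : M}
    (hy : y ∈ Φ.source) (v : E) : chartDerivSymm Φ (Φ y) (chartDeriv Φ y v) = v :=
  DFunLike.congr_fun ((mdifferentiable_of_mem_maximalAtlas hΦ).symm_comp_deriv hy) v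

omit [IsManifold 𝓘(ℝ, E) ∞ M] in
lemma chartDeriv_chartDerivSymm (hΦ : Φ ∈ IsManifold.maximalAtlas 𝓘(ℝ, E) ∞ M) {ξ : E}
    (hξ : ξ ∈ Φ.target) (v : E) : chartDeriv Φ (Φ.symm ξ) (chartDerivSymm Φ ξ v) = v :=
  DFunLike.congr_fun ((mdifferentiable_of_mem_maximalAtlas hΦ).symm.symm_comp_deriv hξ) v

omit [IsManifold 𝓘(ℝ, E) ∞ M] in
/-- In a slice chart the tangent space of the submanifold is the given subspace. -/
lemma IsSliceChart.mem_tangentSpan_iff (hΦ : IsSliceChart N Φ F x) {y : M} (hy : y ∈ Φ.source)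
    (hyN : y ∈ N) (v : E) [FiniteDimensional ℝ E] :
    (show TangentSpace 𝓘(ℝ, E) y from v) ∈ tangentSpan (E := E) N y ↔ chartDeriv Φ y v ∈ F := by
  have hat := mdifferentiable_of_mem_maximalAtlas hΦ.1
  constructor
  · suffices h : tangentSpan (E := E) N y ≤
        F.comap (show E →ₗ[ℝ] E from (mfderiv 𝓘(ℝ, E) 𝓘(ℝ, E) Φ y).toLinearMap) from fun hv => h hv
    -- a curve in `N` is mapped to the subspace `F`, which is closed, so its velocity lies in `F`
    refine Submodule.span_le.2 ?_
    rintro w ⟨c, hc, hcN, heq⟩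
    cases heq
    have hd : HasDerivAt (fun s => Φ (c s))
        (mfderiv 𝓘(ℝ, E) 𝓘(ℝ, E) Φ (c 0) (mfderiv 𝓘(ℝ, ℝ) 𝓘(ℝ, E) c 0 (1 : ℝ)) : E) 0 := by
      have h1 := (hat.mdifferentiableAt hy).hasMFDerivAt.comp (0 : ℝ) hc.hasMFDerivAt
      obtain ⟨L, hL, h2⟩ : ∃ L : ℝ →L[ℝ] E, L 1 = (mfderiv 𝓘(ℝ, E) 𝓘(ℝ, E) Φ (c 0)
          (mfderiv 𝓘(ℝ, ℝ) 𝓘(ℝ, E) c 0 (1 : ℝ)) : E) ∧ HasFDerivAt (fun s => Φ (c s)) L 0 :=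
        ⟨_, rfl, hasMFDerivAt_iff_hasFDerivAt.1 h1⟩
      have h3 := h2.hasDerivAt
      rwa [hL] at h3
    have hmem : ∀ᶠ s in 𝓝 (0 : ℝ), Φ (c s) ∈ F := by
      filter_upwards [hcN, hc.continuousAt.eventually (Φ.open_source.mem_nhds hy)] with s h1 h2
      exact (hΦ.2.2 _ h2).1 h1
    have hcl : IsClosed (F : Set E) := F.closed_of_finiteDimensional
    have h0 : Φ (c 0) ∈ F := hmem.self_of_nhds
    refine hcl.mem_of_tendsto (hasDerivAt_iff_tendsto_slope.1 hd) ?_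
    filter_upwards [hmem.filter_mono nhdsWithin_le_nhds] with s hs
    rw [slope_def_module]
    exact F.smul_mem _ (F.sub_mem hs h0)
  · intro hv
    set a : E := chartDeriv Φ y v with ha
    have hl : HasDerivAt (fun s : ℝ => Φ y + s • a) a 0 := by
      have := ((hasDerivAt_id (0 : ℝ)).smul_const a).const_add (Φ y)
      rwa [one_smul] at this
    have hl0 : (fun s : ℝ => Φ y + s • a) 0 = Φ y := by simp
    have hsymm : MDifferentiableAt 𝓘(ℝ, E) 𝓘(ℝ, E) Φ.symm ((fun s : ℝ => Φ y + s • a) 0) := by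
      rw [hl0]; exact hat.mdifferentiableAt_symm (Φ.map_source hy)
    have hlm : HasMFDerivAt 𝓘(ℝ, ℝ) 𝓘(ℝ, E) (fun s : ℝ => Φ y + s • a) 0
        (ContinuousLinearMap.toSpanSingleton ℝ a) := hl.hasFDerivAt.hasMFDerivAt
    have hc := hsymm.hasMFDerivAt.comp (0 : ℝ) hlm
    have hc0 : Φ.symm (Φ y + (0 : ℝ) • a) = y := by rw [zero_smul, add_zero, Φ.left_inv hy]
    -- conversely, straight lines in `F` give curves in `N`
    refine Submodule.subset_span ⟨fun s => Φ.symm (Φ y + s • a), hc.mdifferentiableAt, ?_, ?_⟩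
    · have hmem : ∀ᶠ s in 𝓝 (0 : ℝ), Φ y + s • a ∈ Φ.target :=
        hl.continuousAt.eventually (Φ.open_target.mem_nhds (by rw [hl0]; exact Φ.map_source hy))
      filter_upwards [hmem] with s hs
      refine (hΦ.2.2 _ (Φ.map_target hs)).2 ?_
      rw [Φ.right_inv hs]
      exact F.add_mem ((hΦ.2.2 _ hy).1 hyN) (F.smul_mem s hv)
    · refine tangentBundle_mk_eq hc0 ?_
      have h1 : mfderiv 𝓘(ℝ, ℝ) 𝓘(ℝ, E) (fun s : ℝ => Φ.symm (Φ y + s • a)) 0 = _ := hc.mfderiv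
      rw [h1]
      have h2 : (mfderiv 𝓘(ℝ, E) 𝓘(ℝ, E) Φ.symm (Φ y + (0 : ℝ) • a) ((1 : ℝ) • a) : E) = v := by
        rw [zero_smul, add_zero, one_smul]
        exact chartDerivSymm_chartDeriv hΦ.1 hy v
      exact h2

end SliceChart

end

/-! ### The metric and the normal spaces in a slice chart -/

section

section NormalPart

variable {V W : Type*} [NormedAddCommGroup V] [NormedSpace ℝ V] [NormedAddCommGroup W]
  [NormedSpace ℝ W]

/-- The pairing, by the bilinear form `g`, of a vector of `V` with the subspace `ι W`. -/
def restrictedPairing (g : V →L[ℝ] V →L[ℝ] ℝ) (ι : W →L[ℝ] V) : V →L[ℝ] W →L[ℝ] ℝ :=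
  ((ContinuousLinearMap.compL ℝ W V ℝ).flip ι).comp g

lemma restrictedPairing_apply (g : V →L[ℝ] V →L[ℝ] ℝ) (ι : W →L[ℝ] V) (b : V) (a : W) :
    restrictedPairing g ι b a = g b (ι a) := rfl

/-- The component of `b` orthogonal to the subspace `ι W` with respect to the bilinear form `g`. -/
def normalPart (g : V →L[ℝ] V →L[ℝ] ℝ) (ι : W →L[ℝ] V) (b : V) : V :=
  b - ι ((restrictedPairing g ι ∘L ι).inverse (restrictedPairing g ι b))

variable [FiniteDimensional ℝ W] {g : V →L[ℝ] V →L[ℝ] ℝ} {ι : W →L[ℝ] V}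

/-- On a subspace on which `g` has no isotropic vectors, the form `g` is nondegenerate. -/
lemma isInvertible_restrictedPairing (hg : ∀ a : W, g (ι a) (ι a) = 0 → a = 0) :
    (restrictedPairing g ι ∘L ι).IsInvertible := by
  set L : W →L[ℝ] (W →L[ℝ] ℝ) := restrictedPairing g ι ∘L ι
  have hinj : Function.Injective (L : W →ₗ[ℝ] (W →L[ℝ] ℝ)) :=
    (injective_iff_map_eq_zero _).2 fun a ha => hg a (DFunLike.congr_fun ha a)
  exact ⟨(LinearEquiv.ofInjectiveOfFinrankEq (L : W →ₗ[ℝ] (W →L[ℝ] ℝ)) hinj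
    (finrank_strongDual W).symm).toContinuousLinearEquiv, by ext v; rfl⟩

lemma pairing_normalPart (hg : ∀ a : W, g (ι a) (ι a) = 0 → a = 0) (b : V) (a : W) :
    g (normalPart g ι b) (ι a) = 0 := by
  obtain ⟨e, he⟩ := isInvertible_restrictedPairing hg
  have h1 : restrictedPairing g ι (ι ((restrictedPairing g ι ∘L ι).inverse
      (restrictedPairing g ι b))) = restrictedPairing g ι b := by
    rw [← he, ContinuousLinearMap.inverse_equiv]
    have h2 := DFunLike.congr_fun he (e.symm (restrictedPairing g ι b))
    simp only [ContinuousLinearEquiv.coe_coe, ContinuousLinearEquiv.apply_symm_apply] at h2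
    exact h2.symm
  rw [← restrictedPairing_apply, normalPart, map_sub, h1, sub_self]
  rfl

omit [FiniteDimensional ℝ W] in
lemma normalPart_eq_self {b : V} (hb : ∀ a : W, g b (ι a) = 0) : normalPart g ι b = b := by
  have : restrictedPairing g ι b = 0 := ContinuousLinearMap.ext hb
  rw [normalPart, this, map_zero, map_zero, sub_zero]

omit [FiniteDimensional ℝ W] in
lemma normalPart_eq_zero {b : V} (hb : normalPart g ι b = 0) : ∃ a : W, b = ι a :=
  ⟨_, sub_eq_zero.1 hb⟩

lemma contDiffAt_normalPart [CompleteSpace W] (hg : ∀ a : W, g (ι a) (ι a) = 0 → a = 0) (b : V) :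
    ContDiffAt ℝ ∞ (fun p : (V →L[ℝ] V →L[ℝ] ℝ) × V => normalPart p.1 ι p.2) (g, b) := by
  have h1 : ContDiffAt ℝ ∞ (fun p : (V →L[ℝ] V →L[ℝ] ℝ) × V => restrictedPairing p.1 ι) (g, b) :=
    contDiffAt_const.clm_comp contDiffAt_fst
  have h2 : ContDiffAt ℝ ∞ (ContinuousLinearMap.inverse (R := ℝ) (M := W) (M₂ := W →L[ℝ] ℝ))
      (restrictedPairing g ι ∘L ι) := (isInvertible_restrictedPairing hg).contDiffAt_map_inverse
  have h3 : ContDiffAt ℝ ∞ (fun p : (V →L[ℝ] V →L[ℝ] ℝ) × V =>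
      (restrictedPairing p.1 ι ∘L ι).inverse) (g, b) :=
    ContDiffAt.comp (f := fun p : (V →L[ℝ] V →L[ℝ] ℝ) × V => restrictedPairing p.1 ι ∘L ι) (g, b)
      h2 (h1.clm_comp contDiffAt_const)
  have h4 := h3.clm_apply (h1.clm_apply contDiffAt_snd)
  exact contDiffAt_snd.sub (ι.contDiff.contDiffAt.comp (g, b) h4)

end NormalPart

section NormalFrame

variable {E : Type*} [NormedAddCommGroup E] [NormedSpace ℝ E]
variable {M : Type*} [EMetricSpace M] [ChartedSpace E M] [IsManifold 𝓘(ℝ, E) ∞ M]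
  [RiemannianBundle (fun x : M => TangentSpace 𝓘(ℝ, E) x)]
  {N : Set M} {Φ : OpenPartialHomeomorph M E} {F : Submodule ℝ E} {x : M}

/-- The Riemannian metric on `T_y M`, in the trivialization that underlies the definition of the
tangent space. -/
def fiberMetric (y : M) : E →ₗ[ℝ] E →ₗ[ℝ] ℝ :=
  innerₗ (TangentSpace 𝓘(ℝ, E) y)

omit [IsManifold 𝓘(ℝ, E) ∞ M] in
lemma fiberMetric_comm (y : M) (u v : E) : fiberMetric y u v = fiberMetric y v u :=
  real_inner_comm (F := TangentSpace 𝓘(ℝ, E) y) v u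

omit [IsManifold 𝓘(ℝ, E) ∞ M] in
lemma fiberMetric_self_eq_zero {y : M} {v : E} (h : fiberMetric y v v = 0) : v = 0 := by
  have h1 : inner ℝ (show TangentSpace 𝓘(ℝ, E) y from v) (show TangentSpace 𝓘(ℝ, E) y from v) = (0 : ℝ) := h
  exact (inner_self_eq_zero (𝕜 := ℝ) (x := (show TangentSpace 𝓘(ℝ, E) y from v))).1 h1

lemma mem_normalSpace_iff' {y : M} {v : TangentSpace 𝓘(ℝ, E) y} :
    v ∈ normalSpace E N y ↔ ∀ w ∈ tangentSpan (E := E) N y, fiberMetric (E := E) y w v = 0 :=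
  Submodule.mem_orthogonal (tangentSpan (E := E) N y) v

variable [FiniteDimensional ℝ E]

/-- The Riemannian metric in the chart `Φ`. -/
def chartMetric (Φ : OpenPartialHomeomorph M E) (ξ : E) : E →L[ℝ] E →L[ℝ] ℝ :=
  ((fiberMetric (Φ.symm ξ)).compl₁₂ (chartDerivSymm Φ ξ).toLinearMap
    (chartDerivSymm Φ ξ).toLinearMap).toContinuousBilinearMap

omit [IsManifold 𝓘(ℝ, E) ∞ M] in
lemma chartMetric_apply (ξ a b : E) : chartMetric Φ ξ a b =
    fiberMetric (Φ.symm ξ) (chartDerivSymm Φ ξ a) (chartDerivSymm Φ ξ b) := rfl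

lemma contDiffOn_chartMetric [IsContMDiffRiemannianBundle 𝓘(ℝ, E) ∞ E (fun x : M => TangentSpace 𝓘(ℝ, E) x)]
    (hΦ : Φ ∈ IsManifold.maximalAtlas 𝓘(ℝ, E) ∞ M) : ContDiffOn ℝ ∞ (chartMetric Φ) Φ.target := by
  rw [contDiffOn_clm_apply]
  intro a
  rw [contDiffOn_clm_apply]
  intro b
  have hs : ∀ a : E, ContMDiffOn 𝓘(ℝ, E) 𝓘(ℝ, E).tangent ∞
      (fun ξ : E => (⟨Φ.symm ξ, chartDerivSymm Φ ξ a⟩ : TangentBundle 𝓘(ℝ, E) M)) Φ.target := by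
    intro a
    have h1 : ContMDiff 𝓘(ℝ, E) 𝓘(ℝ, E × E) ∞ (fun ξ : E => (ξ, a)) :=
      contMDiff_iff_contDiff.2 (by fun_prop)
    exact (contMDiffOn_mk_mfderiv_symm hΦ).comp h1.contMDiffOn fun ξ hξ => ⟨hξ, mem_univ _⟩
  exact contMDiffOn_iff_contDiffOn.1 (ContMDiffOn.inner_bundle
    (E := fun x : M => TangentSpace 𝓘(ℝ, E) x) (b := Φ.symm) (hs a) (hs b))

omit [IsManifold 𝓘(ℝ, E) ∞ M] in
lemma chartMetric_self_eq_zero (hΦ : Φ ∈ IsManifold.maximalAtlas 𝓘(ℝ, E) ∞ M) {ξ : E}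
    (hξ : ξ ∈ Φ.target) {a : E} (ha : chartMetric Φ ξ a a = 0) : a = 0 := by
  rw [chartMetric_apply] at ha
  have h := chartDeriv_chartDerivSymm hΦ hξ a
  rw [fiberMetric_self_eq_zero ha, map_zero] at h
  exact h.symm

omit [IsManifold 𝓘(ℝ, E) ∞ M] in
lemma chartMetric_pos_on (hΦ : Φ ∈ IsManifold.maximalAtlas 𝓘(ℝ, E) ∞ M) {ξ : E}
    (hξ : ξ ∈ Φ.target) (a : F) (ha : chartMetric Φ ξ (F.subtypeL a) (F.subtypeL a) = 0) : a = 0 :=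
  Subtype.ext (chartMetric_self_eq_zero hΦ hξ ha)

/-- In a slice chart, the normal space consists of the vectors that are orthogonal to `F` with respect
to the metric in the chart. -/
lemma IsSliceChart.mem_normalSpace_iff (hΦ : IsSliceChart N Φ F x) {ξ : E} (hξ : ξ ∈ Φ.target)
    (hξF : ξ ∈ F) (b : E) : (show TangentSpace 𝓘(ℝ, E) (Φ.symm ξ) from chartDerivSymm Φ ξ b) ∈
      normalSpace E N (Φ.symm ξ) ↔ ∀ a : F, chartMetric Φ ξ b (F.subtypeL a) = 0 := by
  have hy : Φ.symm ξ ∈ Φ.source := Φ.map_target hξ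
  have hyN : Φ.symm ξ ∈ N := (hΦ.2.2 _ hy).2 (by rwa [Φ.right_inv hξ])
  rw [mem_normalSpace_iff']
  constructor
  · intro h a
    rw [chartMetric_apply, fiberMetric_comm]
    refine h _ ((hΦ.mem_tangentSpan_iff hy hyN _).2 ?_)
    rw [chartDeriv_chartDerivSymm hΦ.1 hξ]
    exact a.2
  · intro h w hw
    have h1 := h ⟨_, (hΦ.mem_tangentSpan_iff hy hyN w).1 hw⟩
    rw [chartMetric_apply, fiberMetric_comm] at h1
    have h2 := chartDerivSymm_chartDeriv hΦ.1 hy w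
    rw [Φ.right_inv hξ] at h2
    rw [Submodule.subtypeL_apply, h2] at h1
    exact h1

/-- The vector `u ∈ T_x^⊥ N`, transported in the chart `Φ` to the point with the coordinate `ξ` and
projected to the normal space there, in the chart. -/
def frameVector (Φ : OpenPartialHomeomorph M E) (F : Submodule ℝ E) (N : Set M) (x : M)
    (ξ : E) (u : normalSpace E N x) : E :=
  normalPart (chartMetric Φ ξ) F.subtypeL (chartDeriv Φ x (u : TangentSpace 𝓘(ℝ, E) x))

/-- The local trivialization of the normal bundle of `N` given by `frameVector`. -/
def normalFrame (Φ : OpenPartialHomeomorph M E) (F : Submodule ℝ E) (N : Set M) (x : M)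
    (ξ : E) (u : normalSpace E N x) : TangentBundle 𝓘(ℝ, E) M :=
  ⟨Φ.symm ξ, chartDerivSymm Φ ξ (frameVector Φ F N x ξ u)⟩

end NormalFrame

end

/-! ### Local trivialization of the normal bundle -/

section

section NormalFrame

variable {E : Type*} [NormedAddCommGroup E] [NormedSpace ℝ E] [FiniteDimensional ℝ E]
variable {M : Type*} [EMetricSpace M] [ChartedSpace E M] [IsManifold 𝓘(ℝ, E) ∞ M]
  [RiemannianBundle (fun x : M => TangentSpace 𝓘(ℝ, E) x)]
  {N : Set M} {Φ : OpenPartialHomeomorph M E} {F : Submodule ℝ E} {x : M}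

instance instFiniteDimensionalTangentSpace (y : M) : FiniteDimensional ℝ (TangentSpace 𝓘(ℝ, E) y) :=
  inferInstanceAs (FiniteDimensional ℝ E)

/-- The normal spaces are complementary to the model `F` of the submanifold. -/
lemma IsSliceChart.finrank_normalSpace (hΦ : IsSliceChart N Φ F x) {y : M} (hy : y ∈ Φ.source)
    (hyN : y ∈ N) : Module.finrank ℝ F + Module.finrank ℝ (normalSpace E N y) = Module.finrank ℝ E := by
  have h1 := Submodule.finrank_add_finrank_orthogonal (tangentSpan (E := E) N y)
  have h2 : Module.finrank ℝ (tangentSpan (E := E) N y) = Module.finrank ℝ F := by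
    have hmem : ∀ v : tangentSpan (E := E) N y, chartDeriv Φ y (v : TangentSpace 𝓘(ℝ, E) y) ∈ F :=
      fun v => (hΦ.mem_tangentSpan_iff hy hyN _).1 v.2
    let L : tangentSpan (E := E) N y →ₗ[ℝ] F :=
      { toFun := fun v => ⟨chartDeriv Φ y (v : TangentSpace 𝓘(ℝ, E) y), hmem v⟩
        map_add' := fun v w => Subtype.ext ((chartDeriv Φ y).map_add _ _)
        map_smul' := fun c v => Subtype.ext ((chartDeriv Φ y).map_smul c _) }
    refine LinearEquiv.finrank_eq (LinearEquiv.ofBijective L ⟨?_, ?_⟩)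
    · intro v w hvw
      have h3 : chartDeriv Φ y (v : TangentSpace 𝓘(ℝ, E) y) = chartDeriv Φ y (w : TangentSpace 𝓘(ℝ, E) y) :=
        congrArg Subtype.val hvw
      have h4 := congrArg (chartDerivSymm Φ (Φ y)) h3
      exact Subtype.ext ((chartDerivSymm_chartDeriv hΦ.1 hy _).symm.trans
        (h4.trans (chartDerivSymm_chartDeriv hΦ.1 hy _)))
    · intro a
      have h5 : chartDeriv Φ y (chartDerivSymm Φ (Φ y) a) = a := by
        have := chartDeriv_chartDerivSymm hΦ.1 (Φ.map_source hy) (a : E)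
        rwa [Φ.left_inv hy] at this
      refine ⟨⟨chartDerivSymm Φ (Φ y) a, (hΦ.mem_tangentSpan_iff hy hyN _).2 ?_⟩, Subtype.ext h5⟩
      rw [h5]
      exact a.2
  have h6 : Module.finrank ℝ (TangentSpace 𝓘(ℝ, E) y) = Module.finrank ℝ E := rfl
  rw [h2, h6] at h1
  exact h1

/-- The inclusion of the normal space in the model space. -/
def normalInclusion (N : Set M) (x : M) : normalSpace E N x →L[ℝ] E :=
  LinearMap.toContinuousLinearMap (show normalSpace E N x →ₗ[ℝ] E from (normalSpace E N x).subtype)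

lemma frameVector_eq (ξ : E) (u : normalSpace E N x) : frameVector Φ F N x ξ u =
    normalPart (chartMetric Φ ξ) F.subtypeL (chartDeriv Φ x (normalInclusion N x u)) := rfl

lemma normalPart_add {V W : Type*} [NormedAddCommGroup V] [NormedSpace ℝ V] [NormedAddCommGroup W]
    [NormedSpace ℝ W] (g : V →L[ℝ] V →L[ℝ] ℝ) (ι : W →L[ℝ] V) (a b : V) :
    normalPart g ι (a + b) = normalPart g ι a + normalPart g ι b := by
  simp only [normalPart, map_add]; abel

lemma normalPart_smul {V W : Type*} [NormedAddCommGroup V] [NormedSpace ℝ V] [NormedAddCommGroup W]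
    [NormedSpace ℝ W] (g : V →L[ℝ] V →L[ℝ] ℝ) (ι : W →L[ℝ] V) (c : ℝ) (b : V) :
    normalPart g ι (c • b) = c • normalPart g ι b := by
  simp only [normalPart, map_smul, smul_sub]

lemma frameVector_smul (ξ : E) (c : ℝ) (u : normalSpace E N x) :
    frameVector Φ F N x ξ (c • u) = c • frameVector Φ F N x ξ u := by
  rw [frameVector_eq, map_smul, map_smul, normalPart_smul, frameVector_eq]

/-- A vector normal to `N` has no component tangent to `N` in a slice chart. -/
lemma IsSliceChart.chartMetric_normal (hΦ : IsSliceChart N Φ F x) (hxN : x ∈ N)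
    (u : normalSpace E N x) (a : F) :
    chartMetric Φ (Φ x) (chartDeriv Φ x (normalInclusion N x u)) (F.subtypeL a) = 0 := by
  have hx := hΦ.2.1
  have hu := mem_normalSpace_iff'.1 u.2 _ ((hΦ.mem_tangentSpan_iff hx hxN
    (chartDerivSymm Φ (Φ x) a)).2 (by
      have h1 := chartDeriv_chartDerivSymm hΦ.1 (Φ.map_source hx) (a : E)
      rw [Φ.left_inv hx] at h1
      rw [h1]; exact a.2))
  rw [chartMetric_apply, chartDerivSymm_chartDeriv hΦ.1 hx, Φ.left_inv hx, fiberMetric_comm]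
  exact hu

/-- The normal frame trivializes the normal bundle in the slice chart. -/
lemma IsSliceChart.exists_normalFrame_equiv (hΦ : IsSliceChart N Φ F x) (hxN : x ∈ N) {ξ : E}
    (hξ : ξ ∈ Φ.target) (hξF : ξ ∈ F) :
    ∃ L : normalSpace E N x ≃L[ℝ] normalSpace E N (Φ.symm ξ), ∀ u,
      ((L u : TangentSpace 𝓘(ℝ, E) (Φ.symm ξ)) : E) = chartDerivSymm Φ ξ (frameVector Φ F N x ξ u) := by
  have hx := hΦ.2.1
  have hy : Φ.symm ξ ∈ Φ.source := Φ.map_target hξ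
  have hyN : Φ.symm ξ ∈ N := (hΦ.2.2 _ hy).2 (by rwa [Φ.right_inv hξ])
  have hmem : ∀ u : normalSpace E N x, (show TangentSpace 𝓘(ℝ, E) (Φ.symm ξ) from
      chartDerivSymm Φ ξ (frameVector Φ F N x ξ u)) ∈ normalSpace E N (Φ.symm ξ) := fun u =>
    (hΦ.mem_normalSpace_iff hξ hξF _).2 (pairing_normalPart (chartMetric_pos_on hΦ.1 hξ) _)
  let L : normalSpace E N x →ₗ[ℝ] normalSpace E N (Φ.symm ξ) :=
    { toFun := fun u => ⟨_, hmem u⟩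
      map_add' := fun u v => Subtype.ext (by
        change chartDerivSymm Φ ξ (frameVector Φ F N x ξ (u + v)) =
          chartDerivSymm Φ ξ (frameVector Φ F N x ξ u) + chartDerivSymm Φ ξ (frameVector Φ F N x ξ v)
        rw [← map_add, frameVector_eq, map_add, map_add, normalPart_add, ← frameVector_eq, ← frameVector_eq])
      map_smul' := fun c u => Subtype.ext (by
        change chartDerivSymm Φ ξ (frameVector Φ F N x ξ (c • u)) =
          c • chartDerivSymm Φ ξ (frameVector Φ F N x ξ u)
        rw [frameVector_smul, map_smul]) }
  have hinj : Function.Injective L := by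
    refine (injective_iff_map_eq_zero _).2 fun u hu => ?_
    have h1 : chartDerivSymm Φ ξ (frameVector Φ F N x ξ u) = 0 := congrArg Subtype.val hu
    have h2 := chartDeriv_chartDerivSymm hΦ.1 hξ (frameVector Φ F N x ξ u)
    rw [h1, map_zero] at h2
    -- the transported vector lies in `F`, hence `u` is both normal and tangent
    rw [frameVector_eq] at h2
    obtain ⟨a, ha⟩ : ∃ a : F, chartDeriv Φ x (normalInclusion N x u) = F.subtypeL a :=
      normalPart_eq_zero h2.symm
    have h3 := hΦ.chartMetric_normal hxN u a
    rw [ha] at h3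
    have h4 := chartMetric_pos_on hΦ.1 (Φ.map_source hx) a h3
    rw [h4, map_zero] at ha
    have h5 := chartDerivSymm_chartDeriv hΦ.1 hx (normalInclusion N x u)
    rw [ha, map_zero] at h5
    exact Subtype.ext h5.symm
  have hfin : Module.finrank ℝ (normalSpace E N x) = Module.finrank ℝ (normalSpace E N (Φ.symm ξ)) := by
    have h1 := hΦ.finrank_normalSpace hx hxN
    have h2 := hΦ.finrank_normalSpace hy hyN
    omega
  exact ⟨(LinearEquiv.ofInjectiveOfFinrankEq L hinj hfin).toContinuousLinearEquiv, fun u => rfl⟩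

/-- At the point `x` itself the normal frame is the identity. -/
lemma IsSliceChart.normalFrame_self (hΦ : IsSliceChart N Φ F x) (hxN : x ∈ N) (u : normalSpace E N x) :
    normalFrame Φ F N x (Φ x) u = ⟨x, (u : TangentSpace 𝓘(ℝ, E) x)⟩ := by
  refine tangentBundle_mk_eq (Φ.left_inv hΦ.2.1) ?_
  rw [frameVector_eq, normalPart_eq_self (hΦ.chartMetric_normal hxN u),
    chartDerivSymm_chartDeriv hΦ.1 hΦ.2.1]
  rfl

lemma normalFrame_smul (ξ : E) (c : ℝ) (u : normalSpace E N x) :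
    normalFrame Φ F N x ξ (c • u) = ⟨Φ.symm ξ, c • (normalFrame Φ F N x ξ u).2⟩ := by
  refine tangentBundle_mk_eq rfl ?_
  rw [frameVector_smul, map_smul]
  rfl

lemma contMDiffAt_normalFrame [IsContMDiffRiemannianBundle 𝓘(ℝ, E) ∞ E (fun x : M => TangentSpace 𝓘(ℝ, E) x)]
    (hΦ : IsSliceChart N Φ F x) {p : F × normalSpace E N x} (hp : (p.1 : E) ∈ Φ.target) :
    ContMDiffAt 𝓘(ℝ, F × normalSpace E N x) 𝓘(ℝ, E).tangent ∞
      (fun p : F × normalSpace E N x => normalFrame Φ F N x p.1 p.2) p := by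
  have h1 : ContDiffAt ℝ ∞ (fun p : F × normalSpace E N x => (p.1 : E)) p :=
    F.subtypeL.contDiff.contDiffAt.comp p contDiffAt_fst
  have h2 : ContDiffAt ℝ ∞ (fun p : F × normalSpace E N x => chartMetric Φ p.1) p :=
    ContDiffAt.comp (g := chartMetric Φ) p
      ((contDiffOn_chartMetric hΦ.1).contDiffAt (Φ.open_target.mem_nhds hp)) h1
  have h3 : ContDiffAt ℝ ∞ (fun p : F × normalSpace E N x => chartDeriv Φ x (normalInclusion N x p.2)) p :=
    ((chartDeriv Φ x).comp (normalInclusion N x)).contDiff.contDiffAt.comp p contDiffAt_snd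
  have h4 : ContDiffAt ℝ ∞ (fun p : F × normalSpace E N x => frameVector Φ F N x p.1 p.2) p :=
    ContDiffAt.comp (f := fun p : F × normalSpace E N x =>
      (chartMetric Φ p.1, chartDeriv Φ x (normalInclusion N x p.2))) p
      (contDiffAt_normalPart (chartMetric_pos_on hΦ.1 hp) _) (h2.prodMk h3)
  have h5 : ContMDiffAt 𝓘(ℝ, F × normalSpace E N x) 𝓘(ℝ, E × E) ∞
      (fun p : F × normalSpace E N x => ((p.1 : E), frameVector Φ F N x p.1 p.2)) p :=
    contMDiffAt_iff_contDiffAt.2 (h1.prodMk h4)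
  exact ContMDiffAt.comp p ((contMDiffOn_mk_mfderiv_symm hΦ.1).contMDiffAt
    ((Φ.open_target.prod isOpen_univ).mem_nhds ⟨hp, mem_univ _⟩)) h5

end NormalFrame

end

/-! ### Local tubes -/

section

section LocalTube

variable {E : Type*} [NormedAddCommGroup E] [NormedSpace ℝ E]
variable {F G : Type*} [NormedAddCommGroup F] [NormedSpace ℝ F] [NormedAddCommGroup G]
  [NormedSpace ℝ G]

/-- In the coordinates `Ψ : F × G → M` near the point `Ψ (ξ₀, 0)`, the sets `𝒯 ε` are the tubes
`{Ψ (ξ, ε η) : η ∈ D ξ}` of the strictly convex profiles `D ξ ⊆ G` around `F × 0`, and `𝒮 ε` are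
their boundaries. -/
structure IsLocalTube {M : Type*} [TopologicalSpace M] [ChartedSpace E M] (𝒯 𝒮 : ℝ → Set M)
    (Ψ : F × G → M) (D : F → Set G) (ξ₀ : F) : Prop where
  contMDiffAt : ContMDiffAt 𝓘(ℝ, F × G) 𝓘(ℝ, E) ∞ Ψ (ξ₀, 0)
  bijective : Function.Bijective (mfderiv 𝓘(ℝ, F × G) 𝓘(ℝ, E) Ψ (ξ₀, 0))
  isOpen : ∀ᶠ ξ in 𝓝 ξ₀, IsOpen (D ξ)
  convex : ∀ᶠ ξ in 𝓝 ξ₀, Convex ℝ (D ξ)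
  zero_mem : 0 ∈ D ξ₀
  isBounded : Bornology.IsBounded (D ξ₀)
  boundary : ∀ η ∈ frontier (D ξ₀), ∃ ρ : F × G → ℝ, ContDiffAt ℝ ∞ ρ (ξ₀, η) ∧
    IsDefiningFunction D ρ (ξ₀, η) ∧ ∀ w : G, fderiv ℝ ρ (ξ₀, η) (0, w) = 0 → w ≠ 0 →
      0 < fderiv ℝ (fderiv ℝ ρ) (ξ₀, η) (0, w) (0, w)
  mem_boundary : ∀ᶠ ξ in 𝓝 ξ₀, ∀ ε : ℝ, ∀ η ∈ frontier (D ξ), Ψ (ξ, ε • η) ∈ 𝒮 ε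
  of_mem : ∃ ε₁ > (0 : ℝ), ∀ᶠ p in 𝓝 (ξ₀, (0 : G)), ∀ ε ∈ Ioo 0 ε₁,
    (Ψ p ∈ 𝒯 ε → ε⁻¹ • p.2 ∈ D p.1) ∧ (Ψ p ∈ 𝒮 ε → ε⁻¹ • p.2 ∈ frontier (D p.1))

lemma hasFDerivAt_fderiv_inr {ρ : F × G → ℝ} {ξ : F} {s : G} (h : ContDiffAt ℝ 2 ρ (ξ, s)) :
    HasFDerivAt (fun u => ρ (ξ, u)) (fderiv ℝ ρ (ξ, s) ∘L .inr ℝ F G) s :=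
  HasFDerivAt.comp s (h.differentiableAt (by norm_num)).hasFDerivAt (hasFDerivAt_prodMk_right ξ s)

lemma fderiv_fderiv_inr {ρ : F × G → ℝ} {ξ : F} {s : G} (h : ContDiffAt ℝ 2 ρ (ξ, s)) (v w : G) :
    fderiv ℝ (fderiv ℝ (fun u => ρ (ξ, u))) s v w = fderiv ℝ (fderiv ℝ ρ) (ξ, s) (0, v) (0, w) := by
  have hin : ContinuousAt (fun u : G => (ξ, u)) s := by fun_prop
  have h1 : fderiv ℝ (fun u => ρ (ξ, u)) =ᶠ[𝓝 s] fun u => fderiv ℝ ρ (ξ, u) ∘L .inr ℝ F G := by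
    filter_upwards [hin.eventually (h.eventually (by simp))] with u hu
    exact (hasFDerivAt_fderiv_inr hu).fderiv
  rw [h1.fderiv_eq]
  have h2 : DifferentiableAt ℝ (fderiv ℝ ρ) (ξ, s) :=
    (h.fderiv_right (m := 1) (by norm_num)).differentiableAt one_ne_zero
  have h3 : HasFDerivAt (fun u => fderiv ℝ ρ (ξ, u)) (fderiv ℝ (fderiv ℝ ρ) (ξ, s) ∘L .inr ℝ F G) s :=
    HasFDerivAt.comp s h2.hasFDerivAt (hasFDerivAt_prodMk_right ξ s)
  have h4 := ((ContinuousLinearMap.compL ℝ G (F × G) ℝ).flip (.inr ℝ F G)).hasFDerivAt.comp s h3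
  have h5 := h4.fderiv
  exact DFunLike.congr_fun (DFunLike.congr_fun h5 v) w

variable {M : Type*} [TopologicalSpace M] [ChartedSpace E M] [IsManifold 𝓘(ℝ, E) ∞ M]

/-- The inverse function theorem for parametrizations of a manifold. -/
lemma exists_local_inverse {Y : Type*} [NormedAddCommGroup Y] [NormedSpace ℝ Y] [FiniteDimensional ℝ Y]
    {Ψ : Y → M} {b : Y} (hΨ : ContMDiffAt 𝓘(ℝ, Y) 𝓘(ℝ, E) ∞ Ψ b)
    (hbij : Function.Bijective (mfderiv 𝓘(ℝ, Y) 𝓘(ℝ, E) Ψ b)) :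
    ∃ Θ : M → Y, ContMDiffAt 𝓘(ℝ, E) 𝓘(ℝ, Y) ∞ Θ (Ψ b) ∧ (∀ᶠ y in 𝓝 b, Θ (Ψ y) = y) ∧
      ∀ᶠ q in 𝓝 (Ψ b), Ψ (Θ q) = q := by
  have : CompleteSpace Y := FiniteDimensional.complete ℝ Y
  set φ := extChartAt 𝓘(ℝ, E) (Ψ b) with hφ
  have hsrc : Ψ b ∈ φ.source := mem_extChartAt_source _
  have hφd : ContMDiffAt 𝓘(ℝ, E) 𝓘(ℝ, E) ∞ φ (Ψ b) := contMDiffAt_extChartAt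
  have hc : ContDiffAt ℝ ∞ (fun y => φ (Ψ y)) b := contMDiffAt_iff_contDiffAt.1 (hφd.comp b hΨ)
  set A := fderiv ℝ (fun y => φ (Ψ y)) b
  have hA : ∀ v, A v = mfderiv 𝓘(ℝ, Y) 𝓘(ℝ, E) Ψ b v := by
    intro v
    have h1 := fderiv_extChartAt_comp (hΨ.mdifferentiableAt (by simp)) hsrc v
    rw [mfderiv_extChartAt_self] at h1
    exact h1
  have hAbij : Function.Bijective (A : Y →ₗ[ℝ] E) := by
    have h1 : (A : Y → E) = mfderiv 𝓘(ℝ, Y) 𝓘(ℝ, E) Ψ b := funext hA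
    change Function.Bijective (A : Y → E)
    rw [h1]; exact hbij
  have hAe : FiniteDimensional ℝ E := (LinearEquiv.ofBijective (A : Y →ₗ[ℝ] E) hAbij).finiteDimensional
  let e : Y ≃L[ℝ] E := (LinearEquiv.ofBijective (A : Y →ₗ[ℝ] E) hAbij).toContinuousLinearEquiv
  have hAd : HasFDerivAt (fun y => φ (Ψ y)) (e : Y →L[ℝ] E) b :=
    (hc.differentiableAt (by simp)).hasFDerivAt
  set P := hc.toOpenPartialHomeomorph (fun y => φ (Ψ y)) hAd (by simp)
  have hPb : b ∈ P.source := hc.mem_toOpenPartialHomeomorph_source hAd (by simp)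
  have hPc : ∀ y, P y = φ (Ψ y) := fun y => rfl
  refine ⟨fun q => P.symm (φ q), ?_, ?_, ?_⟩
  · have h1 : ContDiffAt ℝ ∞ P.symm (φ (Ψ b)) := hc.to_localInverse hAd (by simp)
    exact ContMDiffAt.comp (Ψ b) (contMDiffAt_iff_contDiffAt.2 h1) hφd
  · filter_upwards [P.open_source.mem_nhds hPb] with y hy
    rw [← hPc, P.left_inv hy]
  · have h1 : ∀ᶠ q in 𝓝 (Ψ b), φ q ∈ P.target :=
      (continuousAt_extChartAt (I := 𝓘(ℝ, E)) (Ψ b)).eventually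
        (P.open_target.mem_nhds (by rw [← hφ, ← hPc]; exact P.map_source hPb))
    have h2 : ContinuousAt (fun q => Ψ (P.symm (φ q))) (Ψ b) := by
      have h3 : ContinuousAt (fun q => P.symm (φ q)) (Ψ b) :=
        ContinuousAt.comp (g := P.symm) (P.continuousAt_symm (by rw [← hPc]; exact P.map_source hPb))
          (continuousAt_extChartAt (I := 𝓘(ℝ, E)) (Ψ b))
      refine ContinuousAt.comp (g := Ψ) ?_ h3
      rw [show P.symm (φ (Ψ b)) = b by rw [← hPc, P.left_inv hPb]]
      exact hΨ.continuousAt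
    have h4 : ∀ᶠ q in 𝓝 (Ψ b), Ψ (P.symm (φ q)) ∈ φ.source :=
      h2.eventually ((isOpen_extChartAt_source (I := 𝓘(ℝ, E)) (Ψ b)).mem_nhds (by
        change Ψ (P.symm (φ (Ψ b))) ∈ φ.source
        rw [show P.symm (φ (Ψ b)) = b by rw [← hPc, P.left_inv hPb]]; exact hsrc))
    filter_upwards [h1, h4, (isOpen_extChartAt_source (I := 𝓘(ℝ, E)) (Ψ b)).mem_nhds hsrc]
      with q hq1 hq2 hq3
    refine φ.injOn hq2 hq3 ?_
    rw [← hPc, P.right_inv hq1]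

end LocalTube

end

/-! ### Profiles in a slice chart and the size of thin tubes -/

section

section ChartProfile

variable {E : Type*} [NormedAddCommGroup E] [NormedSpace ℝ E] [FiniteDimensional ℝ E]
variable {M : Type*} [EMetricSpace M] [ChartedSpace E M] [IsManifold 𝓘(ℝ, E) ∞ M]
  [RiemannianBundle (fun x : M => TangentSpace 𝓘(ℝ, E) x)]
  {N : Set M} {Φ : OpenPartialHomeomorph M E} {F : Submodule ℝ E} {x : M}
  {B : ∀ x : M, Set (normalSpace E N x)}

/-- The union of the sets `B y` in the tangent bundle. -/
def profileSet (B : ∀ x : M, Set (normalSpace E N x)) : Set (TangentBundle 𝓘(ℝ, E) M) :=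
  {y | ∃ h : y.2 ∈ normalSpace E N y.proj, (⟨y.2, h⟩ : normalSpace E N y.proj) ∈ B y.proj}

/-- The set `B y`, where `y` has the coordinate `ξ`, in the local trivialization of the normal
bundle. -/
def chartProfile (Φ : OpenPartialHomeomorph M E) (F : Submodule ℝ E)
    (B : ∀ x : M, Set (normalSpace E N x)) (x : M) (ξ : E) : Set (normalSpace E N x) :=
  {u | normalFrame Φ F N x ξ u ∈ profileSet B}

omit [FiniteDimensional ℝ E] in
lemma mk_mem_profileSet {y : M} (u : normalSpace E N y) :
    (⟨y, (u : TangentSpace 𝓘(ℝ, E) y)⟩ : TangentBundle 𝓘(ℝ, E) M) ∈ profileSet B ↔ u ∈ B y :=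
  ⟨fun h => h.2, fun h => ⟨u.2, h⟩⟩

/-- The profile in the local trivialization is the preimage of the profile under a linear
isomorphism of normal spaces. The base point `y` is kept apart from `Φ.symm ξ`, because the
types of the vectors depend on it. -/
lemma IsSliceChart.exists_frame (hΦ : IsSliceChart N Φ F x) (hxN : x ∈ N) {ξ : E}
    (hξ : ξ ∈ Φ.target) (hξF : ξ ∈ F) {y : M} (hy : Φ.symm ξ = y)
    (B : ∀ x : M, Set (normalSpace E N x)) :
    ∃ L : normalSpace E N x ≃L[ℝ] normalSpace E N y,
      (∀ (c : ℝ) (u : normalSpace E N x), normalFrame Φ F N x ξ (c • u) =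
        ⟨y, c • (L u : TangentSpace 𝓘(ℝ, E) y)⟩) ∧ chartProfile Φ F B x ξ = L ⁻¹' B y := by
  subst hy
  obtain ⟨L, hL⟩ := hΦ.exists_normalFrame_equiv hxN hξ hξF
  have h1 : ∀ (c : ℝ) (u : normalSpace E N x), normalFrame Φ F N x ξ (c • u) =
      ⟨Φ.symm ξ, c • (L u : TangentSpace 𝓘(ℝ, E) (Φ.symm ξ))⟩ := by
    intro c u
    rw [normalFrame_smul]
    refine tangentBundle_mk_eq rfl (congrArg (fun v : E => c • v) (hL u).symm)
  refine ⟨L, h1, ?_⟩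
  ext u
  have h2 := h1 1 u
  rw [one_smul, one_smul] at h2
  rw [chartProfile, mem_ofPred_eq, h2, mk_mem_profileSet, mem_preimage]

lemma IsSliceChart.chartProfile_self (hΦ : IsSliceChart N Φ F x) (hxN : x ∈ N) :
    chartProfile Φ F B x (Φ x) = B x := by
  ext u
  rw [chartProfile, mem_ofPred_eq, hΦ.normalFrame_self hxN, mk_mem_profileSet]

variable [IsContMDiffRiemannianBundle 𝓘(ℝ, E) ∞ E (fun x : M => TangentSpace 𝓘(ℝ, E) x)]

/-- In a slice chart the profiles are given by smooth defining functions. -/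
lemma IsConvexProfile.exists_definingFunction (hB : IsConvexProfile N B) (hΦ : IsSliceChart N Φ F x)
    (hxN : x ∈ N) {ξ₀ : F} (hξ₀ : (ξ₀ : E) = Φ x) {s : normalSpace E N x} (hs : s ∈ frontier (B x)) :
    ∃ ρ : F × normalSpace E N x → ℝ, ContDiffAt ℝ ∞ ρ (ξ₀, s) ∧
      IsDefiningFunction (fun ξ : F => chartProfile Φ F B x ξ) ρ (ξ₀, s) ∧
      ∀ w : normalSpace E N x, fderiv ℝ ρ (ξ₀, s) (0, w) = 0 → w ≠ 0 →
        0 < fderiv ℝ (fderiv ℝ ρ) (ξ₀, s) (0, w) (0, w) := by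
  obtain ⟨ρ, hρ, hmem, hne, hpos⟩ := hB.boundary x hxN s hs
  have hself : ∀ u, normalFrame Φ F N x ξ₀ u = ⟨x, (u : TangentSpace 𝓘(ℝ, E) x)⟩ := fun u => by
    rw [hξ₀, hΦ.normalFrame_self hxN]
  have htar : (ξ₀ : E) ∈ Φ.target := by rw [hξ₀]; exact Φ.map_source hΦ.2.1
  have hframe := contMDiffAt_normalFrame (p := (ξ₀, s)) hΦ htar
  set ρ' : F × normalSpace E N x → ℝ := fun p => ρ (normalFrame Φ F N x p.1 p.2) with hρ'
  have hd : ContDiffAt ℝ ∞ ρ' (ξ₀, s) := by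
    refine contMDiffAt_iff_contDiffAt.1 (ContMDiffAt.comp (ξ₀, s) (g := ρ) ?_ hframe)
    change ContMDiffAt _ _ _ ρ (normalFrame Φ F N x ξ₀ s)
    rw [hself]; exact hρ
  have hd2 : ContDiffAt ℝ 2 ρ' (ξ₀, s) := contDiffAt_infty.1 hd 2
  have hline : (fun u => ρ' (ξ₀, u)) =
      fun u : normalSpace E N x => ρ ⟨x, (u : TangentSpace 𝓘(ℝ, E) x)⟩ := by
    funext u; simp only [hρ', hself]
  have hfd : ∀ w, fderiv ℝ ρ' (ξ₀, s) (0, w) =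
      fderiv ℝ (fun u : normalSpace E N x => ρ ⟨x, (u : TangentSpace 𝓘(ℝ, E) x)⟩) s w := by
    intro w
    rw [← hline, (hasFDerivAt_fderiv_inr hd2).fderiv]
    rfl
  refine ⟨ρ', hd, ⟨contDiffAt_infty.1 hd 1, ?_, ?_⟩, ?_⟩
  · have h1 : Tendsto (fun p : F × normalSpace E N x => normalFrame Φ F N x p.1 p.2) (𝓝 (ξ₀, s))
        (𝓝 ⟨x, (s : TangentSpace 𝓘(ℝ, E) x)⟩) := by
      have := hframe.continuousAt.tendsto
      rwa [hself] at this
    have h2 : ∀ᶠ p in 𝓝 (ξ₀, s), (p.1 : E) ∈ Φ.target := by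
      have h3 : ContinuousAt (fun p : F × normalSpace E N x => (p.1 : E)) (ξ₀, s) := by fun_prop
      exact h3.eventually (Φ.open_target.mem_nhds htar)
    filter_upwards [h1.eventually hmem, h2] with p hp hpt
    obtain ⟨L, hL, -⟩ := hΦ.exists_frame hxN hpt p.1.2 rfl B
    have hyN : Φ.symm (p.1 : E) ∈ N :=
      (hΦ.2.2 _ (Φ.map_target hpt)).2 (by rw [Φ.right_inv hpt]; exact p.1.2)
    have h4 : normalFrame Φ F N x p.1 p.2 =
        ⟨Φ.symm (p.1 : E), (L p.2 : TangentSpace 𝓘(ℝ, E) (Φ.symm (p.1 : E)))⟩ := by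
      have := hL 1 p.2
      rwa [one_smul, one_smul] at this
    change normalFrame Φ F N x p.1 p.2 ∈ profileSet B ↔ ρ (normalFrame Φ F N x p.1 p.2) < 0
    rw [h4] at hp ⊢
    rw [mk_mem_profileSet]
    exact hp hyN (L p.2).2
  · by_contra! hcon
    exact hne (ContinuousLinearMap.ext fun w => by rw [← hfd, hcon]; rfl)
  · intro w hw hw0
    rw [hfd] at hw
    have h1 := hpos w hw hw0
    rw [← fderiv_fderiv_inr hd2, hline]
    exact h1

omit [IsContMDiffRiemannianBundle 𝓘(ℝ, E) ∞ E (fun x : M => TangentSpace 𝓘(ℝ, E) x)] in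
lemma IsConvexProfile.eventually_chartProfile (hB : IsConvexProfile N B) (hΦ : IsSliceChart N Φ F x)
    (hxN : x ∈ N) {ξ₀ : F} (hξ₀ : (ξ₀ : E) = Φ x) :
    ∀ᶠ ξ : F in 𝓝 ξ₀, IsOpen (chartProfile Φ F B x ξ) ∧ Convex ℝ (chartProfile Φ F B x ξ) ∧
      0 ∈ chartProfile Φ F B x ξ := by
  have htar : (ξ₀ : E) ∈ Φ.target := by rw [hξ₀]; exact Φ.map_source hΦ.2.1
  have hc : ContinuousAt (fun ξ : F => (ξ : E)) ξ₀ := by fun_prop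
  filter_upwards [hc.eventually (Φ.open_target.mem_nhds htar)] with ξ hξ
  obtain ⟨L, -, hLB⟩ := hΦ.exists_frame hxN hξ ξ.2 rfl B
  have hyN : Φ.symm (ξ : E) ∈ N :=
    (hΦ.2.2 _ (Φ.map_target hξ)).2 (by rw [Φ.right_inv hξ]; exact ξ.2)
  rw [hLB]
  refine ⟨(hB.isOpen _ hyN).preimage L.continuous, ?_, ?_⟩
  · exact (hB.convex _ hyN).linear_preimage L.toLinearEquiv.toLinearMap
  · rw [mem_preimage, map_zero]; exact hB.zero_mem _ hyN

lemma IsConvexProfile.exists_chartProfile_bounded (hB : IsConvexProfile N B)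
    (hΦ : IsSliceChart N Φ F x) (hxN : x ∈ N) {ξ₀ : F} (hξ₀ : (ξ₀ : E) = Φ x) :
    ∃ R : ℝ, ∀ᶠ ξ : F in 𝓝 ξ₀, ∀ v ∈ closure (chartProfile Φ F B x ξ), ‖v‖ ≤ R := by
  have hself : chartProfile Φ F B x ξ₀ = B x := by rw [hξ₀, hΦ.chartProfile_self hxN]
  have hev := hB.eventually_chartProfile hΦ hxN hξ₀
  refine exists_eventually_bounded (B := fun ξ : F => chartProfile Φ F B x ξ) (ξ₀ := ξ₀) ?_ ?_
    (hev.mono fun _ h => h.2.1) (hev.mono fun _ h => h.2.2) ?_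
  · exact hev.self_of_nhds.1
  · simp only [hself]; exact hB.bounded x hxN
  · intro s hs
    simp only [hself] at hs
    obtain ⟨ρ, -, h, -⟩ := hB.exists_definingFunction hΦ hxN hξ₀ hs
    exact ⟨ρ, h⟩

variable {f : TangentBundle 𝓘(ℝ, E) M → M}

/-- The parametrization of a neighbourhood of `x` by the normal bundle. -/
def tubeMap (Φ : OpenPartialHomeomorph M E) (F : Submodule ℝ E) (N : Set M) (x : M)
    (f : TangentBundle 𝓘(ℝ, E) M → M) (p : F × normalSpace E N x) : M :=
  f (normalFrame Φ F N x p.1 p.2)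

omit [IsContMDiffRiemannianBundle 𝓘(ℝ, E) ∞ E (fun x : M => TangentSpace 𝓘(ℝ, E) x)] in
/-- The zero section is mapped to the submanifold. -/
lemma IsTubularMap.tubeMap_zero (hf : IsTubularMap N f) (hΦ : IsSliceChart N Φ F x) (hxN : x ∈ N)
    {ξ : F} (hξ : (ξ : E) ∈ Φ.target) : tubeMap Φ F N x f (ξ, 0) = Φ.symm ξ := by
  have hyN : Φ.symm (ξ : E) ∈ N :=
    (hΦ.2.2 _ (Φ.map_target hξ)).2 (by rw [Φ.right_inv hξ]; exact ξ.2)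
  obtain ⟨L, hL, -⟩ := hΦ.exists_frame (B := fun _ => univ) hxN hξ ξ.2 rfl
  have h1 := hL 0 0
  rw [zero_smul, zero_smul] at h1
  rw [tubeMap, h1]
  exact hf.2.1 _ hyN

lemma IsTubularMap.contMDiffAt_tubeMap (hf : IsTubularMap N f) (hΦ : IsSliceChart N Φ F x)
    (hxN : x ∈ N) {ξ₀ : F} (hξ₀ : (ξ₀ : E) = Φ x) :
    ContMDiffAt 𝓘(ℝ, F × normalSpace E N x) 𝓘(ℝ, E) ∞ (tubeMap Φ F N x f) (ξ₀, 0) := by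
  obtain ⟨V, hV, hxV, hfV⟩ := hf.1
  have htar : (ξ₀ : E) ∈ Φ.target := by rw [hξ₀]; exact Φ.map_source hΦ.2.1
  refine ContMDiffAt.comp (ξ₀, (0 : normalSpace E N x)) (g := f) ?_
    (contMDiffAt_normalFrame (p := (ξ₀, 0)) hΦ htar)
  refine hfV.contMDiffAt (hV.mem_nhds ?_)
  change normalFrame Φ F N x ξ₀ 0 ∈ V
  rw [hξ₀, hΦ.normalFrame_self hxN]
  exact hxV x hxN

/-- Thin tubes around a point stay near this point. -/
lemma IsTubularMap.exists_small_local (hf : IsTubularMap N f) (hB : IsConvexProfile N B)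
    (hΦ : IsSliceChart N Φ F x) (hxN : x ∈ N) {O : Set M} (hO : O ∈ 𝓝 x) :
    ∃ ε₁ > (0 : ℝ), ∀ᶠ y in 𝓝[N] x, ∀ ε ∈ Ioo 0 ε₁, ∀ v ∈ closure (B y),
      f ⟨y, ε • (v : TangentSpace 𝓘(ℝ, E) y)⟩ ∈ O := by
  have hx := hΦ.2.1
  set ξ₀ : F := ⟨Φ x, (hΦ.2.2 x hx).1 hxN⟩ with hξ₀
  have hΨ := (hf.contMDiffAt_tubeMap hΦ hxN (ξ₀ := ξ₀) rfl).continuousAt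
  obtain ⟨R, hR⟩ := hB.exists_chartProfile_bounded hΦ hxN (ξ₀ := ξ₀) rfl
  have hO' : O ∈ 𝓝 (tubeMap Φ F N x f (ξ₀, 0)) := by
    rw [hf.tubeMap_zero hΦ hxN (Φ.map_source hx), Φ.left_inv hx]; exact hO
  obtain ⟨r, hr, hball⟩ := Metric.mem_nhds_iff.1 (hΨ.preimage_mem_nhds hO')
  obtain ⟨r', hr', hball'⟩ := Metric.mem_nhds_iff.1 hR
  refine ⟨r / (|R| + 1), by positivity, ?_⟩
  have hΦc : ∀ᶠ y in 𝓝 x, y ∈ Φ.source ∧ dist (Φ y) (Φ x) < min r r' :=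
    Eventually.and (Φ.open_source.mem_nhds hx)
      ((Φ.continuousAt hx).eventually (Metric.ball_mem_nhds _ (lt_min hr hr')))
  filter_upwards [nhdsWithin_le_nhds hΦc, self_mem_nhdsWithin] with y hy hyN ε hε v hv
  set ξ : F := ⟨Φ y, (hΦ.2.2 y hy.1).1 hyN⟩ with hξ
  obtain ⟨L, hL, hLB⟩ := hΦ.exists_frame hxN (Φ.map_source hy.1) ξ.2 (Φ.left_inv hy.1) B
  obtain ⟨u, rfl⟩ := L.surjective v
  have hu : u ∈ closure (chartProfile Φ F B x ξ) := by
    have h1 : L ⁻¹' closure (B y) = closure (L ⁻¹' B y) := L.toHomeomorph.preimage_closure (B y)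
    change u ∈ closure (chartProfile Φ F B x (Φ y))
    rw [hLB, ← h1]; exact hv
  have hdist : dist ξ ξ₀ < min r r' := hy.2
  have hnorm : ‖u‖ ≤ R := hball' (hdist.trans_le (min_le_right _ _)) u hu
  rw [← hL]
  refine hball (show (ξ, ε • u) ∈ Metric.ball (ξ₀, (0 : normalSpace E N x)) r from ?_)
  rw [Metric.mem_ball, Prod.dist_eq, max_lt_iff]
  refine ⟨hdist.trans_le (min_le_left _ _), ?_⟩
  change dist (ε • u) 0 < r
  rw [dist_zero_right, norm_smul, Real.norm_of_nonneg hε.1.le]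
  have h2 : ε * (|R| + 1) < r := (lt_div_iff₀ (by positivity)).1 hε.2
  nlinarith [le_abs_self R, hε.1]

/-- Thin tubes around a compact set stay in a given neighbourhood of it. -/
lemma IsTubularMap.exists_small (hf : IsTubularMap N f) (hB : IsConvexProfile N B)
    (hN : IsDegenerateScatterer E N) {C : Set M} (hC : IsCompact C) (hCN : C ⊆ N) {O : Set M}
    (hO : IsOpen O) (hCO : C ⊆ O) :
    ∃ ε₁ > (0 : ℝ), ∀ y ∈ C, ∀ ε ∈ Ioo 0 ε₁, ∀ v ∈ closure (B y),
      f ⟨y, ε • (v : TangentSpace 𝓘(ℝ, E) y)⟩ ∈ O := by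
  refine hC.induction_on (p := fun S => ∃ ε₁ > (0 : ℝ), ∀ y ∈ S, ∀ ε ∈ Ioo 0 ε₁,
    ∀ v ∈ closure (B y), f ⟨y, ε • (v : TangentSpace 𝓘(ℝ, E) y)⟩ ∈ O) ?_ ?_ ?_ ?_
  · exact ⟨1, one_pos, fun y hy => hy.elim⟩
  · rintro s t hst ⟨ε₁, h1, h2⟩
    exact ⟨ε₁, h1, fun y hy => h2 y (hst hy)⟩
  · rintro s t ⟨ε₁, h1, h2⟩ ⟨ε₂, h3, h4⟩
    refine ⟨min ε₁ ε₂, lt_min h1 h3, fun y hy ε hε => ?_⟩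
    rcases hy with hy | hy
    · exact h2 y hy ε ⟨hε.1, hε.2.trans_le (min_le_left _ _)⟩
    · exact h4 y hy ε ⟨hε.1, hε.2.trans_le (min_le_right _ _)⟩
  · intro x hx
    obtain ⟨Φ, F, hΦ, -⟩ := hN x (hCN hx)
    obtain ⟨ε₁, h1, h2⟩ := hf.exists_small_local hB hΦ (hCN hx) (hO.mem_nhds (hCO hx))
    exact ⟨_, nhdsWithin_mono x hCN h2, ε₁, h1, fun y hy => hy⟩

/-- Away from the scatterer there are no points of the thin tubes. -/
lemma IsTubularMap.exists_avoid (hf : IsTubularMap N f) (hB : IsConvexProfile N B)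
    (hN : IsDegenerateScatterer E N) {C : Set M} (hC : IsCompact C) (hCN : C ⊆ N) {q : M}
    (hq : q ∉ C) :
    ∃ O ∈ 𝓝 q, ∃ ε₁ > (0 : ℝ), ∀ y ∈ O, ∀ ε ∈ Ioo 0 ε₁,
      y ∉ tube C f B ε ∧ y ∉ tubeBoundary C f B ε := by
  obtain ⟨O, O', hO, hO', hqO, hCO, hdis⟩ :=
    SeparatedNhds.of_isCompact_isCompact isCompact_singleton hC (disjoint_singleton_left.2 hq)
  obtain ⟨ε₁, h1, h2⟩ := hf.exists_small hB hN hC hCN hO' hCO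
  refine ⟨O, hO.mem_nhds (hqO rfl), ε₁, h1, fun y hy ε hε => ⟨?_, ?_⟩⟩
  · rintro ⟨y', hy', u, hu, rfl⟩
    exact disjoint_left.1 hdis hy (h2 y' hy' ε hε u (subset_closure hu))
  · rintro ⟨y', hy', u, hu, rfl⟩
    exact disjoint_left.1 hdis hy (h2 y' hy' ε hε u (frontier_subset_closure hu))

end ChartProfile

end

/-! ### Tubular maps as local coordinates -/

section

section TubeMap

variable {E : Type*} [NormedAddCommGroup E] [NormedSpace ℝ E]

lemma eq_of_tangentBundle_mk_eq {M : Type*} [TopologicalSpace M] [ChartedSpace E M] {x y : M}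
    {u v : E} (h : (⟨x, (show TangentSpace 𝓘(ℝ, E) x from u)⟩ : TangentBundle 𝓘(ℝ, E) M) =
      ⟨y, (show TangentSpace 𝓘(ℝ, E) y from v)⟩) : u = v := by
  cases h; rfl

/-- If the section `F × 0` is mapped to `C`, then its tangent vectors are tangent to `C`. -/
lemma mfderiv_mem_tangentSpan {M : Type*} [TopologicalSpace M] [ChartedSpace E M]
    [IsManifold 𝓘(ℝ, E) ∞ M] {F G : Type*} [NormedAddCommGroup F] [NormedSpace ℝ F]
    [NormedAddCommGroup G] [NormedSpace ℝ G] {Ψ : F × G → M} {ξ₀ : F}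
    (hΨ : MDifferentiableAt 𝓘(ℝ, F × G) 𝓘(ℝ, E) Ψ (ξ₀, 0)) {C : Set M}
    (hC : ∀ᶠ ξ in 𝓝 ξ₀, Ψ (ξ, 0) ∈ C) (a : F) :
    mfderiv 𝓘(ℝ, F × G) 𝓘(ℝ, E) Ψ (ξ₀, 0) ((a, 0) : F × G) ∈
      tangentSpan (E := E) C (Ψ (ξ₀, 0)) := by
  have hline : HasDerivAt (fun s : ℝ => (ξ₀ + s • a, (0 : G))) (a, 0) 0 := by
    have h1 : HasDerivAt (fun s : ℝ => ξ₀ + s • a) ((1 : ℝ) • a) 0 :=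
      ((hasDerivAt_id (0 : ℝ)).smul_const a).const_add ξ₀
    rw [one_smul] at h1
    exact h1.prodMk (hasDerivAt_const _ _)
  have h0 : (ξ₀ + (0 : ℝ) • a, (0 : G)) = (ξ₀, 0) := by simp
  have hΨ' : HasMFDerivAt 𝓘(ℝ, F × G) 𝓘(ℝ, E) Ψ (ξ₀ + (0 : ℝ) • a, (0 : G))
      (mfderiv 𝓘(ℝ, F × G) 𝓘(ℝ, E) Ψ (ξ₀, 0)) := by
    rw [h0]; exact hΨ.hasMFDerivAt
  have hcomp : HasMFDerivAt 𝓘(ℝ, ℝ) 𝓘(ℝ, E) (fun s : ℝ => Ψ (ξ₀ + s • a, 0)) 0 _ :=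
    HasMFDerivAt.comp (0 : ℝ) (g := Ψ) (f := fun s : ℝ => (ξ₀ + s • a, (0 : G))) hΨ'
      hline.hasFDerivAt.hasMFDerivAt
  refine Submodule.subset_span ⟨fun s : ℝ => Ψ (ξ₀ + s • a, 0), hcomp.mdifferentiableAt, ?_, ?_⟩
  · have h1 : Tendsto (fun s : ℝ => ξ₀ + s • a) (𝓝 0) (𝓝 ξ₀) := by
      have : Continuous (fun s : ℝ => ξ₀ + s • a) := by fun_prop
      simpa using this.tendsto 0
    exact h1.eventually hC
  · refine tangentBundle_mk_eq (by simp) ?_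
    rw [hcomp.mfderiv]
    change (mfderiv 𝓘(ℝ, F × G) 𝓘(ℝ, E) Ψ (ξ₀, 0)) ((1 : ℝ) • ((a, 0) : F × G)) = _
    rw [one_smul]

end TubeMap

section LocalTube

variable {E : Type*} [NormedAddCommGroup E] [NormedSpace ℝ E] [FiniteDimensional ℝ E]
variable {M : Type*} [EMetricSpace M] [ChartedSpace E M] [IsManifold 𝓘(ℝ, E) ∞ M]
  [RiemannianBundle (fun x : M => TangentSpace 𝓘(ℝ, E) x)]
  [IsContMDiffRiemannianBundle 𝓘(ℝ, E) ∞ E (fun x : M => TangentSpace 𝓘(ℝ, E) x)]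
  {N : Set M} {Φ : OpenPartialHomeomorph M E} {F : Submodule ℝ E} {x : M}
  {B : ∀ x : M, Set (normalSpace E N x)} {f : TangentBundle 𝓘(ℝ, E) M → M}

/-- At the zero section the derivative of the parametrization is the identification of
`T_x N ⊕ T_x^⊥ N` with `T_x M`. -/
lemma IsTubularMap.mfderiv_tubeMap (hf : IsTubularMap N f) (hΦ : IsSliceChart N Φ F x)
    (hxN : x ∈ N) {ξ₀ : F} (hξ₀ : (ξ₀ : E) = Φ x) (a : F) (w : normalSpace E N x) :
    (show E from mfderiv 𝓘(ℝ, F × normalSpace E N x) 𝓘(ℝ, E) (tubeMap Φ F N x f) (ξ₀, 0)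
      ((a, w) : F × normalSpace E N x)) = chartDerivSymm Φ (Φ x) a + normalInclusion N x w := by
  have hx := hΦ.2.1
  have htar : (ξ₀ : E) ∈ Φ.target := by rw [hξ₀]; exact Φ.map_source hx
  have hΨ : HasMFDerivAt 𝓘(ℝ, F × normalSpace E N x) 𝓘(ℝ, E) (tubeMap Φ F N x f) (ξ₀, 0) _ :=
    ((hf.contMDiffAt_tubeMap hΦ hxN hξ₀).mdifferentiableAt (by simp)).hasMFDerivAt
  set A : F × normalSpace E N x →L[ℝ] E :=
    mfderiv 𝓘(ℝ, F × normalSpace E N x) 𝓘(ℝ, E) (tubeMap Φ F N x f) (ξ₀, 0) with hA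
  change A (a, w) = _
  have h1 : A (a, 0) = chartDerivSymm Φ (Φ x) a := by
    have e1 : HasMFDerivAt 𝓘(ℝ, F) 𝓘(ℝ, E) (fun ξ : F => tubeMap Φ F N x f (ξ, 0)) ξ₀
        (A ∘L .inl ℝ F (normalSpace E N x)) :=
      HasMFDerivAt.comp ξ₀ (g := tubeMap Φ F N x f) (f := fun ξ : F => (ξ, (0 : normalSpace E N x)))
        hΨ (hasFDerivAt_prodMk_left ξ₀ (0 : normalSpace E N x)).hasMFDerivAt
    have e2 : HasMFDerivAt 𝓘(ℝ, F) 𝓘(ℝ, E) (fun ξ : F => Φ.symm (ξ : E)) ξ₀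
        (show F →L[ℝ] E from (chartDerivSymm Φ (Φ x)).comp F.subtypeL) := by
      rw [← hξ₀]
      have h1 : HasMFDerivAt 𝓘(ℝ, E) 𝓘(ℝ, E) Φ.symm (ξ₀ : E)
          (show E →L[ℝ] E from chartDerivSymm Φ ξ₀) :=
        ((mdifferentiable_of_mem_maximalAtlas hΦ.1).mdifferentiableAt_symm htar).hasMFDerivAt
      have h2 : HasMFDerivAt 𝓘(ℝ, F) 𝓘(ℝ, E) (fun ξ : F => (ξ : E)) ξ₀ F.subtypeL :=
        F.subtypeL.hasFDerivAt.hasMFDerivAt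
      exact h1.comp ξ₀ h2
    have e3 : (fun ξ : F => tubeMap Φ F N x f (ξ, 0)) =ᶠ[𝓝 ξ₀] fun ξ : F => Φ.symm (ξ : E) := by
      have hc : ContinuousAt (fun ξ : F => (ξ : E)) ξ₀ := by fun_prop
      filter_upwards [hc.eventually (Φ.open_target.mem_nhds htar)] with ξ hξ
      exact hf.tubeMap_zero hΦ hxN hξ
    have e4 := e1.mfderiv.symm.trans (e2.congr_of_eventuallyEq e3).mfderiv
    exact DFunLike.congr_fun (show A ∘L .inl ℝ F (normalSpace E N x) =
      chartDerivSymm Φ (Φ x) ∘L F.subtypeL from e4) a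
  have h2 : A (0, w) = normalInclusion N x w := by
    have hline : HasDerivAt (fun s : ℝ => (ξ₀, s • w)) (0, w) 0 := by
      have h1 : HasDerivAt (fun s : ℝ => s • w) ((1 : ℝ) • w) 0 :=
        (hasDerivAt_id (0 : ℝ)).smul_const w
      rw [one_smul] at h1
      exact (hasDerivAt_const _ _).prodMk h1
    have hΨ' : HasMFDerivAt 𝓘(ℝ, F × normalSpace E N x) 𝓘(ℝ, E) (tubeMap Φ F N x f)
        (ξ₀, (0 : ℝ) • w) A := by
      rw [zero_smul]; exact hΨ
    have e1 : HasMFDerivAt 𝓘(ℝ, ℝ) 𝓘(ℝ, E) (fun s : ℝ => tubeMap Φ F N x f (ξ₀, s • w)) 0 _ :=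
      HasMFDerivAt.comp (0 : ℝ) (g := tubeMap Φ F N x f) (f := fun s : ℝ => (ξ₀, s • w)) hΨ'
        hline.hasFDerivAt.hasMFDerivAt
    have e2 : (fun s : ℝ => tubeMap Φ F N x f (ξ₀, s • w)) =
        fun s : ℝ => f ⟨x, s • (w : TangentSpace 𝓘(ℝ, E) x)⟩ := by
      funext s
      rw [tubeMap, hξ₀, hΦ.normalFrame_self hxN]
      rfl
    have e3 := hf.2.2 x hxN w w.2
    have e4 := eq_of_tangentBundle_mk_eq e3
    rw [← e2, e1.mfderiv] at e4
    have e5 : A ((1 : ℝ) • (0, w)) = normalInclusion N x w := e4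
    rwa [one_smul] at e5
  rw [← h1, ← h2, ← map_add, Prod.mk_add_mk, add_zero, zero_add]

lemma IsTubularMap.bijective_mfderiv_tubeMap (hf : IsTubularMap N f) (hΦ : IsSliceChart N Φ F x)
    (hxN : x ∈ N) {ξ₀ : F} (hξ₀ : (ξ₀ : E) = Φ x) : Function.Bijective
      (mfderiv 𝓘(ℝ, F × normalSpace E N x) 𝓘(ℝ, E) (tubeMap Φ F N x f) (ξ₀, 0)) := by
  have hx := hΦ.2.1
  set A : F × normalSpace E N x →L[ℝ] E :=
    mfderiv 𝓘(ℝ, F × normalSpace E N x) 𝓘(ℝ, E) (tubeMap Φ F N x f) (ξ₀, 0) with hA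
  have hAv : ∀ a w, A (a, w) = chartDerivSymm Φ (Φ x) a + normalInclusion N x w :=
    hf.mfderiv_tubeMap hΦ hxN hξ₀
  have hinj : Function.Injective A := by
    refine (injective_iff_map_eq_zero _).2 ?_
    rintro ⟨a, w⟩ h
    rw [hAv] at h
    have h1 := congrArg (chartDeriv Φ x) h
    have h2 : chartDeriv Φ x (chartDerivSymm Φ (Φ x) a) = a := by
      have := chartDeriv_chartDerivSymm hΦ.1 (Φ.map_source hx) (a : E)
      rwa [Φ.left_inv hx] at this
    rw [map_add, map_zero, h2] at h1
    have h3 := hΦ.chartMetric_normal hxN w a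
    rw [eq_neg_of_add_eq_zero_right h1, map_neg, neg_apply, neg_eq_zero] at h3
    have ha := chartMetric_pos_on hΦ.1 (Φ.map_source hx) a h3
    rw [ha, ZeroMemClass.coe_zero, map_zero, zero_add] at h
    rw [ha, show w = 0 from Subtype.ext h]
    rfl
  have hfin : Module.finrank ℝ (F × normalSpace E N x) = Module.finrank ℝ E := by
    rw [Module.finrank_prod]; exact hΦ.finrank_normalSpace hx hxN
  exact ⟨hinj, (LinearMap.injective_iff_surjective_of_finrank_eq_finrank hfin
    (f := (A : F × normalSpace E N x →ₗ[ℝ] E))).1 hinj⟩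

/-- The thin tubes around `C` are local tubes in the coordinates given by the normal bundle. -/
theorem IsTubularMap.isLocalTube (hf : IsTubularMap N f) (hB : IsConvexProfile N B)
    (hN : IsDegenerateScatterer E N) {C : Set M} (hC : IsCompact C) (hCN : C ⊆ N)
    (hΦ : IsSliceChart N Φ F x) (hxN : x ∈ N) (hxC : C ∈ 𝓝[N] x) {ξ₀ : F}
    (hξ₀ : (ξ₀ : E) = Φ x) :
    IsLocalTube (E := E) (tube C f B) (tubeBoundary C f B) (tubeMap Φ F N x f)
      (fun ξ : F => chartProfile Φ F B x ξ) ξ₀ := by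
  have hx := hΦ.2.1
  have htar : (ξ₀ : E) ∈ Φ.target := by rw [hξ₀]; exact Φ.map_source hx
  have hself : chartProfile Φ F B x ξ₀ = B x := by rw [hξ₀, hΦ.chartProfile_self hxN]
  have hev := hB.eventually_chartProfile hΦ hxN hξ₀
  have hcoe : ContinuousAt (fun ξ : F => (ξ : E)) ξ₀ := by fun_prop
  have hΨ := hf.contMDiffAt_tubeMap hΦ hxN hξ₀
  have hΨ0 : tubeMap Φ F N x f (ξ₀, 0) = x := by
    rw [hf.tubeMap_zero hΦ hxN htar, hξ₀, Φ.left_inv hx]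
  have hfr : ∀ {ξ : F} {y : M} {L : normalSpace E N x ≃L[ℝ] normalSpace E N y},
      chartProfile Φ F B x ξ = L ⁻¹' B y → ∀ u, u ∈ frontier (chartProfile Φ F B x ξ) ↔
        L u ∈ frontier (B y) := by
    intro ξ y L hL u
    rw [hL]
    have h1 : L ⁻¹' frontier (B y) = frontier (L ⁻¹' B y) := L.toHomeomorph.preimage_frontier (B y)
    rw [← h1, mem_preimage]
  refine ⟨hΨ, hf.bijective_mfderiv_tubeMap hΦ hxN hξ₀, hev.mono fun _ h => h.1,
    hev.mono fun _ h => h.2.1, hev.self_of_nhds.2.2, ?_, ?_, ?_, ?_⟩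
  · simp only [hself]; exact hB.bounded x hxN
  · simp only [hself]
    intro η hη
    exact hB.exists_definingFunction hΦ hxN hξ₀ hη
  · have h1 : Tendsto (fun ξ : F => Φ.symm (ξ : E)) (𝓝 ξ₀) (𝓝 x) := by
      have := ContinuousAt.comp (g := Φ.symm) (Φ.continuousAt_symm htar) hcoe
      have h2 := this.tendsto
      simp only [Function.comp_apply, hξ₀, Φ.left_inv hx] at h2
      exact h2
    filter_upwards [h1.eventually (eventually_nhdsWithin_iff.1 hxC),
      hcoe.eventually (Φ.open_target.mem_nhds htar)] with ξ hξC hξ ε η hη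
    have hyN : Φ.symm (ξ : E) ∈ N :=
      (hΦ.2.2 _ (Φ.map_target hξ)).2 (by rw [Φ.right_inv hξ]; exact ξ.2)
    obtain ⟨L, hL, hLB⟩ := IsSliceChart.exists_frame hΦ hxN hξ ξ.2 rfl B
    exact ⟨Φ.symm (ξ : E), hξC hyN, L η, (hfr hLB η).1 hη, by rw [tubeMap, hL]⟩
  · obtain ⟨Θ, -, hΘ, -⟩ := exists_local_inverse hΨ (hf.bijective_mfderiv_tubeMap hΦ hxN hξ₀)
    obtain ⟨r, hr, hball⟩ := Metric.mem_nhds_iff.1 hΘ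
    obtain ⟨R, hR⟩ := hB.exists_chartProfile_bounded hΦ hxN hξ₀
    obtain ⟨r', hr', hball'⟩ := Metric.mem_nhds_iff.1 hR
    have hW : {y | y ∈ Φ.source ∧ dist (Φ y) (Φ x) < min r r'} ∈ 𝓝 x :=
      Filter.Eventually.and (Φ.open_source.mem_nhds hx)
        ((Φ.continuousAt hx).eventually (Metric.ball_mem_nhds _ (lt_min hr hr')))
    -- Points of the tubes near `x` come from base points in the neighbourhood `W` of `x`, because the
    -- thin tubes around the compact set `C \ W` stay away from `x`.
    obtain ⟨W, hWW, hWo, hxW⟩ := _root_.mem_nhds_iff.1 hW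
    obtain ⟨K, hK, hKc, hKW⟩ := exists_mem_nhds_isClosed_subset (hWo.mem_nhds hxW)
    obtain ⟨ε₁, hε₁, hfar⟩ := hf.exists_small hB hN (hC.diff hWo) (sdiff_subset.trans hCN)
      hKc.isOpen_compl (fun y hy hyK => hy.2 (hKW hyK))
    refine ⟨min ε₁ (r / (|R| + 1)), lt_min hε₁ (by positivity), ?_⟩
    have hΨK : ∀ᶠ p in 𝓝 (ξ₀, (0 : normalSpace E N x)), tubeMap Φ F N x f p ∈ K :=
      hΨ.continuousAt.eventually (by rw [hΨ0]; exact hK)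
    filter_upwards [hΨK, Metric.ball_mem_nhds _ hr] with p hpK hpr ε hε
    have hε' : ε ∈ Ioo 0 ε₁ := ⟨hε.1, hε.2.trans_le (min_le_left _ _)⟩
    have key : ∀ y ∈ C, ∀ v ∈ closure (B y),
        tubeMap Φ F N x f p = f ⟨y, ε • (v : TangentSpace 𝓘(ℝ, E) y)⟩ →
        ∃ L : normalSpace E N x ≃L[ℝ] normalSpace E N y,
          chartProfile Φ F B x p.1 = L ⁻¹' B y ∧ L (ε⁻¹ • p.2) = v := by
      intro y hy v hv hpv
      have hyW : y ∈ W := by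
        by_contra hyW
        exact hfar y ⟨hy, hyW⟩ ε hε' v hv (hpv ▸ hpK)
      obtain ⟨hys, hyd⟩ := hWW hyW
      set ξ : F := ⟨Φ y, (hΦ.2.2 y hys).1 (hCN hy)⟩ with hξ
      obtain ⟨L, hL, hLB⟩ := hΦ.exists_frame hxN (Φ.map_source hys) ξ.2 (Φ.left_inv hys) B
      obtain ⟨u, rfl⟩ := L.surjective v
      have hu : u ∈ closure (chartProfile Φ F B x ξ) := by
        have h1 : L ⁻¹' closure (B y) = closure (L ⁻¹' B y) := L.toHomeomorph.preimage_closure (B y)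
        change u ∈ closure (chartProfile Φ F B x (Φ y))
        rw [hLB, ← h1]; exact hv
      have hdist : dist ξ ξ₀ < min r r' := by
        rw [Subtype.dist_eq, hξ₀]; exact hyd
      have hnorm : ‖u‖ ≤ R := hball' (hdist.trans_le (min_le_right _ _)) u hu
      have hmem : (ξ, ε • u) ∈ Metric.ball (ξ₀, (0 : normalSpace E N x)) r := by
        rw [Metric.mem_ball, Prod.dist_eq, max_lt_iff]
        refine ⟨hdist.trans_le (min_le_left _ _), ?_⟩
        change dist (ε • u) 0 < r
        rw [dist_zero_right, norm_smul, Real.norm_of_nonneg hε.1.le]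
        have h2 : ε * (|R| + 1) < r :=
          (lt_div_iff₀ (by positivity)).1 (hε.2.trans_le (min_le_right _ _))
        nlinarith [le_abs_self R, hε.1]
      have heq : tubeMap Φ F N x f p = tubeMap Φ F N x f (ξ, ε • u) := by
        rw [hpv, tubeMap, hL]
      -- the parametrization is injective near `(ξ₀, 0)`
      have hp : p = (ξ, ε • u) := by
        have h1 : Θ (tubeMap Φ F N x f p) = p := hball hpr
        rw [← h1, heq]
        exact hball hmem
      refine ⟨L, ?_, ?_⟩
      · rw [hp]; exact hLB
      · rw [hp]; simp only [inv_smul_smul₀ hε.1.ne']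
    constructor
    · rintro ⟨y, hy, v, hv, hpv⟩
      obtain ⟨L, hLB, hLp⟩ := key y hy v (subset_closure hv) hpv
      change ε⁻¹ • p.2 ∈ chartProfile Φ F B x p.1
      rw [hLB, mem_preimage, hLp]
      exact hv
    · rintro ⟨y, hy, v, hv, hpv⟩
      obtain ⟨L, hLB, hLp⟩ := key y hy v (frontier_subset_closure hv) hpv
      change ε⁻¹ • p.2 ∈ frontier (chartProfile Φ F B x p.1)
      rw [hfr hLB, hLp]
      exact hv

end LocalTube

end

/-! ### Lagrange multipliers for thin constraints -/

section

section Multiplier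

variable {X Y J : Type*} [NormedAddCommGroup X] [NormedSpace ℝ X] [FiniteDimensional ℝ X]
  [NormedAddCommGroup Y] [NormedSpace ℝ Y] [FiniteDimensional ℝ Y] [Fintype J]

/-- The left-hand sides of the equations for the critical points of `A (ξ, ε η)` on the set where
the functions `ρ j (ξ, η)` vanish, with multipliers `ε μ j`; the equation for the derivative in the
direction of `η` is divided by `ε`. -/
def multiplierMap (A : X × Y → ℝ) (ρ : J → X × Y → ℝ) (p : ℝ × (X × Y × (J → ℝ))) :
    (X →L[ℝ] ℝ) × (Y →L[ℝ] ℝ) × (J → ℝ) :=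
  (fderiv ℝ A (p.2.1, p.1 • p.2.2.1) ∘L .inl ℝ X Y +
      p.1 • ∑ j, p.2.2.2 j • (fderiv ℝ (ρ j) (p.2.1, p.2.2.1) ∘L .inl ℝ X Y),
    fderiv ℝ A (p.2.1, p.1 • p.2.2.1) ∘L .inr ℝ X Y +
      ∑ j, p.2.2.2 j • (fderiv ℝ (ρ j) (p.2.1, p.2.2.1) ∘L .inr ℝ X Y),
    fun j => ρ j (p.2.1, p.2.2.1))

omit [FiniteDimensional ℝ X] [FiniteDimensional ℝ Y] in
lemma contDiffAt_multiplierMap {A : X × Y → ℝ} {ρ : J → X × Y → ℝ} {ξ₀ : X} {η₀ : Y} (μ₀ : J → ℝ)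
    (hA : ContDiffAt ℝ 2 A (ξ₀, 0)) (hρ : ∀ j, ContDiffAt ℝ 2 (ρ j) (ξ₀, η₀)) :
    ContDiffAt ℝ 1 (multiplierMap A ρ) (0, (ξ₀, η₀, μ₀)) := by
  have h1 : ContDiffAt ℝ 1 (fun p : ℝ × (X × Y × (J → ℝ)) => fderiv ℝ A (p.2.1, p.1 • p.2.2.1))
      (0, (ξ₀, η₀, μ₀)) := by
    refine ContDiffAt.comp (g := fderiv ℝ A) _ ?_ (by fun_prop)
    simp only [zero_smul]
    exact hA.fderiv_right (by norm_num)
  have h2 : ∀ j, ContDiffAt ℝ 1 (fun p : ℝ × (X × Y × (J → ℝ)) => fderiv ℝ (ρ j) (p.2.1, p.2.2.1))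
      (0, (ξ₀, η₀, μ₀)) := fun j =>
    ContDiffAt.comp (g := fderiv ℝ (ρ j)) (0, (ξ₀, η₀, μ₀)) ((hρ j).fderiv_right (by norm_num))
      (by fun_prop)
  have h3 : ∀ j, ContDiffAt ℝ 1 (fun p : ℝ × (X × Y × (J → ℝ)) => ρ j (p.2.1, p.2.2.1))
      (0, (ξ₀, η₀, μ₀)) := fun j =>
    ContDiffAt.comp (g := ρ j) (0, (ξ₀, η₀, μ₀)) ((hρ j).of_le (by norm_num)) (by fun_prop)
  have h4 : ∀ j, ContDiffAt ℝ 1 (fun p : ℝ × (X × Y × (J → ℝ)) => p.2.2.2 j)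
      (0, (ξ₀, η₀, μ₀)) := fun j => by fun_prop
  refine ContDiffAt.prodMk (ContDiffAt.add ?_ (contDiffAt_fst.smul (ContDiffAt.sum fun j _ =>
    (h4 j).smul ?_))) (ContDiffAt.prodMk (ContDiffAt.add ?_ (ContDiffAt.sum fun j _ =>
      (h4 j).smul ?_)) (contDiffAt_pi.2 h3))
  · exact h1.clm_comp contDiffAt_const
  · exact (h2 j).clm_comp contDiffAt_const
  · exact h1.clm_comp contDiffAt_const
  · exact (h2 j).clm_comp contDiffAt_const

/-- Lagrange multipliers for thin constraints: a nondegenerate critical point `ξ₀` of `A (·, 0)` and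
a nondegenerate critical point `η₀` of the linear function `∂A/∂η (ξ₀, 0)` on the set
`ρ (ξ₀, ·) = 0` give rise to critical points of `A (ξ, ε η)` on the set `ρ = 0`. -/
theorem exists_multiplier_curve {A : X × Y → ℝ} {ρ : J → X × Y → ℝ} {ξ₀ : X} {η₀ : Y} {μ₀ : J → ℝ}
    (hA : ContDiffAt ℝ 2 A (ξ₀, 0)) (hρ : ∀ j, ContDiffAt ℝ 2 (ρ j) (ξ₀, η₀))
    (hcrit : ∀ a, fderiv ℝ A (ξ₀, 0) (a, 0) = 0)
    (hmult : ∀ w, fderiv ℝ A (ξ₀, 0) (0, w) + ∑ j, μ₀ j * fderiv ℝ (ρ j) (ξ₀, η₀) (0, w) = 0)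
    (hzero : ∀ j, ρ j (ξ₀, η₀) = 0)
    (hhess : ∀ a, (∀ b, fderiv ℝ (fderiv ℝ A) (ξ₀, 0) (a, 0) (b, 0) = 0) → a = 0)
    (hpos : ∀ w, (∀ j, fderiv ℝ (ρ j) (ξ₀, η₀) (0, w) = 0) →
      ∑ j, μ₀ j * fderiv ℝ (fderiv ℝ (ρ j)) (ξ₀, η₀) (0, w) (0, w) = 0 → w = 0)
    (hindep : ∀ ν : J → ℝ, (∀ w, ∑ j, ν j * fderiv ℝ (ρ j) (ξ₀, η₀) (0, w) = 0) → ν = 0) :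
    ∃ (ξ : ℝ → X) (η : ℝ → Y) (μ : ℝ → J → ℝ), ξ 0 = ξ₀ ∧ η 0 = η₀ ∧ μ 0 = μ₀ ∧
      ContDiffAt ℝ 1 ξ 0 ∧ ContDiffAt ℝ 1 η 0 ∧ ContDiffAt ℝ 1 μ 0 ∧ ∀ᶠ ε in 𝓝 (0 : ℝ),
        (∀ a w, fderiv ℝ A (ξ ε, ε • η ε) (a, w) +
          ∑ j, μ ε j * fderiv ℝ (ρ j) (ξ ε, η ε) (ε • a, w) = 0) ∧ ∀ j, ρ j (ξ ε, η ε) = 0 := by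
  have hR := contDiffAt_multiplierMap μ₀ hA hρ
  have hR0 : multiplierMap A ρ (0, (ξ₀, η₀, μ₀)) = 0 := by
    refine Prod.ext ?_ (Prod.ext ?_ ?_)
    · ext a
      simpa [multiplierMap] using hcrit a
    · ext w
      simpa [multiplierMap] using hmult w
    · funext j; exact hzero j
  have hker : ∀ v : X × Y × (J → ℝ),
      fderiv ℝ (multiplierMap A ρ) (0, (ξ₀, η₀, μ₀)) (0, v) = 0 → v = 0 := by
    rintro ⟨a', w', ν⟩ hv
    -- the derivative is computed along a line
    have hline : HasDerivAt (fun s : ℝ => ((0 : ℝ), (ξ₀ + s • a', η₀ + s • w', μ₀ + s • ν)))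
        (0, (a', w', ν)) 0 := by
      refine (hasDerivAt_const _ _).prodMk (HasDerivAt.prodMk ?_ (HasDerivAt.prodMk ?_ ?_))
      · simpa using ((hasDerivAt_id (0 : ℝ)).smul_const a').const_add ξ₀
      · simpa using ((hasDerivAt_id (0 : ℝ)).smul_const w').const_add η₀
      · simpa using ((hasDerivAt_id (0 : ℝ)).smul_const ν).const_add μ₀
    have hd := (hR.differentiableAt one_ne_zero).hasFDerivAt.comp_hasDerivAt_of_eq (0 : ℝ) hline
      (by simp)
    rw [hv] at hd
    set c : ℝ → (X →L[ℝ] ℝ) × (Y →L[ℝ] ℝ) × (J → ℝ) := fun s =>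
      multiplierMap A ρ (0, (ξ₀ + s • a', η₀ + s • w', μ₀ + s • ν)) with hc
    have hd1 : HasDerivAt (fun s => (c s).1) 0 0 := hd.fst
    have hd2 : HasDerivAt (fun s => (c s).2.1) 0 0 := hd.snd.fst
    have hd3 : HasDerivAt (fun s => (c s).2.2) 0 0 := hd.snd.snd
    have hA' : HasFDerivAt (fderiv ℝ A) (fderiv ℝ (fderiv ℝ A) (ξ₀, 0)) (ξ₀, 0) :=
      ((hA.fderiv_right (m := 1) (by norm_num)).differentiableAt one_ne_zero).hasFDerivAt
    have hρ' : ∀ j, HasFDerivAt (fderiv ℝ (ρ j)) (fderiv ℝ (fderiv ℝ (ρ j)) (ξ₀, η₀)) (ξ₀, η₀) :=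
      fun j => (((hρ j).fderiv_right (m := 1) (by norm_num)).differentiableAt one_ne_zero).hasFDerivAt
    have hlA : HasDerivAt (fun s : ℝ => (ξ₀ + s • a', (0 : Y))) (a', 0) 0 := by
      refine HasDerivAt.prodMk ?_ (hasDerivAt_const _ _)
      simpa using ((hasDerivAt_id (0 : ℝ)).smul_const a').const_add ξ₀
    have hlρ : HasDerivAt (fun s : ℝ => (ξ₀ + s • a', η₀ + s • w')) (a', w') 0 := by
      refine HasDerivAt.prodMk ?_ ?_
      · simpa using ((hasDerivAt_id (0 : ℝ)).smul_const a').const_add ξ₀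
      · simpa using ((hasDerivAt_id (0 : ℝ)).smul_const w').const_add η₀
    have hA'' : HasDerivAt (fun s : ℝ => fderiv ℝ A (ξ₀ + s • a', (0 : Y)))
        (fderiv ℝ (fderiv ℝ A) (ξ₀, 0) (a', 0)) 0 :=
      hA'.comp_hasDerivAt_of_eq (0 : ℝ) hlA (by simp)
    -- The system decouples at `ε = 0`: the first equation involves only `a'`, and once `a' = 0`, the
    -- second one, paired with `w'`, shows that `w'` is in the kernel of the second fundamental form.
    have ha : a' = 0 := by
      refine hhess a' fun b => ?_
      have e1 : HasDerivAt (fun s : ℝ => fderiv ℝ A (ξ₀ + s • a', (0 : Y)) (b, 0))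
          (fderiv ℝ (fderiv ℝ A) (ξ₀, 0) (a', 0) (b, 0)) 0 := by
        simpa using hA''.clm_apply (hasDerivAt_const (0 : ℝ) ((b, 0) : X × Y))
      have e2 : HasDerivAt (fun s : ℝ => fderiv ℝ A (ξ₀ + s • a', (0 : Y)) (b, 0)) 0 0 := by
        have := hd1.clm_apply (hasDerivAt_const (0 : ℝ) b)
        simpa [hc, multiplierMap, Prod.mk_zero_zero] using this
      exact e1.unique e2
    subst ha
    have hw3 : ∀ j, fderiv ℝ (ρ j) (ξ₀, η₀) (0, w') = 0 := by
      intro j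
      have e1 : HasDerivAt (fun s : ℝ => ρ j (ξ₀ + s • 0, η₀ + s • w'))
          (fderiv ℝ (ρ j) (ξ₀, η₀) (0, w')) 0 :=
        ((hρ j).differentiableAt (by norm_num)).hasFDerivAt.comp_hasDerivAt_of_eq (0 : ℝ) hlρ (by simp)
      have e2 : HasDerivAt (fun s : ℝ => ρ j (ξ₀ + s • 0, η₀ + s • w')) 0 0 := by
        simpa [hc, multiplierMap] using (hasDerivAt_pi.1 hd3) j
      exact e1.unique e2
    have hw2 : ∀ b, ∑ j, (ν j * fderiv ℝ (ρ j) (ξ₀, η₀) (0, b) +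
        μ₀ j * fderiv ℝ (fderiv ℝ (ρ j)) (ξ₀, η₀) (0, w') (0, b)) = 0 := by
      intro b
      have e0 : HasDerivAt (fun s : ℝ => fderiv ℝ A (ξ₀ + s • 0, (0 : Y)) (0, b)) 0 0 := by
        simpa using hasDerivAt_const (0 : ℝ) (fderiv ℝ A (ξ₀, (0 : Y)) (0, b))
      have e1 : ∀ j, HasDerivAt (fun s : ℝ => (μ₀ + s • ν) j *
          fderiv ℝ (ρ j) (ξ₀ + s • 0, η₀ + s • w') (0, b))
          (ν j * fderiv ℝ (ρ j) (ξ₀, η₀) (0, b) +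
            μ₀ j * fderiv ℝ (fderiv ℝ (ρ j)) (ξ₀, η₀) (0, w') (0, b)) 0 := by
        intro j
        have k1 : HasDerivAt (fun s : ℝ => (μ₀ + s • ν) j) (ν j) 0 := by
          have := ((hasDerivAt_id (0 : ℝ)).mul_const (ν j)).const_add (μ₀ j)
          simpa using this
        have k2 : HasDerivAt (fun s : ℝ => fderiv ℝ (ρ j) (ξ₀ + s • 0, η₀ + s • w'))
            (fderiv ℝ (fderiv ℝ (ρ j)) (ξ₀, η₀) (0, w')) 0 :=
          (hρ' j).comp_hasDerivAt_of_eq (0 : ℝ) hlρ (by simp)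
        have k3 := k1.mul (k2.clm_apply (hasDerivAt_const (0 : ℝ) ((0, b) : X × Y)))
        simpa [Pi.mul_def] using k3
      have e2 := e0.add (HasDerivAt.fun_sum fun j (_ : j ∈ Finset.univ) => e1 j)
      have e3 : HasDerivAt (fun s : ℝ => fderiv ℝ A (ξ₀ + s • 0, (0 : Y)) (0, b) +
          ∑ j, (μ₀ + s • ν) j * fderiv ℝ (ρ j) (ξ₀ + s • 0, η₀ + s • w') (0, b)) 0 0 := by
        have := hd2.clm_apply (hasDerivAt_const (0 : ℝ) b)
        simpa [hc, multiplierMap, Prod.mk_zero_zero] using this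
      have e4 := e2.unique e3
      simpa using e4
    have hw : w' = 0 := by
      refine hpos w' hw3 ?_
      have := hw2 w'
      simpa [Finset.sum_add_distrib, hw3] using this
    subst hw
    -- the remaining equation says that the constraints are linearly dependent, unless `ν = 0`
    have hν : ν = 0 := hindep ν fun b => by
      have := hw2 b
      simpa [Finset.sum_add_distrib, Prod.mk_zero_zero] using this
    rw [hν]; rfl
  have hfin : Module.finrank ℝ (X × Y × (J → ℝ)) =
      Module.finrank ℝ ((X →L[ℝ] ℝ) × (Y →L[ℝ] ℝ) × (J → ℝ)) := by
    simp only [Module.finrank_prod, finrank_strongDual]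
  obtain ⟨g, hg0, hg, hgR⟩ := exists_implicit_function hR hR0 hfin hker
  refine ⟨fun ε => (g ε).1, fun ε => (g ε).2.1, fun ε => (g ε).2.2, congrArg Prod.fst hg0,
    congrArg (fun q => q.2.1) hg0, congrArg (fun q => q.2.2) hg0, hg.fst, hg.snd.fst, hg.snd.snd, ?_⟩
  filter_upwards [hgR] with ε hε
  constructor
  · intro a w
    have k1 := DFunLike.congr_fun (congrArg Prod.fst hε) a
    have k2 := DFunLike.congr_fun (congrArg (fun q => q.2.1) hε) w
    simp only [multiplierMap, Prod.fst_zero, Prod.snd_zero, add_apply, smul_apply, sum_apply,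
      ContinuousLinearMap.comp_apply, ContinuousLinearMap.inl_apply, ContinuousLinearMap.inr_apply,
      zero_apply, smul_eq_mul] at k1 k2
    have k3 : ((a, w) : X × Y) = (a, 0) + (0, w) := by simp
    have k4 : ((ε • a, w) : X × Y) = ε • (a, 0) + (0, w) := by simp
    rw [k3, k4]
    simp only [map_add, map_smul, smul_eq_mul, mul_add, Finset.sum_add_distrib]
    rw [Finset.mul_sum] at k1
    have k5 : ∀ j, (g ε).2.2 j * (ε * fderiv ℝ (ρ j) ((g ε).1, (g ε).2.1) (a, 0)) =
        ε * ((g ε).2.2 j * fderiv ℝ (ρ j) ((g ε).1, (g ε).2.1) (a, 0)) := fun j => by ring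
    simp only [k5]
    linarith
  · intro j
    exact congrFun (congrArg (fun q => q.2.2) hε) j

end Multiplier

end

/-! ### Estimates for the Riemannian distance -/

section

section Distance

open scoped NNReal
open MeasureTheory

variable {E : Type*} [NormedAddCommGroup E] [NormedSpace ℝ E] [FiniteDimensional ℝ E]
variable {M : Type*} [EMetricSpace M] [ChartedSpace E M] [IsManifold 𝓘(ℝ, E) ∞ M]
  [RiemannianBundle (fun x : M => TangentSpace 𝓘(ℝ, E) x)]
  [IsContMDiffRiemannianBundle 𝓘(ℝ, E) ∞ E (fun x : M => TangentSpace 𝓘(ℝ, E) x)]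
  [IsRiemannianManifold 𝓘(ℝ, E) M]

omit [IsManifold 𝓘(ℝ, E) ∞ M] [IsContMDiffRiemannianBundle 𝓘(ℝ, E) ∞ E
  (fun x : M => TangentSpace 𝓘(ℝ, E) x)] [IsRiemannianManifold 𝓘(ℝ, E) M] in
/-- A bound on the metric in the chart bounds the derivative of the inverse of the chart. -/
lemma enorm_chartDerivSymm_le {Φ : OpenPartialHomeomorph M E} {ξ : E} {K : ℝ≥0}
    (hK : ‖chartMetric Φ ξ‖ ≤ K) (v : E) :
    ‖(show TangentSpace 𝓘(ℝ, E) (Φ.symm ξ) from chartDerivSymm Φ ξ v)‖ₑ ≤ NNReal.sqrt K * ‖v‖ₑ := by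
  set w : TangentSpace 𝓘(ℝ, E) (Φ.symm ξ) := chartDerivSymm Φ ξ v
  have h1 : ‖w‖ * ‖w‖ = chartMetric Φ ξ v v := (real_inner_self_eq_norm_mul_norm w).symm
  have h2 : chartMetric Φ ξ v v ≤ K * ‖v‖ * ‖v‖ :=
    (Real.le_norm_self _).trans (((chartMetric Φ ξ).le_opNorm₂ v v).trans (by gcongr))
  have h3 : ‖w‖ ≤ Real.sqrt K * ‖v‖ := by
    refine abs_le_of_sq_le_sq' ?_ (by positivity) |>.2
    rw [mul_pow, Real.sq_sqrt (NNReal.coe_nonneg K)]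
    nlinarith
  have h4 : ‖w‖₊ ≤ NNReal.sqrt K * ‖v‖₊ := by
    rw [← NNReal.coe_le_coe]
    simpa using h3
  have h5 : ‖w‖ₑ ≤ NNReal.sqrt K * ‖v‖ₑ := by
    rw [enorm_eq_nnnorm, enorm_eq_nnnorm]
    exact_mod_cast ENNReal.coe_le_coe.2 h4
  exact h5

lemma exists_eventually_norm_le {V W : Type*} [NormedAddCommGroup V] [NormedSpace ℝ V]
    [NormedAddCommGroup W] [NormedSpace ℝ W] {c : V → W} {v : V} (hc : ContDiffAt ℝ ∞ c v) :
    ∃ K : ℝ≥0, ∀ᶠ w in 𝓝 v, ‖c w‖ ≤ K := by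
  refine ⟨‖c v‖₊ + 1, ?_⟩
  have h1 : ‖c v‖ < ‖c v‖ + 1 := lt_add_one _
  exact (hc.continuousAt.norm.eventually (gt_mem_nhds h1)).mono fun w hw => hw.le

/-- Charts are locally bi-Lipschitz; this is the estimate for the inverse of a chart. -/
lemma eventually_edist_le_extChartAt (x : M) : ∃ K : ℝ≥0, ∀ᶠ p in 𝓝 (x, x),
    edist p.1 p.2 ≤ K * edist (extChartAt 𝓘(ℝ, E) x p.1) (extChartAt 𝓘(ℝ, E) x p.2) := by
  set Φ := chartAt E x with hΦ
  have hΦa : Φ ∈ IsManifold.maximalAtlas 𝓘(ℝ, E) ∞ M := IsManifold.chart_mem_maximalAtlas x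
  have hx : x ∈ Φ.source := mem_chart_source E x
  obtain ⟨K, hK⟩ : ∃ K : ℝ≥0, ∀ᶠ ξ in 𝓝 (Φ x), ‖chartMetric Φ ξ‖ ≤ K :=
    exists_eventually_norm_le ((contDiffOn_chartMetric hΦa).contDiffAt
      (Φ.open_target.mem_nhds (Φ.map_source hx)))
  obtain ⟨r, hr, hball⟩ := Metric.mem_nhds_iff.1
    (inter_mem (Φ.open_target.mem_nhds (Φ.map_source hx)) hK)
  refine ⟨NNReal.sqrt K, ?_⟩
  have hU : {y | y ∈ Φ.source ∧ Φ y ∈ Metric.ball (Φ x) r} ∈ 𝓝 x :=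
    Filter.Eventually.and (Φ.open_source.mem_nhds hx)
      ((Φ.continuousAt hx).eventually (Metric.ball_mem_nhds _ hr))
  rw [nhds_prod_eq]
  filter_upwards [prod_mem_prod hU hU] with p hp
  obtain ⟨⟨h1, h1'⟩, h2, h2'⟩ := hp
  rw [IsRiemannianManifold.out (I := 𝓘(ℝ, E)) p.1 p.2]
  -- the distance is at most the length of the curve that is a straight line in the chart
  set c : ℝ → E := fun t => Φ p.1 + t • (Φ p.2 - Φ p.1) with hcdef
  have hcball : ∀ t ∈ Icc (0 : ℝ) 1, c t ∈ Metric.ball (Φ x) r := fun t ht =>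
    (convex_ball (Φ x) r).add_smul_sub_mem h1' h2' ht
  have hcd : ContDiff ℝ 1 c := by fun_prop
  have hle : Manifold.riemannianEDist 𝓘(ℝ, E) p.1 p.2 ≤
      Manifold.pathELength 𝓘(ℝ, E) (fun t => Φ.symm (c t)) 0 1 := by
    refine Manifold.riemannianEDist_le_pathELength ?_ ?_ ?_ zero_le_one
    · refine ContMDiffOn.comp (t := Φ.target) (g := Φ.symm)
        ((contMDiffOn_symm_of_mem_maximalAtlas hΦa).of_le (by simp)) hcd.contMDiff.contMDiffOn
        fun t ht => (hball (hcball t ht)).1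
    · simp [hcdef, Φ.left_inv h1]
    · simp [hcdef, Φ.left_inv h2]
  refine hle.trans ?_
  rw [Manifold.pathELength_eq_lintegral_mfderivWithin_Icc]
  have hbound : ∀ t ∈ Icc (0 : ℝ) 1,
      ‖mfderivWithin 𝓘(ℝ, ℝ) 𝓘(ℝ, E) (fun t => Φ.symm (c t)) (Icc 0 1) t (1 : ℝ)‖ₑ ≤
        NNReal.sqrt K * edist (Φ p.1) (Φ p.2) := by
    intro t ht
    have hct := hball (hcball t ht)
    have e1 : HasMFDerivAt 𝓘(ℝ, E) 𝓘(ℝ, E) Φ.symm (c t)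
        (show E →L[ℝ] E from chartDerivSymm Φ (c t)) :=
      ((mdifferentiable_of_mem_maximalAtlas hΦa).mdifferentiableAt_symm hct.1).hasMFDerivAt
    have e2 : HasDerivAt c (Φ p.2 - Φ p.1) t := by
      have := ((hasDerivAt_id t).smul_const (Φ p.2 - Φ p.1)).const_add (Φ p.1)
      rwa [one_smul] at this
    have e3 := (e1.comp t e2.hasFDerivAt.hasMFDerivAt).hasMFDerivWithinAt (s := Icc (0 : ℝ) 1)
    have e4 := e3.mfderivWithin
      ((uniqueDiffOn_Icc (zero_lt_one (α := ℝ)) t ht).uniqueMDiffWithinAt)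
    have e5 : (show E from mfderivWithin 𝓘(ℝ, ℝ) 𝓘(ℝ, E) (fun t => Φ.symm (c t)) (Icc 0 1) t (1 : ℝ)) =
        chartDerivSymm Φ (c t) (Φ p.2 - Φ p.1) := by
      have e6 := DFunLike.congr_fun e4 (1 : ℝ)
      have e7 : chartDerivSymm Φ (c t) ((1 : ℝ) • (Φ p.2 - Φ p.1)) =
        chartDerivSymm Φ (c t) (Φ p.2 - Φ p.1) := by rw [one_smul]
      exact e6.trans e7
    have e8 := enorm_chartDerivSymm_le hct.2 (Φ p.2 - Φ p.1)
    rw [← e5] at e8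
    rw [edist_comm, edist_eq_enorm_sub]
    exact e8
  calc _ ≤ ∫⁻ _ in Icc (0 : ℝ) 1, NNReal.sqrt K * edist (Φ p.1) (Φ p.2) :=
        setLIntegral_mono' measurableSet_Icc hbound
    _ = NNReal.sqrt K * edist (Φ p.1) (Φ p.2) := by simp

/-- A continuously differentiable curve of paths moves at bounded speed. -/
lemma exists_edist_le_mul {g : ℝ × ℝ → M}
    (hg : ∀ θ ∈ Icc (0 : ℝ) 1, ContMDiffAt 𝓘(ℝ, ℝ × ℝ) 𝓘(ℝ, E) 1 g (0, θ)) :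
    ∃ K : ℝ≥0, ∀ᶠ ε in 𝓝 (0 : ℝ), ∀ θ ∈ Icc (0 : ℝ) 1,
      edist (g (ε, θ)) (g (0, θ)) ≤ K * ENNReal.ofReal |ε| := by
  have hloc : ∀ θ ∈ Icc (0 : ℝ) 1, ∃ K : ℝ≥0, ∀ᶠ p in 𝓝 ((0 : ℝ), θ),
      edist (g p) (g (0, p.2)) ≤ K * ENNReal.ofReal |p.1| := by
    intro θ hθ
    obtain ⟨K₁, hK₁⟩ := eventually_edist_le_extChartAt (E := E) (g (0, θ))
    have hd : ContDiffAt ℝ 1 (fun p => extChartAt 𝓘(ℝ, E) (g (0, θ)) (g p)) (0, θ) :=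
      contMDiffAt_iff_contDiffAt.1
        ((contMDiffAt_extChartAt (n := 1)).comp ((0 : ℝ), θ) (hg θ hθ))
    obtain ⟨K₂, t, ht, hK₂⟩ := hd.exists_lipschitzOnWith
    have hproj : Tendsto (fun p : ℝ × ℝ => ((0 : ℝ), p.2)) (𝓝 (0, θ)) (𝓝 (0, θ)) := by
      have : Continuous (fun p : ℝ × ℝ => ((0 : ℝ), p.2)) := by fun_prop
      exact this.tendsto' _ _ rfl
    have hcont := (hg θ hθ).continuousAt.tendsto
    have hpair : Tendsto (fun p : ℝ × ℝ => (g p, g (0, p.2))) (𝓝 (0, θ))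
        (𝓝 (g (0, θ), g (0, θ))) := hcont.prodMk_nhds (hcont.comp hproj)
    refine ⟨K₁ * K₂, ?_⟩
    filter_upwards [hpair.eventually hK₁, ht, hproj.eventually ht] with p h1 h2 h3
    refine h1.trans ?_
    rw [ENNReal.coe_mul, mul_assoc]
    gcongr
    refine (hK₂ h2 h3).trans ?_
    gcongr
    rw [Prod.edist_eq]
    simp [edist_dist]
  obtain ⟨K, hK⟩ := (isCompact_Icc (a := (0 : ℝ)) (b := 1)).induction_on
    (p := fun S => ∃ K : ℝ≥0, ∀ᶠ ε in 𝓝 (0 : ℝ), ∀ θ ∈ S,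
      edist (g (ε, θ)) (g (0, θ)) ≤ K * ENNReal.ofReal |ε|)
    ⟨0, by simp⟩
    (fun s t hst ⟨K, hK⟩ => ⟨K, hK.mono fun ε h θ hθ => h θ (hst hθ)⟩)
    (fun s t ⟨K, hK⟩ ⟨K', hK'⟩ => ⟨K + K', (hK.and hK').mono fun ε h θ hθ => by
      rcases hθ with hθ | hθ
      · exact (h.1 θ hθ).trans (by gcongr; exact le_self_add)
      · exact (h.2 θ hθ).trans (by gcongr; exact le_add_self)⟩)
    (fun θ hθ => by
      obtain ⟨K, hK⟩ := hloc θ hθ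
      rw [nhds_prod_eq] at hK
      obtain ⟨P, hP, Q, hQ, hPQ⟩ := eventually_prod_iff.1 hK
      exact ⟨{θ | Q θ}, mem_nhdsWithin_of_mem_nhds hQ, K, hP.mono fun ε hε θ' hθ' => hPQ hε hθ'⟩)
  exact ⟨K, hK⟩

end Distance

end

/-! ### Trajectories with prescribed end points -/

section

variable {E : Type*} [NormedAddCommGroup E] [NormedSpace ℝ E]
variable {M : Type*} [TopologicalSpace M] [ChartedSpace E M] [IsManifold 𝓘(ℝ, E) ∞ M]

section Segment

variable {P P' : Type*} [NormedAddCommGroup P] [NormedSpace ℝ P] [NormedAddCommGroup P']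
  [NormedSpace ℝ P']

/-- The derivative of a parametrization `Ψ` of the manifold `M` by a vector space, in the
trivialization that underlies the definition of the tangent space. -/
def paramDeriv (Ψ : P → M) (b : P) : P →L[ℝ] E :=
  mfderiv 𝓘(ℝ, P) 𝓘(ℝ, E) Ψ b

/-- The momentum of a point of `T*M`, in the trivialization that underlies the definition of the
cotangent space. -/
def momentum (ζ : CotangentBundle E M) : E →L[ℝ] ℝ := ζ.2

lemma tautologicalForm_eq_momentum {Y : Type*} [NormedAddCommGroup Y] [NormedSpace ℝ Y]
    {ζ : Y → CotangentBundle E M} {Ψ : P → M} {l : Y →L[ℝ] P} {b : Y}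
    (h : ∀ᶠ b in 𝓝 b, (ζ b).proj = Ψ (l b)) (hΨ : MDifferentiableAt 𝓘(ℝ, P) 𝓘(ℝ, E) Ψ (l b)) (v : Y) :
    tautologicalForm ζ b v = momentum (ζ b) (paramDeriv Ψ (l b) (l v)) := by
  have h1 : HasMFDerivAt 𝓘(ℝ, Y) 𝓘(ℝ, E) (fun b => Ψ (l b)) b
      (show Y →L[ℝ] E from (paramDeriv Ψ (l b)).comp l) :=
    hΨ.hasMFDerivAt.comp b l.hasFDerivAt.hasMFDerivAt
  have h2 := (h1.congr_of_eventuallyEq (f₁ := fun b => (ζ b).proj) h).mfderiv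
  exact congrArg (momentum (ζ b)) (DFunLike.congr_fun h2 v)

lemma eventually_contMDiffAt_one {Ψ : P → M} {b : P} (hΨ : ContMDiffAt 𝓘(ℝ, P) 𝓘(ℝ, E) ∞ Ψ b) :
    ∀ᶠ b' in 𝓝 b, ContMDiffAt 𝓘(ℝ, P) 𝓘(ℝ, E) 1 Ψ b' :=
  (contMDiffAt_iff_contMDiffAt_nhds (by simp)).1 (contMDiffAt_infty.1 hΨ 1)

/-- If the projection to `M` of a `C¹` map `ζ` is smooth, then `ζ^*(p dq)` is `C¹`: no derivative is
lost. This makes the action twice differentiable. -/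
lemma contDiffAt_tautologicalForm {Y : Type*} [NormedAddCommGroup Y] [NormedSpace ℝ Y]
    {ζ : Y → CotangentBundle E M} {Ψ : P → M} {l : Y →L[ℝ] P} {b : Y}
    (h : ∀ᶠ b in 𝓝 b, (ζ b).proj = Ψ (l b)) (hΨ : ContMDiffAt 𝓘(ℝ, P) 𝓘(ℝ, E) ∞ Ψ (l b))
    (hζ : ContMDiffAt 𝓘(ℝ, Y) (coI E) 1 ζ b) :
    ContDiffAt ℝ 1 (tautologicalForm ζ) b := by
  have hsrc : ζ b ∈ (extChartAt (coI E) (ζ b)).source := mem_extChartAt_source _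
  have hΨl : ContMDiffAt 𝓘(ℝ, Y) 𝓘(ℝ, E) ∞ (fun b => Ψ (l b)) b :=
    hΨ.comp b l.contDiff.contMDiff.contMDiffAt
  have h1 : ContDiffAt ℝ 1 (fun y => (extChartAt (coI E) (ζ b) (ζ y)).2) b :=
    (contDiffAt_chart (by simp) (ζ b) hζ hsrc).snd
  have h2 : ContDiffAt ℝ ∞ (fun y => extChartAt 𝓘(ℝ, E) (ζ b).proj (Ψ (l y))) b := by
    rw [← contMDiffAt_iff_contDiffAt]
    have h3 : ContMDiffAt 𝓘(ℝ, E) 𝓘(ℝ, E) ∞ (extChartAt 𝓘(ℝ, E) (ζ b).proj) (Ψ (l b)) := by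
      rw [← h.self_of_nhds]; exact contMDiffAt_extChartAt
    exact h3.comp b hΨl
  have h4 : ContDiffAt ℝ 1 (fderiv ℝ fun y => extChartAt 𝓘(ℝ, E) (ζ b).proj (Ψ (l y))) b :=
    (contDiffAt_infty.1 h2 2).fderiv_right (by norm_num)
  refine (h1.clm_comp h4).congr_of_eventuallyEq ?_
  have hev : ∀ᶠ y in 𝓝 b, ζ y ∈ (extChartAt (coI E) (ζ b)).source :=
    hζ.continuousAt.eventually (extChartAt_source_mem_nhds _)
  filter_upwards [hev, h.eventually_nhds, eventually_contMDiffAt_one hΨl]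
    with y hy hyΨ hyd
  have h5 : (fun b => (ζ b).proj) =ᶠ[𝓝 y] fun b => Ψ (l b) := hyΨ
  rw [tautologicalForm_chart (ζ b) ((hyd.congr_of_eventuallyEq h5).mdifferentiableAt one_ne_zero) hy]
  congr 1
  refine Filter.EventuallyEq.fderiv_eq ?_
  filter_upwards [hyΨ] with y' hy'
  rw [extChartAt_fst, hy']

variable [FiniteDimensional ℝ E]

/-- A flow restricts to shorter, and extends to slightly longer, time intervals. -/
lemma IsFlowOn.restrict {H : CotangentBundle E M → ℝ}
    {Φ : CotangentBundle E M → ℝ → CotangentBundle E M} {U : Set (CotangentBundle E M)} {T δ : ℝ}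
    (hΦ : IsFlowOn H Φ U T δ) {T' : ℝ} (hT' : T' < T + δ) :
    ∃ δ', IsFlowOn H Φ U T' δ' := by
  have hsub : Ioo (-min δ (T + δ - T')) (T' + min δ (T + δ - T')) ⊆ Ioo (-δ) (T + δ) :=
    Ioo_subset_Ioo (neg_le_neg (min_le_left _ _)) (by linarith [min_le_right δ (T + δ - T')])
  exact ⟨min δ (T + δ - T'), hΦ.isOpen, lt_min hΦ.delta_pos (by linarith), hΦ.map_zero,
    fun ζ hζ t ht => hΦ.hamiltonian ζ hζ t (hsub ht),
    hΦ.contMDiffOn.mono (prod_mono_right hsub)⟩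

variable [T2Space M]

/-- A trajectory `z` with nonconjugate end points belongs to a family of trajectories of the same
energy, parametrized by the end points. In terms of parametrizations `Ψ`, `Ψ'` of neighbourhoods of
the end points, the derivative of the action of these trajectories is `p₊ dq₊ - p₋ dq₋`. -/
theorem exists_segment {H : CotangentBundle E M → ℝ} (hH : ContMDiff (coI E) 𝓘(ℝ, ℝ) 3 H)
    {e : ℝ} {z : ℝ → CotangentBundle E M} {T : ℝ} (hz : IsEnergyArc H e z T)
    (hnc : NonConjugate H z T) (hv : stateVelocity H (z T) ≠ 0)
    {Ψ : P → M} {b : P} (hΨ : ContMDiffAt 𝓘(ℝ, P) 𝓘(ℝ, E) ∞ Ψ b) (hb : Ψ b = (z 0).proj)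
    {Ψ' : P' → M} {b' : P'} (hΨ' : ContMDiffAt 𝓘(ℝ, P') 𝓘(ℝ, E) ∞ Ψ' b') (hb' : Ψ' b' = (z T).proj) :
    ∃ (Φ : CotangentBundle E M → ℝ → CotangentBundle E M) (U : Set (CotangentBundle E M)) (δ : ℝ)
      (ζ : P × P' → CotangentBundle E M) (τ : P × P' → ℝ),
      IsFlowOn H Φ U T δ ∧ EqOn (Φ (z 0)) z (Icc 0 T) ∧ ζ (b, b') = z 0 ∧ τ (b, b') = T ∧
      ContDiffAt ℝ 2 (fun p => localAction H e z T (Ψ p.1, Ψ' p.2)) (b, b') ∧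
      ∀ᶠ p in 𝓝 (b, b'), ContMDiffAt 𝓘(ℝ, P × P') (coI E) 1 ζ p ∧ ContDiffAt ℝ 1 τ p ∧
        ζ p ∈ U ∧ τ p ∈ Ioo 0 (T + δ) ∧ H (ζ p) = e ∧ (ζ p).proj = Ψ p.1 ∧
        (Φ (ζ p) (τ p)).proj = Ψ' p.2 ∧
        ∀ d, fderiv ℝ (fun p => localAction H e z T (Ψ p.1, Ψ' p.2)) p d =
          momentum (Φ (ζ p) (τ p)) (paramDeriv Ψ' p.2 d.2) - momentum (ζ p) (paramDeriv Ψ p.1 d.1) := by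
  have hT := hz.arc.pos
  obtain ⟨Φ, U, δ, hΦ, hU, heq⟩ := exists_flow hH hz.arc
  have hδ := hΦ.delta_pos
  obtain ⟨ζ, τ, hζ0, hτ0, hev⟩ := localAction_eq e hH hΦ hT hU (heq ⟨hT.le, le_rfl⟩)
    (hz.energy 0 ⟨le_rfl, hT.le⟩) hnc hv
  set q : P × P' → M × M := fun p => (Ψ p.1, Ψ' p.2) with hq
  have hqd : ContMDiffAt 𝓘(ℝ, P × P') (𝓘(ℝ, E).prod 𝓘(ℝ, E)) ∞ q (b, b') := by
    have h1 : ContMDiffAt 𝓘(ℝ, P × P') 𝓘(ℝ, P) ∞ (fun p : P × P' => p.1) (b, b') :=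
      contMDiffAt_iff_contDiffAt.2 contDiffAt_fst
    have h2 : ContMDiffAt 𝓘(ℝ, P × P') 𝓘(ℝ, P') ∞ (fun p : P × P' => p.2) (b, b') :=
      contMDiffAt_iff_contDiffAt.2 contDiffAt_snd
    exact (ContMDiffAt.comp (b, b') (g := Ψ) hΨ h1).prodMk (ContMDiffAt.comp (b, b') (g := Ψ') hΨ' h2)
  have hqb : q (b, b') = ((z 0).proj, (z T).proj) := by rw [hq]; simp only [hb, hb']
  have hqt : Tendsto q (𝓝 (b, b')) (𝓝 ((z 0).proj, (z T).proj)) := by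
    rw [← hqb]; exact hqd.continuousAt
  have hΨ1 : ∀ᶠ p : P × P' in 𝓝 (b, b'), ContMDiffAt 𝓘(ℝ, P) 𝓘(ℝ, E) 1 Ψ p.1 :=
    continuousAt_fst.eventually (eventually_contMDiffAt_one hΨ)
  have hΨ1' : ∀ᶠ p : P × P' in 𝓝 (b, b'), ContMDiffAt 𝓘(ℝ, P') 𝓘(ℝ, E) 1 Ψ' p.2 :=
    continuousAt_snd.eventually (eventually_contMDiffAt_one hΨ')
  have hq1 := contMDiffAt_iff_contMDiffAt_nhds (by simp) |>.1 (contMDiffAt_infty.1 hqd 1)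
  have hev' := hqt.eventually hev
  have hmain : ∀ᶠ p in 𝓝 (b, b'), ContMDiffAt 𝓘(ℝ, P × P') (coI E) 1 (fun p => ζ (q p)) p ∧
      ContDiffAt ℝ 1 (fun p => τ (q p)) p ∧
      ζ (q p) ∈ U ∧ τ (q p) ∈ Ioo 0 (T + δ) ∧ H (ζ (q p)) = e ∧ (ζ (q p)).proj = Ψ p.1 ∧
      (Φ (ζ (q p)) (τ (q p))).proj = Ψ' p.2 ∧
      localAction H e z T (q p) = ∫ t in (0 : ℝ)..τ (q p), actionDensity H (Φ (ζ (q p)) t) := by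
    filter_upwards [hq1, hev'] with p hp1 hp2
    exact ⟨hp2.1.comp p hp1, contMDiffAt_iff_contDiffAt.1 (hp2.2.1.comp p hp1), hp2.2.2⟩
  have hω : ∀ᶠ p in 𝓝 (b, b'), ContMDiffAt 𝓘(ℝ, P × P') (coI E) 1
      (fun p => Φ (ζ (q p)) (τ (q p))) p := by
    filter_upwards [hmain] with p hp
    exact hΦ.contMDiffAt_comp hp.1 (contMDiffAt_iff_contDiffAt.2 hp.2.1) hp.2.2.1
      ⟨by linarith [hp.2.2.2.1.1], hp.2.2.2.1.2⟩
  -- the first variation formula, at all points near the given end points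
  have hfirst : ∀ᶠ p in 𝓝 (b, b'), HasFDerivAt (fun p => localAction H e z T (q p))
      (tautologicalForm (fun p => Φ (ζ (q p)) (τ (q p))) p - tautologicalForm (fun p => ζ (q p)) p) p := by
    filter_upwards [hmain.eventually_nhds] with p hp
    obtain ⟨h1, h2, h3, h4, h5, -⟩ := hp.self_of_nhds
    obtain ⟨δ', hΦ'⟩ := hΦ.restrict h4.2
    have h6 := first_variation hH hΦ' h4.1.le (ζ := fun p => ζ (q p)) (τ := fun p => τ (q p)) h1 h3
      (hp.mono fun p' h => h.2.2.2.2.1) (h2.differentiableAt one_ne_zero) rfl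
    exact h6.congr_of_eventuallyEq (hp.mono fun p' h => h.2.2.2.2.2.2.2)
  refine ⟨Φ, U, δ, fun p => ζ (q p), fun p => τ (q p), hΦ, heq, ?_, ?_, ?_, ?_⟩
  · simp only [hqb, hζ0]
  · simp only [hqb, hτ0]
  · rw [show (2 : WithTop ℕ∞) = (1 : ℕ) + 1 by norm_num, contDiffAt_succ_iff_hasFDerivAt]
    refine ⟨_, ⟨_, hfirst, fun p hp => hp⟩, ?_⟩
    rw [Nat.cast_one]
    refine ContDiffAt.sub ?_ ?_
    · exact contDiffAt_tautologicalForm (l := .snd ℝ P P') (b := (b, b'))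
        (hmain.mono fun p h => h.2.2.2.2.2.2.1) hΨ' hω.self_of_nhds
    · exact contDiffAt_tautologicalForm (l := .fst ℝ P P') (b := (b, b'))
        (hmain.mono fun p h => h.2.2.2.2.2.1) hΨ hmain.self_of_nhds.1
  · filter_upwards [hmain.eventually_nhds, hfirst, hΨ1, hΨ1'] with p hp hp1 hp2 hp3
    obtain ⟨h1, h2, h3, h4, h5, h6, h7, -⟩ := hp.self_of_nhds
    refine ⟨h1, h2, h3, h4, h5, h6, h7, fun d => ?_⟩
    rw [hp1.fderiv, sub_apply]
    rw [tautologicalForm_eq_momentum (l := .snd ℝ P P') (hp.mono fun p h => h.2.2.2.2.2.2.1)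
      (hp3.mdifferentiableAt one_ne_zero), tautologicalForm_eq_momentum (l := .fst ℝ P P')
      (hp.mono fun p h => h.2.2.2.2.2.1) (hp2.mdifferentiableAt one_ne_zero)]
    rfl

end Segment

end

/-! ### The geometry of thin tubes -/

section

section TubeBoundary

variable {E : Type*} [NormedAddCommGroup E] [NormedSpace ℝ E]
variable {M : Type*} [TopologicalSpace M] [ChartedSpace E M] [IsManifold 𝓘(ℝ, E) ∞ M]
variable {F G : Type*} [NormedAddCommGroup F] [NormedSpace ℝ F] [NormedAddCommGroup G]
  [NormedSpace ℝ G] {S S' : ℝ → Set M} {Ψ : F × G → M} {D : F → Set G} {ξ₀ : F} {η₀ : G}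
  {ρ : F × G → ℝ}

omit [NormedSpace ℝ F] in
lemma tendsto_scaling (ξ₀ : F) (η₀ : G) :
    Tendsto (fun p : ℝ × F × G => (p.2.1, p.1 • p.2.2)) (𝓝 (0, ξ₀, η₀)) (𝓝 (ξ₀, 0)) := by
  have h : Continuous (fun p : ℝ × F × G => (p.2.1, p.1 • p.2.2)) := by fun_prop
  exact h.tendsto' _ _ (by simp)

omit [IsManifold 𝓘(ℝ, E) ∞ M] in
/-- The zeros of the defining function lie on the boundary of the tube and not in the tube. -/
lemma IsLocalTube.eventually_mem_boundary (h : IsLocalTube (E := E) S S' Ψ D ξ₀)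
    (hρ : IsDefiningFunction D ρ (ξ₀, η₀)) :
    ∀ᶠ p : ℝ × F × G in 𝓝 (0, ξ₀, η₀), 0 < p.1 → ρ p.2 = 0 →
      Ψ (p.2.1, p.1 • p.2.2) ∈ S' p.1 ∧ Ψ (p.2.1, p.1 • p.2.2) ∉ S p.1 := by
  obtain ⟨ε₁, hε₁, hof⟩ := h.of_mem
  have hsnd : Tendsto (fun p : ℝ × F × G => p.2) (𝓝 (0, ξ₀, η₀)) (𝓝 (ξ₀, η₀)) :=
    continuous_snd.tendsto _
  have hξ : Tendsto (fun p : ℝ × F × G => p.2.1) (𝓝 (0, ξ₀, η₀)) (𝓝 ξ₀) :=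
    (continuous_fst.comp continuous_snd).tendsto _
  have hopen : ∀ᶠ p : F × G in 𝓝 (ξ₀, η₀), IsOpen (D p.1) :=
    (continuous_fst.tendsto' (ξ₀, η₀) ξ₀ rfl : Tendsto (fun p : F × G => p.1) _ _).eventually h.isOpen
  have hε : ∀ᶠ p : ℝ × F × G in 𝓝 (0, ξ₀, η₀), p.1 < ε₁ :=
    (continuous_fst.tendsto _).eventually (gt_mem_nhds hε₁)
  filter_upwards [(tendsto_scaling ξ₀ η₀).eventually hof, hsnd.eventually (hρ.eventually_mem_frontier hopen),
    hsnd.eventually hρ.mem_iff, hξ.eventually h.mem_boundary, hε] with p h1 h2 h3 h4 h5 hpos hzero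
  refine ⟨h4 _ _ (h2 hzero), fun hmem => ?_⟩
  have h6 := (h1 p.1 ⟨hpos, h5⟩).1 hmem
  rw [inv_smul_smul₀ hpos.ne'] at h6
  exact absurd (h3.1 h6) (by rw [hzero]; exact lt_irrefl 0)

/-- The tangent space of the boundary of the tube is the kernel of the derivative of the defining
function. -/
lemma IsLocalTube.eventually_annihilates [FiniteDimensional ℝ F] [FiniteDimensional ℝ G]
    (h : IsLocalTube (E := E) S S' Ψ D ξ₀)
    (hρ : IsDefiningFunction D ρ (ξ₀, η₀)) :
    ∀ᶠ p : ℝ × F × G in 𝓝 (0, ξ₀, η₀), 0 < p.1 → ∀ (α : E →L[ℝ] ℝ) (μ : ℝ),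
      (∀ a w, α (paramDeriv Ψ (p.2.1, p.1 • p.2.2) (a, w)) = μ * fderiv ℝ ρ p.2 (p.1 • a, w)) →
      ∀ v ∈ tangentSpan (E := E) (S' p.1) (Ψ (p.2.1, p.1 • p.2.2)), α v = 0 := by
  obtain ⟨ε₁, hε₁, hof⟩ := h.of_mem
  obtain ⟨Θ, hΘ, hΘΨ, hΨΘ⟩ := exists_local_inverse h.contMDiffAt h.bijective
  have hsnd : Tendsto (fun p : ℝ × F × G => p.2) (𝓝 (0, ξ₀, η₀)) (𝓝 (ξ₀, η₀)) :=
    continuous_snd.tendsto _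
  have hε : ∀ᶠ p : ℝ × F × G in 𝓝 (0, ξ₀, η₀), p.1 < ε₁ :=
    (continuous_fst.tendsto _).eventually (gt_mem_nhds hε₁)
  have hΘ1 : ∀ᶠ q in 𝓝 (Ψ (ξ₀, 0)), ContMDiffAt 𝓘(ℝ, E) 𝓘(ℝ, F × G) 1 Θ q :=
    (contMDiffAt_iff_contMDiffAt_nhds (by simp)).1 (contMDiffAt_infty.1 hΘ 1)
  have hsc := tendsto_scaling ξ₀ η₀
  have hscΨ : Tendsto (fun p : ℝ × F × G => Ψ (p.2.1, p.1 • p.2.2)) (𝓝 (0, ξ₀, η₀)) (𝓝 (Ψ (ξ₀, 0))) :=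
    h.contMDiffAt.continuousAt.tendsto.comp hsc
  filter_upwards [hsc.eventually hof.eventually_nhds, hsc.eventually hΘΨ,
    hscΨ.eventually hΨΘ.eventually_nhds, hscΨ.eventually hΘ1,
    hsc.eventually (eventually_contMDiffAt_one h.contMDiffAt),
    hsnd.eventually hρ.eventually_eq_zero_of_mem_frontier.eventually_nhds,
    hsnd.eventually (hρ.contDiffAt.eventually (by simp)), hε]
    with p h1 h2 h3 h4 h5 h6 h7 h8 hpos α μ hα v hv
  set b := (p.2.1, p.1 • p.2.2) with hb
  suffices hle : tangentSpan (E := E) (S' p.1) (Ψ b) ≤ LinearMap.ker (show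
      TangentSpace 𝓘(ℝ, E) (Ψ b) →ₗ[ℝ] ℝ from α.toLinearMap) from hle hv
  refine Submodule.span_le.2 ?_
  rintro v ⟨c, hc, hcS, hcv⟩
  have hc0 : c 0 = Ψ b := congrArg TotalSpace.proj hcv
  -- the curve in the coordinates given by `Ψ`
  have hk : MDifferentiableAt 𝓘(ℝ, ℝ) 𝓘(ℝ, F × G) (fun s => Θ (c s)) 0 := by
    refine MDifferentiableAt.comp (I' := 𝓘(ℝ, E)) (0 : ℝ) (g := Θ) ?_ hc
    rw [hc0]; exact h4.mdifferentiableAt one_ne_zero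
  obtain ⟨k', hk'⟩ : ∃ k' : F × G, HasDerivAt (fun s => Θ (c s)) k' 0 :=
    ⟨_, (mdifferentiableAt_iff_differentiableAt.1 hk).hasDerivAt⟩
  have hk0 : Θ (c 0) = b := by rw [hc0, h2]
  have hcc : ContinuousAt c 0 := hc.continuousAt
  have hcΨ : c =ᶠ[𝓝 0] fun s => Ψ (Θ (c s)) := by
    have h9 : ∀ᶠ q in 𝓝 (c 0), Ψ (Θ q) = q := by rw [hc0]; exact h3
    exact (hcc.eventually h9).mono fun s hs => hs.symm
  have hcd : HasMFDerivAt 𝓘(ℝ, ℝ) 𝓘(ℝ, E) (fun s => Ψ (Θ (c s))) 0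
      (show ℝ →L[ℝ] E from (paramDeriv Ψ b).comp (ContinuousLinearMap.toSpanSingleton ℝ k')) := by
    refine HasMFDerivAt.comp (0 : ℝ) (g := Ψ) (g' := (show F × G →L[ℝ] E from paramDeriv Ψ b))
      (f := fun s => Θ (c s)) ?_ hk'.hasFDerivAt.hasMFDerivAt
    rw [hk0]; exact (h5.mdifferentiableAt one_ne_zero).hasMFDerivAt
  have hvk : (show E from v) = paramDeriv Ψ b k' := by
    have e1 := (hcd.congr_of_eventuallyEq hcΨ).mfderiv
    have e2 : (show ℝ →L[ℝ] E from mfderiv 𝓘(ℝ, ℝ) 𝓘(ℝ, E) c 0) (1 : ℝ) = v :=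
      eq_of_tangentBundle_mk_eq hcv
    have e3 := DFunLike.congr_fun (show (show ℝ →L[ℝ] E from mfderiv 𝓘(ℝ, ℝ) 𝓘(ℝ, E) c 0) =
      (paramDeriv Ψ b).comp (ContinuousLinearMap.toSpanSingleton ℝ k') from e1) (1 : ℝ)
    rw [e2] at e3
    simpa using e3
  -- the defining function vanishes along the rescaled curve
  have hr : HasDerivAt (fun s => ((Θ (c s)).1, p.1⁻¹ • (Θ (c s)).2)) (k'.1, p.1⁻¹ • k'.2) 0 := by
    have hd1 : HasDerivAt (fun s => (Θ (c s)).1) k'.1 0 := hk'.fst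
    have hd2 : HasDerivAt (fun s => (Θ (c s)).2) k'.2 0 := hk'.snd
    exact hd1.prodMk (hd2.const_smul p.1⁻¹)
  have hr0 : ((Θ (c 0)).1, p.1⁻¹ • (Θ (c 0)).2) = p.2 := by
    rw [hk0, hb]; simp only [inv_smul_smul₀ hpos.ne']
  have hρd := (h7.differentiableAt one_ne_zero).hasFDerivAt.comp_hasDerivAt_of_eq (0 : ℝ) hr hr0.symm
  have hzero : (fun s => ρ ((Θ (c s)).1, p.1⁻¹ • (Θ (c s)).2)) =ᶠ[𝓝 0] fun _ => 0 := by
    have t1 : Tendsto (fun s => Θ (c s)) (𝓝 0) (𝓝 b) := by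
      rw [← hk0]; exact hk'.continuousAt
    have t2 : Tendsto (fun s => ((Θ (c s)).1, p.1⁻¹ • (Θ (c s)).2)) (𝓝 0) (𝓝 p.2) := by
      have := hr.continuousAt.tendsto
      rwa [hr0] at this
    filter_upwards [t1.eventually h1, t2.eventually h6, hcS, hcΨ] with s s1 s2 s3 s4
    exact s2 ((s1 p.1 ⟨hpos, h8⟩).2 (s4 ▸ s3))
  have hz := (hρd.congr_of_eventuallyEq hzero.symm).unique (hasDerivAt_const (0 : ℝ) (0 : ℝ))
  change α (show E from v) = 0
  rw [hvk, show k' = (k'.1, k'.2) from rfl, hα]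
  have hs : ((p.1 • k'.1, k'.2) : F × G) = p.1 • (k'.1, p.1⁻¹ • k'.2) := by
    rw [Prod.smul_mk, smul_inv_smul₀ hpos.ne']
  rw [hs, map_smul, hz, smul_zero, mul_zero]

/-- A family of curves that start on the boundaries of the thin tubes with outward velocities leaves
the tubes and does not return for some time, uniformly in the thickness of the tubes. -/
lemma IsLocalTube.exists_exit [FiniteDimensional ℝ F] [FiniteDimensional ℝ G]
    (h : IsLocalTube (E := E) S S' Ψ D ξ₀)
    (hρ : IsDefiningFunction D ρ (ξ₀, η₀)) {Q : Type*} [NormedAddCommGroup Q] [NormedSpace ℝ Q]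
    {c : Q × ℝ → M} {q₀ : Q} {pr : Q → F × G} (hpr : ContinuousAt pr q₀) (hpr0 : pr q₀ = (ξ₀, 0))
    (hc : ContMDiffAt 𝓘(ℝ, Q × ℝ) 𝓘(ℝ, E) 1 c (q₀, 0)) (hc0 : ∀ᶠ q in 𝓝 q₀, c (q, 0) = Ψ (pr q))
    {v : E} {L : ℝ →L[ℝ] E} (hL : HasMFDerivAt 𝓘(ℝ, ℝ) 𝓘(ℝ, E) (fun t => c (q₀, t)) 0 L)
    (hLv : L 1 = v)
    (hv : ∀ w, paramDeriv Ψ (ξ₀, 0) w = v → 0 < fderiv ℝ ρ (ξ₀, η₀) (0, w.2)) :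
    ∃ δ > (0 : ℝ), ∀ᶠ x : ℝ × Q × G in 𝓝 (0, q₀, η₀), 0 < x.1 → ρ ((pr x.2.1).1, x.2.2) = 0 →
      (pr x.2.1).2 = x.1 • x.2.2 → ∀ t ∈ Ioo 0 δ, c (x.2.1, t) ∉ S x.1 ∧ c (x.2.1, t) ∉ S' x.1 := by
  obtain ⟨ε₁, hε₁, hof⟩ := h.of_mem
  obtain ⟨Θ, hΘ, hΘΨ, hΨΘ⟩ := exists_local_inverse h.contMDiffAt h.bijective
  have hcq : c (q₀, 0) = Ψ (ξ₀, 0) := by rw [hc0.self_of_nhds, hpr0]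
  have hk : ContDiffAt ℝ 1 (fun y => Θ (c y)) (q₀, 0) := by
    refine contMDiffAt_iff_contDiffAt.1 (ContMDiffAt.comp (q₀, (0 : ℝ)) (g := Θ) ?_ hc)
    rw [hcq]; exact contMDiffAt_infty.1 hΘ 1
  set A := fderiv ℝ (fun y => Θ (c y)) (q₀, 0) with hA
  have hstrict : HasStrictFDerivAt (fun y => Θ (c y)) A (q₀, 0) := hk.hasStrictFDerivAt one_ne_zero
  have hk0 : Θ (c (q₀, 0)) = (ξ₀, 0) := by rw [hcq, hΘΨ.self_of_nhds]
  have hkt : Tendsto (fun y => Θ (c y)) (𝓝 (q₀, 0)) (𝓝 (ξ₀, 0)) := by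
    have := hk.continuousAt.tendsto; rwa [hk0] at this
  have hct : Tendsto c (𝓝 (q₀, 0)) (𝓝 (Ψ (ξ₀, 0))) := by
    have := hc.continuousAt.tendsto; rwa [hcq] at this
  -- the velocity in the coordinates given by `Ψ`
  have hvel : paramDeriv Ψ (ξ₀, 0) (A (0, 1)) = v := by
    have hl : HasDerivAt (fun t : ℝ => (q₀, t)) ((0 : Q), (1 : ℝ)) 0 :=
      (hasDerivAt_const _ _).prodMk (hasDerivAt_id _)
    have e1 : HasDerivAt (fun t => Θ (c (q₀, t))) (A (0, 1)) 0 :=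
      hstrict.hasFDerivAt.comp_hasDerivAt_of_eq (0 : ℝ) hl rfl
    have e2 : HasMFDerivAt 𝓘(ℝ, ℝ) 𝓘(ℝ, E) (fun t => Ψ (Θ (c (q₀, t)))) 0 (show ℝ →L[ℝ] E from
        (paramDeriv Ψ (ξ₀, 0)).comp (ContinuousLinearMap.toSpanSingleton ℝ (A (0, 1)))) := by
      refine HasMFDerivAt.comp (0 : ℝ) (g := Ψ) (g' := (show F × G →L[ℝ] E from paramDeriv Ψ (ξ₀, 0)))
        (f := fun t => Θ (c (q₀, t))) ?_ e1.hasFDerivAt.hasMFDerivAt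
      rw [hk0]; exact (h.contMDiffAt.mdifferentiableAt (by simp)).hasMFDerivAt
    have e3 : (fun t => c (q₀, t)) =ᶠ[𝓝 0] fun t => Ψ (Θ (c (q₀, t))) := by
      have h9 : Tendsto (fun t => c (q₀, t)) (𝓝 0) (𝓝 (Ψ (ξ₀, 0))) :=
        hct.comp (Continuous.tendsto' (by fun_prop) _ _ rfl)
      exact (h9.eventually hΨΘ).mono fun s hs => hs.symm
    have e4 := hL.mfderiv.symm.trans (e2.congr_of_eventuallyEq e3).mfderiv
    have e5 := DFunLike.congr_fun (show L = (paramDeriv Ψ (ξ₀, 0)).comp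
      (ContinuousLinearMap.toSpanSingleton ℝ (A (0, 1))) from e4) (1 : ℝ)
    rw [hLv] at e5
    simpa using e5.symm
  obtain ⟨δ₁, hδ₁, hexit⟩ := hρ.exists_exit (hv _ hvel) h.convex (K := 1 + ‖A (0, 1)‖) (by positivity)
  have hbound : ∀ᶠ y : (Q × ℝ) × (Q × ℝ) in 𝓝 ((q₀, 0), (q₀, 0)),
      ‖Θ (c y.1) - Θ (c y.2) - A (y.1 - y.2)‖ ≤ min δ₁ 1 * ‖y.1 - y.2‖ :=
    hstrict.isLittleO.bound (lt_min hδ₁ one_pos)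
  have hpair : Tendsto (fun y : Q × ℝ => (y, (y.1, (0 : ℝ)))) (𝓝 (q₀, 0)) (𝓝 ((q₀, 0), (q₀, 0))) :=
    Continuous.tendsto' (by fun_prop) _ _ rfl
  have hall := (hpair.eventually hbound).and ((hkt.eventually hof).and (hct.eventually hΨΘ))
  rw [nhds_prod_eq] at hall
  obtain ⟨P, hP, R, hR, hPR⟩ := eventually_prod_iff.1 hall
  obtain ⟨δ₂, hδ₂, hRδ⟩ := Metric.eventually_nhds_iff.1 hR
  have tq : Tendsto (fun x : ℝ × Q × G => x.2.1) (𝓝 (0, q₀, η₀)) (𝓝 q₀) :=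
    Continuous.tendsto' (by fun_prop) _ _ rfl
  have tη : Tendsto (fun x : ℝ × Q × G => x.2.2) (𝓝 (0, q₀, η₀)) (𝓝 η₀) :=
    Continuous.tendsto' (by fun_prop) _ _ rfl
  have tε : Tendsto (fun x : ℝ × Q × G => x.1) (𝓝 (0, q₀, η₀)) (𝓝 0) :=
    Continuous.tendsto' (by fun_prop) _ _ rfl
  have tpr : Tendsto (fun x : ℝ × Q × G => pr x.2.1) (𝓝 (0, q₀, η₀)) (𝓝 (ξ₀, 0)) := by
    rw [← hpr0]; exact hpr.tendsto.comp tq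
  have tp : Tendsto (fun x : ℝ × Q × G => ((pr x.2.1).1, x.2.2)) (𝓝 (0, q₀, η₀)) (𝓝 (ξ₀, η₀)) :=
    (continuous_fst.tendsto _ |>.comp tpr).prodMk_nhds tη
  refine ⟨min δ₁ δ₂, lt_min hδ₁ hδ₂, ?_⟩
  filter_upwards [tq.eventually hP, tq.eventually hc0, tpr.eventually hΘΨ,
    tε.eventually (gt_mem_nhds (lt_min hδ₁ hε₁)), tp.eventually (Metric.ball_mem_nhds _ hδ₁)]
    with x x1 x2 x3 x4 x5 hpos hzero hscale t ht
  have ht2 : R t := hRδ (by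
    rw [Real.dist_eq, sub_zero, abs_of_pos ht.1]; exact ht.2.trans_le (min_le_right _ _))
  obtain ⟨y1, y2, y3⟩ := hPR x1 ht2
  set k := Θ (c (x.2.1, t))
  have hd : ‖k - pr x.2.1 - t • A (0, 1)‖ ≤ min δ₁ 1 * t := by
    have e1 : ((x.2.1, t) : Q × ℝ) - (x.2.1, 0) = t • (0, 1) := by simp
    have y1' : ‖Θ (c (x.2.1, t)) - Θ (c (x.2.1, 0)) - A ((x.2.1, t) - (x.2.1, 0))‖ ≤
      min δ₁ 1 * ‖((x.2.1, t) : Q × ℝ) - (x.2.1, 0)‖ := y1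
    rw [x2, x3, e1, map_smul, norm_smul, Real.norm_of_nonneg ht.1.le] at y1'
    simpa [Prod.norm_def] using y1'
  have hd1 : ‖k.1 - (pr x.2.1).1‖ ≤ (1 + ‖A (0, 1)‖) * t := by
    have e1 : ‖k.1 - (pr x.2.1).1 - t • (A (0, 1)).1‖ ≤ min δ₁ 1 * t :=
      (norm_fst_le (k - pr x.2.1 - t • A (0, 1))).trans hd
    have e2 : ‖t • (A (0, 1)).1‖ ≤ ‖A (0, 1)‖ * t := by
      rw [norm_smul, Real.norm_of_nonneg ht.1.le, mul_comm]
      exact mul_le_mul_of_nonneg_right (norm_fst_le _) ht.1.le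
    have e3 : min δ₁ 1 * t ≤ 1 * t := mul_le_mul_of_nonneg_right (min_le_right _ _) ht.1.le
    have e4 := norm_add_le (k.1 - (pr x.2.1).1 - t • (A (0, 1)).1) (t • (A (0, 1)).1)
    rw [sub_add_cancel] at e4
    linarith
  have hd2 : ‖k.2 - x.1 • x.2.2 - t • (A (0, 1)).2‖ ≤ δ₁ * t := by
    rw [← hscale]
    exact ((norm_snd_le (k - pr x.2.1 - t • A (0, 1))).trans hd).trans
      (mul_le_mul_of_nonneg_right (min_le_left _ _) ht.1.le)
  have hout := hexit x.1 t ((pr x.2.1).1, x.2.2) k.1 k.2 ⟨hpos, x4.trans_le (min_le_left _ _)⟩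
    ⟨ht.1, ht.2.trans_le (min_le_left _ _)⟩ (by simpa [dist_eq_norm] using x5) hzero hd1 hd2
  have hmem := y2 x.1 ⟨hpos, x4.trans_le (min_le_right _ _)⟩
  have y3' : Ψ k = c (x.2.1, t) := y3
  rw [← y3']
  exact ⟨fun hS => hout (subset_closure (hmem.1 hS)),
    fun hS => hout (frontier_subset_closure (hmem.2 hS))⟩

omit [ChartedSpace E M] [IsManifold 𝓘(ℝ, E) ∞ M] in
/-- Curves that stay away from the scatterer stay away from the thin tubes. -/
lemma eventually_avoid {C : Set M}
    (havoid : ∀ q ∉ C, ∃ O ∈ 𝓝 q, ∃ ε₁ > (0 : ℝ), ∀ y ∈ O, ∀ ε ∈ Ioo 0 ε₁, y ∉ S ε ∧ y ∉ S' ε)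
    {Q : Type*} [TopologicalSpace Q] {c : Q × ℝ → M} {q₀ : Q} {a b : ℝ}
    (hc : ∀ t ∈ Icc a b, ContinuousAt c (q₀, t)) (hcC : ∀ t ∈ Icc a b, c (q₀, t) ∉ C) :
    ∀ᶠ x : ℝ × Q in 𝓝 (0, q₀), 0 < x.1 → ∀ t ∈ Icc a b, c (x.2, t) ∉ S x.1 ∧ c (x.2, t) ∉ S' x.1 := by
  have key : ∀ᶠ x : ℝ × Q in 𝓝 (0, q₀), ∀ t ∈ Icc a b,
      0 < x.1 → c (x.2, t) ∉ S x.1 ∧ c (x.2, t) ∉ S' x.1 := by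
    refine isCompact_Icc.eventually_forall_of_forall_eventually (P := fun (x : ℝ × Q) t =>
      0 < x.1 → c (x.2, t) ∉ S x.1 ∧ c (x.2, t) ∉ S' x.1) fun t ht => ?_
    obtain ⟨O, hO, ε₁, hε₁, hav⟩ := havoid _ (hcC t ht)
    have h1 : Tendsto (fun y : (ℝ × Q) × ℝ => c (y.1.2, y.2)) (𝓝 ((0, q₀), t)) (𝓝 (c (q₀, t))) :=
      (hc t ht).tendsto.comp (Continuous.tendsto' (by fun_prop) _ _ rfl)
    have h2 : ∀ᶠ y : (ℝ × Q) × ℝ in 𝓝 ((0, q₀), t), y.1.1 < ε₁ :=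
      (Continuous.tendsto' (by fun_prop) _ _ rfl : Tendsto (fun y : (ℝ × Q) × ℝ => y.1.1)
        (𝓝 ((0, q₀), t)) (𝓝 0)).eventually (gt_mem_nhds hε₁)
    filter_upwards [h1.eventually hO, h2] with y hy1 hy2 hpos
    exact hav _ hy1 _ ⟨hpos, hy2⟩
  exact key.mono fun x hx hpos t ht => hx t ht hpos

end TubeBoundary

end

/-! ### Trajectories that avoid the tubes -/

section

section Avoid

variable {E : Type*} [NormedAddCommGroup E] [NormedSpace ℝ E] [FiniteDimensional ℝ E]
variable {M : Type*} [TopologicalSpace M] [ChartedSpace E M] [IsManifold 𝓘(ℝ, E) ∞ M]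

/-- The underlying curves of a flow in `M` have the velocity `stateVelocity`. -/
lemma IsFlowOn.hasMFDerivAt_proj {H : CotangentBundle E M → ℝ}
    {Φ : CotangentBundle E M → ℝ → CotangentBundle E M} {U : Set (CotangentBundle E M)} {T δ : ℝ}
    (hΦ : IsFlowOn H Φ U T δ) {ζ : CotangentBundle E M} (hζ : ζ ∈ U) {t : ℝ}
    (ht : t ∈ Ioo (-δ) (T + δ)) : ∃ L : ℝ →L[ℝ] E,
      HasMFDerivAt 𝓘(ℝ, ℝ) 𝓘(ℝ, E) (fun r => (Φ ζ r).proj) t L ∧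
      L 1 = (show E from stateVelocity H (Φ ζ t)) := by
  have h1 := hΦ.hamiltonian ζ hζ t ht
  have h2 := mdifferentiableWithinAt_univ.1 (hasMFDerivWithinAt_proj h1)
  refine ⟨mfderiv 𝓘(ℝ, ℝ) 𝓘(ℝ, E) (fun r => (Φ ζ r).proj) t, h2.hasMFDerivAt, ?_⟩
  have h3 := velocity_eq h1 uniqueDiffWithinAt_univ
  rw [mfderivWithin_univ] at h3
  exact h3

variable {F G F' G' : Type*} [NormedAddCommGroup F] [NormedSpace ℝ F] [NormedAddCommGroup G]
  [NormedSpace ℝ G] [NormedAddCommGroup F'] [NormedSpace ℝ F'] [NormedAddCommGroup G']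
  [NormedSpace ℝ G'] [FiniteDimensional ℝ F] [FiniteDimensional ℝ G] [FiniteDimensional ℝ F']
  [FiniteDimensional ℝ G']

/-- Trajectories between the boundaries of thin tubes around the end points of a trajectory `z` that
does not meet the scatterer in between do not meet the tubes in between. -/
theorem segment_avoids {H : CotangentBundle E M → ℝ}
    {Φ : CotangentBundle E M → ℝ → CotangentBundle E M} {U : Set (CotangentBundle E M)} {T δ : ℝ}
    (hΦ : IsFlowOn H Φ U T δ) (hT : 0 < T) {z : ℝ → CotangentBundle E M} (hzU : z 0 ∈ U)
    (hz : EqOn (Φ (z 0)) z (Icc 0 T)) {S S' : ℝ → Set M} {C : Set M}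
    (havoid : ∀ q ∉ C, ∃ O ∈ 𝓝 q, ∃ ε₁ > (0 : ℝ), ∀ y ∈ O, ∀ ε ∈ Ioo 0 ε₁, y ∉ S ε ∧ y ∉ S' ε)
    (hzC : ∀ t ∈ Ioo 0 T, (z t).proj ∉ C)
    {Ψ : F × G → M} {D : F → Set G} {ξ₀ : F} {η₀ : G} {ρ : F × G → ℝ}
    {Ψ' : F' × G' → M} {D' : F' → Set G'} {ξ₀' : F'} {η₀' : G'} {ρ' : F' × G' → ℝ}
    (h : IsLocalTube (E := E) S S' Ψ D ξ₀) (hρ : IsDefiningFunction D ρ (ξ₀, η₀))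
    (h' : IsLocalTube (E := E) S S' Ψ' D' ξ₀') (hρ' : IsDefiningFunction D' ρ' (ξ₀', η₀'))
    {ζ : (F × G) × (F' × G') → CotangentBundle E M} {τ : (F × G) × (F' × G') → ℝ}
    (hζ : ContMDiffAt 𝓘(ℝ, (F × G) × (F' × G')) (coI E) 1 ζ ((ξ₀, 0), (ξ₀', 0)))
    (hτ : ContDiffAt ℝ 1 τ ((ξ₀, 0), (ξ₀', 0)))
    (hζ0 : ζ ((ξ₀, 0), (ξ₀', 0)) = z 0) (hτ0 : τ ((ξ₀, 0), (ξ₀', 0)) = T)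
    (hstart : ∀ᶠ q in 𝓝 ((ξ₀, 0), (ξ₀', 0)), (ζ q).proj = Ψ q.1)
    (hend : ∀ᶠ q in 𝓝 ((ξ₀, 0), (ξ₀', 0)), (Φ (ζ q) (τ q)).proj = Ψ' q.2)
    (hv : ∀ w, paramDeriv Ψ (ξ₀, 0) w = (show E from stateVelocity H (z 0)) →
      0 < fderiv ℝ ρ (ξ₀, η₀) (0, w.2))
    (hv' : ∀ w, paramDeriv Ψ' (ξ₀', 0) w = (show E from stateVelocity H (z T)) →
      fderiv ℝ ρ' (ξ₀', η₀') (0, w.2) < 0) :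
    ∀ᶠ x : ℝ × ((F × G) × (F' × G')) × G × G' in 𝓝 (0, ((ξ₀, 0), (ξ₀', 0)), η₀, η₀'), 0 < x.1 →
      x.2.1.1.2 = x.1 • x.2.2.1 → x.2.1.2.2 = x.1 • x.2.2.2 →
      ρ (x.2.1.1.1, x.2.2.1) = 0 → ρ' (x.2.1.2.1, x.2.2.2) = 0 →
      ∀ t ∈ Ioo 0 (τ x.2.1), (Φ (ζ x.2.1) t).proj ∉ S x.1 ∧ (Φ (ζ x.2.1) t).proj ∉ S' x.1 := by
  have hδ := hΦ.delta_pos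
  set q₀ : (F × G) × (F' × G') := ((ξ₀, 0), (ξ₀', 0)) with hq₀
  have hζU : ζ q₀ ∈ U := by rw [hζ0]; exact hzU
  have hfst : ∀ y : ((F × G) × (F' × G')) × ℝ, ContMDiffAt 𝓘(ℝ, ((F × G) × (F' × G')) × ℝ)
      𝓘(ℝ, (F × G) × (F' × G')) 1 (fun y => y.1) y := fun y =>
    contMDiffAt_iff_contDiffAt.2 contDiffAt_fst
  have hζfst : ∀ t : ℝ, ContMDiffAt 𝓘(ℝ, ((F × G) × (F' × G')) × ℝ) (coI E) 1
      (fun y : ((F × G) × (F' × G')) × ℝ => ζ y.1) (q₀, t) := fun t =>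
    ContMDiffAt.comp (q₀, t) (g := ζ) (f := fun y : ((F × G) × (F' × G')) × ℝ => y.1) hζ (hfst _)
  have hcflow : ∀ t ∈ Icc 0 T, ContMDiffAt 𝓘(ℝ, ((F × G) × (F' × G')) × ℝ) 𝓘(ℝ, E) 1
      (fun y : ((F × G) × (F' × G')) × ℝ => (Φ (ζ y.1) y.2).proj) (q₀, t) := fun t ht =>
    contMDiffAt_proj_comp (by simp) (hΦ.contMDiffAt_comp (ζ := fun y => ζ y.1) (τ := fun y => y.2)
      (b := (q₀, t)) (hζfst t)
      (contMDiffAt_iff_contDiffAt.2 contDiffAt_snd) hζU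
      (show t ∈ Ioo (-δ) (T + δ) from ⟨by linarith [ht.1], by linarith [ht.2]⟩))
  have hcback : ContMDiffAt 𝓘(ℝ, ((F × G) × (F' × G')) × ℝ) 𝓘(ℝ, E) 1
      (fun y : ((F × G) × (F' × G')) × ℝ => (Φ (ζ y.1) (τ y.1 - y.2)).proj) (q₀, 0) := by
    refine contMDiffAt_proj_comp (by simp) (hΦ.contMDiffAt_comp (ζ := fun y => ζ y.1)
      (τ := fun y => τ y.1 - y.2) (b := (q₀, 0)) (hζfst 0)
      (contMDiffAt_iff_contDiffAt.2 ?_) hζU ?_)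
    · exact (ContDiffAt.comp (q₀, (0 : ℝ)) (g := τ) hτ contDiffAt_fst).sub contDiffAt_snd
    · simp only [hτ0, sub_zero]; exact ⟨by linarith, by linarith⟩
  have hzeq : Φ (ζ q₀) 0 = z 0 := by rw [hζ0]; exact hz ⟨le_rfl, hT.le⟩
  have hzeqT : Φ (ζ q₀) T = z T := by rw [hζ0]; exact hz ⟨hT.le, le_rfl⟩
  -- near the starting point
  obtain ⟨L, hL, hL1⟩ := hΦ.hasMFDerivAt_proj hζU (t := 0) ⟨by linarith, by linarith⟩
  rw [hzeq] at hL1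
  have hζev : ∀ᶠ q in 𝓝 q₀, ζ q ∈ U := hζ.continuousAt.eventually (hΦ.isOpen.mem_nhds hζU)
  obtain ⟨δ₁, hδ₁, hexit₁⟩ := h.exists_exit hρ (Q := (F × G) × (F' × G')) (pr := Prod.fst)
    (c := fun y => (Φ (ζ y.1) y.2).proj) continuousAt_fst (by rw [hq₀])
    (hcflow 0 ⟨le_rfl, hT.le⟩) (by
      filter_upwards [hstart, hζev] with q hq hqU
      simp only [hΦ.map_zero _ hqU, hq]) hL hL1 hv
  -- near the end point, with reversed time
  obtain ⟨L', hL', hL1'⟩ := hΦ.hasMFDerivAt_proj hζU (t := T) ⟨by linarith, by linarith⟩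
  rw [hzeqT] at hL1'
  have hLback : HasMFDerivAt 𝓘(ℝ, ℝ) 𝓘(ℝ, E) (fun t => (Φ (ζ q₀) (τ q₀ - t)).proj) 0 (-L') := by
    have e1 : HasDerivAt (fun t : ℝ => τ q₀ - t) (-1) 0 := by
      simpa using (hasDerivAt_id (0 : ℝ)).const_sub (τ q₀)
    have e2 : HasMFDerivAt 𝓘(ℝ, ℝ) 𝓘(ℝ, E) (fun r => (Φ (ζ q₀) r).proj) (τ q₀ - 0) L' := by
      rw [sub_zero, hτ0]; exact hL'
    have e3 := HasMFDerivAt.comp (0 : ℝ) (f := fun t : ℝ => τ q₀ - t) e2 e1.hasFDerivAt.hasMFDerivAt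
    have e4 : (show ℝ →L[ℝ] E from L'.comp (ContinuousLinearMap.toSpanSingleton ℝ (-1 : ℝ))) = -L' := by
      ext; simp
    rw [← e4]; exact e3
  obtain ⟨δ₂, hδ₂, hexit₂⟩ := h'.exists_exit hρ' (Q := (F × G) × (F' × G')) (pr := Prod.snd)
    (c := fun y => (Φ (ζ y.1) (τ y.1 - y.2)).proj) continuousAt_snd (by rw [hq₀])
    hcback (by simpa only [sub_zero] using hend) hLback (v := -(show E from stateVelocity H (z T)))
    (by rw [neg_apply, hL1']) (fun w hw => by
      have h1 := hv' (-w) (by rw [map_neg, hw, neg_neg])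
      have h2 : ((0, (-w).2) : F' × G') = -(0, w.2) := by simp
      rw [h2, map_neg] at h1
      linarith)
  -- in between
  have hmid := eventually_avoid (Q := (F × G) × (F' × G')) havoid
    (c := fun y => (Φ (ζ y.1) y.2).proj) (q₀ := q₀) (a := δ₁ / 2) (b := T - δ₂ / 2)
    (fun t ht => (hcflow t ⟨by linarith [ht.1], by linarith [ht.2]⟩).continuousAt)
    (fun t ht => by
      have ht' : t ∈ Ioo 0 T := ⟨by linarith [ht.1], by linarith [ht.2]⟩
      simp only [hζ0, hz ⟨ht'.1.le, ht'.2.le⟩]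
      exact hzC t ht')
  have t1 : Tendsto (fun x : ℝ × ((F × G) × (F' × G')) × G × G' => (x.1, x.2.1, x.2.2.1))
      (𝓝 (0, q₀, η₀, η₀')) (𝓝 (0, q₀, η₀)) := Continuous.tendsto' (by fun_prop) _ _ rfl
  have t2 : Tendsto (fun x : ℝ × ((F × G) × (F' × G')) × G × G' => (x.1, x.2.1, x.2.2.2))
      (𝓝 (0, q₀, η₀, η₀')) (𝓝 (0, q₀, η₀')) := Continuous.tendsto' (by fun_prop) _ _ rfl
  have t3 : Tendsto (fun x : ℝ × ((F × G) × (F' × G')) × G × G' => (x.1, x.2.1))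
      (𝓝 (0, q₀, η₀, η₀')) (𝓝 (0, q₀)) := Continuous.tendsto' (by fun_prop) _ _ rfl
  have t4 : Tendsto (fun x : ℝ × ((F × G) × (F' × G')) × G × G' => τ x.2.1)
      (𝓝 (0, q₀, η₀, η₀')) (𝓝 T) := by
    have h1 := hτ.continuousAt.tendsto
    rw [hτ0] at h1
    exact h1.comp (Continuous.tendsto' (by fun_prop) _ _ rfl)
  filter_upwards [t1.eventually hexit₁, t2.eventually hexit₂, t3.eventually hmid,
    t4.eventually (gt_mem_nhds (show T < T + δ₂ / 2 by linarith))]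
    with x x1 x2 x3 x4 hpos hs hs' hz1 hz2 t ht
  rcases lt_or_ge t δ₁ with hlt | hge
  · exact x1 hpos hz1 hs t ⟨ht.1, hlt⟩
  rcases lt_or_ge (τ x.2.1 - t) δ₂ with hlt' | hge'
  · have := x2 hpos hz2 hs' (τ x.2.1 - t) ⟨by linarith [ht.2], hlt'⟩
    simpa only [sub_sub_cancel] using this
  · exact x3 hpos t ⟨by linarith, by linarith⟩

end Avoid

end

/-! ### Supporting points and reflections -/

section

section Support

variable {F G : Type*} [NormedAddCommGroup F] [NormedSpace ℝ F] [NormedAddCommGroup G]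
  [NormedSpace ℝ G]

/-- A nonzero linear function on a bounded open set attains its supremum on the boundary. -/
lemma exists_mem_frontier_forall_le [FiniteDimensional ℝ G] {D : Set G}
    (hne : D.Nonempty) (hb : Bornology.IsBounded D) {c : G →L[ℝ] ℝ} (hc : c ≠ 0) :
    ∃ η₀ ∈ frontier D, ∀ η ∈ closure D, c η ≤ c η₀ := by
  have hcpt : IsCompact (closure D) := Metric.isCompact_of_isClosed_isBounded isClosed_closure hb.closure
  obtain ⟨η₀, hη₀, hmax⟩ := hcpt.exists_isMaxOn hne.closure c.continuous.continuousOn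
  refine ⟨η₀, ⟨hη₀, fun hint => hc ?_⟩, fun η hη => hmax hη⟩
  have hloc : IsLocalMax c η₀ := by
    filter_upwards [isOpen_interior.mem_nhds hint] with η hη
    exact hmax (interior_subset_closure hη)
  have := hloc.fderiv_eq_zero
  rwa [c.fderiv] at this

/-- The Lagrange multiplier of a linear function at a point where it attains its maximum on a set
with a defining function is positive. -/
lemma IsDefiningFunction.exists_multiplier {D : F → Set G} {ρ : F × G → ℝ} {ξ₀ : F} {η₀ : G}
    (hρ : IsDefiningFunction D ρ (ξ₀, η₀)) (hη₀ : η₀ ∈ frontier (D ξ₀)) {c : G →L[ℝ] ℝ} (hc : c ≠ 0)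
    (hmax : ∀ η ∈ closure (D ξ₀), c η ≤ c η₀) :
    ∃ μ > (0 : ℝ), ∀ w, c w = μ * fderiv ℝ ρ (ξ₀, η₀) (0, w) := by
  have hρd : DifferentiableAt ℝ ρ (ξ₀, η₀) := hρ.contDiffAt.differentiableAt one_ne_zero
  have hρ0 : ρ (ξ₀, η₀) = 0 := hρ.eventually_eq_zero_of_mem_frontier.self_of_nhds hη₀
  set l : G →L[ℝ] ℝ := fderiv ℝ ρ (ξ₀, η₀) ∘L .inr ℝ F G with hl
  have hlw : ∀ w, fderiv ℝ ρ (ξ₀, η₀) (0, w) = l w := fun w => rfl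
  -- directions that point into the set do not increase `c`
  have key : ∀ w, l w < 0 → c w ≤ 0 := by
    intro w hw
    have h1 := eventually_neg_line hρd hρ0 (w := w) hw
    have h2 := (tendsto_line (ξ₀, η₀) w).eventually hρ.mem_iff
    obtain ⟨t, ⟨ht1, ht2⟩, ht3⟩ := ((h1.and h2).and
      self_mem_nhdsWithin).exists
    have h3 := hmax _ (subset_closure (ht2.2 ht1))
    have h4 : c (η₀ + t • w) = c η₀ + t * c w := by simp
    have h5 : c (η₀ + t • w) ≤ c η₀ := h3
    have h6 : (0 : ℝ) < t := ht3
    by_contra! hcon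
    nlinarith [mul_pos h6 hcon]
  obtain ⟨w₁, hw₁⟩ : ∃ w₁, l w₁ < 0 := by
    obtain ⟨w, hw⟩ := hρ.fderiv_ne
    rcases lt_or_gt_of_ne hw with h | h
    · exact ⟨w, h⟩
    · exact ⟨-w, by rw [map_neg]; exact neg_neg_of_pos h⟩
  have hker : ∀ w, l w = 0 → c w ≤ 0 := by
    intro w hw
    have h1 : ∀ s > (0 : ℝ), c w + s * c w₁ ≤ 0 := by
      intro s hs
      have := key (w + s • w₁) (by rw [map_add, map_smul, hw, zero_add]; exact mul_neg_of_pos_of_neg hs hw₁)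
      simpa using this
    have h2 : Tendsto (fun s : ℝ => c w + s * c w₁) (𝓝[>] 0) (𝓝 (c w)) := by
      have : Continuous (fun s : ℝ => c w + s * c w₁) := by fun_prop
      exact (this.tendsto' 0 _ (by simp)).mono_left nhdsWithin_le_nhds
    exact le_of_tendsto h2 (eventually_mem_nhdsWithin.mono h1)
  have heq : ∀ w, c w = c w₁ / l w₁ * l w := by
    intro w
    have h1 : l (w - (l w / l w₁) • w₁) = 0 := by
      rw [map_sub, map_smul, smul_eq_mul, div_mul_cancel₀ _ hw₁.ne, sub_self]
    have h2 := hker _ h1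
    have h3 := hker (-(w - (l w / l w₁) • w₁)) (by rw [map_neg, h1, neg_zero])
    rw [map_neg] at h3
    have h4 : c (w - (l w / l w₁) • w₁) = 0 := by linarith
    rw [map_sub, map_smul, smul_eq_mul] at h4
    field_simp at h4 ⊢
    linarith
  have hnn : 0 ≤ c w₁ / l w₁ := div_nonneg_of_nonpos (key w₁ hw₁) hw₁.le
  refine ⟨c w₁ / l w₁, lt_of_le_of_ne hnn fun h0 => hc ?_, heq⟩
  ext w
  rw [heq, ← h0, zero_mul]
  rfl

lemma fderiv_comp_clm {V W : Type*} [NormedAddCommGroup V] [NormedSpace ℝ V] [NormedAddCommGroup W]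
    [NormedSpace ℝ W] {f : W → ℝ} (L : V →L[ℝ] W) {x : V} (hf : DifferentiableAt ℝ f (L x)) (u : V) :
    fderiv ℝ (fun y => f (L y)) x u = fderiv ℝ f (L x) (L u) :=
  DFunLike.congr_fun (hf.hasFDerivAt.comp x L.hasFDerivAt).fderiv u

lemma fderiv_fderiv_comp_clm {V W : Type*} [NormedAddCommGroup V] [NormedSpace ℝ V]
    [NormedAddCommGroup W] [NormedSpace ℝ W] {f : W → ℝ} (L : V →L[ℝ] W) {x : V}
    (hf : ContDiffAt ℝ 2 f (L x)) (u v : V) :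
    fderiv ℝ (fderiv ℝ (fun y => f (L y))) x u v = fderiv ℝ (fderiv ℝ f) (L x) (L u) (L v) := by
  have h1 : fderiv ℝ (fun y => f (L y)) =ᶠ[𝓝 x] fun y => fderiv ℝ f (L y) ∘L L := by
    filter_upwards [L.continuous.continuousAt.eventually (hf.eventually (by simp))] with y hy
    exact ((hy.differentiableAt (by norm_num)).hasFDerivAt.comp y L.hasFDerivAt).fderiv
  rw [h1.fderiv_eq]
  have h2 : DifferentiableAt ℝ (fderiv ℝ f) (L x) :=
    (hf.fderiv_right (m := 1) (by norm_num)).differentiableAt one_ne_zero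
  have h3 : HasFDerivAt (fun y => fderiv ℝ f (L y)) (fderiv ℝ (fderiv ℝ f) (L x) ∘L L) x :=
    h2.hasFDerivAt.comp x L.hasFDerivAt
  have h4 := ((ContinuousLinearMap.compL ℝ V W ℝ).flip L).hasFDerivAt.comp x h3
  have h5 := h4.fderiv
  exact DFunLike.congr_fun (DFunLike.congr_fun h5 u) v

end Support

section Reflection

variable {E : Type*} [NormedAddCommGroup E] [NormedSpace ℝ E] [FiniteDimensional ℝ E]
variable {M : Type*} [TopologicalSpace M] [ChartedSpace E M] [IsManifold 𝓘(ℝ, E) ∞ M]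
  {H : CotangentBundle E M → ℝ} {A : Set M} {ζ ζ' : CotangentBundle E M}

/-- The statement of `jump_velocity` for two states over the same point. -/
lemma momentum_jump_velocity (hH : IsConvexHamiltonian H) (hp : ζ.proj = ζ'.proj)
    (he : H ζ' = H ζ) (hne : momentum ζ' ≠ momentum ζ) :
    (momentum ζ' - momentum ζ) (show E from stateVelocity H ζ) < 0 ∧
      0 < (momentum ζ' - momentum ζ) (show E from stateVelocity H ζ') := by
  obtain ⟨x, p⟩ := ζ
  obtain ⟨x', p'⟩ := ζ'
  obtain rfl : x = x' := hp
  exact jump_velocity hH x p p' hne he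

omit [FiniteDimensional ℝ E] in
/-- The law of reflection in terms of the jump of the momentum. -/
lemma isElasticReflection_iff : IsElasticReflection H A ζ ζ' ↔ ζ.proj = ζ'.proj ∧ ζ.proj ∈ A ∧
    (∀ v : E, (show TangentSpace 𝓘(ℝ, E) ζ.proj from v) ∈ tangentSpan (E := E) A ζ.proj →
      (momentum ζ' - momentum ζ) v = 0) ∧ H ζ' = H ζ ∧ momentum ζ' ≠ momentum ζ := by
  constructor
  · rintro ⟨x, p, p', rfl, rfl, hx, hv, hH, hne⟩
    exact ⟨rfl, hx, fun v hvA => sub_eq_zero.2 (hv v hvA), hH, hne⟩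
  · obtain ⟨x, p⟩ := ζ
    obtain ⟨x', p'⟩ := ζ'
    rintro ⟨h, hx, hv, hH, hne⟩
    obtain rfl : x = x' := h
    exact ⟨x, p, p', rfl, rfl, hx, fun v hvA => sub_eq_zero.1 (hv v hvA), hH, hne⟩

/-- The members of a flow are trajectories. -/
lemma IsFlowOn.isEnergyArc (hH : ContMDiff (coI E) 𝓘(ℝ, ℝ) 3 H)
    {Φ : CotangentBundle E M → ℝ → CotangentBundle E M} {U : Set (CotangentBundle E M)} {T δ : ℝ}
    (hΦ : IsFlowOn H Φ U T δ) (hT : 0 ≤ T) (hζ : ζ ∈ U) {τ : ℝ} (hτ : τ ∈ Ioo 0 (T + δ)) {e : ℝ}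
    (he : H ζ = e) : IsEnergyArc H e (Φ ζ) τ := by
  have hδ := hΦ.delta_pos
  have hI : ∀ t ∈ Icc 0 τ, t ∈ Ioo (-δ) (T + δ) := fun t ht =>
    ⟨by linarith [ht.1], ht.2.trans_lt hτ.2⟩
  exact ⟨isHamiltonianArc_iff.2 ⟨hτ.1, fun t ht => (hΦ.hamiltonian ζ hζ t (hI t ht)).mono (subset_univ _)⟩,
    fun t ht => (hΦ.energy_eq hH hT hζ (hI t ht)).trans he⟩

end Reflection

end

/-! ### Critical points of the periodic action -/

section

section Families

variable {n : ℕ} {F G : Fin n → Type*}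
  [∀ j, NormedAddCommGroup (F j)] [∀ j, NormedSpace ℝ (F j)]
  [∀ j, NormedAddCommGroup (G j)] [∀ j, NormedSpace ℝ (G j)]

/-- The coordinates of the `j`-th collision point. -/
def coordProj (F G : Fin n → Type*) [∀ j, NormedAddCommGroup (F j)] [∀ j, NormedSpace ℝ (F j)]
    [∀ j, NormedAddCommGroup (G j)] [∀ j, NormedSpace ℝ (G j)] (j : Fin n) :
    (∀ j, F j) × (∀ j, G j) →L[ℝ] F j × G j :=
  ((ContinuousLinearMap.proj j).comp (.fst ℝ _ _)).prod ((ContinuousLinearMap.proj j).comp (.snd ℝ _ _))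

/-- The coordinates of the end points of the `j`-th trajectory. -/
def edgeProj [NeZero n] (F G : Fin n → Type*) [∀ j, NormedAddCommGroup (F j)] [∀ j, NormedSpace ℝ (F j)]
    [∀ j, NormedAddCommGroup (G j)] [∀ j, NormedSpace ℝ (G j)] (j : Fin n) :
    (∀ j, F j) × (∀ j, G j) →L[ℝ] (F j × G j) × (F (j + 1) × G (j + 1)) :=
  (coordProj F G j).prod (coordProj F G (j + 1))

/-- The existence of the critical points of the action with one end point of each trajectory on the
boundary of a thin tube, in coordinates. -/
theorem exists_critical_curves [∀ j, FiniteDimensional ℝ (F j)] [∀ j, FiniteDimensional ℝ (G j)]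
    {A : (∀ j, F j) × (∀ j, G j) → ℝ} {ξ₀ : ∀ j, F j} (hA : ContDiffAt ℝ 2 A (ξ₀, 0))
    {c : ∀ j, F j × G j →L[ℝ] ℝ} (hAc : ∀ d, fderiv ℝ A (ξ₀, 0) d = -∑ j, c j (d.1 j, d.2 j))
    (hcF : ∀ j a, c j (a, 0) = 0) (hcG : ∀ j, c j ≠ 0)
    (hhess : ∀ u, fderiv ℝ (fderiv ℝ fun ξ => A (ξ, 0)) ξ₀ u = 0 → u = 0)
    {D : ∀ j, F j → Set (G j)} (hD0 : ∀ j, (D j (ξ₀ j)).Nonempty)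
    (hDb : ∀ j, Bornology.IsBounded (D j (ξ₀ j)))
    (hD : ∀ j, ∀ η ∈ frontier (D j (ξ₀ j)), ∃ ρ : F j × G j → ℝ, ContDiffAt ℝ ∞ ρ (ξ₀ j, η) ∧
      IsDefiningFunction (D j) ρ (ξ₀ j, η) ∧ ∀ w : G j, fderiv ℝ ρ (ξ₀ j, η) (0, w) = 0 → w ≠ 0 →
        0 < fderiv ℝ (fderiv ℝ ρ) (ξ₀ j, η) (0, w) (0, w)) :
    ∃ (η₀ : ∀ j, G j) (ρ : ∀ j, F j × G j → ℝ) (μ₀ : Fin n → ℝ) (ξ : ℝ → ∀ j, F j)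
      (η : ℝ → ∀ j, G j) (μ : ℝ → Fin n → ℝ),
      (∀ j, IsDefiningFunction (D j) (ρ j) (ξ₀ j, η₀ j)) ∧ (∀ j, 0 < μ₀ j) ∧
      (∀ j w, c j (0, w) = μ₀ j * fderiv ℝ (ρ j) (ξ₀ j, η₀ j) (0, w)) ∧
      ξ 0 = ξ₀ ∧ η 0 = η₀ ∧ μ 0 = μ₀ ∧
      ContDiffAt ℝ 1 ξ 0 ∧ ContDiffAt ℝ 1 η 0 ∧ ContDiffAt ℝ 1 μ 0 ∧ ∀ᶠ ε in 𝓝 (0 : ℝ), ∀ j,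
        (∀ a w, fderiv ℝ A (ξ ε, ε • η ε) (Pi.single j a, Pi.single j w) +
          μ ε j * fderiv ℝ (ρ j) (ξ ε j, η ε j) (ε • a, w) = 0) ∧ ρ j (ξ ε j, η ε j) = 0 := by
  have hcG' : ∀ j, c j ∘L .inr ℝ (F j) (G j) ≠ 0 := by
    intro j h0
    refine hcG j (ContinuousLinearMap.ext fun p => ?_)
    have h1 : c j (0, p.2) = 0 := DFunLike.congr_fun h0 p.2
    have h2 : p = (p.1, 0) + (0, p.2) := by simp
    rw [h2, map_add, hcF, h1, add_zero]
    rfl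
  -- `η₀ j` is the boundary point of the profile where the momentum jump `c j` is maximal
  have hsup := fun j => exists_mem_frontier_forall_le (hD0 j) (hDb j) (hcG' j)
  choose η₀ hη₀ hmax using hsup
  have hρex := fun j => hD j (η₀ j) (hη₀ j)
  choose ρ hρs hρ hρpos using hρex
  have hmul := fun j => (hρ j).exists_multiplier (hη₀ j) (hcG' j) (hmax j)
  choose μ₀ hμ₀ hcμ using hmul
  have hcμ' : ∀ j w, c j (0, w) = μ₀ j * fderiv ℝ (ρ j) (ξ₀ j, η₀ j) (0, w) := hcμ
  have hρ0 : ∀ j, ρ j (ξ₀ j, η₀ j) = 0 := fun j =>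
    (hρ j).eventually_eq_zero_of_mem_frontier.self_of_nhds (hη₀ j)
  have hρ2 : ∀ j, ContDiffAt ℝ 2 (ρ j) (coordProj F G j (ξ₀, η₀)) := fun j =>
    contDiffAt_infty.1 (hρs j) 2
  set r : Fin n → (∀ j, F j) × (∀ j, G j) → ℝ := fun j x => ρ j (coordProj F G j x) with hr
  have hr2 : ∀ j, ContDiffAt ℝ 2 (r j) (ξ₀, η₀) := fun j =>
    (hρ2 j).comp (ξ₀, η₀) (coordProj F G j).contDiff.contDiffAt
  have hrd : ∀ j u, fderiv ℝ (r j) (ξ₀, η₀) u = fderiv ℝ (ρ j) (ξ₀ j, η₀ j) (u.1 j, u.2 j) :=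
    fun j u => fderiv_comp_clm _ ((hρ2 j).differentiableAt (by norm_num)) u
  have hrdd : ∀ j u v, fderiv ℝ (fderiv ℝ (r j)) (ξ₀, η₀) u v =
      fderiv ℝ (fderiv ℝ (ρ j)) (ξ₀ j, η₀ j) (u.1 j, u.2 j) (v.1 j, v.2 j) :=
    fun j u v => fderiv_fderiv_comp_clm _ (hρ2 j) u v
  -- the second fundamental forms are positive and weighted with positive multipliers, so their sum
  -- vanishes only at zero
  obtain ⟨ξ, η, μ, hξ0, hη0, hμ0, hξ, hη, hμ, hev⟩ := exists_multiplier_curve (μ₀ := μ₀) hA hr2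
    (fun a => by rw [hAc]; simp [hcF])
    (fun w => by
      rw [hAc]
      simp only [hrd, Pi.zero_apply, hcμ']
      exact neg_add_cancel _)
    hρ0
    (fun a ha => hhess a (ContinuousLinearMap.ext fun b => by
      have h1 := fderiv_fderiv_comp_clm (.inl ℝ (∀ j, F j) (∀ j, G j)) (x := ξ₀) (f := A) hA a b
      exact h1.trans (ha b)))
    (fun w hw0 hw => by
      simp only [hrd, hrdd, Pi.zero_apply] at hw0 hw
      have hnn : ∀ j ∈ Finset.univ, 0 ≤ μ₀ j * fderiv ℝ (fderiv ℝ (ρ j)) (ξ₀ j, η₀ j) (0, w j) (0, w j) := by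
        intro j _
        by_cases hwj : w j = 0
        · rw [hwj, Prod.mk_zero_zero, map_zero]; simp
        · exact mul_nonneg (hμ₀ j).le (hρpos j _ (hw0 j) hwj).le
      funext j
      by_contra hwj
      have h1 := (Finset.sum_eq_zero_iff_of_nonneg hnn).1 hw j (Finset.mem_univ j)
      exact (mul_pos (hμ₀ j) (hρpos j _ (hw0 j) hwj)).ne' h1)
    (fun ν hν => by
      funext j
      obtain ⟨w, hw⟩ := (hρ j).fderiv_ne
      have h1 := hν (Pi.single j w)
      simp only [hrd, Pi.zero_apply] at h1
      rw [Finset.sum_eq_single j (fun i _ hij => by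
        rw [Pi.single_eq_of_ne hij, Prod.mk_zero_zero, map_zero, mul_zero])
        (fun h => absurd (Finset.mem_univ j) h), Pi.single_eq_same] at h1
      exact (mul_eq_zero.1 h1).resolve_right hw)
  refine ⟨η₀, ρ, μ₀, ξ, η, μ, hρ, hμ₀, hcμ', hξ0, hη0, hμ0, hξ, hη, hμ, ?_⟩
  have hdiff : ∀ᶠ ε in 𝓝 (0 : ℝ), ∀ j, DifferentiableAt ℝ (ρ j) (ξ ε j, η ε j) := by
    refine eventually_all.2 fun j => ?_
    have h1 : Tendsto (fun ε => coordProj F G j (ξ ε, η ε)) (𝓝 0) (𝓝 (coordProj F G j (ξ₀, η₀))) := by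
      have h2 := (coordProj F G j).continuous.continuousAt.comp (hξ.continuousAt.prodMk hη.continuousAt)
      have h3 := h2.tendsto
      simp only [Function.comp_apply, hξ0, hη0] at h3
      exact h3
    exact (h1.eventually ((hρ2 j).eventually (by simp))).mono fun ε h => h.differentiableAt (by norm_num)
  filter_upwards [hev, hdiff] with ε hε hεd j
  refine ⟨fun a w => ?_, hε.2 j⟩
  have h1 := hε.1 (Pi.single j a) (Pi.single j w)
  have h2 : ∀ i, fderiv ℝ (r i) (ξ ε, η ε) (ε • Pi.single j a, Pi.single j w) =
      fderiv ℝ (ρ i) (ξ ε i, η ε i) ((ε • Pi.single j a : ∀ j, F j) i, (Pi.single j w : ∀ j, G j) i) :=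
    fun i => fderiv_comp_clm (coordProj F G i) (hεd i) _
  simp only [h2] at h1
  rw [Finset.sum_eq_single j (fun i _ hij => by
    rw [Pi.smul_apply, Pi.single_eq_of_ne hij, Pi.single_eq_of_ne hij, smul_zero, Prod.mk_zero_zero,
      map_zero, mul_zero]) (fun h => absurd (Finset.mem_univ j) h), Pi.smul_apply, Pi.single_eq_same,
    Pi.single_eq_same] at h1
  exact h1

end Families

section Chain

variable {E : Type*} [NormedAddCommGroup E] [NormedSpace ℝ E] [FiniteDimensional ℝ E]
variable {M : Type*} [TopologicalSpace M] [ChartedSpace E M] [IsManifold 𝓘(ℝ, E) ∞ M] [T2Space M]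
variable {n : ℕ} [NeZero n] {F G : Fin n → Type*}
  [∀ j, NormedAddCommGroup (F j)] [∀ j, NormedSpace ℝ (F j)]
  [∀ j, NormedAddCommGroup (G j)] [∀ j, NormedSpace ℝ (G j)]

/-- The trajectories of a closed chain belong to families of trajectories of the same energy that
join neighbouring points. The derivative of the action of the broken periodic trajectories made up
of them is given by the jumps of the momentum. -/
theorem exists_chain_family {H : CotangentBundle E M → ℝ} (hH : ContMDiff (coI E) 𝓘(ℝ, ℝ) 3 H)
    {e : ℝ} {z : Fin n → ℝ → CotangentBundle E M} {T : Fin n → ℝ}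
    (hz : ∀ j, IsEnergyArc H e (z j) (T j)) (hnc : ∀ j, NonConjugate H (z j) (T j))
    (hv : ∀ j, stateVelocity H (z j (T j)) ≠ 0)
    (hclose : ∀ j, (z j (T j)).proj = (z (j + 1) 0).proj)
    {Ψ : ∀ j, F j × G j → M} {ξ₀ : ∀ j, F j}
    (hΨ : ∀ j, ContMDiffAt 𝓘(ℝ, F j × G j) 𝓘(ℝ, E) ∞ (Ψ j) (ξ₀ j, 0))
    (hΨ0 : ∀ j, Ψ j (ξ₀ j, 0) = (z j 0).proj) :
    ∃ (Φ : Fin n → CotangentBundle E M → ℝ → CotangentBundle E M)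
      (U : Fin n → Set (CotangentBundle E M)) (δ : Fin n → ℝ)
      (ζ : ∀ j, (F j × G j) × (F (j + 1) × G (j + 1)) → CotangentBundle E M)
      (τ : ∀ j, (F j × G j) × (F (j + 1) × G (j + 1)) → ℝ),
      (∀ j, IsFlowOn H (Φ j) (U j) (T j) (δ j)) ∧ (∀ j, EqOn (Φ j (z j 0)) (z j) (Icc 0 (T j))) ∧
      (∀ j, ζ j ((ξ₀ j, 0), (ξ₀ (j + 1), 0)) = z j 0) ∧
      (∀ j, τ j ((ξ₀ j, 0), (ξ₀ (j + 1), 0)) = T j) ∧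
      (∀ j, ∀ᶠ p in 𝓝 ((ξ₀ j, 0), (ξ₀ (j + 1), 0)),
        ContMDiffAt 𝓘(ℝ, (F j × G j) × (F (j + 1) × G (j + 1))) (coI E) 1 (ζ j) p ∧
        ContDiffAt ℝ 1 (τ j) p ∧ ζ j p ∈ U j ∧ τ j p ∈ Ioo 0 (T j + δ j) ∧ H (ζ j p) = e ∧
        (ζ j p).proj = Ψ j p.1 ∧ (Φ j (ζ j p) (τ j p)).proj = Ψ (j + 1) p.2) ∧
      ContDiffAt ℝ 2 (fun x => periodicAction H e z T fun j => Ψ j (coordProj F G j x)) (ξ₀, 0) ∧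
      ∀ᶠ x in 𝓝 (ξ₀, 0), ∀ d,
        fderiv ℝ (fun x => periodicAction H e z T fun j => Ψ j (coordProj F G j x)) x d =
        -∑ j, (momentum (ζ j (edgeProj F G j x)) - momentum (Φ (j - 1) (ζ (j - 1) (edgeProj F G (j - 1) x))
          (τ (j - 1) (edgeProj F G (j - 1) x))))
          (paramDeriv (Ψ j) (coordProj F G j x) (coordProj F G j d)) := by
  have hseg := fun j => exists_segment hH (hz j) (hnc j) (hv j) (hΨ j) (hΨ0 j) (hΨ (j + 1))
    ((hΨ0 (j + 1)).trans (hclose j).symm)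
  choose Φ U δ ζ τ hΦ heq hζ0 hτ0 hL hev using hseg
  refine ⟨Φ, U, δ, ζ, τ, hΦ, heq, hζ0, hτ0, fun j => (hev j).mono fun p hp =>
    ⟨hp.1, hp.2.1, hp.2.2.1, hp.2.2.2.1, hp.2.2.2.2.1, hp.2.2.2.2.2.1, hp.2.2.2.2.2.2.1⟩, ?_, ?_⟩
  · exact ContDiffAt.sum fun j _ => ContDiffAt.comp (ξ₀, (0 : ∀ j, G j))
      (g := fun p : (F j × G j) × (F (j + 1) × G (j + 1)) =>
        localAction H e (z j) (T j) (Ψ j p.1, Ψ (j + 1) p.2)) (f := edgeProj F G j)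
      (hL j) (edgeProj F G j).contDiff.contDiffAt
  · have hedge : ∀ j, Tendsto (edgeProj F G j) (𝓝 (ξ₀, 0)) (𝓝 ((ξ₀ j, 0), (ξ₀ (j + 1), 0))) :=
      fun j => (edgeProj F G j).continuous.tendsto' _ _ rfl
    have hall : ∀ᶠ x in 𝓝 ((ξ₀, 0) : (∀ j, F j) × (∀ j, G j)), ∀ j,
        DifferentiableAt ℝ (fun p : (F j × G j) × (F (j + 1) × G (j + 1)) =>
          localAction H e (z j) (T j) (Ψ j p.1, Ψ (j + 1) p.2)) (edgeProj F G j x) ∧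
        ∀ d, fderiv ℝ (fun p : (F j × G j) × (F (j + 1) × G (j + 1)) =>
          localAction H e (z j) (T j) (Ψ j p.1, Ψ (j + 1) p.2)) (edgeProj F G j x) d =
          momentum (Φ j (ζ j (edgeProj F G j x)) (τ j (edgeProj F G j x)))
            (paramDeriv (Ψ (j + 1)) (coordProj F G (j + 1) x) d.2) -
          momentum (ζ j (edgeProj F G j x)) (paramDeriv (Ψ j) (coordProj F G j x) d.1) := by
      refine eventually_all.2 fun j => ?_
      filter_upwards [(hedge j).eventually ((hL j).eventually (by simp)), (hedge j).eventually (hev j)]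
        with x h1 h2
      exact ⟨h1.differentiableAt (by norm_num), h2.2.2.2.2.2.2.2⟩
    filter_upwards [hall] with x hx d
    have h1 : ∀ j, HasFDerivAt (fun x => localAction H e (z j) (T j)
        (Ψ j (coordProj F G j x), Ψ (j + 1) (coordProj F G (j + 1) x))) _ x := fun j =>
      HasFDerivAt.comp x (g := fun p : (F j × G j) × (F (j + 1) × G (j + 1)) =>
        localAction H e (z j) (T j) (Ψ j p.1, Ψ (j + 1) p.2)) (f := edgeProj F G j)
        (hx j).1.hasFDerivAt (edgeProj F G j).hasFDerivAt
    have h2 : HasFDerivAt (fun x => periodicAction H e z T fun j => Ψ j (coordProj F G j x)) _ x :=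
      HasFDerivAt.fun_sum fun j (_ : j ∈ Finset.univ) => h1 j
    rw [h2.fderiv, sum_apply]
    simp only [ContinuousLinearMap.comp_apply, (hx _).2]
    rw [Finset.sum_sub_distrib]
    simp only [sub_apply]
    rw [Finset.sum_sub_distrib, neg_sub]
    congr 1
    -- the contributions of the final states are shifted by one index
    refine Fintype.sum_equiv (Equiv.addRight (1 : Fin n)) _ _ fun j => ?_
    let finalState : Fin n → CotangentBundle E M := fun i =>
      Φ i (ζ i (edgeProj F G i x)) (τ i (edgeProj F G i x))
    have hlast : finalState (j + 1 - 1) = finalState j := congrArg finalState (add_sub_cancel_right j 1)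
    change momentum (finalState j) (paramDeriv (Ψ (j + 1)) (coordProj F G (j + 1) x)
      (coordProj F G (j + 1) d)) = momentum (finalState (j + 1 - 1)) (paramDeriv (Ψ (j + 1))
      (coordProj F G (j + 1) x) (coordProj F G (j + 1) d))
    rw [hlast]

end Chain

end

/-! ### Billiard orbits -/

section

section Orbit

variable {E : Type*} [NormedAddCommGroup E] [NormedSpace ℝ E] [FiniteDimensional ℝ E]
variable {M : Type*} [TopologicalSpace M] [ChartedSpace E M] [IsManifold 𝓘(ℝ, E) ∞ M]
variable {H : CotangentBundle E M → ℝ} {e : ℝ} {n : ℕ} [NeZero n]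

/-- A closed chain of trajectories is a billiard orbit if the jumps of the momentum are nonzero and
annihilate the tangent spaces of the scatterer: by convexity of the Hamiltonian, the velocities are
then not tangent to the scatterer. -/
theorem isPeriodicBilliardOrbit_of_momentum_jump (hH : IsConvexHamiltonian H) {S A : Set M}
    {z : Fin n → ℝ → CotangentBundle E M} {T : Fin n → ℝ} (harc : ∀ j, IsEnergyArc H e (z j) (T j))
    (hclose : ∀ j, (z (j - 1) (T (j - 1))).proj = (z j 0).proj)
    (hA : ∀ j, (z j 0).proj ∈ A) (hS : ∀ j, (z j 0).proj ∉ S)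
    (havoid : ∀ j, ∀ t ∈ Ioo 0 (T j), (z j t).proj ∉ S ∧ (z j t).proj ∉ A)
    (hjump : ∀ j, ∀ v : E,
      (show TangentSpace 𝓘(ℝ, E) (z j 0).proj from v) ∈ tangentSpan (E := E) A (z j 0).proj →
      (momentum (z j 0) - momentum (z (j - 1) (T (j - 1)))) v = 0)
    (hne : ∀ j, momentum (z j 0) ≠ momentum (z (j - 1) (T (j - 1)))) :
    IsPeriodicBilliardOrbit H e Sᶜ A z T := by
  have hpos : ∀ j, 0 < T j := fun j => (harc j).arc.pos
  have henergy : ∀ j, H (z j 0) = H (z (j - 1) (T (j - 1))) := fun j =>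
    ((harc j).energy 0 ⟨le_rfl, (hpos j).le⟩).trans
      ((harc (j - 1)).energy _ ⟨(hpos (j - 1)).le, le_rfl⟩).symm
  have hvel := fun j => momentum_jump_velocity hH (hclose j) (henergy j) (hne j)
  have hend : ∀ j, (z j (T j)).proj = (z (j + 1) 0).proj := fun j => by
    have := hclose (j + 1)
    rwa [add_sub_cancel_right] at this
  have htrans : ∀ {x y : M} (_ : x = y) (α : E →L[ℝ] ℝ), (∀ v : E,
      (show TangentSpace 𝓘(ℝ, E) x from v) ∈ tangentSpan (E := E) A x → α v = 0) →
      ∀ v : E, (show TangentSpace 𝓘(ℝ, E) y from v) ∈ tangentSpan (E := E) A y → α v = 0 := by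
    rintro x _ rfl α h
    exact h
  refine ⟨harc, fun j t ht => ?_, fun j t ht => (havoid j t ht).2, fun j hmem => ?_, fun j hmem => ?_,
    fun j => ?_⟩
  · rcases ht.1.eq_or_lt with rfl | h0
    · exact hS j
    rcases ht.2.eq_or_lt with rfl | h1
    · rw [mem_compl_iff, hend]; exact hS (j + 1)
    · exact (havoid j t ⟨h0, h1⟩).1
  · rw [velocity_eq_stateVelocity (harc j).arc ⟨le_rfl, (hpos j).le⟩] at hmem
    exact (hvel j).2.ne' (hjump j _ hmem)
  · rw [velocity_eq_stateVelocity (harc j).arc ⟨(hpos j).le, le_rfl⟩] at hmem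
    have h1 := (hvel (j + 1)).1
    have h2 := htrans (hend j).symm _ (hjump (j + 1))
    rw [add_sub_cancel_right] at h1 h2
    exact h1.ne (h2 _ hmem)
  · have h1 := henergy (j + 1)
    have h2 := htrans (hend j).symm _ (hjump (j + 1))
    have h3 := hne (j + 1)
    rw [add_sub_cancel_right] at h1 h2 h3
    exact isElasticReflection_iff.2 ⟨hend j, by rw [hend]; exact hA (j + 1), h2, h1, h3⟩

variable [T2Space M] {F G : Fin n → Type*}
  [∀ j, NormedAddCommGroup (F j)] [∀ j, NormedSpace ℝ (F j)]
  [∀ j, NormedAddCommGroup (G j)] [∀ j, NormedSpace ℝ (G j)]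
  [∀ j, FiniteDimensional ℝ (F j)] [∀ j, FiniteDimensional ℝ (G j)]

/-- A collision chain whose collision points are a nondegenerate critical point of the action
continues to a family of billiard orbits outside of thin tubes, given by a differentiable family of
the collision points, in coordinates. -/
theorem exists_orbit_family (hH : IsConvexHamiltonian H)
    {z : Fin n → ℝ → CotangentBundle E M} {T : Fin n → ℝ} {C : Set M}
    (hz : IsPeriodicBilliardOrbit H e univ C z T) (hnc : ∀ j, NonConjugate H (z j) (T j))
    {S S' : ℝ → Set M} {Ψ : ∀ j, F j × G j → M} {D : ∀ j, F j → Set (G j)} {ξ₀ : ∀ j, F j}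
    (hΨ : ∀ j, IsLocalTube (E := E) S S' (Ψ j) (D j) (ξ₀ j))
    (hΨ0 : ∀ j, Ψ j (ξ₀ j, 0) = (z j 0).proj) (hΨC : ∀ j, ∀ᶠ ξ in 𝓝 (ξ₀ j), Ψ j (ξ, 0) ∈ C)
    (havoid : ∀ q ∉ C, ∃ O ∈ 𝓝 q, ∃ ε₁ > (0 : ℝ), ∀ y ∈ O, ∀ ε ∈ Ioo 0 ε₁, y ∉ S ε ∧ y ∉ S' ε)
    (hhess : ∀ u, fderiv ℝ (fderiv ℝ fun ξ : ∀ j, F j =>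
      periodicAction H e z T fun j => Ψ j (ξ j, 0)) ξ₀ u = 0 → u = 0) :
    ∃ (Φ : Fin n → CotangentBundle E M → ℝ → CotangentBundle E M)
      (U : Fin n → Set (CotangentBundle E M)) (δ : Fin n → ℝ) (ζ : Fin n → ℝ → CotangentBundle E M)
      (τ : Fin n → ℝ → ℝ),
      (∀ j, IsFlowOn H (Φ j) (U j) (T j) (δ j)) ∧ (∀ j, EqOn (Φ j (z j 0)) (z j) (Icc 0 (T j))) ∧
      (∀ j, z j 0 ∈ U j) ∧ (∀ j, ζ j 0 = z j 0) ∧ (∀ j, τ j 0 = T j) ∧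
      (∀ j, ContMDiffAt 𝓘(ℝ, ℝ) (coI E) 1 (ζ j) 0) ∧ (∀ j, ContDiffAt ℝ 1 (τ j) 0) ∧
      ∀ᶠ ε in 𝓝[>] (0 : ℝ), IsPeriodicBilliardOrbit H e (S ε)ᶜ (S' ε)
        (fun j => Φ j (ζ j ε)) (fun j => τ j ε) := by
  have hpos : ∀ j, 0 < T j := fun j => (hz.arc j).arc.pos
  have hrefl : ∀ j, IsElasticReflection H C (z (j - 1) (T (j - 1))) (z j 0) := fun j => by
    have := hz.reflection (j - 1)
    rwa [sub_add_cancel] at this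
  have hr := fun j => isElasticReflection_iff.1 (hrefl j)
  have hsign := fun j => momentum_jump_velocity hH (hr j).1 (hr j).2.2.2.1 (hr j).2.2.2.2
  have hclose : ∀ j, (z j (T j)).proj = (z (j + 1) 0).proj := fun j =>
    (isElasticReflection_iff.1 (hz.reflection j)).1
  have hsign' : ∀ j, (momentum (z (j + 1) 0) - momentum (z j (T j)))
      (show E from stateVelocity H (z j (T j))) < 0 := fun j => by
    have h := (hsign (j + 1)).1
    rwa [add_sub_cancel_right] at h
  have hv : ∀ j, stateVelocity H (z j (T j)) ≠ 0 := fun j h0 => by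
    have h1 := hsign' j
    rw [h0] at h1
    exact h1.ne (map_zero _)
  obtain ⟨Φ, U, δ, ζ, τ, hΦ, heq, hζ0, hτ0, hfam, hA, hAd⟩ := exists_chain_family hH.contMDiff hz.arc
    hnc hv hclose (fun j => (hΨ j).contMDiffAt) hΨ0
  have hζU : ∀ j, z j 0 ∈ U j := fun j => by
    rw [← hζ0 j]; exact (hfam j).self_of_nhds.2.2.1
  -- the jump of the momentum at the `j`-th collision
  set c : ∀ j, F j × G j →L[ℝ] ℝ := fun j =>
    (momentum (z j 0) - momentum (z (j - 1) (T (j - 1)))).comp (paramDeriv (Ψ j) (ξ₀ j, 0)) with hc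
  have hAc : ∀ d, fderiv ℝ (fun x => periodicAction H e z T fun j => Ψ j (coordProj F G j x))
      (ξ₀, 0) d = -∑ j, c j (d.1 j, d.2 j) := by
    intro d
    rw [hAd.self_of_nhds d]
    congr 1
    refine Finset.sum_congr rfl fun j _ => ?_
    have e1 : ∀ i, ζ i (edgeProj F G i (ξ₀, 0)) = z i 0 := hζ0
    have e2 : ∀ i, τ i (edgeProj F G i (ξ₀, 0)) = T i := hτ0
    rw [e1, e1, e2, heq (j - 1) ⟨(hpos _).le, le_rfl⟩]
    rfl
  -- the jump annihilates the tangent space of the scatterer, and it is nonzero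
  have hcF : ∀ j a, c j (a, 0) = 0 := by
    intro j a
    have h1 := mfderiv_mem_tangentSpan ((hΨ j).contMDiffAt.mdifferentiableAt (by simp)) (hΨC j) a
    rw [hΨ0, ← (hr j).1] at h1
    exact (hr j).2.2.1 _ h1
  have hcG : ∀ j, c j ≠ 0 := by
    intro j h0
    refine (hr j).2.2.2.2 (sub_eq_zero.1 (ContinuousLinearMap.ext fun v => ?_))
    obtain ⟨w, hw⟩ := (hΨ j).bijective.2 v
    have h1 : c j w = 0 := by rw [h0]; rfl
    rw [← hw]
    exact h1
  obtain ⟨η₀, ρ, μ₀, ξ, η, μ, hρ, hμ₀, hcμ, hξ0, hη0, hμ0, hξ, hη, hμ, hcrit⟩ :=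
    exists_critical_curves hA hAc hcF hcG hhess (fun j => ⟨0, (hΨ j).zero_mem⟩)
      (fun j => (hΨ j).isBounded) (fun j => (hΨ j).boundary)
  -- the sign of the velocities at the ends of the trajectories
  have hsplit : ∀ j (w : F j × G j), c j w = μ₀ j * fderiv ℝ (ρ j) (ξ₀ j, η₀ j) (0, w.2) := by
    intro j w
    have h1 : w = (w.1, 0) + (0, w.2) := by simp
    conv_lhs => rw [h1]
    rw [map_add, hcF, zero_add, hcμ]
  have hout : ∀ j w, paramDeriv (Ψ j) (ξ₀ j, 0) w = (show E from stateVelocity H (z j 0)) →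
      0 < fderiv ℝ (ρ j) (ξ₀ j, η₀ j) (0, w.2) := by
    intro j w hw
    have h1 : 0 < c j w := by
      have h2 := (hsign j).2
      rw [← hw] at h2
      exact h2
    rw [hsplit] at h1
    exact (pos_iff_pos_of_mul_pos h1).1 (hμ₀ j)
  have hin : ∀ j w, paramDeriv (Ψ (j + 1)) (ξ₀ (j + 1), 0) w =
      (show E from stateVelocity H (z j (T j))) →
      fderiv ℝ (ρ (j + 1)) (ξ₀ (j + 1), η₀ (j + 1)) (0, w.2) < 0 := by
    intro j w hw
    have h0 := hsign' j
    have h1 : c (j + 1) w = (momentum (z (j + 1) 0) - momentum (z j (T j)))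
        (paramDeriv (Ψ (j + 1)) (ξ₀ (j + 1), 0) w) := by
      have : momentum (z (j + 1 - 1) (T (j + 1 - 1))) = momentum (z j (T j)) := by
        rw [add_sub_cancel_right]
      rw [← this]
      rfl
    rw [hw] at h1
    rw [← h1, hsplit] at h0
    exact neg_of_mul_neg_right h0 (hμ₀ _).le
  -- the coordinates of the collision points, and their limits as `ε → 0`
  set X : ℝ → (∀ j, F j) × (∀ j, G j) := fun ε => (ξ ε, ε • η ε) with hX
  have hX0 : X 0 = (ξ₀, 0) := by rw [hX]; simp only [hξ0, zero_smul]
  have hXc : ContDiffAt ℝ 1 X 0 := hξ.prodMk (contDiffAt_id.smul hη)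
  have hedge0 : ∀ j, edgeProj F G j (X 0) = ((ξ₀ j, 0), (ξ₀ (j + 1), 0)) := fun j => by
    rw [hX0]; rfl
  have hedge : ∀ j, ContDiffAt ℝ 1 (fun ε => edgeProj F G j (X ε)) 0 := fun j =>
    (edgeProj F G j).contDiff.contDiffAt.comp 0 hXc
  have tX : Tendsto X (𝓝 0) (𝓝 (ξ₀, 0)) := by
    have := hXc.continuousAt.tendsto; rwa [hX0] at this
  have tedge : ∀ j, Tendsto (fun ε => edgeProj F G j (X ε)) (𝓝 0)
      (𝓝 ((ξ₀ j, 0), (ξ₀ (j + 1), 0))) := fun j => by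
    have := (hedge j).continuousAt.tendsto; rwa [hedge0] at this
  have tη : ∀ j, Tendsto (fun ε => η ε j) (𝓝 0) (𝓝 (η₀ j)) := fun j => by
    have := ((continuous_apply j).continuousAt.comp hη.continuousAt).tendsto
    simpa only [Function.comp_def, hη0] using this
  have tξ : ∀ j, Tendsto (fun ε => ξ ε j) (𝓝 0) (𝓝 (ξ₀ j)) := fun j => by
    have := ((continuous_apply j).continuousAt.comp hξ.continuousAt).tendsto
    simpa only [Function.comp_def, hξ0] using this
  have tscale : ∀ j, Tendsto (fun ε => (ε, ξ ε j, η ε j)) (𝓝 0) (𝓝 (0, ξ₀ j, η₀ j)) := fun j =>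
    tendsto_id.prodMk_nhds ((tξ j).prodMk_nhds (tη j))
  have tseg : ∀ j, Tendsto (fun ε => (ε, edgeProj F G j (X ε), η ε j, η ε (j + 1))) (𝓝 0)
      (𝓝 (0, ((ξ₀ j, 0), (ξ₀ (j + 1), 0)), η₀ j, η₀ (j + 1))) := fun j =>
    tendsto_id.prodMk_nhds ((tedge j).prodMk_nhds ((tη j).prodMk_nhds (tη (j + 1))))
  -- the multipliers, and hence the momentum jumps, do not vanish
  have hμne : ∀ j, ∀ᶠ ε in 𝓝 (0 : ℝ), ∃ w, μ ε j * fderiv ℝ (ρ j) (ξ ε j, η ε j) (0, w) ≠ 0 := by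
    intro j
    obtain ⟨w, hw⟩ := (hρ j).fderiv_ne
    have t1 : Tendsto (fun ε => μ ε j) (𝓝 0) (𝓝 (μ₀ j)) := by
      have := ((continuous_apply j).continuousAt.comp hμ.continuousAt).tendsto
      simpa only [Function.comp_def, hμ0] using this
    have t2 : Tendsto (fun ε => fderiv ℝ (ρ j) (ξ ε j, η ε j) (0, w)) (𝓝 0)
        (𝓝 (fderiv ℝ (ρ j) (ξ₀ j, η₀ j) (0, w))) := by
      have h1 : ContinuousAt (fderiv ℝ (ρ j)) (ξ₀ j, η₀ j) :=
        ((hρ j).contDiffAt.fderiv_right (m := 0) le_rfl).continuousAt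
      have h2 := h1.tendsto.comp ((tξ j).prodMk_nhds (tη j))
      exact ((ContinuousLinearMap.apply ℝ ℝ ((0, w) : F j × G j)).continuous.tendsto _).comp h2
    exact ((t1.mul t2).eventually_ne (mul_ne_zero (hμ₀ j).ne' hw)).mono fun ε h => ⟨w, h⟩
  refine ⟨Φ, U, δ, fun j ε => ζ j (edgeProj F G j (X ε)), fun j ε => τ j (edgeProj F G j (X ε)), hΦ, heq,
    hζU, fun j => (congrArg (ζ j) (hedge0 j)).trans (hζ0 j),
    fun j => (congrArg (τ j) (hedge0 j)).trans (hτ0 j), fun j => ?_, fun j => ?_, ?_⟩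
  · refine ContMDiffAt.comp (0 : ℝ) (g := ζ j) (f := fun ε => edgeProj F G j (X ε)) ?_
      (contMDiffAt_iff_contDiffAt.2 (hedge j))
    rw [hedge0]; exact (hfam j).self_of_nhds.1
  · refine ContDiffAt.comp (0 : ℝ) (g := τ j) (f := fun ε => edgeProj F G j (X ε)) ?_ (hedge j)
    rw [hedge0]; exact (hfam j).self_of_nhds.2.1
  have hseg := fun j => segment_avoids (hΦ j) (hpos j) (hζU j) (heq j) havoid
    (fun t ht => hz.no_early_collision j t ht) (hΨ j) (hρ j) (hΨ (j + 1)) (hρ (j + 1))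
    (hfam j).self_of_nhds.1 (hfam j).self_of_nhds.2.1 (hζ0 j) (hτ0 j)
    ((hfam j).mono fun p hp => hp.2.2.2.2.2.1) ((hfam j).mono fun p hp => hp.2.2.2.2.2.2)
    (hout j) (hin j)
  filter_upwards [self_mem_nhdsWithin, nhdsWithin_le_nhds hcrit,
    nhdsWithin_le_nhds (tX.eventually hAd),
    nhdsWithin_le_nhds (eventually_all.2 fun j => (tedge j).eventually (hfam j)),
    nhdsWithin_le_nhds (eventually_all.2 fun j => (tseg j).eventually (hseg j)),
    nhdsWithin_le_nhds (eventually_all.2 fun j =>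
      (tscale j).eventually ((hΨ j).eventually_mem_boundary (hρ j))),
    nhdsWithin_le_nhds (eventually_all.2 fun j =>
      (tscale j).eventually ((hΨ j).eventually_annihilates (hρ j))),
    nhdsWithin_le_nhds (eventually_all.2 hμne)] with ε hε h1 h2 h3 h4 h5 h6 h7
  have hε' : 0 < ε := hε
  have hzero : ∀ j, Φ j (ζ j (edgeProj F G j (X ε))) 0 = ζ j (edgeProj F G j (X ε)) := fun j =>
    (hΦ j).map_zero _ (h3 j).2.2.1
  have hproj : ∀ j, (Φ j (ζ j (edgeProj F G j (X ε))) 0).proj = Ψ j (ξ ε j, ε • η ε j) := fun j => by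
    rw [hzero]; exact (h3 j).2.2.2.2.2.1
  -- the jump of the momentum is proportional to the derivative of the defining function
  have hjump : ∀ j a w, (momentum (ζ j (edgeProj F G j (X ε))) -
      momentum (Φ (j - 1) (ζ (j - 1) (edgeProj F G (j - 1) (X ε)))
        (τ (j - 1) (edgeProj F G (j - 1) (X ε))))) (paramDeriv (Ψ j) (ξ ε j, ε • η ε j) (a, w)) =
      μ ε j * fderiv ℝ (ρ j) (ξ ε j, η ε j) (ε • a, w) := by
    intro j a w
    have e1 := (h1 j).1 a w
    have e2 := h2 (Pi.single j a, Pi.single j w)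
    have e0 : ∀ i, i ≠ j → coordProj F G i (Pi.single j a, Pi.single j w) = 0 := fun i h =>
      Prod.ext (Pi.single_eq_of_ne h a) (Pi.single_eq_of_ne h w)
    have e0' : coordProj F G j (Pi.single j a, Pi.single j w) = (a, w) :=
      Prod.ext (Pi.single_eq_same j a) (Pi.single_eq_same j w)
    rw [Finset.sum_eq_single j (fun i _ hij => by rw [e0 i hij, map_zero, map_zero])
      (fun h => absurd (Finset.mem_univ j) h), e0'] at e2
    have e3 := e2.symm.trans (eq_neg_of_add_eq_zero_left e1)
    exact neg_injective e3
  refine isPeriodicBilliardOrbit_of_momentum_jump hH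
    (fun j => (hΦ j).isEnergyArc hH.contMDiff (hpos j).le (h3 j).2.2.1 (h3 j).2.2.2.1 (h3 j).2.2.2.2.1)
    (fun j => ?_) (fun j => ?_) (fun j => ?_) (fun j => ?_) (fun j => ?_) (fun j => ?_)
  · rw [hproj]
    have h8 : ∀ i k, i + 1 = k → (Φ i (ζ i (edgeProj F G i (X ε))) (τ i (edgeProj F G i (X ε)))).proj =
        Ψ k (ξ ε k, ε • η ε k) := by
      rintro i _ rfl
      exact (h3 i).2.2.2.2.2.2
    exact h8 _ _ (sub_add_cancel j 1)
  · rw [hproj]; exact (h5 j hε' (h1 j).2).1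
  · rw [hproj]; exact (h5 j hε' (h1 j).2).2
  · exact h4 j hε' rfl rfl (h1 j).2 (h1 (j + 1)).2
  · rw [hproj, hzero]
    exact fun v hv => h6 j hε' _ _ (hjump j) v hv
  · obtain ⟨w, hw⟩ := h7 j
    intro h8
    rw [hzero] at h8
    have h9 := hjump j 0 w
    rw [sub_eq_zero.2 h8, smul_zero] at h9
    exact hw h9.symm

end Orbit

end

/-! ### Shadowing -/

section

section Shadowing

variable {E : Type*} [NormedAddCommGroup E] [NormedSpace ℝ E] [FiniteDimensional ℝ E]
variable {M : Type*} [EMetricSpace M] [ChartedSpace E M] [IsManifold 𝓘(ℝ, E) ∞ M]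
  [RiemannianBundle (fun x : M => TangentSpace 𝓘(ℝ, E) x)]
  [IsContMDiffRiemannianBundle 𝓘(ℝ, E) ∞ E (fun x : M => TangentSpace 𝓘(ℝ, E) x)]
  [IsRiemannianManifold 𝓘(ℝ, E) M]

/-- Trajectories that depend differentiably on a parameter stay close, to first order, to the
trajectory with parameter zero. -/
lemma IsFlowOn.exists_shadow_bound {H : CotangentBundle E M → ℝ}
    {Φ : CotangentBundle E M → ℝ → CotangentBundle E M} {U : Set (CotangentBundle E M)} {T δ : ℝ}
    (hΦ : IsFlowOn H Φ U T δ) (hT : 0 < T) {z : ℝ → CotangentBundle E M}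
    (hz : EqOn (Φ (z 0)) z (Icc 0 T)) (hzU : z 0 ∈ U) {ζ : ℝ → CotangentBundle E M} {τ : ℝ → ℝ}
    (hζ0 : ζ 0 = z 0) (hτ0 : τ 0 = T) (hζ : ContMDiffAt 𝓘(ℝ, ℝ) (coI E) 1 ζ 0)
    (hτ : ContDiffAt ℝ 1 τ 0) : ∃ K : ℝ, ∀ᶠ ε in 𝓝[>] (0 : ℝ), |τ ε - T| ≤ K * ε ∧
      ∀ θ ∈ Icc (0 : ℝ) 1,
        edist (Φ (ζ ε) (θ * τ ε)).proj (z (θ * T)).proj ≤ ENNReal.ofReal (K * ε) := by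
  have hδ := hΦ.delta_pos
  have hI : ∀ θ ∈ Icc (0 : ℝ) 1, θ * T ∈ Icc 0 T := fun θ hθ =>
    ⟨mul_nonneg hθ.1 hT.le, mul_le_of_le_one_left hT.le hθ.2⟩
  obtain ⟨K₁, hK₁⟩ := (hτ.differentiableAt one_ne_zero).isBigO_sub.bound
  obtain ⟨K₂, hK₂⟩ := exists_edist_le_mul (E := E)
    (g := fun y : ℝ × ℝ => (Φ (ζ y.1) (y.2 * τ y.1)).proj) fun θ hθ => by
      refine contMDiffAt_proj_comp (by simp) (hΦ.contMDiffAt_comp (ζ := fun y => ζ y.1)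
        (τ := fun y => y.2 * τ y.1) (b := ((0 : ℝ), θ)) ?_ (contMDiffAt_iff_contDiffAt.2 ?_) ?_ ?_)
      · exact ContMDiffAt.comp ((0 : ℝ), θ) (g := ζ) (f := fun y : ℝ × ℝ => y.1) hζ
          (contMDiffAt_iff_contDiffAt.2 contDiffAt_fst)
      · exact contDiffAt_snd.mul (ContDiffAt.comp ((0 : ℝ), θ) (g := τ) hτ contDiffAt_fst)
      · simp only [hζ0]; exact hzU
      · simp only [hτ0]; exact ⟨by linarith [(hI θ hθ).1], by linarith [(hI θ hθ).2]⟩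
  refine ⟨max K₁ K₂, ?_⟩
  filter_upwards [self_mem_nhdsWithin, nhdsWithin_le_nhds hK₁, nhdsWithin_le_nhds hK₂]
    with ε hε h1 h2
  have hε' : 0 < ε := hε
  refine ⟨?_, fun θ hθ => ?_⟩
  · rw [hτ0, sub_zero, Real.norm_eq_abs, Real.norm_of_nonneg hε'.le] at h1
    exact h1.trans (mul_le_mul_of_nonneg_right (le_max_left _ _) hε'.le)
  · have h3 := h2 θ hθ
    simp only [hζ0, hτ0] at h3
    rw [hz (hI θ hθ), abs_of_pos hε', ← ENNReal.ofReal_coe_nnreal,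
      ← ENNReal.ofReal_mul K₂.coe_nonneg] at h3
    exact h3.trans (ENNReal.ofReal_le_ofReal
      (mul_le_mul_of_nonneg_right (le_max_right _ _) hε'.le))

/-- Periodic orbits made up of trajectories that depend differentiably on `ε` shadow the chain with
error `O(ε)`. -/
lemma exists_eventually_shadows {n : ℕ} {H : CotangentBundle E M → ℝ}
    {Φ : Fin n → CotangentBundle E M → ℝ → CotangentBundle E M}
    {U : Fin n → Set (CotangentBundle E M)} {T δ : Fin n → ℝ}
    (hΦ : ∀ j, IsFlowOn H (Φ j) (U j) (T j) (δ j)) (hT : ∀ j, 0 < T j)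
    {z : Fin n → ℝ → CotangentBundle E M} (hz : ∀ j, EqOn (Φ j (z j 0)) (z j) (Icc 0 (T j)))
    (hzU : ∀ j, z j 0 ∈ U j) {ζ : Fin n → ℝ → CotangentBundle E M} {τ : Fin n → ℝ → ℝ}
    (hζ0 : ∀ j, ζ j 0 = z j 0) (hτ0 : ∀ j, τ j 0 = T j)
    (hζ : ∀ j, ContMDiffAt 𝓘(ℝ, ℝ) (coI E) 1 (ζ j) 0) (hτ : ∀ j, ContDiffAt ℝ 1 (τ j) 0) :
    ∃ K : ℝ, ∀ᶠ ε in 𝓝[>] (0 : ℝ),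
      Shadows (fun j => Φ j (ζ j ε)) (fun j => τ j ε) z T (K * ε) := by
  have h := fun j => (hΦ j).exists_shadow_bound (hT j) (hz j) (hzU j) (hζ0 j) (hτ0 j) (hζ j) (hτ j)
  choose K hK using h
  refine ⟨∑ j, |K j|, ?_⟩
  filter_upwards [self_mem_nhdsWithin, eventually_all.2 hK] with ε hε hKε j
  have hε' : 0 < ε := hε
  have h1 : K j * ε ≤ (∑ j, |K j|) * ε := mul_le_mul_of_nonneg_right
    ((le_abs_self _).trans (Finset.single_le_sum (f := fun j => |K j|) (fun i _ => abs_nonneg _)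
      (Finset.mem_univ j))) hε'.le
  exact ⟨(hKε j).1.trans h1, fun θ hθ => ((hKε j).2 θ hθ).trans (ENNReal.ofReal_le_ofReal h1)⟩

end Shadowing

end

end DegenerateBilliard

end

open DegenerateBilliard in
theorem mainTheorem3
    {E : Type*} [NormedAddCommGroup E] [NormedSpace ℝ E] [FiniteDimensional ℝ E]
    {M : Type*} [EMetricSpace M] [ChartedSpace E M] [IsManifold 𝓘(ℝ, E) ∞ M]
    [RiemannianBundle (fun x : M => TangentSpace 𝓘(ℝ, E) x)]
    [IsContMDiffRiemannianBundle 𝓘(ℝ, E) ∞ E (fun x : M => TangentSpace 𝓘(ℝ, E) x)]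
    [IsRiemannianManifold 𝓘(ℝ, E) M]
    (H : CotangentBundle E M → ℝ) (hH : IsConvexHamiltonian H)
    (N C : Set M) (hN : IsDegenerateScatterer E N) (hCN : C ⊆ N) (hC : IsCompact C)
    (f : TangentBundle 𝓘(ℝ, E) M → M) (hf : IsTubularMap N f)
    (B : ∀ x : M, Set (normalSpace E N x)) (hB : IsConvexProfile N B)
    (e : ℝ) (he : ∀ x ∈ C, minEnergy H x < e)
    {n : ℕ} [NeZero n] (z : Fin n → ℝ → CotangentBundle E M) (T : Fin n → ℝ)
    (hz : IsPeriodicBilliardOrbit H e univ C z T)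
    (hCz : ∀ j, C ∈ 𝓝[N] (z j 0).proj)
    (hnd : IsNondegenerateChain H e N z T) :
    ∃ ε₀ > (0 : ℝ), ∃ K : ℝ, ∀ ε ∈ Ioo 0 ε₀,
      ∃ (z' : Fin n → ℝ → CotangentBundle E M) (T' : Fin n → ℝ),
        IsPeriodicBilliardOrbit H e (tube C f B ε)ᶜ (tubeBoundary C f B ε) z' T' ∧
        Shadows z' T' z T (K * ε) := by
  have hpos : ∀ j, 0 < T j := fun j => (hz.arc j).arc.pos
  have hxC : ∀ j, (z j 0).proj ∈ C := fun j => by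
    have h := isElasticReflection_iff.1 (hz.reflection (j - 1))
    rw [sub_add_cancel] at h
    exact h.1 ▸ h.2.1
  have hxN := fun j => hCN (hxC j)
  -- the slice charts in which the Hessian of the action is nondegenerate
  obtain ⟨Θ, F, ξ₀, hΘ, hξ₀, -, hhess⟩ := hnd.nondegenerate
  have htar : ∀ j, (ξ₀ j : E) ∈ (Θ j).target := fun j => by
    rw [hξ₀]; exact (Θ j).map_source (hΘ j).2.1
  have hev : ∀ j, ∀ᶠ ξ : F j in 𝓝 (ξ₀ j), (ξ : E) ∈ (Θ j).target := fun j =>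
    continuous_subtype_val.continuousAt.eventually ((Θ j).open_target.mem_nhds (htar j))
  have hsymm : ∀ j, (Θ j).symm (ξ₀ j : E) = (z j 0).proj := fun j => by
    rw [hξ₀, (Θ j).left_inv (hΘ j).2.1]
  have hzero : ∀ j, ∀ᶠ ξ : F j in 𝓝 (ξ₀ j),
      tubeMap (Θ j) (F j) N (z j 0).proj f (ξ, 0) = (Θ j).symm ξ := fun j =>
    (hev j).mono fun ξ hξ => hf.tubeMap_zero (hΘ j) (hxN j) hξ
  have hmemC : ∀ j, ∀ᶠ ξ : F j in 𝓝 (ξ₀ j),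
      tubeMap (Θ j) (F j) N (z j 0).proj f (ξ, 0) ∈ C := by
    intro j
    have h1 : Tendsto (fun ξ : F j => (Θ j).symm (ξ : E)) (𝓝 (ξ₀ j)) (𝓝[N] (z j 0).proj) := by
      refine tendsto_nhdsWithin_iff.2 ⟨?_, (hev j).mono fun ξ hξ => ?_⟩
      · rw [← hsymm j]
        exact ((Θ j).continuousAt_symm (htar j)).tendsto.comp
          (continuous_subtype_val.continuousAt (x := ξ₀ j))
      · refine ((hΘ j).2.2 _ ((Θ j).map_target hξ)).2 ?_
        rw [(Θ j).right_inv hξ]; exact ξ.2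
    filter_upwards [hzero j, h1.eventually (hCz j)] with ξ h2 h3
    rw [h2]; exact h3
  -- on the zero section the tubular coordinates agree with the slice charts, so the Hessian is the same
  have hact : (fun ξ : ∀ j, F j => periodicAction H e z T fun j =>
      tubeMap (Θ j) (F j) N (z j 0).proj f (ξ j, 0)) =ᶠ[𝓝 ξ₀]
      fun ξ => periodicAction H e z T fun j => (Θ j).symm (ξ j) := by
    have h1 : ∀ᶠ ξ : ∀ j, F j in 𝓝 ξ₀, ∀ j,
        tubeMap (Θ j) (F j) N (z j 0).proj f (ξ j, 0) = (Θ j).symm (ξ j) :=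
      eventually_all.2 fun j => (continuous_apply j).continuousAt.eventually (hzero j)
    exact h1.mono fun ξ h => congrArg (periodicAction H e z T) (funext h)
  obtain ⟨Φ, U, δ, ζ, τ, hΦ, hΦz, hzU, hζ0, hτ0, hζ, hτ, horbit⟩ := exists_orbit_family hH hz
    hnd.nonConjugate
    (fun j => hf.isLocalTube hB hN hC hCN (hΘ j) (hxN j) (hCz j) (hξ₀ j))
    (fun j => by rw [(hzero j).self_of_nhds, hsymm]) hmemC
    (fun q hq => hf.exists_avoid hB hN hC hCN hq)
    (fun u hu => hhess u (by rwa [hact.fderiv.fderiv_eq] at hu))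
  obtain ⟨K, hK⟩ := exists_eventually_shadows hΦ hpos hΦz hzU hζ0 hτ0 hζ hτ
  obtain ⟨ε₀, hε₀, hε⟩ := mem_nhdsGT_iff_exists_Ioo_subset.1 (horbit.and hK)
  exact ⟨ε₀, hε₀, K, fun ε hεI => ⟨_, _, hε hεI⟩⟩
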